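/- **Soundness of the trace semantics of LMML.** Let $M_1,M_2$ be two terms of Layered Modal ML (LMML) with $\Sigma;\Psi;\Gamma\vdash_i M_1:T$ and $\Sigma;\Psi;\Gamma\vdash_i M_2:T$. If $\mathrm{Tr}(M_1)\subseteq\mathrm{Tr}(M_2)$, then $M_1\lesssim M_2$. The notions are as follows. *Syntax (up to renaming of bound variables).* Types $T::=\mathbf{Unit}\mid\mathbf{Int}\mid T\to T\mid\mathbf{ref}\,T\mid\Box(\Gamma\vdash T)$; local contexts $\Gamma$ list entries $x:T$, global contexts $\Psi$ list entries $u:(\Gamma\vdash T)$, store contexts $\Sigma$ are finite with entries $\ell:\mathbf{ref}\,T$. Terms: $M::=()\mid n\mid x\mid u^\delta\mid\ell\mid\lambda x.M\mid MM\mid\mathbf{rec}\,y(x).M\mid M\oplus M\mid\mathbf{if}\,M\,\mathbf{then}\,M\,\mathbf{else}\,M\mid\mathbf{ref}\,M\mid{!M}\mid M:=M\mid\mathbf{box}\,M\mid\mathbf{letbox}\,u=M\,\mathbf{in}\,M$ with $n\in\mathbb Z$, $\oplus\in\{+,-,*,<,=\}$. Values: $V::=()\mid n\mid\ell\mid x\mid\lambda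 x.M\mid\mathbf{rec}\,y(x).M\mid\mathbf{box}\,M$. A local substitution $\delta$ is a finite map from local variables to values; a heap is a finite map from locations to values. Local variables are bound by $\lambda$ and $\mathbf{rec}$, and $\mathbf{box}$ binds all local variables of its body; $\mathbf{letbox}\,u=M\,\mathbf{in}\,N$ binds $u$ in $N$. Contexts $C$ are terms with one hole, in any position except inside an explicit substitution. Evaluation contexts: $K::=\bullet\mid KM\mid VK\mid K\oplus M\mid V\oplus K\mid\mathbf{if}\,K\,\mathbf{then}\,M\,\mathbf{else}\,M\mid\mathbf{ref}\,K\mid{!K}\mid K:=M\mid V:=K\mid\mathbf{letbox}\,u=K\,\mathbf{in}\,M$. *Typing.* Layers are $i\in\{0,1\}$. $\vdash_iT$ holds for all types without $\Box$ and is preserved by $\to$ and $\mathbf{ref}$; $\vdash_1\Box(\Gamma\vdash T)$ holds if $\vdash_0\Gamma$ and $\vdash_0T$. Contexts declare every variable once; $\vdash_i\Gamma$ means that all types in $\Gamma$ are well formed at layer $i$; $\Psi$ is well formed if its entries are so at layer $0$; $\Sigma$ is well formed if its types are so at layer $1$. All contexts in a judgement $\Sigma;\Psi;\Gamma\vdash_iM:T$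 are well formed (with $\Gamma$ at layer $i$). The rules are the usual ones of simply typed ML with references (arithmetic and tests on $\mathbf{Int}$; $\ell:\mathbf{ref}\,T$ if $\ell:\mathbf{ref}\,T\in\Sigma$ and $\vdash_iT$), at each layer, with: $u^\delta:T$ if $u:(\Gamma'\vdash T)\in\Psi$ and $\Sigma;\Psi;\Gamma\vdash_i\delta:\Gamma'$, that is, $\mathrm{dom}\,\delta=\mathrm{dom}\,\Gamma'$ and $\Sigma;\Psi;\Gamma\vdash_i\delta(x):\Gamma'(x)$; $\Sigma;\Psi;\Gamma\vdash_1\mathbf{box}\,M:\Box(\Gamma'\vdash T)$ if $\Sigma;\Psi;\Gamma'\vdash_0M:T$; $\Sigma;\Psi;\Gamma\vdash_1\mathbf{letbox}\,u=M\,\mathbf{in}\,N:T'$ if $\Sigma;\Psi;\Gamma\vdash_1M:\Box(\Gamma'\vdash T)$ and $\Sigma;\Psi,u:(\Gamma'\vdash T);\Gamma\vdash_1N:T'$. $\Sigma\vdash h:\mathbf{heap}$ means $\mathrm{dom}\,h=\mathrm{dom}\,\Sigma$ and, for each $\ell:\mathbf{ref}\,T\in\Sigma$, $\Sigma;\cdot;\cdot\vdash_jh(\ell):T$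 for some $j$. Contexts $\Sigma\vdash C:(\Psi';\Gamma';i';T')\to(\Psi;\Gamma;i;T)$ are typed by the same rules, with $\bullet:(\Psi';\Gamma';i';T)\to(\Psi;\Gamma;i;T)$ if $\Psi'\subseteq\Psi$, $\Gamma'\subseteq\Gamma$, $i'\le i$. *Reduction.* $(M,h)\to(M',h')$ is the closure under evaluation contexts of the usual call-by-value rules of ML with references (nonzero integers are true, comparisons return $0$ or $1$, a new location is any location outside $\mathrm{dom}\,h$) and of $(\mathbf{letbox}\,u=\mathbf{box}\,M\,\mathbf{in}\,N,h)\to(N[M/u],h)$. Substitutions avoid capture; $M[\delta]$ does not change terms under $\mathbf{box}$ and acts on $u^{\delta'}$ by $u^{\delta'[\delta]}$; $M[\sigma]$, for a map $\sigma$ from global variables to terms, enters $\mathbf{box}$ and satisfies $(u^\delta)[\sigma]=\sigma(u)[\delta[\sigma]]$. $(M,h)\Downarrow$ means that $(M,h)\to^*(V,h')$ for some value $V$ and heap $h'$. *Contextual preorder:* $M_1\lesssim M_2$ if for all $\Sigma'\supseteq\Sigma$, all $\Sigma'\vdash C:(\Psi;\Gamma;i;T)\to(\cdot;\cdot;i';T')$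 and all $\Sigma'\vdash h:\mathbf{heap}$, $(C[M_1],h)\Downarrow$ implies $(C[M_2],h)\Downarrow$. *Names.* For each well-formed function type at layer $i$ there are countably infinitely many function names $f\in\mathrm{FNames}_{T_1\to T_2,i}$, and for each well-formed box type countably infinitely many box names $b\in\mathrm{BNames}_{\Box(\Gamma\vdash T),1}$; all these sets are disjoint. For the trace semantics only, terms are extended by names, which are closed values that have their type at every layer at or above their own, and by terms $\#b^\delta$, with $\#b^\delta:T$ at layer $i$ if $b\in\mathrm{BNames}_{\Box(\Gamma'\vdash T),1}$ and $\delta:\Gamma'$ at layer $i$; substitutions act on $\#b^\delta$ by acting on $\delta$. One adds the rule $(\mathbf{letbox}\,u=b\,\mathbf{in}\,M,h)\to(M[\#b/u],h)$, where $(\#b)[\delta]=\#b^\delta$; also $\#(\mathbf{box}\,M)=M$. An abstract value $A$ is $()$, an integer, a location or a name; $\nu(A)$ and $\mu(A)$ are the sets of names and of locations that are $A$. $A$ abstracts a closed value $\vdash_iV:T$ if $A=V$ for $V$ a unit, integer or location, or if $A$ is a name of type $T$ and of layer $i$ ($i=1$ for a box name) for $T$ a function or box type; in the latter case it records the assignment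 $A\mapsto V$. Substitutions $\delta$ (at one layer) and heaps (each value at some layer) are abstracted entrywise, to $\rho$ and $\chi$, with distinct names in distinct entries; $\nu,\mu$ extend entrywise. Abstract substitutions and heaps are typed as substitutions and heaps, and use distinct names in distinct entries. $h|_X$ denotes the least $h'\subseteq h$ with $X\subseteq\mathrm{dom}\,h'$ such that $h'(\ell)=\ell'$ implies $\ell'\in\mathrm{dom}\,h'$; $\Sigma|_X$ is the restriction of $\Sigma$ to $\mathrm{dom}\,h'$; $(\chi+h)(\ell)$ is $\chi(\ell)$ if defined and otherwise $h(\ell)$. *Transitions.* Passive configurations are $(\Sigma,h,\gamma,\phi,\xi,\theta)$, active ones $(M,i,T,\Sigma,h,\gamma,\phi,\xi,\theta)$, with $\gamma$ an assignment of values to names, $\phi$ a set of names, $\xi$ a stack of typed evaluation contexts, $\theta$ a set of locations. Player actions are $(\overline A,\Sigma',\chi)$, $(\overline f(A),\Sigma',\chi)$, $(\overline{\mathbf{run}\,b^\rho},\Sigma',\chi)$; opponent actions are $(A,\Sigma',\chi)$, $(f(A),\Sigma',\chi)$, $(\mathbf{run}\,b^\rho,\Sigma',\chi)$. In each action the names in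 $A$ or $\rho$ and in $\chi$ are pairwise distinct and not in $\phi$; they are added to $\phi$, and $\theta$ becomes $\mathrm{dom}\,\chi$. Layers that are not determined below are arbitrary. ($\tau$) If $(M_1,h_1)\to(M_2,h_2)$, $\Sigma_1\subseteq\Sigma_2$, $\Sigma_2;\cdot;\cdot\vdash_iM_2:T$ and $\Sigma_2\vdash h_2:\mathbf{heap}$, then $(M_1,i,T,\Sigma_1,h_1,\ldots)\xrightarrow{\tau}(M_2,i,T,\Sigma_2,h_2,\ldots)$. Player: an active configuration with term (PA) a value $V$, (PQF) $K[fV]$ with $f\in\mathrm{FNames}_{T_1\to T_2,i_1}$, or (PQB) $K[\#b^\delta]$ with $b\in\mathrm{BNames}_{\Box(\Gamma\vdash T_1),1}$ becomes passive by $(\overline A,\Sigma',\chi)$, $(\overline f(A),\Sigma',\chi)$, $(\overline{\mathbf{run}\,b^\rho},\Sigma',\chi)$ respectively, where $A$ abstracts $\vdash_iV:T$, resp. $\vdash_{i_2}V:T_1$, resp. $\rho$ abstracts $\vdash_{i_1}\delta:\Gamma$; $\Sigma'$ and $h'$ are $\Sigma|_X$ and $h|_X$ for $X=\theta\cup\mu(A)$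 (resp. $\theta\cup\mu(\rho)$), and $\chi$ abstracts $h'$ (its values being typed in $\Sigma$). The recorded assignments are added to $\gamma$. In (PQF), (PQB) the context $\Sigma\vdash K:(\cdot;\cdot;i_3;T_2)\to(\cdot;\cdot;i;T)$, resp. $\Sigma\vdash K:(\cdot;\cdot;i_1;T_1)\to(\cdot;\cdot;i;T)$, is pushed on $\xi$. Opponent: a passive configuration becomes active with $\Sigma\cup\Sigma'$ and $\chi+h$, where $\Sigma'\vdash\chi:\mathbf{heap}$, $\Sigma$ and $\Sigma'$ agree on common locations, $\mathrm{dom}\,\chi\cap\mathrm{dom}\,h=\theta$ and $\chi=\chi|_X$ for $X=\theta\cup\mu(A)$ (resp. $\theta\cup\mu(\rho)$): (OA) by $(A,\Sigma',\chi)$, if the top of $\xi$ is $K:(\cdot;\cdot;i_1;T_1)\to(\cdot;\cdot;i_2;T_2)$ and $\Sigma';\cdot;\cdot\vdash_{i_1}A:T_1$, popping it, with term $K[A]$, layer $i_2$, type $T_2$; (OQF) by $(f(A),\Sigma',\chi)$, if $f\in\mathrm{FNames}_{T_1\to T_2,i_1}$, $\gamma(f)=V$, $\Sigma';\cdot;\cdot\vdash_{i_2}A:T_1$,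 with term $VA$, layer $\max(i_1,i_2)$, type $T_2$; (OQB) by $(\mathbf{run}\,b^\rho,\Sigma',\chi)$, if $b\in\mathrm{BNames}_{\Box(\Gamma\vdash T),1}$, $\gamma(b)=V$, $\Sigma';\cdot;\cdot\vdash_i\rho:\Gamma$, with term $(\#V)[\rho]$, layer $i$, type $T$. *Traces.* $\mathrm{Tr}(\mathbf C)$ is the set of sequences of actions $\mathbf a_1\cdots\mathbf a_n$ such that $\mathbf C\,(\xrightarrow{\tau})^*\xrightarrow{\mathbf a_1}\cdots(\xrightarrow{\tau})^*\xrightarrow{\mathbf a_n}\mathbf C'$ for some passive $\mathbf C'$ with empty stack. For $\Sigma;\Psi;\Gamma\vdash_iM:T$, $\mathrm{Tr}(M)$ is the set of $(\eta,\rho,\chi,\mathtt t)$ for which there is $\Sigma'\supseteq\Sigma$ such that $\eta$ maps each $u:(\Gamma'\vdash T')\in\Psi$ to $\#b$ with $b\in\mathrm{BNames}_{\Box(\Gamma'\vdash T'),1}$, $\rho$ is an abstract local substitution with $\Sigma';\cdot;\cdot\vdash_i\rho:\Gamma$, $\chi$ is an abstract heap with $\Sigma'\vdash\chi:\mathbf{heap}$,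 all names in $\eta,\rho,\chi$ are distinct, and $\mathtt t\in\mathrm{Tr}\bigl(M[\eta][\rho],i,T,\Sigma',\chi,\emptyset,\nu(\eta)\uplus\nu(\rho)\uplus\nu(\chi),\cdot,\mathrm{dom}\,\chi\bigr)$. -/

import Mathlib

namespace LMML

/-! ## Variables, locations, types, names

Free variables are named. Variables bound inside a term by `lam`, `rec`, `letbox` are de Bruijn
indices, so that a term is literally an alpha-equivalence class. `box` binds by name: the
variables of the code are the named variables that are listed in its contextual type. -/

abbrev LVar := ℕ
abbrev GVar := ℕ
abbrev Loc := ℕ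

/-- The layers `0` and `1`. -/
abbrev Layer := Fin 2

inductive Ty where
  | unit : Ty
  | int : Ty
  | arr : Ty → Ty → Ty
  | ref : Ty → Ty
  | box : List (LVar × Ty) → Ty → Ty

/-- Local variable contexts. The most recent entry comes first. -/
abbrev LCtx := List (LVar × Ty)

/-- Global variable contexts. -/
abbrev GCtx := List (GVar × (LCtx × Ty))

/-- Store contexts: `S ℓ = some T` stands for the entry `ℓ : ref T`. -/
abbrev SCtx := Loc → Option Ty

/-- The function name number `idx` of type `dom → cod` and layer `lvl`. -/
structure FName where
  dom : Ty
  cod : Ty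
  lvl : Layer
  idx : ℕ

/-- The box name number `idx` of type `□(ctx ⊢ ty)` (and layer `1`). -/
structure BName where
  ctx : LCtx
  ty : Ty
  idx : ℕ

inductive Name where
  | fn : FName → Name
  | bx : BName → Name

/-! ## Terms -/

inductive Op where
  | add | sub | mul | lt | eq

def Op.eval : Op → ℤ → ℤ → ℤ
  | .add, m, n => m + n
  | .sub, m, n => m - n
  | .mul, m, n => m * n
  | .lt, m, n => if m < n then 1 else 0
  | .eq, m, n => if m = n then 1 else 0

/-- Global variables: bound (by a `letbox`, de Bruijn index) or free (named). -/
inductive GV where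
  | b : ℕ → GV
  | f : GVar → GV

mutual
/-- Terms. `recf M` is `rec y(x).M`, with `x` the index `0` and `y` the index `1` of `M`;
`letbox M₁ M₂` binds the global index `0` in `M₂`; `gvar u δ` is `u^δ`; `unb b δ` is `#b^δ`.
The source language is the fragment without `fname`, `bname`, `unb`. -/
inductive Tm where
  | unit : Tm
  | int : ℤ → Tm
  | bvar : ℕ → Tm
  | fvar : LVar → Tm
  | gvar : GV → LSub → Tm
  | loc : Loc → Tm
  | lam : Tm → Tm
  | app : Tm → Tm → Tm
  | recf : Tm → Tm
  | arith : Op → Tm → Tm → Tm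
  | ite : Tm → Tm → Tm → Tm
  | ref : Tm → Tm
  | deref : Tm → Tm
  | assign : Tm → Tm → Tm
  | box : Tm → Tm
  | letbox : Tm → Tm → Tm
  | fname : FName → Tm
  | bname : BName → Tm
  | unb : BName → LSub → Tm
/-- Explicit local substitutions. -/
inductive LSub where
  | nil : LSub
  | cons : LVar → Tm → LSub → LSub
end

def Tm.IsValue : Tm → Prop
  | .unit | .int _ | .loc _ | .bvar _ | .fvar _ | .lam _ | .recf _ | .box _
  | .fname _ | .bname _ => True
  | _ => False

def LSub.keys : LSub → List LVar
  | .nil => []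
  | .cons x _ d => x :: d.keys

def LSub.lookup : LSub → LVar → Option Tm
  | .nil, _ => none
  | .cons x V d, y => if y = x then some V else d.lookup y

mutual
/-- Terms of the source language: no names. -/
def Tm.Src : Tm → Prop
  | .unit | .int _ | .bvar _ | .fvar _ | .loc _ => True
  | .gvar _ d => d.Src
  | .lam M | .recf M | .ref M | .deref M | .box M => M.Src
  | .app M N | .arith _ M N | .assign M N | .letbox M N => M.Src ∧ N.Src
  | .ite M N P => M.Src ∧ N.Src ∧ P.Src
  | .fname _ | .bname _ | .unb _ _ => False
def LSub.Src : LSub → Prop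
  | .nil => True
  | .cons _ V d => V.Src ∧ d.Src
end

/-! ## Renaming and substitution -/

/-- Extension of a renaming of indices under one binder. -/
def upRen (r : ℕ → ℕ) : ℕ → ℕ
  | 0 => 0
  | k + 1 => r k + 1

mutual
/-- Renaming of local indices. No local index of the outside is visible inside `box`. -/
def Tm.lren (r : ℕ → ℕ) : Tm → Tm
  | .unit => .unit
  | .int n => .int n
  | .bvar k => .bvar (r k)
  | .fvar x => .fvar x
  | .gvar v d => .gvar v (d.lren r)
  | .loc l => .loc l
  | .lam M => .lam (M.lren (upRen r))
  | .app M N => .app (M.lren r) (N.lren r)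
  | .recf M => .recf (M.lren (upRen (upRen r)))
  | .arith o M N => .arith o (M.lren r) (N.lren r)
  | .ite M N P => .ite (M.lren r) (N.lren r) (P.lren r)
  | .ref M => .ref (M.lren r)
  | .deref M => .deref (M.lren r)
  | .assign M N => .assign (M.lren r) (N.lren r)
  | .box M => .box M
  | .letbox M N => .letbox (M.lren r) (N.lren r)
  | .fname f => .fname f
  | .bname b => .bname b
  | .unb b d => .unb b (d.lren r)
def LSub.lren (r : ℕ → ℕ) : LSub → LSub
  | .nil => .nil
  | .cons x V d => .cons x (V.lren r) (d.lren r)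
end

def GV.shift : GV → GV
  | .b k => .b (k + 1)
  | .f u => .f u

def upGRen (r : GV → GV) : GV → GV
  | .b 0 => .b 0
  | .b (k + 1) => (r (.b k)).shift
  | .f u => (r (.f u)).shift

mutual
/-- Renaming of global variables. -/
def Tm.gren (r : GV → GV) : Tm → Tm
  | .unit => .unit
  | .int n => .int n
  | .bvar k => .bvar k
  | .fvar x => .fvar x
  | .gvar v d => .gvar (r v) (d.gren r)
  | .loc l => .loc l
  | .lam M => .lam (M.gren r)
  | .app M N => .app (M.gren r) (N.gren r)
  | .recf M => .recf (M.gren r)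
  | .arith o M N => .arith o (M.gren r) (N.gren r)
  | .ite M N P => .ite (M.gren r) (N.gren r) (P.gren r)
  | .ref M => .ref (M.gren r)
  | .deref M => .deref (M.gren r)
  | .assign M N => .assign (M.gren r) (N.gren r)
  | .box M => .box (M.gren r)
  | .letbox M N => .letbox (M.gren r) (N.gren (upGRen r))
  | .fname f => .fname f
  | .bname b => .bname b
  | .unb b d => .unb b (d.gren r)
def LSub.gren (r : GV → GV) : LSub → LSub
  | .nil => .nil
  | .cons x V d => .cons x (V.gren r) (d.gren r)
end

def upSub (s : ℕ → Tm) : ℕ → Tm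
  | 0 => .bvar 0
  | k + 1 => (s k).lren Nat.succ

mutual
/-- Simultaneous capture-avoiding substitution of local variables: indices by `s`, named
variables by `e`. It does not enter `box`, and it is composed with explicit substitutions. -/
def Tm.lsub (s : ℕ → Tm) (e : LVar → Tm) : Tm → Tm
  | .unit => .unit
  | .int n => .int n
  | .bvar k => s k
  | .fvar x => e x
  | .gvar v d => .gvar v (d.lsub s e)
  | .loc l => .loc l
  | .lam M => .lam (M.lsub (upSub s) (fun x => (e x).lren Nat.succ))
  | .app M N => .app (M.lsub s e) (N.lsub s e)
  | .recf M => .recf (M.lsub (upSub (upSub s))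
      (fun x => ((e x).lren Nat.succ).lren Nat.succ))
  | .arith o M N => .arith o (M.lsub s e) (N.lsub s e)
  | .ite M N P => .ite (M.lsub s e) (N.lsub s e) (P.lsub s e)
  | .ref M => .ref (M.lsub s e)
  | .deref M => .deref (M.lsub s e)
  | .assign M N => .assign (M.lsub s e) (N.lsub s e)
  | .box M => .box M
  | .letbox M N => .letbox (M.lsub s e)
      (N.lsub (fun k => (s k).gren GV.shift) (fun x => (e x).gren GV.shift))
  | .fname f => .fname f
  | .bname b => .bname b
  | .unb b d => .unb b (d.lsub s e)
def LSub.lsub (s : ℕ → Tm) (e : LVar → Tm) : LSub → LSub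
  | .nil => .nil
  | .cons x V d => .cons x (V.lsub s e) (d.lsub s e)
end

/-- `M[e]` for a partial map `e` from named local variables to terms. -/
def Tm.inst (e : LVar → Option Tm) (M : Tm) : Tm :=
  M.lsub .bvar (fun x => (e x).getD (.fvar x))

/-- Global substitutions: a global variable is kept as a variable or replaced by a term. -/
abbrev GSub := GV → GV ⊕ Tm

def upGSub (s : GSub) : GSub
  | .b 0 => .inl (.b 0)
  | .b (k + 1) => (s (.b k)).map GV.shift (Tm.gren GV.shift)
  | .f u => (s (.f u)).map GV.shift (Tm.gren GV.shift)

mutual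
/-- Global substitution, with `(u^δ)[σ] = σ(u)[δ[σ]]`. The terms `σ(u)` have no local index of
the outside, and all their local variables are replaced by `δ[σ]`. -/
def Tm.gsub (s : GSub) : Tm → Tm
  | .unit => .unit
  | .int n => .int n
  | .bvar k => .bvar k
  | .fvar x => .fvar x
  | .gvar v d =>
    match s v with
    | .inl v' => .gvar v' (d.gsub s)
    | .inr N => N.inst (d.gsub s).lookup
  | .loc l => .loc l
  | .lam M => .lam (M.gsub s)
  | .app M N => .app (M.gsub s) (N.gsub s)
  | .recf M => .recf (M.gsub s)
  | .arith o M N => .arith o (M.gsub s) (N.gsub s)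
  | .ite M N P => .ite (M.gsub s) (N.gsub s) (P.gsub s)
  | .ref M => .ref (M.gsub s)
  | .deref M => .deref (M.gsub s)
  | .assign M N => .assign (M.gsub s) (N.gsub s)
  | .box M => .box (M.gsub s)
  | .letbox M N => .letbox (M.gsub s) (N.gsub (upGSub s))
  | .fname f => .fname f
  | .bname b => .bname b
  | .unb b d => .unb b (d.gsub s)
def LSub.gsub (s : GSub) : LSub → LSub
  | .nil => .nil
  | .cons x V d => .cons x (V.gsub s) (d.gsub s)
end

/-- `M[V/x]` for the body `M` of `λx.M`. -/
def Tm.beta (M V : Tm) : Tm :=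
  M.lsub (fun k => match k with | 0 => V | k + 1 => .bvar k) .fvar

/-- `M[V/x, W/y]` for the body `M` of `rec y(x).M`. -/
def Tm.beta2 (M V W : Tm) : Tm :=
  M.lsub (fun k => match k with | 0 => V | 1 => W | k + 2 => .bvar k) .fvar

/-- `M[N/u]` for the body `M` of a `letbox` that binds `u`. -/
def Tm.gbeta (M N : Tm) : Tm :=
  M.gsub (fun v => match v with
    | .b 0 => .inr N
    | .b (k + 1) => .inl (.b k)
    | .f u => .inl (.f u))

/-- `λx.M` for a named variable `x`. -/
def Tm.lamN (x : LVar) (M : Tm) : Tm :=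
  .lam (M.lsub (fun k => .bvar (k + 1)) (fun y => if y = x then .bvar 0 else .fvar y))

/-- `rec y(x).M` for named variables `y`, `x`. -/
def Tm.recN (y x : LVar) (M : Tm) : Tm :=
  .recf (M.lsub (fun k => .bvar (k + 2))
    (fun z => if z = x then .bvar 0 else if z = y then .bvar 1 else .fvar z))

/-- `letbox u = M in N` for a named global variable `u`. -/
def Tm.letboxN (u : GVar) (M N : Tm) : Tm :=
  .letbox M (N.gren (fun v => match v with
    | .b k => .b (k + 1)
    | .f w => if w = u then .b 0 else .f w))

/-- The identity substitution `x/x` on a local context. -/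
def idSub : LCtx → LSub
  | [] => .nil
  | (x, _) :: G => .cons x (.fvar x) (idSub G)

/-- `#b`, as `#b` under the identity substitution: then `(#b)[δ]` is `#b^δ`. -/
def BName.unbox (b : BName) : Tm := .unb b (idSub b.ctx)

/-- `#V` for a value `V` of box type: `#(box M) = M`, and `#b` for a box name `b`.
The last line is never used. -/
def Tm.unboxed : Tm → Tm
  | .box M => M
  | .bname b => b.unbox
  | M => M

/-! ## Well-formed types and contexts, typing -/

def LCtx.dom (G : LCtx) : List LVar := G.map Prod.fst

inductive WfTy : Layer → Ty → Prop
  | unit (i : Layer) : WfTy i .unit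
  | int (i : Layer) : WfTy i .int
  | arr {i : Layer} {T₁ T₂ : Ty} : WfTy i T₁ → WfTy i T₂ → WfTy i (.arr T₁ T₂)
  | ref {i : Layer} {T : Ty} : WfTy i T → WfTy i (.ref T)
  | box {G : List (LVar × Ty)} {T : Ty} : (G.map Prod.fst).Nodup →
      (∀ x S, (x, S) ∈ G → WfTy 0 S) → WfTy 0 T → WfTy 1 (.box G T)

def WfLCtx (i : Layer) (G : LCtx) : Prop :=
  (G.map Prod.fst).Nodup ∧ ∀ x T, (x, T) ∈ G → WfTy i T

def WfGCtx (P : GCtx) : Prop :=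
  (P.map Prod.fst).Nodup ∧ ∀ u G T, (u, (G, T)) ∈ P → WfLCtx 0 G ∧ WfTy 0 T

/-- Well-formed store contexts (finite, with types of any layer). -/
def WfSCtx (S : SCtx) : Prop :=
  {l | (S l).isSome}.Finite ∧ ∀ l T, S l = some T → WfTy 1 T

/-- All contexts of a judgement at layer `i` are well formed; `F` and `D` are the contexts of the
bound global and the bound local variables. -/
structure WfCtxs (S : SCtx) (P : GCtx) (F : List (LCtx × Ty)) (G : LCtx) (D : List Ty)
    (i : Layer) : Prop where
  store : WfSCtx S
  glob : WfGCtx P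
  globB : ∀ G' T, (G', T) ∈ F → WfLCtx 0 G' ∧ WfTy 0 T
  loc : WfLCtx i G
  locB : ∀ T ∈ D, WfTy i T

def FName.WF (f : FName) : Prop := WfTy f.lvl (.arr f.dom f.cod)
def BName.WF (b : BName) : Prop := WfTy 1 (.box b.ctx b.ty)

/-- `HasTy S P F G D i M T`: the term `M` has type `T` at layer `i` in the store context `S`, the
global contexts `P` (named) and `F` (indices), the local contexts `G` (named) and `D` (indices). -/
inductive HasTy (S : SCtx) (P : GCtx) :
    List (LCtx × Ty) → LCtx → List Ty → Layer → Tm → Ty → Prop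
  | unit {F G D i} : WfCtxs S P F G D i → HasTy S P F G D i .unit .unit
  | int {F G D i} (n : ℤ) : WfCtxs S P F G D i → HasTy S P F G D i (.int n) .int
  | bvar {F G D i k T} : WfCtxs S P F G D i → D[k]? = some T →
      HasTy S P F G D i (.bvar k) T
  | fvar {F G D i x T} : WfCtxs S P F G D i → (x, T) ∈ G →
      HasTy S P F G D i (.fvar x) T
  | gvarB {F G D i k d G' T} : WfCtxs S P F G D i → F[k]? = some (G', T) →
      d.keys.Nodup → (∀ x, x ∈ d.keys ↔ x ∈ G'.dom) →
      (∀ x V, d.lookup x = some V → V.IsValue) →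
      (∀ x V T', (x, T') ∈ G' → d.lookup x = some V → HasTy S P F G D i V T') →
      HasTy S P F G D i (.gvar (.b k) d) T
  | gvarF {F G D i u d G' T} : WfCtxs S P F G D i → (u, (G', T)) ∈ P →
      d.keys.Nodup → (∀ x, x ∈ d.keys ↔ x ∈ G'.dom) →
      (∀ x V, d.lookup x = some V → V.IsValue) →
      (∀ x V T', (x, T') ∈ G' → d.lookup x = some V → HasTy S P F G D i V T') →
      HasTy S P F G D i (.gvar (.f u) d) T
  | loc {F G D i l T} : WfCtxs S P F G D i → S l = some T → WfTy i T →
      HasTy S P F G D i (.loc l) (.ref T)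
  | lam {F G D i M T₁ T₂} : HasTy S P F G (T₁ :: D) i M T₂ →
      HasTy S P F G D i (.lam M) (.arr T₁ T₂)
  | app {F G D i M N T₁ T₂} : HasTy S P F G D i M (.arr T₁ T₂) → HasTy S P F G D i N T₁ →
      HasTy S P F G D i (.app M N) T₂
  | recf {F G D i M T₁ T₂} : HasTy S P F G (T₁ :: .arr T₁ T₂ :: D) i M T₂ →
      HasTy S P F G D i (.recf M) (.arr T₁ T₂)
  | arith {F G D i o M N} : HasTy S P F G D i M .int → HasTy S P F G D i N .int →
      HasTy S P F G D i (.arith o M N) .int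
  | ite {F G D i M N N' T} : HasTy S P F G D i M .int → HasTy S P F G D i N T →
      HasTy S P F G D i N' T → HasTy S P F G D i (.ite M N N') T
  | ref {F G D i M T} : HasTy S P F G D i M T → HasTy S P F G D i (.ref M) (.ref T)
  | deref {F G D i M T} : HasTy S P F G D i M (.ref T) → HasTy S P F G D i (.deref M) T
  | assign {F G D i M N T} : HasTy S P F G D i M (.ref T) → HasTy S P F G D i N T →
      HasTy S P F G D i (.assign M N) .unit
  | box {F G D G' M T} : WfLCtx 1 G → (∀ T' ∈ D, WfTy 1 T') → HasTy S P F G' [] 0 M T →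
      HasTy S P F G D 1 (.box M) (.box G' T)
  | letbox {F G D M N G' T T'} : HasTy S P F G D 1 M (.box G' T) →
      HasTy S P ((G', T) :: F) G D 1 N T' → HasTy S P F G D 1 (.letbox M N) T'
  | fname {F G D i f} : WfCtxs S P F G D i → f.WF → f.lvl ≤ i →
      HasTy S P F G D i (.fname f) (.arr f.dom f.cod)
  | bname {F G D b} : WfCtxs S P F G D 1 → b.WF →
      HasTy S P F G D 1 (.bname b) (.box b.ctx b.ty)
  | unb {F G D i b d} : WfCtxs S P F G D i → b.WF →
      d.keys.Nodup → (∀ x, x ∈ d.keys ↔ x ∈ b.ctx.dom) →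
      (∀ x V, d.lookup x = some V → V.IsValue) →
      (∀ x V T', (x, T') ∈ b.ctx → d.lookup x = some V → HasTy S P F G D i V T') →
      HasTy S P F G D i (.unb b d) b.ty

/-- Typing of terms whose free variables are all named. -/
abbrev Typed (S : SCtx) (P : GCtx) (G : LCtx) (i : Layer) (M : Tm) (T : Ty) : Prop :=
  HasTy S P [] G [] i M T

/-- Typing of closed terms. -/
abbrev ClTyped (S : SCtx) (i : Layer) (M : Tm) (T : Ty) : Prop := Typed S [] [] i M T

/-! ## Heaps, contexts, reduction -/

abbrev Heap := Loc → Option Tm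

/-- Inclusion of partial maps. -/
def PSub {α β : Type} (f g : α → Option β) : Prop := ∀ a b, f a = some b → g a = some b

/-- Well-typed heaps of closed values. -/
structure WfHeap (S : SCtx) (h : Heap) : Prop where
  store : WfSCtx S
  dom : ∀ l, (h l).isSome ↔ (S l).isSome
  value : ∀ l V, h l = some V → V.IsValue
  typed : ∀ l V T, h l = some V → S l = some T → ∃ i, ClTyped S i V T

/-- Term contexts. The binders above the hole are named, since they capture. -/
inductive Cx where
  | hole : Cx
  | lam : LVar → Cx → Cx
  | appL : Cx → Tm → Cx
  | appR : Tm → Cx → Cx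
  | recf : LVar → LVar → Cx → Cx
  | arithL : Op → Cx → Tm → Cx
  | arithR : Op → Tm → Cx → Cx
  | iteC : Cx → Tm → Tm → Cx
  | iteT : Tm → Cx → Tm → Cx
  | iteE : Tm → Tm → Cx → Cx
  | ref : Cx → Cx
  | deref : Cx → Cx
  | assignL : Cx → Tm → Cx
  | assignR : Tm → Cx → Cx
  | box : Cx → Cx
  | letboxL : Cx → Tm → Cx
  | letboxR : GVar → Tm → Cx → Cx

/-- `C[M]`. -/
def Cx.plug : Cx → Tm → Tm
  | .hole, M => M
  | .lam x C, M => Tm.lamN x (C.plug M)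
  | .appL C N, M => .app (C.plug M) N
  | .appR N C, M => .app N (C.plug M)
  | .recf y x C, M => Tm.recN y x (C.plug M)
  | .arithL o C N, M => .arith o (C.plug M) N
  | .arithR o N C, M => .arith o N (C.plug M)
  | .iteC C N N', M => .ite (C.plug M) N N'
  | .iteT N C N', M => .ite N (C.plug M) N'
  | .iteE N N' C, M => .ite N N' (C.plug M)
  | .ref C, M => .ref (C.plug M)
  | .deref C, M => .deref (C.plug M)
  | .assignL C N, M => .assign (C.plug M) N
  | .assignR N C, M => .assign N (C.plug M)
  | .box C, M => .box (C.plug M)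
  | .letboxL C N, M => .letbox (C.plug M) N
  | .letboxR u N C, M => Tm.letboxN u N (C.plug M)

/-- Contexts of the source language: no names. -/
def Cx.Src : Cx → Prop
  | .hole => True
  | .lam _ C | .recf _ _ C | .ref C | .deref C | .box C => C.Src
  | .appL C N | .appR N C | .arithL _ C N | .arithR _ N C | .assignL C N | .assignR N C
  | .letboxL C N | .letboxR _ N C => C.Src ∧ N.Src
  | .iteC C N N' | .iteT N C N' | .iteE N N' C => C.Src ∧ N.Src ∧ N'.Src

/-- Evaluation contexts. -/
def Cx.IsEval : Cx → Prop
  | .hole => True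
  | .appL C _ | .arithL _ C _ | .iteC C _ _ | .ref C | .deref C | .assignL C _
  | .letboxL C _ => C.IsEval
  | .appR V C | .arithR _ V C | .assignR V C => V.IsValue ∧ C.IsEval
  | _ => False

/-- `CxTy S P' G' i' T' C P G i T`: the context `C` takes terms of type `T'` at layer `i'` in
`P'; G'` to terms of type `T` at layer `i` in `P; G`. -/
inductive CxTy (S : SCtx) (P' : GCtx) (G' : LCtx) (i' : Layer) (T' : Ty) :
    Cx → GCtx → LCtx → Layer → Ty → Prop
  | hole {P G i} : WfSCtx S → WfGCtx P → WfLCtx i G → P' ⊆ P → G' ⊆ G → i' ≤ i →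
      CxTy S P' G' i' T' .hole P G i T'
  | lam {P G i x C T₁ T₂} : CxTy S P' G' i' T' C P ((x, T₁) :: G) i T₂ →
      CxTy S P' G' i' T' (.lam x C) P G i (.arr T₁ T₂)
  | appL {P G i C N T₁ T₂} : CxTy S P' G' i' T' C P G i (.arr T₁ T₂) → Typed S P G i N T₁ →
      CxTy S P' G' i' T' (.appL C N) P G i T₂
  | appR {P G i C N T₁ T₂} : Typed S P G i N (.arr T₁ T₂) → CxTy S P' G' i' T' C P G i T₁ →
      CxTy S P' G' i' T' (.appR N C) P G i T₂
  | recf {P G i y x C T₁ T₂} :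
      CxTy S P' G' i' T' C P ((x, T₁) :: (y, .arr T₁ T₂) :: G) i T₂ →
      CxTy S P' G' i' T' (.recf y x C) P G i (.arr T₁ T₂)
  | arithL {P G i o C N} : CxTy S P' G' i' T' C P G i .int → Typed S P G i N .int →
      CxTy S P' G' i' T' (.arithL o C N) P G i .int
  | arithR {P G i o C N} : Typed S P G i N .int → CxTy S P' G' i' T' C P G i .int →
      CxTy S P' G' i' T' (.arithR o N C) P G i .int
  | iteC {P G i C N N' T} : CxTy S P' G' i' T' C P G i .int → Typed S P G i N T →
      Typed S P G i N' T → CxTy S P' G' i' T' (.iteC C N N') P G i T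
  | iteT {P G i C N N' T} : Typed S P G i N .int → CxTy S P' G' i' T' C P G i T →
      Typed S P G i N' T → CxTy S P' G' i' T' (.iteT N C N') P G i T
  | iteE {P G i C N N' T} : Typed S P G i N .int → Typed S P G i N' T →
      CxTy S P' G' i' T' C P G i T → CxTy S P' G' i' T' (.iteE N N' C) P G i T
  | ref {P G i C T} : CxTy S P' G' i' T' C P G i T →
      CxTy S P' G' i' T' (.ref C) P G i (.ref T)
  | deref {P G i C T} : CxTy S P' G' i' T' C P G i (.ref T) →
      CxTy S P' G' i' T' (.deref C) P G i T
  | assignL {P G i C N T} : CxTy S P' G' i' T' C P G i (.ref T) → Typed S P G i N T →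
      CxTy S P' G' i' T' (.assignL C N) P G i .unit
  | assignR {P G i C N T} : Typed S P G i N (.ref T) → CxTy S P' G' i' T' C P G i T →
      CxTy S P' G' i' T' (.assignR N C) P G i .unit
  | box {P G C G₀ T} : WfLCtx 1 G → CxTy S P' G' i' T' C P G₀ 0 T →
      CxTy S P' G' i' T' (.box C) P G 1 (.box G₀ T)
  | letboxL {P G C N G₀ T₀ T} : CxTy S P' G' i' T' C P G 1 (.box G₀ T₀) →
      HasTy S P [(G₀, T₀)] G [] 1 N T → CxTy S P' G' i' T' (.letboxL C N) P G 1 T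
  | letboxR {P G u C N G₀ T₀ T} : Typed S P G 1 N (.box G₀ T₀) →
      CxTy S P' G' i' T' C ((u, (G₀, T₀)) :: P) G 1 T →
      CxTy S P' G' i' T' (.letboxR u N C) P G 1 T

/-- Small-step reduction of terms with heaps. -/
inductive Step : Tm × Heap → Tm × Heap → Prop
  | beta {M V h} : V.IsValue → Step (.app (.lam M) V, h) (M.beta V, h)
  | arith {o m n h} : Step (.arith o (.int m) (.int n), h) (.int (o.eval m n), h)
  | iteTrue {n M N h} : n ≠ 0 → Step (.ite (.int n) M N, h) (M, h)
  | iteFalse {M N h} : Step (.ite (.int 0) M N, h) (N, h)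
  | ref {V l} {h : Heap} : V.IsValue → h l = none →
      Step (.ref V, h) (.loc l, Function.update h l (some V))
  | deref {l V} {h : Heap} : h l = some V → Step (.deref (.loc l), h) (V, h)
  | assign {l V} {h : Heap} : V.IsValue → (h l).isSome →
      Step (.assign (.loc l) V, h) (.unit, Function.update h l (some V))
  | recf {M V h} : V.IsValue → Step (.app (.recf M) V, h) (M.beta2 V (.recf M), h)
  | letbox {M N h} : Step (.letbox (.box M) N, h) (N.gbeta M, h)
  | letboxName {b N h} : Step (.letbox (.bname b) N, h) (N.gbeta b.unbox, h)
  | ktx {K : Cx} {M h M' h'} : K.IsEval → Step (M, h) (M', h') →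
      Step (K.plug M, h) (K.plug M', h')

/-- `(M, h)` reduces to a value. -/
def Converges (M : Tm) (h : Heap) : Prop :=
  ∃ V h', V.IsValue ∧ Relation.ReflTransGen Step (M, h) (V, h')

/-- The contextual preorder on terms of type `T` at layer `i` in `S; P; G`. -/
def CtxPreorder (S : SCtx) (P : GCtx) (G : LCtx) (i : Layer) (T : Ty) (M₁ M₂ : Tm) : Prop :=
  ∀ (S' : SCtx) (C : Cx) (i' : Layer) (T' : Ty) (h : Heap),
    PSub S S' → C.Src → CxTy S' P G i T C [] [] i' T' →
    WfHeap S' h → (∀ l V, h l = some V → V.Src) →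
    Converges (C.plug M₁) h → Converges (C.plug M₂) h

/-! ## Abstract values, actions -/

/-- Abstract values. -/
inductive Abs where
  | unit : Abs
  | int : ℤ → Abs
  | loc : Loc → Abs
  | fn : FName → Abs
  | bx : BName → Abs

def Abs.toTm : Abs → Tm
  | .unit => .unit
  | .int n => .int n
  | .loc l => .loc l
  | .fn f => .fname f
  | .bx b => .bname b

/-- `ν(A)`. -/
def Abs.names : Abs → Set Name
  | .fn f => {.fn f}
  | .bx b => {.bx b}
  | _ => ∅

/-- `μ(A)`. -/
def Abs.locs : Abs → Set Loc
  | .loc l => {l}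
  | _ => ∅

/-- `A` is an abstraction of the closed value `V` of type `T` at layer `i`. The name assignment
that comes with it is `A.bind V`. -/
inductive AVal (S : SCtx) (i : Layer) : Tm → Ty → Abs → Prop
  | unit : ClTyped S i .unit .unit → AVal S i .unit .unit .unit
  | int {n} : ClTyped S i (.int n) .int → AVal S i (.int n) .int (.int n)
  | loc {l T} : ClTyped S i (.loc l) (.ref T) → AVal S i (.loc l) (.ref T) (.loc l)
  | fn {V} {f : FName} : V.IsValue → ClTyped S i V (.arr f.dom f.cod) → f.lvl = i →
      AVal S i V (.arr f.dom f.cod) (.fn f)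
  | bx {V} {b : BName} : V.IsValue → i = 1 → ClTyped S i V (.box b.ctx b.ty) →
      AVal S i V (.box b.ctx b.ty) (.bx b)

/-- The assignment `n ↦ V` if `A` is a name `n`, and nothing otherwise. -/
def Abs.bind (A : Abs) (V : Tm) : Set (Name × Tm) := {p | p.1 ∈ A.names ∧ p.2 = V}

/-- Abstract heaps. -/
abbrev AHeap := Loc → Option Abs
/-- Abstract local substitutions. -/
abbrev ASub := LVar → Option Abs
/-- Abstract global substitutions: `η u = some b` stands for `u ↦ #b`. -/
abbrev AGSub := GVar → Option BName

def domOf {α β : Type} (f : α → Option β) : Set α := {a | (f a).isSome}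
def namesOf {α : Type} (f : α → Option Abs) : Set Name := {n | ∃ a A, f a = some A ∧ n ∈ A.names}
def locsOf {α : Type} (f : α → Option Abs) : Set Loc := {l | ∃ a A, f a = some A ∧ l ∈ A.locs}
def AGSub.names (η : AGSub) : Set Name := {n | ∃ u b, η u = some b ∧ n = .bx b}

/-- Distinct entries use distinct names. -/
def DistinctNames {α : Type} (f : α → Option Abs) : Prop :=
  ∀ a a' A A', a ≠ a' → f a = some A → f a' = some A' → Disjoint A.names A'.names

/-- The name assignment of an entrywise abstraction `f` of `g`. -/
def bindOf {α : Type} (f : α → Option Abs) (g : α → Option Tm) : Set (Name × Tm) :=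
  {p | ∃ a A V, f a = some A ∧ g a = some V ∧ p ∈ A.bind V}

def toTms {α : Type} (f : α → Option Abs) : α → Option Tm := fun a => (f a).map Abs.toTm

/-- `ρ` is an abstraction of the closed local substitution `d` for `G`. -/
def AValSub (S : SCtx) (i : Layer) (d : LSub) (G : LCtx) (ρ : ASub) : Prop :=
  (∀ x, (ρ x).isSome ↔ x ∈ G.dom) ∧
  (∀ x T, (x, T) ∈ G → ∃ V A, d.lookup x = some V ∧ ρ x = some A ∧ AVal S i V T A) ∧
  DistinctNames ρ

/-- `χ` is an abstraction of the heap `h`, whose locations have the types given by `S'`; the values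
are typed in `S`. -/
def AValHeap (S S' : SCtx) (h : Heap) (χ : AHeap) : Prop :=
  domOf χ = domOf h ∧
  (∀ l V A T, h l = some V → χ l = some A → S' l = some T → ∃ i, AVal S i V T A) ∧
  DistinctNames χ

/-- Well-typed abstract local substitutions for `G`. -/
structure WfASub (S : SCtx) (i : Layer) (ρ : ASub) (G : LCtx) : Prop where
  dom : ∀ x, (ρ x).isSome ↔ x ∈ G.dom
  typed : ∀ x T A, (x, T) ∈ G → ρ x = some A → ClTyped S i A.toTm T
  distinct : DistinctNames ρ

/-- Well-typed abstract global substitutions for `P`. -/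
structure WfAGSub (η : AGSub) (P : GCtx) : Prop where
  dom : ∀ u, (η u).isSome ↔ u ∈ P.map Prod.fst
  typed : ∀ u G T b, (u, (G, T)) ∈ P → η u = some b → b.WF ∧ b.ctx = G ∧ b.ty = T
  distinct : ∀ u u' b b', u ≠ u' → η u = some b → η u' = some b' → b ≠ b'

/-- Well-typed abstract heaps. -/
structure WfAHeap (S : SCtx) (χ : AHeap) : Prop where
  heap : WfHeap S (toTms χ)
  distinct : DistinctNames χ

/-- `h'` is contained in `h`, its domain contains `X`, and it is closed under following
locations that are stored in it. -/
structure ClosedPart (h : Heap) (X : Set Loc) (h' : Heap) : Prop where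
  sub : PSub h' h
  cover : X ⊆ domOf h'
  closed : ∀ l l', h' l = some (.loc l') → l' ∈ domOf h'

/-- `h'` is the restriction of `h` to `X`: the least closed part of `h`. -/
structure IsRestr (h : Heap) (X : Set Loc) (h' : Heap) : Prop where
  part : ClosedPart h X h'
  least : ∀ h'', ClosedPart h X h'' → PSub h' h''

/-- `(S', h')` is the restriction of `(S, h)` to `X`. -/
structure IsRestrS (S : SCtx) (h : Heap) (X : Set Loc) (S' : SCtx) (h' : Heap) : Prop where
  heap : IsRestr h X h'
  store : PSub S' S
  dom : domOf S' = domOf h'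

inductive Polarity where
  | player | opponent

inductive Move where
  | ans : Abs → Move
  | call : FName → Abs → Move
  | run : BName → ASub → Move

structure Action where
  pol : Polarity
  move : Move
  store : SCtx
  heap : AHeap

/-! ## Configurations and transitions -/

/-- A stack frame: an evaluation context together with its typing. -/
structure Frame where
  S : SCtx
  K : Cx
  T₁ : Ty
  i₁ : Layer
  T₂ : Ty
  i₂ : Layer

/-- Configurations. The top of the stack is the head of the list. -/
inductive Cfg where
  | passive (S : SCtx) (h : Heap) (γ : Set (Name × Tm)) (φ : Set Name) (ξ : List Frame)
      (θ : Set Loc) : Cfg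
  | active (M : Tm) (i : Layer) (T : Ty) (S : SCtx) (h : Heap) (γ : Set (Name × Tm))
      (φ : Set Name) (ξ : List Frame) (θ : Set Loc) : Cfg

/-- Left-biased union of partial maps. -/
def pUnion {α β : Type} (f g : α → Option β) : α → Option β :=
  fun a => match f a with
    | some b => some b
    | none => g a

def Agree {α β : Type} (f g : α → Option β) : Prop :=
  ∀ a b b', f a = some b → g a = some b' → b = b'

/-- Silent transitions. -/
inductive Tau : Cfg → Cfg → Prop
  | mk {M₁ M₂ i T} {S₁ S₂ : SCtx} {h₁ h₂ γ φ ξ θ} : Step (M₁, h₁) (M₂, h₂) →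
      PSub S₁ S₂ → WfHeap S₂ h₂ → ClTyped S₂ i M₂ T →
      Tau (.active M₁ i T S₁ h₁ γ φ ξ θ) (.active M₂ i T S₂ h₂ γ φ ξ θ)

/-- The conditions on the heap part `S', χ` of an opponent action that mentions the locations
`X`, in a passive configuration with store context `S`, heap `h` and shared locations `θ`. -/
structure OppHeap (S : SCtx) (h : Heap) (θ X : Set Loc) (S' : SCtx) (χ : AHeap) : Prop where
  typed : WfAHeap S' χ
  agree : Agree S S'
  shared : domOf χ ∩ domOf h = θ
  least : IsRestr (toTms χ) (θ ∪ X) (toTms χ)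

/-- Transitions that are labelled with actions. -/
inductive Act : Cfg → Action → Cfg → Prop
  | PA {V i T S h γ φ ξ θ A S' h' χ} : V.IsValue → AVal S i V T A →
      IsRestrS S h (θ ∪ A.locs) S' h' → AValHeap S S' h' χ →
      Disjoint A.names (namesOf χ) → Disjoint φ (A.names ∪ namesOf χ) →
      Act (.active V i T S h γ φ ξ θ) ⟨.player, .ans A, S', χ⟩
        (.passive S h (γ ∪ A.bind V ∪ bindOf χ h') (φ ∪ A.names ∪ namesOf χ) ξ (domOf χ))
  | PQF {K : Cx} {f : FName} {V i i₂ i₃ T S h γ φ ξ θ A S' h' χ} :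
      K.IsEval → V.IsValue → f.WF → CxTy S [] [] i₃ f.cod K [] [] i T → AVal S i₂ V f.dom A →
      IsRestrS S h (θ ∪ A.locs) S' h' → AValHeap S S' h' χ →
      Disjoint A.names (namesOf χ) → Disjoint φ (A.names ∪ namesOf χ) →
      Act (.active (K.plug (.app (.fname f) V)) i T S h γ φ ξ θ) ⟨.player, .call f A, S', χ⟩
        (.passive S h (γ ∪ A.bind V ∪ bindOf χ h') (φ ∪ A.names ∪ namesOf χ)
          (⟨S, K, f.cod, i₃, T, i⟩ :: ξ) (domOf χ))
  | PQB {K : Cx} {b : BName} {d i i₁ T S h γ φ ξ θ ρ S' h' χ} :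
      K.IsEval → b.WF → CxTy S [] [] i₁ b.ty K [] [] i T → AValSub S i₁ d b.ctx ρ →
      IsRestrS S h (θ ∪ locsOf ρ) S' h' → AValHeap S S' h' χ →
      Disjoint (namesOf ρ) (namesOf χ) → Disjoint φ (namesOf ρ ∪ namesOf χ) →
      Act (.active (K.plug (.unb b d)) i T S h γ φ ξ θ) ⟨.player, .run b ρ, S', χ⟩
        (.passive S h (γ ∪ bindOf ρ d.lookup ∪ bindOf χ h') (φ ∪ namesOf ρ ∪ namesOf χ)
          (⟨S, K, b.ty, i₁, T, i⟩ :: ξ) (domOf χ))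
  | OA {S₀ K T₁ i₁ T₂ i₂ S h γ φ ξ θ A S' χ} :
      ClTyped S' i₁ A.toTm T₁ → OppHeap S h θ A.locs S' χ →
      Disjoint A.names (namesOf χ) → Disjoint φ (A.names ∪ namesOf χ) →
      Act (.passive S h γ φ (⟨S₀, K, T₁, i₁, T₂, i₂⟩ :: ξ) θ) ⟨.opponent, .ans A, S', χ⟩
        (.active (K.plug A.toTm) i₂ T₂ (pUnion S S') (pUnion (toTms χ) h) γ
          (φ ∪ A.names ∪ namesOf χ) ξ (domOf χ))
  | OQF {f : FName} {V i₂ S h γ φ ξ θ A S' χ} :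
      (Name.fn f, V) ∈ γ → ClTyped S' i₂ A.toTm f.dom → OppHeap S h θ A.locs S' χ →
      Disjoint A.names (namesOf χ) → Disjoint φ (A.names ∪ namesOf χ) →
      Act (.passive S h γ φ ξ θ) ⟨.opponent, .call f A, S', χ⟩
        (.active (.app V A.toTm) (max f.lvl i₂) f.cod (pUnion S S') (pUnion (toTms χ) h) γ
          (φ ∪ A.names ∪ namesOf χ) ξ (domOf χ))
  | OQB {b : BName} {V i S h γ φ ξ θ ρ S' χ} :
      (Name.bx b, V) ∈ γ → WfASub S' i ρ b.ctx → OppHeap S h θ (locsOf ρ) S' χ →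
      Disjoint (namesOf ρ) (namesOf χ) → Disjoint φ (namesOf ρ ∪ namesOf χ) →
      Act (.passive S h γ φ ξ θ) ⟨.opponent, .run b ρ, S', χ⟩
        (.active (V.unboxed.inst (toTms ρ)) i b.ty (pUnion S S') (pUnion (toTms χ) h) γ
          (φ ∪ namesOf ρ ∪ namesOf χ) ξ (domOf χ))

/-! ## Trace semantics -/

/-- `C` performs silent transitions and then the action `a`. -/
def WeakAct (C : Cfg) (a : Action) (C' : Cfg) : Prop :=
  ∃ C'', Relation.ReflTransGen Tau C C'' ∧ Act C'' a C'

inductive Run : Cfg → List Action → Cfg → Prop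
  | nil (C : Cfg) : Run C [] C
  | cons {C C' C'' a t} : WeakAct C a C' → Run C' t C'' → Run C (a :: t) C''

/-- The traces of a configuration: those that lead to a passive configuration with empty stack. -/
def CfgTraces (C : Cfg) : Set (List Action) :=
  {t | ∃ S h γ φ θ, Run C t (.passive S h γ φ [] θ)}

/-- `M[η]`. -/
def Tm.ginst (η : AGSub) (M : Tm) : Tm :=
  M.gsub (fun v => match v with
    | .b k => .inl (.b k)
    | .f u => match η u with
      | some b => .inr b.unbox
      | none => .inl (.f u))

/-- The initial configuration of a term `M` of type `T` at layer `i`. -/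
def initCfg (M : Tm) (i : Layer) (T : Ty) (S' : SCtx) (η : AGSub) (ρ : ASub) (χ : AHeap) : Cfg :=
  .active ((M.ginst η).inst (toTms ρ)) i T S' (toTms χ) ∅
    (η.names ∪ namesOf ρ ∪ namesOf χ) [] (domOf χ)

/-- The trace semantics of a term `M` of type `T` at layer `i` in `S; P; G`. -/
def Traces (S : SCtx) (P : GCtx) (G : LCtx) (i : Layer) (T : Ty) (M : Tm) :
    Set (AGSub × ASub × AHeap × List Action) :=
  {q | ∃ η ρ χ t, q = (η, ρ, χ, t) ∧ ∃ S' : SCtx, PSub S S' ∧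
    WfAGSub η P ∧ WfASub S' i ρ G ∧ WfAHeap S' χ ∧
    Disjoint η.names (namesOf ρ) ∧ Disjoint (η.names ∪ namesOf ρ) (namesOf χ) ∧
    t ∈ CfgTraces (initCfg M i T S' η ρ χ)}

end LMML

namespace LMML

-- Substitution calculus, scopes and occurrences.

/-! ## Algebra of renamings and substitutions -/

-- A program and its environment are treated as the two sides of a dialogue. Each side has its own
-- heap, values for the names it has handed out, and a stack of evaluation contexts; functions and
-- boxes that it receives are mere names. Replacing all names by the values assigned to them and
-- merging the two heaps turns such a pair back into an ordinary term `Q` with a heap `H` (`Comp`,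
-- `Game`). Two facts carry everything: a reduction step of the active side is exactly one step of
-- `Q` (`Game.st`), and an exchange of a move leaves `Q` and `H` unchanged (`Game.exchange`).
--
-- The first half proves that trace inclusion implies the preorder `Ciu`, in which a term is tested
-- by closing substitutions, evaluation contexts and heaps (`ciu_of_traces`). Such a test is an
-- environment, the same for both terms (`exists_init`). If the composite with `M₁` converges,
-- following its reduction produces a trace of `M₁`, which ends when the environment has reached a
-- value and the program has an empty stack. The induction is on the number of steps of the
-- composite and, since exchanges cost no step, on a measure that decreases with each exchange
-- (`exists_measure_lt`). The same induction shows that every program with this trace converges in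
-- this environment: the environment repeats its half of the dialogue, and the trace fixes the other
-- half (`claims`, `PState.goal`). By trace inclusion `M₂` is such a program. Types serve to find
-- legal moves for `M₁`; the composition with `M₂` is handled without types.
--
-- The environment lives at layer 1 and the program at layer `s`. A program of layer 0 can hold
-- values in its heap whose types it cannot use. These are always abstract values received from the
-- environment, so the program at most hands them back under new names and forwards calls to them.
-- This is why `VOK`, `PBind`, `PFrame` and `PTerm` have two alternatives each, and why the measure
-- must bound chains of forwarded calls.
--
-- The second half proves that `Ciu` is preserved by all contexts (`Ciu.plug`). If the hole is in
-- evaluation position this is immediate; if a subterm is evaluated before the hole, one waits for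
-- its value (`CCiu.of_values`). For `lam`, `rec` and `box` the two closed values to be compared are
-- hidden behind a single name, and the reduction with the smaller value is replayed with the larger
-- one, one use of the name at a time (`Repl.conv`). At every use the hypothesis on the bodies
-- applies, in the evaluation context of that use.

@[simp] theorem upRen_zero (r : ℕ → ℕ) : upRen r 0 = 0 := rfl
@[simp] theorem upRen_succ (r : ℕ → ℕ) (k : ℕ) : upRen r (k + 1) = r k + 1 := rfl
@[simp] theorem upSub_zero (s : ℕ → Tm) : upSub s 0 = .bvar 0 := rfl
@[simp] theorem upSub_succ (s : ℕ → Tm) (k : ℕ) : upSub s (k + 1) = (s k).lren Nat.succ := rfl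

theorem upRen_comp (r r' : ℕ → ℕ) : upRen (r ∘ r') = upRen r ∘ upRen r' := by
  funext k; cases k <;> rfl

theorem upGRen_comp (r r' : GV → GV) : upGRen (r ∘ r') = upGRen r ∘ upGRen r' := by
  funext v; rcases v with (_ | k) | u
  · rfl
  · simp only [upGRen, Function.comp]; cases r' (.b k) <;> rfl
  · simp only [upGRen, Function.comp]; cases r' (.f u) <;> rfl

theorem upGRen_shift (r : GV → GV) : upGRen r ∘ GV.shift = GV.shift ∘ r := by
  funext v; cases v <;> rfl

/-- The composition laws build on one another because of binders: going under a binder composes a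
substitution with a shift, so the laws for substitutions need those for renamings in the cases of
`lam`, `rec` and `letbox`. -/
theorem Tm.lren_lren (M : Tm) : ∀ r r' : ℕ → ℕ, (M.lren r).lren r' = M.lren (r' ∘ r) := by
  induction M using Tm.rec
    (motive_2 := fun d => ∀ r r' : ℕ → ℕ, (d.lren r).lren r' = d.lren (r' ∘ r)) <;>
    intros <;> simp_all [Tm.lren, LSub.lren, upRen_comp]

theorem Tm.gren_gren (M : Tm) : ∀ r r' : GV → GV, (M.gren r).gren r' = M.gren (r' ∘ r) := by
  induction M using Tm.rec
    (motive_2 := fun d => ∀ r r' : GV → GV, (d.gren r).gren r' = d.gren (r' ∘ r)) <;>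
    intros <;> simp_all [Tm.gren, LSub.gren, upGRen_comp]

theorem Tm.gren_lren (M : Tm) : ∀ (r : ℕ → ℕ) (g : GV → GV),
    (M.lren r).gren g = (M.gren g).lren r := by
  induction M using Tm.rec
    (motive_2 := fun d => ∀ (r : ℕ → ℕ) (g : GV → GV),
      (d.lren r).gren g = (d.gren g).lren r) <;>
    intros <;> simp_all [Tm.gren, LSub.gren, Tm.lren, LSub.lren]

theorem Tm.gren_shift (M : Tm) (g : GV → GV) :
    (M.gren GV.shift).gren (upGRen g) = (M.gren g).gren GV.shift := by
  rw [Tm.gren_gren, Tm.gren_gren, upGRen_shift]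

theorem upSub_comp_upRen (s : ℕ → Tm) (r : ℕ → ℕ) : upSub s ∘ upRen r = upSub (s ∘ r) := by
  funext k; cases k <;> rfl

theorem Tm.lsub_lren (M : Tm) : ∀ (r : ℕ → ℕ) (s : ℕ → Tm) (e : LVar → Tm),
    (M.lren r).lsub s e = M.lsub (s ∘ r) e := by
  induction M using Tm.rec
    (motive_2 := fun d => ∀ (r : ℕ → ℕ) (s : ℕ → Tm) (e : LVar → Tm),
      (d.lren r).lsub s e = d.lsub (s ∘ r) e) <;>
    intros <;> simp_all [Tm.lsub, LSub.lsub, Tm.lren, LSub.lren, upSub_comp_upRen]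
  rfl

theorem lren_comp_upSub (s : ℕ → Tm) (r : ℕ → ℕ) :
    (fun k => (upSub s k).lren (upRen r)) = upSub (fun k => (s k).lren r) := by
  funext k; cases k
  · rfl
  · simp only [upSub_succ, Tm.lren_lren]; rfl

theorem lren_upRen_succ (M : Tm) (r : ℕ → ℕ) :
    (M.lren Nat.succ).lren (upRen r) = (M.lren r).lren Nat.succ := by
  rw [Tm.lren_lren, Tm.lren_lren]; rfl

theorem Tm.lren_lsub (M : Tm) : ∀ (r : ℕ → ℕ) (s : ℕ → Tm) (e : LVar → Tm),
    (M.lsub s e).lren r = M.lsub (fun k => (s k).lren r) (fun x => (e x).lren r) := by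
  induction M using Tm.rec
    (motive_2 := fun d => ∀ (r : ℕ → ℕ) (s : ℕ → Tm) (e : LVar → Tm),
      (d.lsub s e).lren r = d.lsub (fun k => (s k).lren r) (fun x => (e x).lren r)) <;>
    intros <;> simp_all [Tm.lsub, LSub.lsub, Tm.lren, LSub.lren, lren_comp_upSub,
      lren_upRen_succ, Tm.gren_lren]

theorem gren_comp_upSub (s : ℕ → Tm) (g : GV → GV) :
    (fun k => (upSub s k).gren g) = upSub (fun k => (s k).gren g) := by
  funext k; cases k
  · rfl
  · simp only [upSub_succ, Tm.gren_lren]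

theorem Tm.gren_lsub (M : Tm) : ∀ (g : GV → GV) (s : ℕ → Tm) (e : LVar → Tm),
    (M.lsub s e).gren g = (M.gren g).lsub (fun k => (s k).gren g) (fun x => (e x).gren g) := by
  induction M using Tm.rec
    (motive_2 := fun d => ∀ (g : GV → GV) (s : ℕ → Tm) (e : LVar → Tm),
      (d.lsub s e).gren g = (d.gren g).lsub (fun k => (s k).gren g) (fun x => (e x).gren g)) <;>
    intros <;> simp_all [Tm.lsub, LSub.lsub, Tm.gren, LSub.gren, gren_comp_upSub,
      Tm.gren_lren, Tm.gren_shift]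

theorem lsub_comp_upSub (s s' : ℕ → Tm) (e' : LVar → Tm) :
    (fun k => (upSub s k).lsub (upSub s') (fun x => (e' x).lren Nat.succ)) =
      upSub (fun k => (s k).lsub s' e') := by
  funext k; cases k
  · rfl
  · simp only [upSub_succ, Tm.lsub_lren, Tm.lren_lsub]; rfl

theorem lsub_lren_succ (M : Tm) (s' : ℕ → Tm) (e' : LVar → Tm) :
    (M.lren Nat.succ).lsub (upSub s') (fun x => (e' x).lren Nat.succ) =
      (M.lsub s' e').lren Nat.succ := by
  simp only [Tm.lsub_lren, Tm.lren_lsub]; rfl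

theorem Tm.lsub_lsub (M : Tm) : ∀ (s s' : ℕ → Tm) (e e' : LVar → Tm),
    (M.lsub s e).lsub s' e' = M.lsub (fun k => (s k).lsub s' e') (fun x => (e x).lsub s' e') := by
  induction M using Tm.rec
    (motive_2 := fun d => ∀ (s s' : ℕ → Tm) (e e' : LVar → Tm),
      (d.lsub s e).lsub s' e' =
        d.lsub (fun k => (s k).lsub s' e') (fun x => (e x).lsub s' e')) <;>
    intros <;> simp_all [Tm.lsub, LSub.lsub, lsub_comp_upSub, lsub_lren_succ, ← Tm.gren_lsub]

theorem upSub_bvar : upSub .bvar = .bvar := by funext k; cases k <;> rfl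

theorem Tm.lsub_id (M : Tm) : M.lsub .bvar .fvar = M := by
  induction M using Tm.rec (motive_2 := fun d => d.lsub .bvar .fvar = d) <;>
    simp_all [Tm.lsub, LSub.lsub, upSub_bvar, Tm.lren, Tm.gren]

/-! ## Lookups -/

@[simp] theorem LSub.keys_lren (d : LSub) (r : ℕ → ℕ) : (d.lren r).keys = d.keys := by
  induction d using LSub.rec (motive_1 := fun _ => True) <;> simp_all [LSub.lren, LSub.keys]

@[simp] theorem LSub.keys_gren (d : LSub) (r : GV → GV) : (d.gren r).keys = d.keys := by
  induction d using LSub.rec (motive_1 := fun _ => True) <;> simp_all [LSub.gren, LSub.keys]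

@[simp] theorem LSub.keys_lsub (d : LSub) (s : ℕ → Tm) (e : LVar → Tm) :
    (d.lsub s e).keys = d.keys := by
  induction d using LSub.rec (motive_1 := fun _ => True) <;> simp_all [LSub.lsub, LSub.keys]

@[simp] theorem LSub.keys_gsub (d : LSub) (g : GSub) : (d.gsub g).keys = d.keys := by
  induction d using LSub.rec (motive_1 := fun _ => True) <;> simp_all [LSub.gsub, LSub.keys]

@[simp] theorem LSub.lookup_lren (d : LSub) (r : ℕ → ℕ) (x : LVar) :
    (d.lren r).lookup x = (d.lookup x).map (Tm.lren r) := by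
  induction d using LSub.rec (motive_1 := fun _ => True) <;>
    simp_all [LSub.lren, LSub.lookup]
  split <;> rfl

@[simp] theorem LSub.lookup_gren (d : LSub) (r : GV → GV) (x : LVar) :
    (d.gren r).lookup x = (d.lookup x).map (Tm.gren r) := by
  induction d using LSub.rec (motive_1 := fun _ => True) <;>
    simp_all [LSub.gren, LSub.lookup]
  split <;> rfl

@[simp] theorem LSub.lookup_lsub (d : LSub) (s : ℕ → Tm) (e : LVar → Tm) (x : LVar) :
    (d.lsub s e).lookup x = (d.lookup x).map (Tm.lsub s e) := by
  induction d using LSub.rec (motive_1 := fun _ => True) <;>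
    simp_all [LSub.lsub, LSub.lookup]
  split <;> rfl

@[simp] theorem LSub.lookup_gsub (d : LSub) (g : GSub) (x : LVar) :
    (d.gsub g).lookup x = (d.lookup x).map (Tm.gsub g) := by
  induction d using LSub.rec (motive_1 := fun _ => True) <;>
    simp_all [LSub.gsub, LSub.lookup]
  split <;> rfl

theorem LSub.lookup_isSome (d : LSub) (x : LVar) : (d.lookup x).isSome ↔ x ∈ d.keys := by
  induction d using LSub.rec (motive_1 := fun _ => True) <;> try trivial
  · simp [LSub.lookup, LSub.keys]
  · simp only [LSub.lookup, LSub.keys, List.mem_cons]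
    split <;> rename_i h <;> simp_all [Ne.symm]

theorem LSub.lookup_of_mem {d : LSub} {x : LVar} (h : x ∈ d.keys) : ∃ V, d.lookup x = some V :=
  Option.isSome_iff_exists.1 ((d.lookup_isSome x).2 h)

theorem LSub.mem_of_lookup {d : LSub} {x : LVar} {V : Tm} (h : d.lookup x = some V) :
    x ∈ d.keys := (d.lookup_isSome x).1 (by simp [h])

/-! ## Scoping -/

/-- Extension of a global scope by a variable whose code has its variables in `Y`. -/
def upScope (Y : Set LVar) (Φ : GV → Set LVar → Prop) : GV → Set LVar → Prop
  | .b 0 => fun Z => Z = Y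
  | .b (k + 1) => Φ (.b k)
  | .f u => Φ (.f u)

mutual
/-- `M.Sc Φ n X`: the local indices of `M` are below `n`, its named local variables are in `X`, and
its global variables `v` are in the global scope `Φ` and used with enough local variables. -/
def Tm.Sc : (GV → Set LVar → Prop) → ℕ → Set LVar → Tm → Prop
  | _, _, _, .unit | _, _, _, .int _ | _, _, _, .loc _ | _, _, _, .fname _ | _, _, _, .bname _ =>
    True
  | _, n, _, .bvar k => k < n
  | _, _, X, .fvar x => x ∈ X
  | Φ, n, X, .gvar v d => (∃ Y, Φ v Y ∧ ∀ x ∈ Y, x ∈ d.keys) ∧ d.Sc Φ n X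
  | Φ, n, X, .lam M => M.Sc Φ (n + 1) X
  | Φ, n, X, .recf M => M.Sc Φ (n + 2) X
  | Φ, n, X, .app M N | Φ, n, X, .arith _ M N | Φ, n, X, .assign M N => M.Sc Φ n X ∧ N.Sc Φ n X
  | Φ, n, X, .ite M N P => M.Sc Φ n X ∧ N.Sc Φ n X ∧ P.Sc Φ n X
  | Φ, n, X, .ref M | Φ, n, X, .deref M => M.Sc Φ n X
  | Φ, _, _, .box M => ∃ Y, M.Sc Φ 0 Y
  | Φ, n, X, .letbox M N => M.Sc Φ n X ∧ ∃ Y, N.Sc (upScope Y Φ) n X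
  | Φ, n, X, .unb _ d => d.Sc Φ n X
def LSub.Sc : (GV → Set LVar → Prop) → ℕ → Set LVar → LSub → Prop
  | _, _, _, .nil => True
  | Φ, n, X, .cons _ V d => V.Sc Φ n X ∧ d.Sc Φ n X
end

/-- The empty global scope. -/
def noScope : GV → Set LVar → Prop := fun _ _ => False

/-- Closed code over the local variables `X`. -/
abbrev Tm.Code (X : Set LVar) (M : Tm) : Prop := M.Sc noScope 0 X

/-- Closed terms. -/
abbrev Tm.Closed (M : Tm) : Prop := M.Sc noScope 0 ∅

theorem LSub.Sc.lookup {Φ n X x V} {d : LSub} (h : d.Sc Φ n X) (hx : d.lookup x = some V) :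
    V.Sc Φ n X := by
  induction d using LSub.rec (motive_1 := fun _ => True) <;> try trivial
  · simp only [LSub.lookup, LSub.Sc] at hx h
    split at hx
    · cases hx; exact h.1
    · rename_i ih _; exact ih h.2 hx

theorem upScope_mono {Y : Set LVar} {Φ Φ' : GV → Set LVar → Prop} (h : ∀ v Z, Φ v Z → Φ' v Z) :
    ∀ v Z, upScope Y Φ v Z → upScope Y Φ' v Z := by
  rintro ((_ | k) | u) Z hZ
  · exact hZ
  · exact h _ _ hZ
  · exact h _ _ hZ

theorem Tm.Sc.mono (M : Tm) : ∀ ⦃Φ Φ' : GV → Set LVar → Prop⦄ ⦃n n' : ℕ⦄ ⦃X X' : Set LVar⦄,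
    (∀ v Y, Φ v Y → Φ' v Y) → n ≤ n' → X ⊆ X' → M.Sc Φ n X → M.Sc Φ' n' X' := by
  induction M using Tm.rec
    (motive_2 := fun d => ∀ ⦃Φ Φ' : GV → Set LVar → Prop⦄ ⦃n n' : ℕ⦄ ⦃X X' : Set LVar⦄,
    (∀ v Y, Φ v Y → Φ' v Y) → n ≤ n' → X ⊆ X' → d.Sc Φ n X → d.Sc Φ' n' X')
  case nil => trivial
  case cons ih1 ih2 _ _ _ _ _ _ hΦ hn hX h => exact ⟨ih1 hΦ hn hX h.1, ih2 hΦ hn hX h.2⟩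
  all_goals intro Φ Φ' n n' X X' hΦ hn hX h; simp only [Tm.Sc] at h ⊢
  case bvar => omega
  case fvar => exact hX h
  case gvar v d ih =>
    obtain ⟨⟨Y, hY, hk⟩, hd⟩ := h
    exact ⟨⟨Y, hΦ _ _ hY, hk⟩, ih hΦ hn hX hd⟩
  case lam ih => exact ih hΦ (by omega) hX h
  case recf ih => exact ih hΦ (by omega) hX h
  case app ih1 ih2 => exact ⟨ih1 hΦ hn hX h.1, ih2 hΦ hn hX h.2⟩
  case arith ih1 ih2 => exact ⟨ih1 hΦ hn hX h.1, ih2 hΦ hn hX h.2⟩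
  case assign ih1 ih2 => exact ⟨ih1 hΦ hn hX h.1, ih2 hΦ hn hX h.2⟩
  case ite ih1 ih2 ih3 => exact ⟨ih1 hΦ hn hX h.1, ih2 hΦ hn hX h.2.1, ih3 hΦ hn hX h.2.2⟩
  case ref ih => exact ih hΦ hn hX h
  case deref ih => exact ih hΦ hn hX h
  case box ih => obtain ⟨Y, h⟩ := h; exact ⟨Y, ih hΦ le_rfl subset_rfl h⟩
  case letbox ih1 ih2 =>
    obtain ⟨h1, Y, h2⟩ := h
    exact ⟨ih1 hΦ hn hX h1, Y, ih2 (upScope_mono hΦ) hn hX h2⟩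
  case unb ih => exact ih hΦ hn hX h

/-- A substitution acts only through the variables in scope. This is what the scopes are for: closed
terms are fixed by all substitutions, and two substitutions need to be compared on the relevant
variables only. -/
theorem Tm.lsub_congr (M : Tm) : ∀ ⦃Φ : GV → Set LVar → Prop⦄ ⦃n : ℕ⦄ ⦃X : Set LVar⦄
    ⦃s s' : ℕ → Tm⦄ ⦃e e' : LVar → Tm⦄, M.Sc Φ n X → (∀ k < n, s k = s' k) →
    (∀ x ∈ X, e x = e' x) → M.lsub s e = M.lsub s' e' := by
  have up : ∀ {n : ℕ} {s s' : ℕ → Tm}, (∀ k < n, s k = s' k) →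
      ∀ k < n + 1, upSub s k = upSub s' k := by
    intro n s s' h k hk
    cases k with
    | zero => rfl
    | succ k => simp [h k (by omega)]
  induction M using Tm.rec
    (motive_2 := fun d => ∀ ⦃Φ : GV → Set LVar → Prop⦄ ⦃n : ℕ⦄ ⦃X : Set LVar⦄
      ⦃s s' : ℕ → Tm⦄ ⦃e e' : LVar → Tm⦄, d.Sc Φ n X → (∀ k < n, s k = s' k) →
      (∀ x ∈ X, e x = e' x) → d.lsub s e = d.lsub s' e')
  case nil => rfl
  case cons ih1 ih2 _ _ _ _ _ _ _ h hs he =>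
    simp only [LSub.lsub]; rw [ih1 h.1 hs he, ih2 h.2 hs he]
  all_goals
    intro Φ n X s s' e e' h hs he
    simp only [Tm.Sc] at h
    simp only [Tm.lsub]
  case bvar => exact hs _ h
  case fvar => exact he _ h
  case gvar ih => rw [ih h.2 hs he]
  case lam ih => rw [ih h (up hs) (fun x hx => by rw [he x hx])]
  case recf ih => rw [ih h (up (up hs)) (fun x hx => by rw [he x hx])]
  case app ih1 ih2 => rw [ih1 h.1 hs he, ih2 h.2 hs he]
  case arith ih1 ih2 => rw [ih1 h.1 hs he, ih2 h.2 hs he]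
  case assign ih1 ih2 => rw [ih1 h.1 hs he, ih2 h.2 hs he]
  case ite ih1 ih2 ih3 => rw [ih1 h.1 hs he, ih2 h.2.1 hs he, ih3 h.2.2 hs he]
  case ref ih => rw [ih h hs he]
  case deref ih => rw [ih h hs he]
  case letbox ih1 ih2 =>
    obtain ⟨h1, Y, h2⟩ := h
    rw [ih1 h1 hs he, ih2 h2 (fun k hk => by rw [hs k hk]) (fun x hx => by rw [he x hx])]
  case unb ih => rw [ih h hs he]

theorem Tm.lren_eq_lsub (M : Tm) : ∀ r : ℕ → ℕ, M.lren r = M.lsub (fun k => .bvar (r k)) .fvar := by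
  intro r
  have := Tm.lren_lsub M r .bvar .fvar
  rw [Tm.lsub_id] at this
  rw [this]; rfl

theorem Tm.Closed.lsub {M : Tm} (h : M.Closed) (s : ℕ → Tm) (e : LVar → Tm) : M.lsub s e = M := by
  conv_rhs => rw [← Tm.lsub_id M]
  exact Tm.lsub_congr M h (by simp) (by simp)

theorem Tm.Sc.lren_eq {Φ X} {M : Tm} (h : M.Sc Φ 0 X) (r : ℕ → ℕ) : M.lren r = M := by
  rw [Tm.lren_eq_lsub]
  conv_rhs => rw [← Tm.lsub_id M]
  exact Tm.lsub_congr M h (by simp) (by simp)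

/-- A global renaming that fixes the variables in scope. -/
theorem Tm.gren_eq (M : Tm) : ∀ ⦃Φ : GV → Set LVar → Prop⦄ ⦃n : ℕ⦄ ⦃X : Set LVar⦄
    ⦃r : GV → GV⦄, M.Sc Φ n X → (∀ v Y, Φ v Y → r v = v) → M.gren r = M := by
  induction M using Tm.rec
    (motive_2 := fun d => ∀ ⦃Φ : GV → Set LVar → Prop⦄ ⦃n : ℕ⦄ ⦃X : Set LVar⦄
      ⦃r : GV → GV⦄, d.Sc Φ n X → (∀ v Y, Φ v Y → r v = v) → d.gren r = d)
  case nil => rfl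
  case cons ih1 ih2 _ _ _ _ h hr => simp only [LSub.gren]; rw [ih1 h.1 hr, ih2 h.2 hr]
  all_goals
    intro Φ n X r h hr
    simp only [Tm.Sc] at h
    simp only [Tm.gren]
  case gvar ih => obtain ⟨⟨Y, hY, -⟩, hd⟩ := h; rw [ih hd hr, hr _ _ hY]
  case lam ih => rw [ih h hr]
  case recf ih => rw [ih h hr]
  case app ih1 ih2 => rw [ih1 h.1 hr, ih2 h.2 hr]
  case arith ih1 ih2 => rw [ih1 h.1 hr, ih2 h.2 hr]
  case assign ih1 ih2 => rw [ih1 h.1 hr, ih2 h.2 hr]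
  case ite ih1 ih2 ih3 => rw [ih1 h.1 hr, ih2 h.2.1 hr, ih3 h.2.2 hr]
  case ref ih => rw [ih h hr]
  case deref ih => rw [ih h hr]
  case box ih => obtain ⟨Y, h⟩ := h; rw [ih h hr]
  case letbox ih1 ih2 =>
    obtain ⟨h1, Y, h2⟩ := h
    rw [ih1 h1 hr, ih2 h2]
    rintro ((_ | k) | u) Z hZ
    · rfl
    · simp only [upGRen, hr _ _ hZ]; rfl
    · simp only [upGRen, hr _ _ hZ]; rfl
  case unb ih => rw [ih h hr]

theorem Tm.Code.gren {X} {M : Tm} (h : M.Code X) (r : GV → GV) : M.gren r = M :=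
  Tm.gren_eq M h (by simp [noScope])

/-! ## Scoping of renamed and substituted terms -/

theorem Tm.Sc.lren (M : Tm) : ∀ ⦃Φ : GV → Set LVar → Prop⦄ ⦃n m : ℕ⦄ ⦃X : Set LVar⦄ ⦃r : ℕ → ℕ⦄,
    M.Sc Φ n X → (∀ k < n, r k < m) → (M.lren r).Sc Φ m X := by
  have up : ∀ {n m : ℕ} {r : ℕ → ℕ}, (∀ k < n, r k < m) → ∀ k < n + 1, upRen r k < m + 1 := by
    intro n m r h k hk
    cases k with
    | zero => simp
    | succ k => simp [h k (by omega)]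
  induction M using Tm.rec
    (motive_2 := fun d => ∀ ⦃Φ : GV → Set LVar → Prop⦄ ⦃n m : ℕ⦄ ⦃X : Set LVar⦄ ⦃r : ℕ → ℕ⦄,
    d.Sc Φ n X → (∀ k < n, r k < m) → (d.lren r).Sc Φ m X)
  case nil => trivial
  case cons ih1 ih2 _ _ _ _ _ h hr => exact ⟨ih1 h.1 hr, ih2 h.2 hr⟩
  all_goals
    intro Φ n m X r h hr
    simp only [Tm.Sc] at h
    simp only [Tm.Sc, Tm.lren]
  case bvar => exact hr _ h
  case fvar => exact h
  case gvar ih => simp only [LSub.keys_lren]; exact ⟨h.1, ih h.2 hr⟩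
  case lam ih => exact ih h (up hr)
  case recf ih => exact ih h (up (up hr))
  case app ih1 ih2 => exact ⟨ih1 h.1 hr, ih2 h.2 hr⟩
  case arith ih1 ih2 => exact ⟨ih1 h.1 hr, ih2 h.2 hr⟩
  case assign ih1 ih2 => exact ⟨ih1 h.1 hr, ih2 h.2 hr⟩
  case ite ih1 ih2 ih3 => exact ⟨ih1 h.1 hr, ih2 h.2.1 hr, ih3 h.2.2 hr⟩
  case ref ih => exact ih h hr
  case deref ih => exact ih h hr
  case box => exact h
  case letbox ih1 ih2 => obtain ⟨h1, Y, h2⟩ := h; exact ⟨ih1 h1 hr, Y, ih2 h2 hr⟩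
  case unb ih => exact ih h hr

theorem Tm.Sc.gren (M : Tm) : ∀ ⦃Φ Ψ : GV → Set LVar → Prop⦄ ⦃n : ℕ⦄ ⦃X : Set LVar⦄
    ⦃r : GV → GV⦄, M.Sc Φ n X → (∀ v Y, Φ v Y → Ψ (r v) Y) → (M.gren r).Sc Ψ n X := by
  induction M using Tm.rec
    (motive_2 := fun d => ∀ ⦃Φ Ψ : GV → Set LVar → Prop⦄ ⦃n : ℕ⦄ ⦃X : Set LVar⦄
    ⦃r : GV → GV⦄, d.Sc Φ n X → (∀ v Y, Φ v Y → Ψ (r v) Y) → (d.gren r).Sc Ψ n X)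
  case nil => trivial
  case cons ih1 ih2 _ _ _ _ _ h hr => exact ⟨ih1 h.1 hr, ih2 h.2 hr⟩
  all_goals
    intro Φ Ψ n X r h hr
    simp only [Tm.Sc] at h
    simp only [Tm.Sc, Tm.gren]
  case bvar => exact h
  case fvar => exact h
  case gvar ih =>
    obtain ⟨⟨Y, hY, hk⟩, hd⟩ := h
    simp only [LSub.keys_gren]; exact ⟨⟨Y, hr _ _ hY, hk⟩, ih hd hr⟩
  case lam ih => exact ih h hr
  case recf ih => exact ih h hr
  case app ih1 ih2 => exact ⟨ih1 h.1 hr, ih2 h.2 hr⟩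
  case arith ih1 ih2 => exact ⟨ih1 h.1 hr, ih2 h.2 hr⟩
  case assign ih1 ih2 => exact ⟨ih1 h.1 hr, ih2 h.2 hr⟩
  case ite ih1 ih2 ih3 => exact ⟨ih1 h.1 hr, ih2 h.2.1 hr, ih3 h.2.2 hr⟩
  case ref ih => exact ih h hr
  case deref ih => exact ih h hr
  case box ih => obtain ⟨Y, h⟩ := h; exact ⟨Y, ih h hr⟩
  case letbox ih1 ih2 =>
    obtain ⟨h1, Y, h2⟩ := h
    refine ⟨ih1 h1 hr, Y, ih2 h2 ?_⟩
    rintro ((_ | k) | u) Z hZ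
    · exact hZ
    · have := hr _ _ hZ
      simp only [upGRen]; revert this; cases r (.b k) <;> exact id
    · have := hr _ _ hZ
      simp only [upGRen]; revert this; cases r (.f u) <;> exact id
  case unb ih => exact ih h hr

theorem upScope_shift {Y Z : Set LVar} {Φ : GV → Set LVar → Prop} {v : GV} (h : Φ v Z) :
    upScope Y Φ v.shift Z := by cases v <;> exact h

theorem Tm.Sc.shift {Φ n X} {M : Tm} (h : M.Sc Φ n X) (Y : Set LVar) :
    (M.gren GV.shift).Sc (upScope Y Φ) n X :=
  Tm.Sc.gren M h fun _ _ hv => upScope_shift hv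

theorem Tm.Sc.lsub (M : Tm) : ∀ ⦃Φ : GV → Set LVar → Prop⦄ ⦃n m : ℕ⦄ ⦃X Y : Set LVar⦄
    ⦃s : ℕ → Tm⦄ ⦃e : LVar → Tm⦄, M.Sc Φ n X → (∀ k < n, (s k).Sc Φ m Y) →
    (∀ x ∈ X, (e x).Sc Φ m Y) → (M.lsub s e).Sc Φ m Y := by
  have succ : ∀ {Φ m Y} {V : Tm}, V.Sc Φ m Y → (V.lren Nat.succ).Sc Φ (m + 1) Y :=
    fun h => Tm.Sc.lren _ h fun k hk => by omega
  have up : ∀ {Φ Y} {n m : ℕ} {s : ℕ → Tm}, (∀ k < n, (s k).Sc Φ m Y) →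
      ∀ k < n + 1, (upSub s k).Sc Φ (m + 1) Y := by
    intro Φ Y n m s h k hk
    cases k with
    | zero => simp [Tm.Sc]
    | succ k => exact succ (h k (by omega))
  induction M using Tm.rec
    (motive_2 := fun d => ∀ ⦃Φ : GV → Set LVar → Prop⦄ ⦃n m : ℕ⦄ ⦃X Y : Set LVar⦄
      ⦃s : ℕ → Tm⦄ ⦃e : LVar → Tm⦄, d.Sc Φ n X → (∀ k < n, (s k).Sc Φ m Y) →
      (∀ x ∈ X, (e x).Sc Φ m Y) → (d.lsub s e).Sc Φ m Y)
  case nil => trivial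
  case cons ih1 ih2 _ _ _ _ _ _ _ h hs he => exact ⟨ih1 h.1 hs he, ih2 h.2 hs he⟩
  all_goals
    intro Φ n m X Y s e h hs he
    simp only [Tm.Sc] at h
    simp only [Tm.Sc, Tm.lsub]
  case bvar => exact hs _ h
  case fvar => exact he _ h
  case gvar ih => simp only [LSub.keys_lsub]; exact ⟨h.1, ih h.2 hs he⟩
  case lam ih => exact ih h (up hs) fun x hx => succ (he x hx)
  case recf ih => exact ih h (up (up hs)) fun x hx => succ (succ (he x hx))
  case app ih1 ih2 => exact ⟨ih1 h.1 hs he, ih2 h.2 hs he⟩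
  case arith ih1 ih2 => exact ⟨ih1 h.1 hs he, ih2 h.2 hs he⟩
  case assign ih1 ih2 => exact ⟨ih1 h.1 hs he, ih2 h.2 hs he⟩
  case ite ih1 ih2 ih3 => exact ⟨ih1 h.1 hs he, ih2 h.2.1 hs he, ih3 h.2.2 hs he⟩
  case ref ih => exact ih h hs he
  case deref ih => exact ih h hs he
  case box => exact h
  case letbox ih1 ih2 =>
    obtain ⟨h1, Z, h2⟩ := h
    exact ⟨ih1 h1 hs he, Z, ih2 h2 (fun k hk => (hs k hk).shift Z) fun x hx => (he x hx).shift Z⟩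
  case unb ih => exact ih h hs he

/-! ## Global substitution -/

/-- The substitution `g` takes the global scope `Φ` to `Ψ`. -/
def GSub.Sc (g : GSub) (Φ Ψ : GV → Set LVar → Prop) : Prop :=
  ∀ v Y, Φ v Y → (∀ v', g v = .inl v' → Ψ v' Y) ∧ ∀ N, g v = .inr N → N.Sc Ψ 0 Y

/-- The terms in the range of `g` have no free local indices. -/
def GSub.Lc (g : GSub) : Prop := ∀ v N, g v = .inr N → ∀ r, N.lren r = N

/-- Renaming the result of a global substitution. -/
def GSub.ren (r : GV → GV) (g : GSub) : GSub := fun v => (g v).map r (Tm.gren r)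

theorem upGSub_shift (g : GSub) (v : GV) : upGSub g v.shift = g.ren GV.shift v := by
  cases v <;> rfl

theorem GSub.Sc.up {g : GSub} {Φ Ψ : GV → Set LVar → Prop} (h : g.Sc Φ Ψ) (Z : Set LVar) :
    (upGSub g).Sc (upScope Z Φ) (upScope Z Ψ) := by
  rintro ((_ | k) | u) Y hY
  · simp only [upGSub, Sum.inl.injEq, reduceCtorEq, false_imp_iff, implies_true, and_true]
    rintro _ rfl; exact hY
  · obtain ⟨h1, h2⟩ := h _ _ hY
    simp only [upGSub]
    rcases hg : g (.b k) with v | N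
    · simp only [Sum.map_inl, Sum.inl.injEq, reduceCtorEq, false_imp_iff, implies_true, and_true]
      rintro _ rfl; exact upScope_shift (h1 _ hg)
    · simp only [Sum.map_inr, Sum.inr.injEq, reduceCtorEq, false_imp_iff, implies_true, true_and]
      rintro _ rfl; exact (h2 _ hg).shift _
  · obtain ⟨h1, h2⟩ := h _ _ hY
    simp only [upGSub]
    rcases hg : g (.f u) with v | N
    · simp only [Sum.map_inl, Sum.inl.injEq, reduceCtorEq, false_imp_iff, implies_true, and_true]
      rintro _ rfl; exact upScope_shift (h1 _ hg)
    · simp only [Sum.map_inr, Sum.inr.injEq, reduceCtorEq, false_imp_iff, implies_true, true_and]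
      rintro _ rfl; exact (h2 _ hg).shift _

theorem GSub.Lc.up {g : GSub} (h : g.Lc) : (upGSub g).Lc := by
  rintro ((_ | k) | u) N hN r
  · simp [upGSub] at hN
  · simp only [upGSub] at hN
    rcases hg : g (.b k) with v | N' <;> simp [hg] at hN
    rw [← hN, ← Tm.gren_lren, h _ _ hg]
  · simp only [upGSub] at hN
    rcases hg : g (.f u) with v | N' <;> simp [hg] at hN
    rw [← hN, ← Tm.gren_lren, h _ _ hg]

theorem Tm.lsub_of_lren {N : Tm} (h : ∀ r, N.lren r = N) (r : ℕ → ℕ) (e : LVar → Tm) :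
    N.lsub (fun k => .bvar (r k)) e = N.lsub .bvar e := by
  conv_rhs => rw [← h r]
  rw [Tm.lsub_lren]; rfl

theorem Tm.gsub_gren (M : Tm) : ∀ (r : GV → GV) (g : GSub),
    (M.gren r).gsub g = M.gsub (fun v => g (r v)) := by
  have up : ∀ (r : GV → GV) (g : GSub),
      (fun v => upGSub g (upGRen r v)) = upGSub (fun v => g (r v)) := by
    intro r g
    funext v
    rcases v with (_ | k) | u
    · rfl
    · simp only [upGRen, upGSub_shift]; rfl
    · simp only [upGRen, upGSub_shift]; rfl
  induction M using Tm.rec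
    (motive_2 := fun d => ∀ (r : GV → GV) (g : GSub),
      (d.gren r).gsub g = d.gsub (fun v => g (r v))) <;>
    intros <;> simp_all [Tm.gsub, LSub.gsub, Tm.gren, LSub.gren]

theorem LSub.getD_map (f : Tm → Tm) (d : Option Tm) (V : Tm) :
    (d.map f).getD (f V) = f (d.getD V) := by cases d <;> rfl

theorem Tm.gren_gsub (M : Tm) : ∀ (r : GV → GV) (g : GSub),
    (M.gsub g).gren r = M.gsub (g.ren r) := by
  have up : ∀ (r : GV → GV) (g : GSub), (upGSub g).ren (upGRen r) = upGSub (g.ren r) := by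
    intro r g
    funext v
    rcases v with (_ | k) | u
    · rfl
    · simp only [GSub.ren, upGSub]
      rcases g (.b k) with v | N
      · simp only [Sum.map_inl]; cases v <;> rfl
      · simp only [Sum.map_inr, Tm.gren_shift]
    · simp only [GSub.ren, upGSub]
      rcases g (.f u) with v | N
      · simp only [Sum.map_inl]; cases v <;> rfl
      · simp only [Sum.map_inr, Tm.gren_shift]
  induction M using Tm.rec
    (motive_2 := fun d => ∀ (r : GV → GV) (g : GSub), (d.gsub g).gren r = d.gsub (g.ren r))
  case gvar v d ih =>
    intro r g
    simp only [Tm.gsub, GSub.ren]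
    rcases g v with v' | N
    · simp only [Sum.map_inl, Tm.gren, ih]
    · simp only [Sum.map_inr, Tm.inst, Tm.gren_lsub, Tm.gren]
      congr 1; funext x
      rw [← ih, LSub.lookup_gren]
      exact (LSub.getD_map _ _ (.fvar x)).symm
  all_goals intros; simp_all [Tm.gsub, LSub.gsub, Tm.gren, LSub.gren]

theorem Tm.gsub_shift (M : Tm) (g : GSub) :
    (M.gren GV.shift).gsub (upGSub g) = (M.gsub g).gren GV.shift := by
  rw [Tm.gsub_gren, Tm.gren_gsub]
  congr 1; funext v; exact upGSub_shift g v

/-- `GSub.Lc` is needed because a free index of a substituted term would be renamed on the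
right-hand side only. -/
theorem Tm.gsub_lren (M : Tm) : ∀ {g : GSub}, g.Lc → ∀ (r : ℕ → ℕ),
    (M.lren r).gsub g = (M.gsub g).lren r := by
  induction M using Tm.rec
    (motive_2 := fun d => ∀ {g : GSub}, g.Lc → ∀ (r : ℕ → ℕ),
      (d.lren r).gsub g = (d.gsub g).lren r)
  case gvar v d ih =>
    intro g hg r
    simp only [Tm.gsub, Tm.lren]
    rcases hv : g v with v' | N
    · simp only [ih hg, Tm.lren]
    · simp only [Tm.inst, Tm.lren_lsub, Tm.lren]
      rw [Tm.lsub_of_lren (hg _ _ hv) r, ih hg]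
      refine congrArg (fun e => N.lsub .bvar e) (funext fun x => ?_)
      rw [LSub.lookup_lren]
      exact LSub.getD_map _ _ (.fvar x)
  case letbox ih1 ih2 => intro g hg r; simp [Tm.gsub, Tm.lren, ih1 hg, ih2 hg.up]
  all_goals intros; simp_all [Tm.gsub, LSub.gsub, Tm.lren, LSub.lren]

theorem gsub_comp_upSub {g : GSub} (hg : g.Lc) (s : ℕ → Tm) :
    (fun k => (upSub s k).gsub g) = upSub (fun k => (s k).gsub g) := by
  funext k; cases k
  · rfl
  · simp only [upSub_succ, Tm.gsub_lren _ hg]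

/-- The two kinds of substitution do not commute on arbitrary terms: a variable of the code `g v`
that is missing from the explicit substitution stays free on the left, whereas on the right it is
caught by `e`. The scope of `M` ensures that explicit substitutions cover all variables of the code,
and `GSub.Lc` prevents the capture of indices. -/
theorem Tm.gsub_lsub (M : Tm) : ∀ ⦃Φ Ψ : GV → Set LVar → Prop⦄ ⦃n : ℕ⦄ ⦃X : Set LVar⦄ ⦃g : GSub⦄
    (s : ℕ → Tm) (e : LVar → Tm), M.Sc Φ n X → g.Sc Φ Ψ → g.Lc →
    (M.lsub s e).gsub g = (M.gsub g).lsub (fun k => (s k).gsub g) (fun x => (e x).gsub g) := by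
  induction M using Tm.rec
    (motive_2 := fun d => ∀ ⦃Φ Ψ : GV → Set LVar → Prop⦄ ⦃n : ℕ⦄ ⦃X : Set LVar⦄ ⦃g : GSub⦄
      (s : ℕ → Tm) (e : LVar → Tm), d.Sc Φ n X → g.Sc Φ Ψ → g.Lc →
      (d.lsub s e).gsub g = (d.gsub g).lsub (fun k => (s k).gsub g) (fun x => (e x).gsub g))
  case nil => rfl
  case cons ih1 ih2 _ _ _ _ _ s e h hg hl =>
    simp only [LSub.lsub, LSub.gsub, ih1 s e h.1 hg hl, ih2 s e h.2 hg hl]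
  all_goals
    intro Φ Ψ n X g s e h hg hl
    simp only [Tm.Sc] at h
    simp only [Tm.lsub, Tm.gsub]
  case gvar v d ih =>
    obtain ⟨⟨Y, hY, hk⟩, hd⟩ := h
    rcases hv : g v with v' | N
    · simp only [Tm.lsub, ih s e hd hg hl]
    · simp only [Tm.inst, Tm.lsub_lsub, ih s e hd hg hl]
      refine Tm.lsub_congr N ((hg _ _ hY).2 _ hv) (by simp) fun x hx => ?_
      obtain ⟨V, hV⟩ := LSub.lookup_of_mem (hk x hx)
      simp [hV]
  case lam ih =>
    rw [ih _ _ h hg hl, gsub_comp_upSub hl]; simp only [Tm.gsub_lren _ hl]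
  case recf ih =>
    rw [ih _ _ h hg hl, gsub_comp_upSub hl, gsub_comp_upSub hl]; simp only [Tm.gsub_lren _ hl]
  case app ih1 ih2 => rw [ih1 s e h.1 hg hl, ih2 s e h.2 hg hl]
  case arith ih1 ih2 => rw [ih1 s e h.1 hg hl, ih2 s e h.2 hg hl]
  case assign ih1 ih2 => rw [ih1 s e h.1 hg hl, ih2 s e h.2 hg hl]
  case ite ih1 ih2 ih3 => rw [ih1 s e h.1 hg hl, ih2 s e h.2.1 hg hl, ih3 s e h.2.2 hg hl]
  case ref ih => rw [ih s e h hg hl]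
  case deref ih => rw [ih s e h hg hl]
  case letbox ih1 ih2 =>
    obtain ⟨h1, Y, h2⟩ := h
    rw [ih1 s e h1 hg hl, ih2 _ _ h2 (hg.up Y) hl.up]
    simp only [Tm.gsub_shift]
  case unb ih => rw [ih s e h hg hl]

theorem Tm.Sc.gsub (M : Tm) : ∀ ⦃Φ Ψ : GV → Set LVar → Prop⦄ ⦃n : ℕ⦄ ⦃X : Set LVar⦄ ⦃g : GSub⦄,
    M.Sc Φ n X → g.Sc Φ Ψ → (M.gsub g).Sc Ψ n X := by
  induction M using Tm.rec
    (motive_2 := fun d => ∀ ⦃Φ Ψ : GV → Set LVar → Prop⦄ ⦃n : ℕ⦄ ⦃X : Set LVar⦄ ⦃g : GSub⦄,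
      d.Sc Φ n X → g.Sc Φ Ψ → (d.gsub g).Sc Ψ n X)
  case nil => trivial
  case cons ih1 ih2 _ _ _ _ _ h hr => exact ⟨ih1 h.1 hr, ih2 h.2 hr⟩
  all_goals
    intro Φ Ψ n X g h hr
    simp only [Tm.Sc] at h
    simp only [Tm.Sc, Tm.gsub]
  case bvar => exact h
  case fvar => exact h
  case gvar v d ih =>
    obtain ⟨⟨Y, hY, hk⟩, hd⟩ := h
    rcases hv : g v with v' | N
    · simp only [Tm.Sc, LSub.keys_gsub]
      exact ⟨⟨Y, (hr _ _ hY).1 _ hv, hk⟩, ih hd hr⟩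
    · refine Tm.Sc.lsub N ((hr _ _ hY).2 _ hv) (by simp) fun x hx => ?_
      have hx' := hk x hx
      rw [← LSub.keys_gsub d g] at hx'
      obtain ⟨V, hV⟩ := LSub.lookup_of_mem hx'
      rw [hV]; exact (ih hd hr).lookup hV
  case lam ih => exact ih h hr
  case recf ih => exact ih h hr
  case app ih1 ih2 => exact ⟨ih1 h.1 hr, ih2 h.2 hr⟩
  case arith ih1 ih2 => exact ⟨ih1 h.1 hr, ih2 h.2 hr⟩
  case assign ih1 ih2 => exact ⟨ih1 h.1 hr, ih2 h.2 hr⟩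
  case ite ih1 ih2 ih3 => exact ⟨ih1 h.1 hr, ih2 h.2.1 hr, ih3 h.2.2 hr⟩
  case ref ih => exact ih h hr
  case deref ih => exact ih h hr
  case box ih => obtain ⟨Y, h⟩ := h; exact ⟨Y, ih h hr⟩
  case letbox ih1 ih2 =>
    obtain ⟨h1, Y, h2⟩ := h
    exact ⟨ih1 h1 hr, Y, ih2 h2 (hr.up Y)⟩
  case unb ih => exact ih h hr

theorem Tm.gsub_inl (M : Tm) : M.gsub .inl = M := by
  have up : upGSub .inl = .inl := by
    funext v; rcases v with (_ | k) | u <;> rfl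
  induction M using Tm.rec (motive_2 := fun d => d.gsub .inl = d) <;>
    simp_all [Tm.gsub, LSub.gsub]

theorem Tm.gsub_congr (M : Tm) : ∀ ⦃Φ : GV → Set LVar → Prop⦄ ⦃n : ℕ⦄ ⦃X : Set LVar⦄ ⦃g g' : GSub⦄,
    M.Sc Φ n X → (∀ v Y, Φ v Y → g v = g' v) → M.gsub g = M.gsub g' := by
  induction M using Tm.rec
    (motive_2 := fun d => ∀ ⦃Φ : GV → Set LVar → Prop⦄ ⦃n : ℕ⦄ ⦃X : Set LVar⦄ ⦃g g' : GSub⦄,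
      d.Sc Φ n X → (∀ v Y, Φ v Y → g v = g' v) → d.gsub g = d.gsub g')
  case nil => rfl
  case cons ih1 ih2 _ _ _ _ _ h hr => simp only [LSub.gsub]; rw [ih1 h.1 hr, ih2 h.2 hr]
  all_goals
    intro Φ n X g g' h hr
    simp only [Tm.Sc] at h
    simp only [Tm.gsub]
  case gvar ih => obtain ⟨⟨Y, hY, -⟩, hd⟩ := h; rw [ih hd hr, hr _ _ hY]
  case lam ih => rw [ih h hr]
  case recf ih => rw [ih h hr]
  case app ih1 ih2 => rw [ih1 h.1 hr, ih2 h.2 hr]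
  case arith ih1 ih2 => rw [ih1 h.1 hr, ih2 h.2 hr]
  case assign ih1 ih2 => rw [ih1 h.1 hr, ih2 h.2 hr]
  case ite ih1 ih2 ih3 => rw [ih1 h.1 hr, ih2 h.2.1 hr, ih3 h.2.2 hr]
  case ref ih => rw [ih h hr]
  case deref ih => rw [ih h hr]
  case box ih => obtain ⟨Y, h⟩ := h; rw [ih h hr]
  case letbox ih1 ih2 =>
    obtain ⟨h1, Y, h2⟩ := h
    rw [ih1 h1 hr, ih2 h2]
    rintro ((_ | k) | u) Z hZ
    · rfl
    · simp only [upGSub, hr _ _ hZ]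
    · simp only [upGSub, hr _ _ hZ]
  case unb ih => rw [ih h hr]

theorem Tm.Code.gsub {X} {M : Tm} (h : M.Code X) (g : GSub) : M.gsub g = M := by
  conv_rhs => rw [← Tm.gsub_inl M]
  exact Tm.gsub_congr M h (by simp [noScope])

/-- Composition of global substitutions. -/
def GSub.comp (g g' : GSub) : GSub := fun v =>
  match g v with
  | .inl v' => g' v'
  | .inr N => .inr (N.gsub g')

theorem Tm.gsub_gsub (M : Tm) : ∀ ⦃Φ Ψ Ω : GV → Set LVar → Prop⦄ ⦃n : ℕ⦄ ⦃X : Set LVar⦄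
    ⦃g g' : GSub⦄, M.Sc Φ n X → g.Sc Φ Ψ → g'.Sc Ψ Ω → g'.Lc →
    (M.gsub g).gsub g' = M.gsub (g.comp g') := by
  have up : ∀ g g' : GSub, (upGSub g).comp (upGSub g') = upGSub (g.comp g') := by
    intro g g'; funext v
    rcases v with (_ | k) | u
    · rfl
    · simp only [GSub.comp, upGSub]
      rcases g (.b k) with v | N
      · exact upGSub_shift g' v
      · simp only [Sum.map_inr, Tm.gsub_shift]
    · simp only [GSub.comp, upGSub]
      rcases g (.f u) with v | N
      · exact upGSub_shift g' v
      · simp only [Sum.map_inr, Tm.gsub_shift]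
  induction M using Tm.rec
    (motive_2 := fun d => ∀ ⦃Φ Ψ Ω : GV → Set LVar → Prop⦄ ⦃n : ℕ⦄ ⦃X : Set LVar⦄
      ⦃g g' : GSub⦄, d.Sc Φ n X → g.Sc Φ Ψ → g'.Sc Ψ Ω → g'.Lc →
      (d.gsub g).gsub g' = d.gsub (g.comp g'))
  case nil => rfl
  case cons ih1 ih2 _ _ _ _ _ _ _ h hg hg' hl =>
    simp only [LSub.gsub]; rw [ih1 h.1 hg hg' hl, ih2 h.2 hg hg' hl]
  all_goals
    intro Φ Ψ Ω n X g g' h hg hg' hl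
    simp only [Tm.Sc] at h
    simp only [Tm.gsub]
  case gvar v d ih =>
    obtain ⟨⟨Y, hY, hk⟩, hd⟩ := h
    simp only [GSub.comp]
    rcases hv : g v with v' | N
    · simp only [Tm.gsub, ih hd hg hg' hl]
    · simp only [Tm.inst]
      rw [Tm.gsub_lsub N _ _ ((hg _ _ hY).2 _ hv) hg' hl]
      simp only [Tm.gsub]
      congr 1; funext x
      rw [← ih hd hg hg' hl, LSub.lookup_gsub (d.gsub g) g']
      exact (LSub.getD_map _ _ (.fvar x)).symm
  case lam ih => rw [ih h hg hg' hl]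
  case recf ih => rw [ih h hg hg' hl]
  case app ih1 ih2 => rw [ih1 h.1 hg hg' hl, ih2 h.2 hg hg' hl]
  case arith ih1 ih2 => rw [ih1 h.1 hg hg' hl, ih2 h.2 hg hg' hl]
  case assign ih1 ih2 => rw [ih1 h.1 hg hg' hl, ih2 h.2 hg hg' hl]
  case ite ih1 ih2 ih3 => rw [ih1 h.1 hg hg' hl, ih2 h.2.1 hg hg' hl, ih3 h.2.2 hg hg' hl]
  case ref ih => rw [ih h hg hg' hl]
  case deref ih => rw [ih h hg hg' hl]
  case box ih => obtain ⟨Y, h⟩ := h; rw [ih h hg hg' hl]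
  case letbox ih1 ih2 =>
    obtain ⟨h1, Y, h2⟩ := h
    rw [ih1 h1 hg hg' hl, ih2 h2 (hg.up Y) (hg'.up Y) hl.up, up]
  case unb ih => rw [ih h hg hg' hl]

/-! ## Occurrences of names and locations -/

mutual
/-- `M.In φ L n`: the names of `M` are in `φ`, its locations in `L`, its local indices are below
`n`, and no local index is free under a `box`. -/
def Tm.In (φ : Set Name) (L : Set Loc) : ℕ → Tm → Prop
  | _, .unit | _, .int _ | _, .fvar _ => True
  | n, .bvar k => k < n
  | n, .gvar _ d => d.In φ L n
  | _, .loc l => l ∈ L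
  | n, .lam M => M.In φ L (n + 1)
  | n, .recf M => M.In φ L (n + 2)
  | n, .app M N | n, .arith _ M N | n, .assign M N | n, .letbox M N => M.In φ L n ∧ N.In φ L n
  | n, .ite M N P => M.In φ L n ∧ N.In φ L n ∧ P.In φ L n
  | n, .ref M | n, .deref M => M.In φ L n
  | _, .box M => M.In φ L 0
  | _, .fname f => .fn f ∈ φ
  | _, .bname b => .bx b ∈ φ
  | n, .unb b d => .bx b ∈ φ ∧ d.In φ L n
def LSub.In (φ : Set Name) (L : Set Loc) : ℕ → LSub → Prop
  | _, .nil => True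
  | n, .cons _ V d => V.In φ L n ∧ d.In φ L n
end

section In
variable {φ : Set Name} {L : Set Loc}

theorem LSub.In.lookup {n x V} {d : LSub} (h : d.In φ L n) (hx : d.lookup x = some V) :
    V.In φ L n := by
  induction d using LSub.rec (motive_1 := fun _ => True) <;> try trivial
  · simp only [LSub.lookup, LSub.In] at hx h
    split at hx
    · cases hx; exact h.1
    · rename_i ih _; exact ih h.2 hx

theorem Tm.In.mono (M : Tm) : ∀ {φ φ' : Set Name} {L L' : Set Loc} {n n' : ℕ}, φ ⊆ φ' → L ⊆ L' →
    n ≤ n' → M.In φ L n → M.In φ' L' n' := by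
  induction M using Tm.rec
    (motive_2 := fun d => ∀ {φ φ' : Set Name} {L L' : Set Loc} {n n' : ℕ}, φ ⊆ φ' → L ⊆ L' →
      n ≤ n' → d.In φ L n → d.In φ' L' n')
  case nil => trivial
  case cons ih1 ih2 _ _ _ _ _ _ hφ hL hn h => exact ⟨ih1 hφ hL hn h.1, ih2 hφ hL hn h.2⟩
  all_goals
    intro φ φ' L L' n n' hφ hL hn h
    simp only [Tm.In] at h ⊢
  case bvar => omega
  case loc => exact hL h
  case fname => exact hφ h
  case bname => exact hφ h
  case gvar ih => exact ih hφ hL hn h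
  case lam ih => exact ih hφ hL (by omega) h
  case recf ih => exact ih hφ hL (by omega) h
  case app ih1 ih2 => exact ⟨ih1 hφ hL hn h.1, ih2 hφ hL hn h.2⟩
  case arith ih1 ih2 => exact ⟨ih1 hφ hL hn h.1, ih2 hφ hL hn h.2⟩
  case assign ih1 ih2 => exact ⟨ih1 hφ hL hn h.1, ih2 hφ hL hn h.2⟩
  case letbox ih1 ih2 => exact ⟨ih1 hφ hL hn h.1, ih2 hφ hL hn h.2⟩
  case ite ih1 ih2 ih3 => exact ⟨ih1 hφ hL hn h.1, ih2 hφ hL hn h.2.1, ih3 hφ hL hn h.2.2⟩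
  case ref ih => exact ih hφ hL hn h
  case deref ih => exact ih hφ hL hn h
  case box ih => exact ih hφ hL le_rfl h
  case unb ih => exact ⟨hφ h.1, ih hφ hL hn h.2⟩

theorem Tm.In.lren (M : Tm) : ∀ {n m : ℕ} {r : ℕ → ℕ}, M.In φ L n → (∀ k < n, r k < m) →
    (M.lren r).In φ L m := by
  have up : ∀ {n m : ℕ} {r : ℕ → ℕ}, (∀ k < n, r k < m) → ∀ k < n + 1, upRen r k < m + 1 := by
    intro n m r h k hk
    cases k with
    | zero => simp
    | succ k => simp [h k (by omega)]
  induction M using Tm.rec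
    (motive_2 := fun d => ∀ {n m : ℕ} {r : ℕ → ℕ}, d.In φ L n → (∀ k < n, r k < m) →
    (d.lren r).In φ L m)
  case nil => trivial
  case cons ih1 ih2 _ _ _ h hr => exact ⟨ih1 h.1 hr, ih2 h.2 hr⟩
  case lam ih => intro n m r h hr; exact ih h (up hr)
  case recf ih => intro n m r h hr; exact ih h (up (up hr))
  case bvar => intro n m r h hr; exact hr _ h
  case box => intro n m r h hr; exact h
  case letbox ih1 ih2 => intro n m r h hr; exact ⟨ih1 h.1 hr, ih2 h.2 hr⟩
  case app ih1 ih2 => intro n m r h hr; exact ⟨ih1 h.1 hr, ih2 h.2 hr⟩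
  case arith ih1 ih2 => intro n m r h hr; exact ⟨ih1 h.1 hr, ih2 h.2 hr⟩
  case assign ih1 ih2 => intro n m r h hr; exact ⟨ih1 h.1 hr, ih2 h.2 hr⟩
  case ite ih1 ih2 ih3 => intro n m r h hr; exact ⟨ih1 h.1 hr, ih2 h.2.1 hr, ih3 h.2.2 hr⟩
  case gvar ih => intro n m r h hr; exact ih h hr
  case ref ih => intro n m r h hr; exact ih h hr
  case deref ih => intro n m r h hr; exact ih h hr
  case unb ih => intro n m r h hr; exact ⟨h.1, ih h.2 hr⟩
  all_goals intro n m r h hr; exact h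

theorem Tm.In.gren (M : Tm) : ∀ {n : ℕ} {r : GV → GV}, M.In φ L n → (M.gren r).In φ L n := by
  induction M using Tm.rec
    (motive_2 := fun d => ∀ {n : ℕ} {r : GV → GV}, d.In φ L n → (d.gren r).In φ L n)
  case nil => trivial
  case cons ih1 ih2 _ _ h => exact ⟨ih1 h.1, ih2 h.2⟩
  all_goals intro n r h; simp_all [Tm.In, Tm.gren]

theorem Tm.In.lren_eq (M : Tm) : ∀ {n : ℕ} {r : ℕ → ℕ}, M.In φ L n → (∀ k < n, r k = k) →
    M.lren r = M := by
  have up : ∀ {n : ℕ} {r : ℕ → ℕ}, (∀ k < n, r k = k) → ∀ k < n + 1, upRen r k = k := by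
    intro n r h k hk
    cases k with
    | zero => simp
    | succ k => simp [h k (by omega)]
  induction M using Tm.rec
    (motive_2 := fun d => ∀ {n : ℕ} {r : ℕ → ℕ}, d.In φ L n → (∀ k < n, r k = k) → d.lren r = d)
  case nil => rfl
  case cons ih1 ih2 _ _ h hr => simp only [LSub.lren, ih1 h.1 hr, ih2 h.2 hr]
  case lam ih => intro n r h hr; simp only [Tm.lren, ih h (up hr)]
  case recf ih => intro n r h hr; simp only [Tm.lren, ih h (up (up hr))]
  case bvar => intro n r h hr; simp only [Tm.lren, hr _ h]
  case box => intro n r h hr; rfl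
  case letbox ih1 ih2 => intro n r h hr; simp only [Tm.lren, ih1 h.1 hr, ih2 h.2 hr]
  case app ih1 ih2 => intro n r h hr; simp only [Tm.lren, ih1 h.1 hr, ih2 h.2 hr]
  case arith ih1 ih2 => intro n r h hr; simp only [Tm.lren, ih1 h.1 hr, ih2 h.2 hr]
  case assign ih1 ih2 => intro n r h hr; simp only [Tm.lren, ih1 h.1 hr, ih2 h.2 hr]
  case ite ih1 ih2 ih3 =>
    intro n r h hr; simp only [Tm.lren, ih1 h.1 hr, ih2 h.2.1 hr, ih3 h.2.2 hr]
  case unb ih => intro n r h hr; simp only [Tm.lren, ih h.2 hr]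
  case gvar ih => intro n r h hr; simp only [Tm.lren, ih h hr]
  case ref ih => intro n r h hr; simp only [Tm.lren, ih h hr]
  case deref ih => intro n r h hr; simp only [Tm.lren, ih h hr]
  all_goals intro n r h hr; rfl

theorem Tm.In.lsub (M : Tm) : ∀ {n m : ℕ} {s : ℕ → Tm} {e : LVar → Tm}, M.In φ L n →
    (∀ k < n, (s k).In φ L m) → (∀ x, (e x).In φ L m) → (M.lsub s e).In φ L m := by
  have succ : ∀ {m} {V : Tm}, V.In φ L m → (V.lren Nat.succ).In φ L (m + 1) :=
    fun h => Tm.In.lren _ h fun k hk => by omega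
  have up : ∀ {n m : ℕ} {s : ℕ → Tm}, (∀ k < n, (s k).In φ L m) →
      ∀ k < n + 1, (upSub s k).In φ L (m + 1) := by
    intro n m s h k hk
    cases k with
    | zero => simp [Tm.In]
    | succ k => exact succ (h k (by omega))
  induction M using Tm.rec
    (motive_2 := fun d => ∀ {n m : ℕ} {s : ℕ → Tm} {e : LVar → Tm}, d.In φ L n →
    (∀ k < n, (s k).In φ L m) → (∀ x, (e x).In φ L m) → (d.lsub s e).In φ L m)
  case nil => trivial
  case cons ih1 ih2 _ _ _ _ h hs he => exact ⟨ih1 h.1 hs he, ih2 h.2 hs he⟩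
  all_goals intro n m s e h hs he
  case bvar => exact hs _ h
  case fvar => exact he _
  case lam ih => exact ih h (up hs) fun x => succ (he x)
  case recf ih => exact ih h (up (up hs)) fun x => succ (succ (he x))
  case box => exact h
  case letbox ih1 ih2 =>
    exact ⟨ih1 h.1 hs he, ih2 h.2 (fun k hk => (hs k hk).gren) fun x => (he x).gren⟩
  case app ih1 ih2 => exact ⟨ih1 h.1 hs he, ih2 h.2 hs he⟩
  case arith ih1 ih2 => exact ⟨ih1 h.1 hs he, ih2 h.2 hs he⟩
  case assign ih1 ih2 => exact ⟨ih1 h.1 hs he, ih2 h.2 hs he⟩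
  case ite ih1 ih2 ih3 => exact ⟨ih1 h.1 hs he, ih2 h.2.1 hs he, ih3 h.2.2 hs he⟩
  case unb ih => exact ⟨h.1, ih h.2 hs he⟩
  case gvar ih => exact ih h hs he
  case ref ih => exact ih h hs he
  case deref ih => exact ih h hs he
  all_goals exact h

/-- Names and locations of the range of a global substitution. -/
def GSub.In (φ : Set Name) (L : Set Loc) (g : GSub) : Prop := ∀ v N, g v = .inr N → N.In φ L 0

theorem GSub.In.lc {g : GSub} (h : g.In φ L) : g.Lc :=
  fun v N hv _ => Tm.In.lren_eq N (h v N hv) (by simp)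

theorem GSub.In.up {g : GSub} (h : g.In φ L) : (upGSub g).In φ L := by
  rintro ((_ | k) | u) N hN
  · simp [upGSub] at hN
  · simp only [upGSub] at hN
    rcases hg : g (.b k) with v | N' <;> simp [hg] at hN
    rw [← hN]; exact (h _ _ hg).gren
  · simp only [upGSub] at hN
    rcases hg : g (.f u) with v | N' <;> simp [hg] at hN
    rw [← hN]; exact (h _ _ hg).gren

theorem Tm.In.gsub (M : Tm) : ∀ {n : ℕ} {g : GSub}, M.In φ L n → g.In φ L →
    (M.gsub g).In φ L n := by
  induction M using Tm.rec
    (motive_2 := fun d => ∀ {n : ℕ} {g : GSub}, d.In φ L n → g.In φ L → (d.gsub g).In φ L n)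
  case nil => trivial
  case cons ih1 ih2 _ _ h hs => exact ⟨ih1 h.1 hs, ih2 h.2 hs⟩
  all_goals intro n g h hg
  case gvar v d ih =>
    simp only [Tm.gsub]
    rcases hv : g v with v' | N
    · exact ih h hg
    · refine Tm.In.lsub N (hg _ _ hv) (by simp) fun x => ?_
      rcases hx : (d.gsub g).lookup x with _ | V
      · trivial
      · exact (ih h hg).lookup hx
  case letbox ih1 ih2 => exact ⟨ih1 h.1 hg, ih2 h.2 hg.up⟩
  case lam ih => exact ih h hg
  case recf ih => exact ih h hg
  case box ih => exact ih h hg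
  case app ih1 ih2 => exact ⟨ih1 h.1 hg, ih2 h.2 hg⟩
  case arith ih1 ih2 => exact ⟨ih1 h.1 hg, ih2 h.2 hg⟩
  case assign ih1 ih2 => exact ⟨ih1 h.1 hg, ih2 h.2 hg⟩
  case ite ih1 ih2 ih3 => exact ⟨ih1 h.1 hg, ih2 h.2.1 hg, ih3 h.2.2 hg⟩
  case unb ih => exact ⟨h.1, ih h.2 hg⟩
  case ref ih => exact ih h hg
  case deref ih => exact ih h hg
  all_goals exact h

theorem Tm.In.inst {M : Tm} {n m : ℕ} {e : LVar → Option Tm} (h : M.In φ L n) (hnm : n ≤ m)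
    (he : ∀ x V, e x = some V → V.In φ L m) : (M.inst e).In φ L m := by
  refine Tm.In.lsub M h (fun k hk => by simp only [Tm.In]; omega) fun x => ?_
  rcases hx : e x with _ | V
  · trivial
  · exact he x V hx

theorem Tm.In.beta {M V : Tm} (hM : M.In φ L 1) (hV : V.In φ L 0) : (M.beta V).In φ L 0 := by
  refine Tm.In.lsub M hM (fun k hk => ?_) fun x => trivial
  obtain rfl : k = 0 := by omega
  exact hV

theorem Tm.In.beta2 {M V W : Tm} (hM : M.In φ L 2) (hV : V.In φ L 0) (hW : W.In φ L 0) :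
    (M.beta2 V W).In φ L 0 := by
  refine Tm.In.lsub M hM (fun k hk => ?_) fun x => trivial
  obtain rfl | rfl : k = 0 ∨ k = 1 := by omega
  · exact hV
  · exact hW

theorem Tm.In.gbeta {M N : Tm} (hM : M.In φ L 0) (hN : N.In φ L 0) : (M.gbeta N).In φ L 0 := by
  refine Tm.In.gsub M hM ?_
  rintro ((_ | k) | u) N' h <;> simp at h
  exact h ▸ hN

theorem idSub_keys (G : LCtx) : (idSub G).keys = G.dom := by
  induction G with
  | nil => rfl
  | cons p G ih =>
    obtain ⟨x, T⟩ := p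
    simp only [idSub, LSub.keys, ih]; rfl

theorem idSub_lookup (G : LCtx) (x : LVar) (V : Tm) (h : (idSub G).lookup x = some V) :
    V = .fvar x := by
  induction G with
  | nil => simp [idSub, LSub.lookup] at h
  | cons p G ih =>
    obtain ⟨y, T⟩ := p
    simp only [idSub, LSub.lookup] at h
    split at h
    · cases h; simp_all
    · exact ih h

theorem idSub_In (G : LCtx) (n : ℕ) : (idSub G).In φ L n := by
  induction G with
  | nil => trivial
  | cons p G ih => obtain ⟨y, T⟩ := p; exact ⟨trivial, ih⟩

theorem Tm.In.unboxed {V : Tm} (h : V.In φ L 0) : V.unboxed.In φ L 0 := by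
  cases V <;> try exact h
  exact ⟨h, idSub_In _ _⟩

end In

-- Source terms are those whose names lie in the empty set. Preservation under substitution and
-- reduction is proved for `Tm.In` only, and this brings it back to `Tm.Src`.
mutual
theorem Tm.In.src {φ : Set Name} {L : Set Loc} : ∀ {n : ℕ} (M : Tm), φ = ∅ → M.In φ L n → M.Src
  | _, .unit, _, _ | _, .int _, _, _ | _, .bvar _, _, _ | _, .fvar _, _, _ | _, .loc _, _, _ =>
    trivial
  | _, .gvar _ d, e, h => LSub.In.src d e h
  | _, .lam M, e, h | _, .recf M, e, h | _, .ref M, e, h | _, .deref M, e, h | _, .box M, e, h =>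
    Tm.In.src M e h
  | _, .app M N, e, h | _, .arith _ M N, e, h | _, .assign M N, e, h | _, .letbox M N, e, h =>
    ⟨Tm.In.src M e h.1, Tm.In.src N e h.2⟩
  | _, .ite M N P, e, h => ⟨Tm.In.src M e h.1, Tm.In.src N e h.2.1, Tm.In.src P e h.2.2⟩
  | _, .fname _, e, h => by subst e; exact h.elim
  | _, .bname _, e, h => by subst e; exact h.elim
  | _, .unb _ _, e, h => by subst e; exact h.1.elim
theorem LSub.In.src {φ : Set Name} {L : Set Loc} : ∀ {n : ℕ} (d : LSub), φ = ∅ → d.In φ L n → d.Src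
  | _, .nil, _, _ => trivial
  | _, .cons _ V d, e, h => ⟨Tm.In.src V e h.1, LSub.In.src d e h.2⟩
end

-- Names as closed values, reduction and weights.

/-! ## Resolution of names and renaming of locations -/

/-- An interpretation of names: `f` is a value, `b` the code of a box; and a renaming `r` of
locations. -/
structure Env where
  r : Loc → Loc
  f : FName → Tm
  b : BName → Tm

mutual
/-- Resolution of names and renaming of locations. -/
def Tm.res (w : Env) : Tm → Tm
  | .unit => .unit
  | .int n => .int n
  | .bvar k => .bvar k
  | .fvar x => .fvar x
  | .gvar v d => .gvar v (d.res w)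
  | .loc l => .loc (w.r l)
  | .lam M => .lam (M.res w)
  | .app M N => .app (M.res w) (N.res w)
  | .recf M => .recf (M.res w)
  | .arith o M N => .arith o (M.res w) (N.res w)
  | .ite M N P => .ite (M.res w) (N.res w) (P.res w)
  | .ref M => .ref (M.res w)
  | .deref M => .deref (M.res w)
  | .assign M N => .assign (M.res w) (N.res w)
  | .box M => .box (M.res w)
  | .letbox M N => .letbox (M.res w) (N.res w)
  | .fname f => w.f f
  | .bname b => .box (w.b b)
  -- The default is the closed value `()` and not the variable `x`: a variable left free here would
  -- be reached by later substitutions, and `Tm.res_lsub`, which assumes nothing about `d`, would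
  -- fail.
  | .unb b d => (w.b b).lsub .bvar (fun x => ((d.res w).lookup x).getD .unit)
def LSub.res (w : Env) : LSub → LSub
  | .nil => .nil
  | .cons x V d => .cons x (V.res w) (d.res w)
end

/-- Names are interpreted by closed values and closed code. -/
structure Env.Ok (w : Env) : Prop where
  fval : ∀ f, (w.f f).IsValue
  fcl : ∀ f, (w.f f).Closed
  bcl : ∀ b, (w.b b).Code {x | x ∈ b.ctx.dom}

@[simp] theorem LSub.keys_res (d : LSub) (w : Env) : (d.res w).keys = d.keys := by
  induction d using LSub.rec (motive_1 := fun _ => True) <;> simp_all [LSub.res, LSub.keys]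

@[simp] theorem LSub.lookup_res (d : LSub) (w : Env) (x : LVar) :
    (d.res w).lookup x = (d.lookup x).map (Tm.res w) := by
  induction d using LSub.rec (motive_1 := fun _ => True) <;>
    simp_all [LSub.res, LSub.lookup]
  split <;> rfl

/-- Resolution commutes with renaming and with local and global substitution, because a name stands
for a closed value or for code all of whose variables are replaced by the explicit substitution at
its use. -/
theorem Tm.res_lren {w : Env} (hw : w.Ok) (M : Tm) : ∀ (r : ℕ → ℕ),
    (M.lren r).res w = (M.res w).lren r := by
  induction M using Tm.rec
    (motive_2 := fun d => ∀ (r : ℕ → ℕ), (d.lren r).res w = (d.res w).lren r)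
  case unb b d ih =>
    intro r
    simp only [Tm.res, Tm.lren, Tm.lren_lsub, ih]
    refine Tm.lsub_congr _ (hw.bcl b) (by simp) fun x _ => ?_
    rw [LSub.lookup_lren]; exact LSub.getD_map _ _ .unit
  case fname f => intro r; exact ((hw.fcl f).lren_eq r).symm
  all_goals intros; simp_all [Tm.res, LSub.res, Tm.lren, LSub.lren]

theorem Tm.res_gren {w : Env} (hw : w.Ok) (M : Tm) : ∀ (r : GV → GV),
    (M.gren r).res w = (M.res w).gren r := by
  induction M using Tm.rec
    (motive_2 := fun d => ∀ (r : GV → GV), (d.gren r).res w = (d.res w).gren r)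
  case unb b d ih =>
    intro r
    simp only [Tm.res, Tm.gren, Tm.gren_lsub, ih, (hw.bcl b).gren]
    refine Tm.lsub_congr _ (hw.bcl b) (by simp) fun x _ => ?_
    rw [LSub.lookup_gren]; exact LSub.getD_map _ _ .unit
  case fname f => intro r; exact (Tm.Code.gren (hw.fcl f) r).symm
  case bname b => intro r; simp only [Tm.res, Tm.gren, (hw.bcl b).gren]
  all_goals intros; simp_all [Tm.res, LSub.res, Tm.gren, LSub.gren]

theorem Tm.res_lsub {w : Env} (hw : w.Ok) (M : Tm) : ∀ (s : ℕ → Tm) (e : LVar → Tm),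
    (M.lsub s e).res w = (M.res w).lsub (fun k => (s k).res w) (fun x => (e x).res w) := by
  have up : ∀ s : ℕ → Tm, (fun k => (upSub s k).res w) = upSub (fun k => (s k).res w) := by
    intro s; funext k; cases k
    · rfl
    · simp only [upSub_succ, Tm.res_lren hw]
  induction M using Tm.rec
    (motive_2 := fun d => ∀ (s : ℕ → Tm) (e : LVar → Tm),
      (d.lsub s e).res w = (d.res w).lsub (fun k => (s k).res w) (fun x => (e x).res w))
  case unb b d ih =>
    intro s e
    simp only [Tm.res, Tm.lsub, Tm.lsub_lsub, ih]
    refine Tm.lsub_congr _ (hw.bcl b) (by simp) fun x _ => ?_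
    rw [LSub.lookup_lsub]
    exact LSub.getD_map (Tm.lsub (fun k => (s k).res w) (fun x => (e x).res w)) _ .unit
  case fname f => intro s e; exact ((hw.fcl f).lsub _ _).symm
  all_goals
    intros; simp_all [Tm.res, LSub.res, Tm.lsub, LSub.lsub, Tm.res_lren hw, Tm.res_gren hw]

/-- Resolution of a global substitution. -/
def GSub.res (w : Env) (g : GSub) : GSub := fun v => (g v).map id (Tm.res w)

theorem GSub.Lc.res {w : Env} (hw : w.Ok) {g : GSub} (h : g.Lc) : (g.res w).Lc := by
  intro v N hN r
  simp only [GSub.res] at hN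
  rcases hg : g v with v' | N' <;> simp [hg] at hN
  rw [← hN, ← Tm.res_lren hw, h _ _ hg]

theorem GSub.res_up {w : Env} (hw : w.Ok) (g : GSub) : (upGSub g).res w = upGSub (g.res w) := by
  funext v
  rcases v with (_ | k) | u
  · rfl
  · simp only [GSub.res, upGSub]
    rcases g (.b k) with v | N
    · rfl
    · simp only [Sum.map_inr, Tm.res_gren hw]
  · simp only [GSub.res, upGSub]
    rcases g (.f u) with v | N
    · rfl
    · simp only [Sum.map_inr, Tm.res_gren hw]

theorem Tm.res_inst {w : Env} (hw : w.Ok) (M : Tm) (e : LVar → Option Tm) :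
    (M.inst e).res w = (M.res w).inst (fun x => (e x).map (Tm.res w)) := by
  simp only [Tm.inst, Tm.res_lsub hw, Tm.res]
  congr 1; funext x
  exact (LSub.getD_map (Tm.res w) _ (.fvar x)).symm

theorem Tm.res_gsub {w : Env} (hw : w.Ok) (M : Tm) : ∀ {g : GSub}, g.Lc →
    (M.gsub g).res w = (M.res w).gsub (g.res w) := by
  induction M using Tm.rec
    (motive_2 := fun d => ∀ {g : GSub}, g.Lc → (d.gsub g).res w = (d.res w).gsub (g.res w))
  case gvar v d ih =>
    intro g hg
    simp only [Tm.gsub, Tm.res]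
    rcases hv : g v with v' | N
    · simp only [GSub.res, hv, Sum.map_inl, id, Tm.res, ih hg]
    · simp only [GSub.res, hv, Sum.map_inr, Tm.res_inst hw, ← LSub.lookup_res, ih hg]
  case unb b d ih =>
    intro g hg
    simp only [Tm.gsub, Tm.res, ih hg]
    rw [Tm.gsub_lsub (Ψ := noScope) _ _ _ (hw.bcl b) (by simp [GSub.Sc, noScope]) (hg.res hw),
      (hw.bcl b).gsub]
    simp only [Tm.gsub]
    congr 1; funext x
    rw [LSub.lookup_gsub]
    exact LSub.getD_map (Tm.gsub (g.res w)) _ .unit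
  case fname f => intro g _; exact (Tm.Code.gsub (hw.fcl f) _).symm
  case bname b => intro g _; simp only [Tm.gsub, Tm.res, (hw.bcl b).gsub]
  case letbox ih1 ih2 =>
    intro g hg; simp only [Tm.gsub, Tm.res, ih1 hg, ih2 hg.up, GSub.res_up hw]
  all_goals intros; simp_all [Tm.res, LSub.res, Tm.gsub, LSub.gsub]

theorem Tm.res_beta {w : Env} (hw : w.Ok) (M V : Tm) :
    (M.beta V).res w = (M.res w).beta (V.res w) := by
  simp only [Tm.beta, Tm.res_lsub hw, Tm.res]
  congr 1; funext k; cases k <;> rfl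

theorem Tm.res_beta2 {w : Env} (hw : w.Ok) (M V W : Tm) :
    (M.beta2 V W).res w = (M.res w).beta2 (V.res w) (W.res w) := by
  simp only [Tm.beta2, Tm.res_lsub hw, Tm.res]
  congr 1; funext k; rcases k with _ | _ | k <;> rfl

theorem Tm.res_gbeta {w : Env} (hw : w.Ok) (M N : Tm) (hN : ∀ r, N.lren r = N) :
    (M.gbeta N).res w = (M.res w).gbeta (N.res w) := by
  rw [Tm.gbeta, Tm.res_gsub hw, Tm.gbeta]
  · congr 1; funext v
    rcases v with (_ | k) | u <;> rfl
  · rintro ((_ | k) | u) N' h <;> simp at h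
    exact h ▸ hN

theorem BName.unbox_res {w : Env} (hw : w.Ok) (b : BName) : b.unbox.res w = w.b b := by
  simp only [BName.unbox, Tm.res]
  conv_rhs => rw [← Tm.lsub_id (w.b b)]
  refine Tm.lsub_congr _ (hw.bcl b) (by simp) fun x hx => ?_
  replace hx : x ∈ b.ctx.dom := hx
  rw [← idSub_keys] at hx
  obtain ⟨V, hV⟩ := LSub.lookup_of_mem hx
  rw [LSub.lookup_res, hV, idSub_lookup _ _ _ hV]; rfl

theorem Tm.Sc.res {w : Env} (hw : w.Ok) (M : Tm) : ∀ ⦃Φ : GV → Set LVar → Prop⦄ ⦃n : ℕ⦄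
    ⦃X : Set LVar⦄, M.Sc Φ n X → (M.res w).Sc Φ n X := by
  induction M using Tm.rec
    (motive_2 := fun d => ∀ ⦃Φ : GV → Set LVar → Prop⦄ ⦃n : ℕ⦄ ⦃X : Set LVar⦄,
      d.Sc Φ n X → (d.res w).Sc Φ n X)
  case nil => trivial
  case cons ih1 ih2 _ _ _ h => exact ⟨ih1 h.1, ih2 h.2⟩
  all_goals
    intro Φ n X h
    simp only [Tm.Sc] at h
    simp only [Tm.Sc, Tm.res]
  case unb b d ih =>
    refine Tm.Sc.lsub (n := 0) _ (Tm.Sc.mono _ (by simp [noScope]) le_rfl subset_rfl (hw.bcl b))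
      (by simp) fun x _ => ?_
    rcases hx : (d.res w).lookup x with _ | V
    · trivial
    · exact (ih h).lookup hx
  case fname f => exact Tm.Sc.mono _ (by simp [noScope]) (by simp) (by simp) (hw.fcl f)
  case bname b => exact ⟨_, Tm.Sc.mono _ (by simp [noScope]) le_rfl subset_rfl (hw.bcl b)⟩
  case bvar => exact h
  case fvar => exact h
  case gvar v d ih => simp only [LSub.keys_res]; exact ⟨h.1, ih h.2⟩
  case lam ih => exact ih h
  case recf ih => exact ih h
  case app ih1 ih2 => exact ⟨ih1 h.1, ih2 h.2⟩
  case arith ih1 ih2 => exact ⟨ih1 h.1, ih2 h.2⟩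
  case assign ih1 ih2 => exact ⟨ih1 h.1, ih2 h.2⟩
  case ite ih1 ih2 ih3 => exact ⟨ih1 h.1, ih2 h.2.1, ih3 h.2.2⟩
  case ref ih => exact ih h
  case deref ih => exact ih h
  case box ih => obtain ⟨Y, h⟩ := h; exact ⟨Y, ih h⟩
  case letbox ih1 ih2 => obtain ⟨h1, Y, h2⟩ := h; exact ⟨ih1 h1, Y, ih2 h2⟩

/-- `w` and `w'` agree on the names `φ` and the locations `L`. -/
structure Env.Agree (w w' : Env) (φ : Set Name) (L : Set Loc) : Prop where
  r : ∀ l ∈ L, w.r l = w'.r l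
  f : ∀ f, Name.fn f ∈ φ → w.f f = w'.f f
  b : ∀ b, Name.bx b ∈ φ → w.b b = w'.b b

theorem Tm.res_congr {w w' : Env} {φ : Set Name} {L : Set Loc} (hw : w.Agree w' φ L) (M : Tm) :
    ∀ {n : ℕ}, M.In φ L n → M.res w = M.res w' := by
  induction M using Tm.rec
    (motive_2 := fun d => ∀ {n : ℕ}, d.In φ L n → d.res w = d.res w')
  case nil => rfl
  case cons ih1 ih2 _ h => simp only [LSub.res]; rw [ih1 h.1, ih2 h.2]
  all_goals
    intro n h
    simp only [Tm.In] at h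
    simp only [Tm.res]
  case loc => rw [hw.r _ h]
  case fname => exact hw.f _ h
  case bname => rw [hw.b _ h]
  case unb ih => rw [ih h.2, hw.b _ h.1]
  case gvar ih => rw [ih h]
  case lam ih => rw [ih h]
  case recf ih => rw [ih h]
  case app ih1 ih2 => rw [ih1 h.1, ih2 h.2]
  case arith ih1 ih2 => rw [ih1 h.1, ih2 h.2]
  case assign ih1 ih2 => rw [ih1 h.1, ih2 h.2]
  case ite ih1 ih2 ih3 => rw [ih1 h.1, ih2 h.2.1, ih3 h.2.2]
  case ref ih => rw [ih h]
  case deref ih => rw [ih h]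
  case box ih => rw [ih h]
  case letbox ih1 ih2 => rw [ih1 h.1, ih2 h.2]

theorem Tm.In.res {w : Env} {φ φ' : Set Name} {L L' : Set Loc} (hr : ∀ l ∈ L, w.r l ∈ L')
    (hf : ∀ f, .fn f ∈ φ → (w.f f).In φ' L' 0) (hb : ∀ b, .bx b ∈ φ → (w.b b).In φ' L' 0)
    (M : Tm) : ∀ {n : ℕ}, M.In φ L n → (M.res w).In φ' L' n := by
  induction M using Tm.rec
    (motive_2 := fun d => ∀ {n : ℕ}, d.In φ L n → (d.res w).In φ' L' n)
  case nil => trivial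
  case cons ih1 ih2 _ h => exact ⟨ih1 h.1, ih2 h.2⟩
  all_goals
    intro n h
    simp only [Tm.In] at h
    simp only [Tm.res, Tm.In]
  case loc => exact hr _ h
  case bvar => exact h
  case fname => exact Tm.In.mono _ subset_rfl subset_rfl (Nat.zero_le _) (hf _ h)
  case bname => exact hb _ h
  case unb d ih =>
    refine Tm.In.lsub _ (hb _ h.1) (by simp) fun x => ?_
    rcases hx : (d.res w).lookup x with _ | V
    · trivial
    · exact (ih h.2).lookup hx
  case gvar ih => exact ih h
  case lam ih => exact ih h
  case recf ih => exact ih h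
  case app ih1 ih2 => exact ⟨ih1 h.1, ih2 h.2⟩
  case arith ih1 ih2 => exact ⟨ih1 h.1, ih2 h.2⟩
  case assign ih1 ih2 => exact ⟨ih1 h.1, ih2 h.2⟩
  case ite ih1 ih2 ih3 => exact ⟨ih1 h.1, ih2 h.2.1, ih3 h.2.2⟩
  case ref ih => exact ih h
  case deref ih => exact ih h
  case box ih => exact ih h
  case letbox ih1 ih2 => exact ⟨ih1 h.1, ih2 h.2⟩

theorem Tm.res_src {w : Env} (hr : ∀ l, w.r l = l) (M : Tm) : M.Src → M.res w = M := by
  induction M using Tm.rec (motive_2 := fun d => d.Src → d.res w = d) <;>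
    simp_all [Tm.Src, LSub.Src, Tm.res, LSub.res]

theorem Tm.IsValue.res {w : Env} (hw : w.Ok) {V : Tm} (h : V.IsValue) : (V.res w).IsValue := by
  cases V <;> first | exact h | exact hw.fval _ | trivial

/-! ## Reduction with a given location for allocations -/

/-- One step of reduction, in which `a` is the location that is allocated, if there is one. -/
inductive St (a : Loc) : Tm → Heap → Tm → Heap → Prop
  | beta {M V h} : V.IsValue → St a (.app (.lam M) V) h (M.beta V) h
  | recf {M V h} : V.IsValue → St a (.app (.recf M) V) h (M.beta2 V (.recf M)) h
  | app1 {M N h M' h'} : St a M h M' h' → St a (.app M N) h (.app M' N) h'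
  | app2 {M N h N' h'} : M.IsValue → St a N h N' h' → St a (.app M N) h (.app M N') h'
  | arith {o m n h} : St a (.arith o (.int m) (.int n)) h (.int (o.eval m n)) h
  | arith1 {o M N h M' h'} : St a M h M' h' → St a (.arith o M N) h (.arith o M' N) h'
  | arith2 {o M N h N' h'} : M.IsValue → St a N h N' h' → St a (.arith o M N) h (.arith o M N') h'
  | iteTrue {n M N h} : n ≠ 0 → St a (.ite (.int n) M N) h M h
  | iteFalse {M N h} : St a (.ite (.int 0) M N) h N h
  | ite1 {M N P h M' h'} : St a M h M' h' → St a (.ite M N P) h (.ite M' N P) h'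
  | ref {V} {h : Heap} : V.IsValue → h a = none →
      St a (.ref V) h (.loc a) (Function.update h a (some V))
  | ref1 {M h M' h'} : St a M h M' h' → St a (.ref M) h (.ref M') h'
  | deref {l V} {h : Heap} : h l = some V → St a (.deref (.loc l)) h V h
  | deref1 {M h M' h'} : St a M h M' h' → St a (.deref M) h (.deref M') h'
  | assign {l V} {h : Heap} : V.IsValue → (h l).isSome →
      St a (.assign (.loc l) V) h .unit (Function.update h l (some V))
  | assign1 {M N h M' h'} : St a M h M' h' → St a (.assign M N) h (.assign M' N) h'
  | assign2 {M N h N' h'} : M.IsValue → St a N h N' h' → St a (.assign M N) h (.assign M N') h'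
  | letbox {M N h} : St a (.letbox (.box M) N) h (N.gbeta M) h
  | letboxName {b N h} : St a (.letbox (.bname b) N) h (N.gbeta b.unbox) h
  | letbox1 {M N h M' h'} : St a M h M' h' → St a (.letbox M N) h (.letbox M' N) h'

theorem St.not_value {a M h M' h'} (s : St a M h M' h') : ¬ M.IsValue := by
  cases s <;> simp [Tm.IsValue]

/-- `Step` leaves open the new location and the way in which a term is split into context and redex.
With the location given and congruence rules instead of contexts, at most one rule applies, since
values do not step. -/
theorem St.det {a M h M₁ h₁ M₂ h₂} (s₁ : St a M h M₁ h₁) (s₂ : St a M h M₂ h₂) :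
    M₁ = M₂ ∧ h₁ = h₂ := by
  induction s₁ generalizing M₂ h₂ with
  | beta hv =>
    cases s₂ with
    | beta => exact ⟨rfl, rfl⟩
    | app1 s => cases s
    | app2 _ s => exact (s.not_value hv).elim
  | recf hv =>
    cases s₂ with
    | recf => exact ⟨rfl, rfl⟩
    | app1 s => cases s
    | app2 _ s => exact (s.not_value hv).elim
  | app1 s ih =>
    cases s₂ with
    | beta => cases s
    | recf => cases s
    | app1 s' => obtain ⟨rfl, rfl⟩ := ih s'; exact ⟨rfl, rfl⟩
    | app2 hv => exact (s.not_value hv).elim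
  | app2 hv s ih =>
    cases s₂ with
    | beta hv' => exact (s.not_value hv').elim
    | recf hv' => exact (s.not_value hv').elim
    | app1 s' => exact (s'.not_value hv).elim
    | app2 _ s' => obtain ⟨rfl, rfl⟩ := ih s'; exact ⟨rfl, rfl⟩
  | arith =>
    cases s₂ with
    | arith => exact ⟨rfl, rfl⟩
    | arith1 s => cases s
    | arith2 _ s => cases s
  | arith1 s ih =>
    cases s₂ with
    | arith => cases s
    | arith1 s' => obtain ⟨rfl, rfl⟩ := ih s'; exact ⟨rfl, rfl⟩
    | arith2 hv => exact (s.not_value hv).elim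
  | arith2 hv s ih =>
    cases s₂ with
    | arith => cases s
    | arith1 s' => exact (s'.not_value hv).elim
    | arith2 _ s' => obtain ⟨rfl, rfl⟩ := ih s'; exact ⟨rfl, rfl⟩
  | iteTrue hn =>
    cases s₂ with
    | iteTrue => exact ⟨rfl, rfl⟩
    | iteFalse => exact (hn rfl).elim
    | ite1 s => cases s
  | iteFalse =>
    cases s₂ with
    | iteTrue hn => exact (hn rfl).elim
    | iteFalse => exact ⟨rfl, rfl⟩
    | ite1 s => cases s
  | ite1 s ih =>
    cases s₂ with
    | iteTrue => cases s
    | iteFalse => cases s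
    | ite1 s' => obtain ⟨rfl, rfl⟩ := ih s'; exact ⟨rfl, rfl⟩
  | ref hv =>
    cases s₂ with
    | ref => exact ⟨rfl, rfl⟩
    | ref1 s => exact (s.not_value hv).elim
  | ref1 s ih =>
    cases s₂ with
    | ref hv => exact (s.not_value hv).elim
    | ref1 s' => obtain ⟨rfl, rfl⟩ := ih s'; exact ⟨rfl, rfl⟩
  | deref hl =>
    cases s₂ with
    | deref hl' => rw [hl] at hl'; cases hl'; exact ⟨rfl, rfl⟩
    | deref1 s => cases s
  | deref1 s ih =>
    cases s₂ with
    | deref => cases s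
    | deref1 s' => obtain ⟨rfl, rfl⟩ := ih s'; exact ⟨rfl, rfl⟩
  | assign hv =>
    cases s₂ with
    | assign => exact ⟨rfl, rfl⟩
    | assign1 s => cases s
    | assign2 _ s => exact (s.not_value hv).elim
  | assign1 s ih =>
    cases s₂ with
    | assign => cases s
    | assign1 s' => obtain ⟨rfl, rfl⟩ := ih s'; exact ⟨rfl, rfl⟩
    | assign2 hv => exact (s.not_value hv).elim
  | assign2 hv s ih =>
    cases s₂ with
    | assign hv' => exact (s.not_value hv').elim
    | assign1 s' => exact (s'.not_value hv).elim
    | assign2 _ s' => obtain ⟨rfl, rfl⟩ := ih s'; exact ⟨rfl, rfl⟩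
  | letbox =>
    cases s₂ with
    | letbox => exact ⟨rfl, rfl⟩
    | letbox1 s => cases s
  | letboxName =>
    cases s₂ with
    | letboxName => exact ⟨rfl, rfl⟩
    | letbox1 s => cases s
  | letbox1 s ih =>
    cases s₂ with
    | letbox => cases s
    | letboxName => cases s
    | letbox1 s' => obtain ⟨rfl, rfl⟩ := ih s'; exact ⟨rfl, rfl⟩

theorem St.plug {a M h M' h'} (s : St a M h M' h') : ∀ {K : Cx}, K.IsEval →
    St a (K.plug M) h (K.plug M') h'
  | .hole, _ => s
  | .appL _ _, hK => .app1 (s.plug (K := _) hK)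
  | .appR _ _, hK => .app2 hK.1 (s.plug hK.2)
  | .arithL _ _ _, hK => .arith1 (s.plug (K := _) hK)
  | .arithR _ _ _, hK => .arith2 hK.1 (s.plug hK.2)
  | .iteC _ _ _, hK => .ite1 (s.plug (K := _) hK)
  | .ref _, hK => .ref1 (s.plug (K := _) hK)
  | .deref _, hK => .deref1 (s.plug (K := _) hK)
  | .assignL _ _, hK => .assign1 (s.plug (K := _) hK)
  | .assignR _ _, hK => .assign2 hK.1 (s.plug hK.2)
  | .letboxL _ _, hK => .letbox1 (s.plug (K := _) hK)

theorem St.toStep {a M h M' h'} (s : St a M h M' h') : Step (M, h) (M', h') := by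
  induction s with
  | beta hv => exact .beta hv
  | recf hv => exact .recf hv
  | arith => exact .arith
  | iteTrue hn => exact .iteTrue hn
  | iteFalse => exact .iteFalse
  | ref hv ha => exact .ref hv ha
  | deref hl => exact .deref hl
  | assign hv hl => exact .assign hv hl
  | letbox => exact .letbox
  | letboxName => exact .letboxName
  | app1 _ ih => exact .ktx (K := .appL .hole _) trivial ih
  | app2 hv _ ih => exact .ktx (K := .appR _ .hole) ⟨hv, trivial⟩ ih
  | arith1 _ ih => exact .ktx (K := .arithL _ .hole _) trivial ih
  | arith2 hv _ ih => exact .ktx (K := .arithR _ _ .hole) ⟨hv, trivial⟩ ih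
  | ite1 _ ih => exact .ktx (K := .iteC .hole _ _) trivial ih
  | ref1 _ ih => exact .ktx (K := .ref .hole) trivial ih
  | deref1 _ ih => exact .ktx (K := .deref .hole) trivial ih
  | assign1 _ ih => exact .ktx (K := .assignL .hole _) trivial ih
  | assign2 hv _ ih => exact .ktx (K := .assignR _ .hole) ⟨hv, trivial⟩ ih
  | letbox1 _ ih => exact .ktx (K := .letboxL .hole _) trivial ih

theorem exists_fresh {α : Type} {h : Loc → Option α} (hf : (domOf h).Finite) (X : Set Loc)
    (hX : X.Finite) : ∃ a, h a = none ∧ a ∉ X := by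
  obtain ⟨a, ha⟩ := (hf.union hX).infinite_compl.nonempty
  simp only [Set.mem_compl_iff, Set.mem_union, not_or] at ha
  exact ⟨a, by simpa [domOf] using ha.1, ha.2⟩

/-- An allocation determines `a`; any other step takes an arbitrary location outside the finite
heap. So every step comes with a fresh location, and allocations need no separate treatment later.
-/
theorem Step.toSt {p q : Tm × Heap} (s : Step p q) (hf : (domOf p.2).Finite) :
    ∃ a, p.2 a = none ∧ St a p.1 p.2 q.1 q.2 := by
  obtain ⟨a, ha, -⟩ := exists_fresh hf ∅ Set.finite_empty
  induction s with
  | beta hv => exact ⟨a, ha, .beta hv⟩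
  | recf hv => exact ⟨a, ha, .recf hv⟩
  | arith => exact ⟨a, ha, .arith⟩
  | iteTrue hn => exact ⟨a, ha, .iteTrue hn⟩
  | iteFalse => exact ⟨a, ha, .iteFalse⟩
  | ref hv hl => exact ⟨_, hl, .ref hv hl⟩
  | deref hl => exact ⟨a, ha, .deref hl⟩
  | assign hv hl => exact ⟨a, ha, .assign hv hl⟩
  | letbox => exact ⟨a, ha, .letbox⟩
  | letboxName => exact ⟨a, ha, .letboxName⟩
  | ktx hK _ ih => obtain ⟨b, hb, s⟩ := ih hf ha; exact ⟨b, hb, s.plug hK⟩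

theorem domOf_update {α : Type} {h : Loc → Option α} {l : Loc} {V : α} :
    domOf (Function.update h l (some V)) = insert l (domOf h) := by
  ext m
  by_cases hm : m = l
  · subst hm; simp [domOf]
  · simp [domOf, hm]

theorem St.dom {a M h M' h'} (s : St a M h M' h') :
    domOf h ⊆ domOf h' ∧ domOf h' ⊆ insert a (domOf h) := by
  induction s with
  | ref => rw [domOf_update]; exact ⟨Set.subset_insert _ _, subset_rfl⟩
  | assign _ hl =>
    rw [domOf_update, Set.insert_eq_of_mem (show _ ∈ domOf _ from hl)]; exact ⟨subset_rfl, Set.subset_insert _ _⟩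
  | _ => first | assumption | exact ⟨subset_rfl, Set.subset_insert _ _⟩

theorem St.finite {a M h M' h'} (s : St a M h M' h') (hf : (domOf h).Finite) :
    (domOf h').Finite := (hf.insert a).subset s.dom.2

/-- Convergence in `n` steps. -/
def ConvN : ℕ → Tm → Heap → Prop
  | 0, M, _ => M.IsValue
  | n + 1, M, h => ∃ a M' h', h a = none ∧ St a M h M' h' ∧ ConvN n M' h'

theorem ConvN.converges {n M h} (c : ConvN n M h) : Converges M h := by
  induction n generalizing M h with
  | zero => exact ⟨M, h, c, .refl⟩
  | succ n ih =>
    obtain ⟨a, M', h', -, s, c⟩ := c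
    obtain ⟨V, h'', hV, r⟩ := ih c
    exact ⟨V, h'', hV, .head s.toStep r⟩

theorem Converges.head {M h M' h'} (s : Step (M, h) (M', h')) (c : Converges M' h') :
    Converges M h := by
  obtain ⟨V, h'', hV, r⟩ := c
  exact ⟨V, h'', hV, .head s r⟩

theorem Converges.convN {M h} (c : Converges M h) (hf : (domOf h).Finite) : ∃ n, ConvN n M h := by
  obtain ⟨V, h', hV, r⟩ := c
  generalize hp : (M, h) = p at r
  induction r using Relation.ReflTransGen.head_induction_on generalizing M h with
  | refl => cases hp; exact ⟨0, hV⟩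
  | head s _ ih =>
    subst hp
    obtain ⟨a, ha, s⟩ := s.toSt hf
    obtain ⟨n, c⟩ := ih (s.finite hf) rfl
    exact ⟨n + 1, a, _, _, ha, s, c⟩

theorem Converges.of_value {V h} (hV : V.IsValue) : Converges V h := ⟨V, h, hV, .refl⟩

/-! ## Occurrences along reductions -/

def HeapIn (φ : Set Name) (L : Set Loc) (h : Heap) : Prop := ∀ l V, h l = some V → V.In φ L 0

theorem HeapIn.mono {φ φ' : Set Name} {L L' : Set Loc} {h : Heap} (hφ : φ ⊆ φ') (hL : L ⊆ L')
    (hh : HeapIn φ L h) : HeapIn φ' L' h :=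
  fun l V hl => Tm.In.mono _ hφ hL le_rfl (hh l V hl)

theorem HeapIn.update {φ : Set Name} {L : Set Loc} {h : Heap} (hh : HeapIn φ L h) {l V}
    (hV : V.In φ L 0) : HeapIn φ L (Function.update h l (some V)) := by
  intro m W hm
  by_cases hml : m = l
  · subst hml; simp at hm; exact hm ▸ hV
  · rw [Function.update_of_ne hml] at hm; exact hh m W hm

theorem St.in {φ : Set Name} {a M h M' h'} (s : St a M h M' h') (hM : M.In φ (domOf h) 0)
    (hh : HeapIn φ (domOf h) h) : M'.In φ (domOf h') 0 ∧ HeapIn φ (domOf h') h' := by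
  have mono : ∀ {a M h M' h'}, St a M h M' h' → ∀ {N : Tm} {n : ℕ}, N.In φ (domOf h) n →
      N.In φ (domOf h') n := fun s _ _ hN => Tm.In.mono _ subset_rfl s.dom.1 le_rfl hN
  induction s with
  | beta hv => exact ⟨Tm.In.beta hM.1 hM.2, hh⟩
  | recf hv => exact ⟨Tm.In.beta2 hM.1 hM.2 hM.1, hh⟩
  | arith => exact ⟨trivial, hh⟩
  | iteTrue hn => exact ⟨hM.2.1, hh⟩
  | iteFalse => exact ⟨hM.2.2, hh⟩
  | ref hv ha =>
    rw [domOf_update]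
    exact ⟨Set.mem_insert _ _, (hh.mono subset_rfl (Set.subset_insert _ _)).update
      (Tm.In.mono _ subset_rfl (Set.subset_insert _ _) le_rfl hM)⟩
  | deref hl => exact ⟨hh _ _ hl, hh⟩
  | assign hv hl =>
    rw [domOf_update, Set.insert_eq_of_mem (show _ ∈ domOf _ from hl)]
    exact ⟨trivial, hh.update hM.2⟩
  | letbox => exact ⟨Tm.In.gbeta hM.2 hM.1, hh⟩
  | letboxName => exact ⟨Tm.In.gbeta hM.2 ⟨hM.1, idSub_In _ _⟩, hh⟩
  | app1 s ih => exact ⟨⟨(ih hM.1 hh).1, mono s hM.2⟩, (ih hM.1 hh).2⟩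
  | app2 _ s ih => exact ⟨⟨mono s hM.1, (ih hM.2 hh).1⟩, (ih hM.2 hh).2⟩
  | arith1 s ih => exact ⟨⟨(ih hM.1 hh).1, mono s hM.2⟩, (ih hM.1 hh).2⟩
  | arith2 _ s ih => exact ⟨⟨mono s hM.1, (ih hM.2 hh).1⟩, (ih hM.2 hh).2⟩
  | ite1 s ih => exact ⟨⟨(ih hM.1 hh).1, mono s hM.2.1, mono s hM.2.2⟩, (ih hM.1 hh).2⟩
  | ref1 _ ih => exact ih hM hh
  | deref1 _ ih => exact ih hM hh
  | assign1 s ih => exact ⟨⟨(ih hM.1 hh).1, mono s hM.2⟩, (ih hM.1 hh).2⟩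
  | assign2 _ s ih => exact ⟨⟨mono s hM.1, (ih hM.2 hh).1⟩, (ih hM.2 hh).2⟩
  | letbox1 s ih => exact ⟨⟨(ih hM.1 hh).1, mono s hM.2⟩, (ih hM.1 hh).2⟩

/-! ## Resolution and reduction -/

theorem BName.unbox_lren (b : BName) (r : ℕ → ℕ) : b.unbox.lren r = b.unbox := by
  refine Tm.In.lren_eq (φ := {.bx b}) (L := ∅) (n := 0) _ ?_ (by simp)
  exact ⟨rfl, idSub_In _ _⟩

/-- The heap `H` contains the resolution of `h`. -/
def HRel (w : Env) (h H : Heap) : Prop := ∀ l V, h l = some V → H (w.r l) = some (V.res w)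

/-- Names resolve to values, so a step of a term with names remains one step after resolution;
`letbox` of a box name becomes `letbox` of its code. Injectivity of the renaming keeps an assignment
from overwriting a second location. `H` may be larger than the image of `h`, and the last conclusion
says that the rest is untouched: this protects the private heap of the other side. -/
theorem St.res {w : Env} (hw : w.Ok) {φ : Set Name} {L : Set Loc} {a M h M' h'} {H : Heap}
    (s : St a M h M' h') (hM : M.In φ L 0) (hr : HRel w h H) (hinj : Set.InjOn w.r (domOf h))
    (ha : H (w.r a) = none) :
    ∃ H', St (w.r a) (M.res w) H (M'.res w) H' ∧ HRel w h' H' ∧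
      ∀ m, (∀ l ∈ domOf h', w.r l ≠ m) → H' m = H m := by
  induction s with
  | beta hv => exact ⟨H, by rw [Tm.res_beta hw]; exact .beta (hv.res hw), hr, fun _ _ => rfl⟩
  | recf hv => exact ⟨H, by rw [Tm.res_beta2 hw]; exact .recf (hv.res hw), hr, fun _ _ => rfl⟩
  | arith => exact ⟨H, .arith, hr, fun _ _ => rfl⟩
  | iteTrue hn => exact ⟨H, .iteTrue hn, hr, fun _ _ => rfl⟩
  | iteFalse => exact ⟨H, .iteFalse, hr, fun _ _ => rfl⟩
  | @ref V h hv hl =>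
    refine ⟨Function.update H (w.r a) (some (V.res w)), .ref (hv.res hw) ha, ?_, ?_⟩
    · intro l W hW
      by_cases hla : l = a
      · subst hla; simp at hW; simp [hW]
      · rw [Function.update_of_ne hla] at hW
        rw [Function.update_of_ne, hr _ _ hW]
        intro e; rw [← e, hr _ _ hW] at ha; cases ha
    · intro m hm
      exact Function.update_of_ne (Ne.symm (hm a (by simp [domOf_update]))) _ _
  | deref hl => exact ⟨H, .deref (hr _ _ hl), hr, fun _ _ => rfl⟩
  | @assign l V h hv hl =>
    obtain ⟨W, hW⟩ := Option.isSome_iff_exists.1 hl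
    refine ⟨Function.update H (w.r l) (some (V.res w)),
      .assign (hv.res hw) (by simp [hr _ _ hW]), ?_, ?_⟩
    · intro m W hW
      by_cases hml : m = l
      · subst hml; simp at hW; simp [hW]
      · rw [Function.update_of_ne hml] at hW
        rw [Function.update_of_ne, hr _ _ hW]
        exact fun e => hml (hinj (by simp [domOf, hW]) hl e)
    · intro m hm
      exact Function.update_of_ne (Ne.symm (hm l (by simp [domOf_update]))) _ _
  | @letbox N =>
    refine ⟨H, ?_, hr, fun _ _ => rfl⟩
    rw [Tm.res_gbeta hw _ _ fun r => Tm.In.lren_eq N hM.1 (by simp)]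
    exact .letbox
  | @letboxName b =>
    refine ⟨H, ?_, hr, fun _ _ => rfl⟩
    rw [Tm.res_gbeta hw _ _ b.unbox_lren, BName.unbox_res hw]
    exact .letbox
  | app1 _ ih => obtain ⟨H', s, hh⟩ := ih hM.1 hr hinj; exact ⟨H', .app1 s, hh⟩
  | app2 hv _ ih =>
    obtain ⟨H', s, hh⟩ := ih hM.2 hr hinj; exact ⟨H', .app2 (hv.res hw) s, hh⟩
  | arith1 _ ih => obtain ⟨H', s, hh⟩ := ih hM.1 hr hinj; exact ⟨H', .arith1 s, hh⟩
  | arith2 hv _ ih =>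
    obtain ⟨H', s, hh⟩ := ih hM.2 hr hinj; exact ⟨H', .arith2 (hv.res hw) s, hh⟩
  | ite1 _ ih => obtain ⟨H', s, hh⟩ := ih hM.1 hr hinj; exact ⟨H', .ite1 s, hh⟩
  | ref1 _ ih => obtain ⟨H', s, hh⟩ := ih hM hr hinj; exact ⟨H', .ref1 s, hh⟩
  | deref1 _ ih => obtain ⟨H', s, hh⟩ := ih hM hr hinj; exact ⟨H', .deref1 s, hh⟩
  | assign1 _ ih => obtain ⟨H', s, hh⟩ := ih hM.1 hr hinj; exact ⟨H', .assign1 s, hh⟩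
  | assign2 hv _ ih =>
    obtain ⟨H', s, hh⟩ := ih hM.2 hr hinj; exact ⟨H', .assign2 (hv.res hw) s, hh⟩
  | letbox1 _ ih => obtain ⟨H', s, hh⟩ := ih hM.1 hr hinj; exact ⟨H', .letbox1 s, hh⟩

/-! ## Evaluation contexts -/

/-- Resolution of evaluation contexts. -/
def Cx.res (w : Env) : Cx → Cx
  | .appL C N => .appL (C.res w) (N.res w)
  | .appR N C => .appR (N.res w) (C.res w)
  | .arithL o C N => .arithL o (C.res w) (N.res w)
  | .arithR o N C => .arithR o (N.res w) (C.res w)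
  | .iteC C N N' => .iteC (C.res w) (N.res w) (N'.res w)
  | .ref C => .ref (C.res w)
  | .deref C => .deref (C.res w)
  | .assignL C N => .assignL (C.res w) (N.res w)
  | .assignR N C => .assignR (N.res w) (C.res w)
  | .letboxL C N => .letboxL (C.res w) (N.res w)
  | C => C

/-- Occurrences in evaluation contexts. -/
def Cx.In (φ : Set Name) (L : Set Loc) (K : Cx) : Prop := (K.plug .unit).In φ L 0

theorem Cx.res_plug (w : Env) {K : Cx} (hK : K.IsEval) (M : Tm) :
    (K.plug M).res w = (K.res w).plug (M.res w) := by
  induction K <;> simp_all [Cx.IsEval, Cx.plug, Cx.res, Tm.res]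

theorem Cx.IsEval.res {w : Env} (hw : w.Ok) {K : Cx} (hK : K.IsEval) : (K.res w).IsEval := by
  induction K <;> simp_all [Cx.IsEval, Cx.res, Tm.IsValue.res]

theorem Cx.in_plug {φ : Set Name} {L : Set Loc} {K : Cx} (hK : K.IsEval) {M : Tm} :
    (K.plug M).In φ L 0 ↔ K.In φ L ∧ M.In φ L 0 := by
  induction K <;> simp_all [Cx.IsEval, Cx.plug, Cx.In, Tm.In] <;> tauto

theorem Cx.res_congr {w w' : Env} {φ : Set Name} {L : Set Loc} (hw : w.Agree w' φ L) {K : Cx}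
    (hK : K.IsEval) (h : K.In φ L) : K.res w = K.res w' := by
  have key : ∀ {n : ℕ} {M : Tm}, M.In φ L n → M.res w = M.res w' := fun h => Tm.res_congr hw _ h
  induction K <;> simp_all [Cx.IsEval, Cx.plug, Cx.In, Tm.In, Cx.res] <;>
    (repeat' apply And.intro) <;>
    first
    | exact key h.1
    | exact key h.2
    | exact key h.2.1
    | exact key h.2.2

theorem Cx.In.mono {φ φ' : Set Name} {L L' : Set Loc} {K : Cx} (hφ : φ ⊆ φ') (hL : L ⊆ L')
    (h : K.In φ L) : K.In φ' L' := Tm.In.mono _ hφ hL le_rfl h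

theorem Cx.plug_value {K : Cx} (hK : K.IsEval) {M : Tm} (h : (K.plug M).IsValue) :
    K = .hole ∧ M.IsValue := by
  cases K <;> simp_all [Cx.IsEval, Cx.plug, Tm.IsValue]

/-! ## Weights -/

/-- The number of uses `#b` in evaluation position, each with weight `W b`. -/
def Tm.wt (W : BName → ℕ) : Tm → ℕ
  | .app M N | .arith _ M N | .assign M N => M.wt W + N.wt W
  | .ite M _ _ | .ref M | .deref M | .letbox M _ => M.wt W
  | .unb b _ => W b
  | _ => 0

def Cx.wt (W : BName → ℕ) (K : Cx) : ℕ := (K.plug .unit).wt W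

theorem Tm.IsValue.wt {V : Tm} (h : V.IsValue) (W : BName → ℕ) : V.wt W = 0 := by
  cases V <;> simp_all [Tm.IsValue, Tm.wt]

theorem Cx.wt_plug (W : BName → ℕ) {K : Cx} (hK : K.IsEval) (M : Tm) :
    (K.plug M).wt W = K.wt W + M.wt W := by
  induction K <;> simp_all [Cx.IsEval, Cx.plug, Cx.wt, Tm.wt] <;> omega

/-- Values have weight 0, since uses under `lam` or `box` are not in evaluation position. Hence
substituting values leaves the weight as it is. -/
theorem Tm.wt_lsub (W : BName → ℕ) {s : ℕ → Tm} {e : LVar → Tm} (hs : ∀ k, (s k).IsValue)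
    (he : ∀ x, (e x).IsValue) (M : Tm) : (M.lsub s e).wt W = M.wt W := by
  induction M using Tm.rec (motive_2 := fun _ => True) <;>
    simp_all [Tm.lsub, Tm.wt, Tm.IsValue.wt]

theorem Tm.wt_inst (W : BName → ℕ) {e : LVar → Option Tm} (he : ∀ x V, e x = some V → V.IsValue)
    (M : Tm) : (M.inst e).wt W = M.wt W := by
  refine Tm.wt_lsub W (s := .bvar) (fun _ => trivial) (fun x => ?_) M
  rcases hx : e x with _ | V
  · trivial
  · exact he x V hx

theorem Tm.wt_congr {W W' : BName → ℕ} {φ : Set Name} {L : Set Loc}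
    (h : ∀ b, Name.bx b ∈ φ → W b = W' b) {n : ℕ} (M : Tm) (hM : M.In φ L n) :
    M.wt W = M.wt W' := by
  induction M using Tm.rec (motive_2 := fun _ => True) <;> simp_all [Tm.In, Tm.wt]

theorem Tm.IsValue.lsub {V : Tm} (h : V.IsValue) {s : ℕ → Tm} {e : LVar → Tm}
    (hs : ∀ k, (s k).IsValue) (he : ∀ x, (e x).IsValue) : (V.lsub s e).IsValue := by
  cases V <;> simp_all [Tm.IsValue, Tm.lsub]

theorem Tm.IsValue.lren {V : Tm} (h : V.IsValue) (r : ℕ → ℕ) : (V.lren r).IsValue := by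
  cases V <;> simp_all [Tm.IsValue, Tm.lren]

theorem Tm.IsValue.gren {V : Tm} (h : V.IsValue) (r : GV → GV) : (V.gren r).IsValue := by
  cases V <;> simp_all [Tm.IsValue, Tm.gren]

theorem Tm.IsValue.gsub {V : Tm} (h : V.IsValue) (g : GSub) : (V.gsub g).IsValue := by
  cases V <;> simp_all [Tm.IsValue, Tm.gsub]

-- Typing: substitution, subject reduction and progress.

/-! ## Well-formedness -/

theorem WfTy.mono {i j : Layer} {T : Ty} (h : WfTy i T) (hij : i ≤ j) : WfTy j T := by
  induction h with
  | unit => exact .unit _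
  | int => exact .int _
  | arr _ _ ih1 ih2 => exact .arr (ih1 hij) (ih2 hij)
  | ref _ ih => exact .ref (ih hij)
  | box h1 h2 h3 =>
    obtain rfl : j = 1 := le_antisymm (Fin.le_last j) hij
    exact .box h1 h2 h3

theorem layer_le_one (i : Layer) : i ≤ 1 := Fin.le_last i

theorem WfLCtx.nil (i : Layer) : WfLCtx i [] := ⟨List.nodup_nil, by simp⟩

theorem WfGCtx.nil : WfGCtx [] := ⟨List.nodup_nil, by simp⟩

theorem LCtx.mem_dom {G : LCtx} {x : LVar} : x ∈ G.dom ↔ ∃ T, (x, T) ∈ G := by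
  simp [LCtx.dom]

theorem LCtx.unique {G : LCtx} (h : (G.map Prod.fst).Nodup) {x : LVar} {T T' : Ty}
    (h1 : (x, T) ∈ G) (h2 : (x, T') ∈ G) : T = T' :=
  congrArg Prod.snd (List.inj_on_of_nodup_map h h1 h2 rfl)

/-- Declarations of global variables. -/
def GDecl (P : GCtx) (F : List (LCtx × Ty)) : GV → LCtx × Ty → Prop
  | .b k, p => F[k]? = some p
  | .f u, p => (u, p) ∈ P

theorem HasTy.gvar {S P F G D i v d G' T} (hc : WfCtxs S P F G D i) (hv : GDecl P F v (G', T))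
    (h1 : d.keys.Nodup) (h2 : ∀ x, x ∈ d.keys ↔ x ∈ G'.dom)
    (h3 : ∀ x V, d.lookup x = some V → V.IsValue)
    (h4 : ∀ x V T', (x, T') ∈ G' → d.lookup x = some V → HasTy S P F G D i V T') :
    HasTy S P F G D i (.gvar v d) T := by
  cases v with
  | b k => exact .gvarB hc hv h1 h2 h3 h4
  | f u => exact .gvarF hc hv h1 h2 h3 h4

theorem HasTy.wf {S P F G D i M T} (h : HasTy S P F G D i M T) :
    WfCtxs S P F G D i ∧ WfTy i T := by
  induction h with
  | unit hc => exact ⟨hc, .unit _⟩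
  | int _ hc => exact ⟨hc, .int _⟩
  | bvar hc hk => exact ⟨hc, hc.locB _ (List.mem_of_getElem? hk)⟩
  | fvar hc hx => exact ⟨hc, hc.loc.2 _ _ hx⟩
  | gvarB hc hk => exact ⟨hc, (hc.globB _ _ (List.mem_of_getElem? hk)).2.mono (Fin.zero_le _)⟩
  | gvarF hc hk => exact ⟨hc, (hc.glob.2 _ _ _ hk).2.mono (Fin.zero_le _)⟩
  | loc hc _ hT => exact ⟨hc, .ref hT⟩
  | lam _ ih =>
    obtain ⟨hc, hT⟩ := ih
    exact ⟨⟨hc.store, hc.glob, hc.globB, hc.loc, fun T h => hc.locB T (List.mem_cons_of_mem _ h)⟩,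
      .arr (hc.locB _ List.mem_cons_self) hT⟩
  | app _ _ ih1 _ => obtain ⟨hc, hT⟩ := ih1; cases hT; exact ⟨hc, by assumption⟩
  | recf _ ih =>
    obtain ⟨hc, hT⟩ := ih
    exact ⟨⟨hc.store, hc.glob, hc.globB, hc.loc,
      fun T h => hc.locB T (List.mem_cons_of_mem _ (List.mem_cons_of_mem _ h))⟩,
      hc.locB _ (List.mem_cons_of_mem _ List.mem_cons_self)⟩
  | arith _ _ ih1 _ => exact ih1
  | ite _ _ _ _ ih2 _ => exact ih2
  | ref _ ih => exact ⟨ih.1, .ref ih.2⟩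
  | deref _ ih => obtain ⟨hc, hT⟩ := ih; cases hT; exact ⟨hc, by assumption⟩
  | assign _ _ ih1 _ => exact ⟨ih1.1, .unit _⟩
  | box hG hD _ ih =>
    obtain ⟨hc, hT⟩ := ih
    exact ⟨⟨hc.store, hc.glob, hc.globB, hG, hD⟩, .box hc.loc.1 hc.loc.2 hT⟩
  | letbox _ _ ih1 ih2 => exact ⟨ih1.1, ih2.2⟩
  | fname hc hf hl => exact ⟨hc, WfTy.mono hf hl⟩
  | bname hc hb => exact ⟨hc, hb⟩
  | unb hc hb =>
    refine ⟨hc, ?_⟩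
    cases hb with
    | box _ _ h => exact h.mono (Fin.zero_le _)

theorem HasTy.weaken {S S' P P' F G G' D i j M T} (h : HasTy S P F G D i M T) (hS : PSub S S')
    (hS' : WfSCtx S') (hP : P ⊆ P') (hP' : WfGCtx P') (hG : G ⊆ G') (hG' : WfLCtx j G')
    (hij : i ≤ j) : HasTy S' P' F G' D j M T := by
  have wf : ∀ {F G G' D i j}, WfCtxs S P F G D i → WfLCtx j G' → i ≤ j →
      WfCtxs S' P' F G' D j := fun hc hG' hij =>
    ⟨hS', hP', hc.globB, hG', fun T h => (hc.locB T h).mono hij⟩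
  induction h generalizing G' j with
  | unit hc => exact .unit (wf hc hG' hij)
  | int n hc => exact .int n (wf hc hG' hij)
  | bvar hc hk => exact .bvar (wf hc hG' hij) hk
  | fvar hc hx => exact .fvar (wf hc hG' hij) (hG hx)
  | gvarB hc hk h1 h2 h3 _ ih =>
    exact .gvarB (wf hc hG' hij) hk h1 h2 h3 fun x V T hx hV => ih x V T hx hV hG hG' hij
  | gvarF hc hk h1 h2 h3 _ ih =>
    exact .gvarF (wf hc hG' hij) (hP hk) h1 h2 h3 fun x V T hx hV => ih x V T hx hV hG hG' hij
  | loc hc hl hT => exact .loc (wf hc hG' hij) (hS _ _ hl) (hT.mono hij)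
  | lam _ ih => exact .lam (ih hG hG' hij)
  | app _ _ ih1 ih2 => exact .app (ih1 hG hG' hij) (ih2 hG hG' hij)
  | recf _ ih => exact .recf (ih hG hG' hij)
  | arith _ _ ih1 ih2 => exact .arith (ih1 hG hG' hij) (ih2 hG hG' hij)
  | ite _ _ _ ih1 ih2 ih3 => exact .ite (ih1 hG hG' hij) (ih2 hG hG' hij) (ih3 hG hG' hij)
  | ref _ ih => exact .ref (ih hG hG' hij)
  | deref _ ih => exact .deref (ih hG hG' hij)
  | assign _ _ ih1 ih2 => exact .assign (ih1 hG hG' hij) (ih2 hG hG' hij)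
  | box _ hD hM ih =>
    obtain rfl : j = 1 := le_antisymm (layer_le_one j) hij
    exact .box hG' hD (ih (List.Subset.refl _) hM.wf.1.loc le_rfl)
  | letbox _ _ ih1 ih2 =>
    obtain rfl : j = 1 := le_antisymm (layer_le_one j) hij
    exact .letbox (ih1 hG hG' hij) (ih2 hG hG' hij)
  | fname hc hf hl => exact .fname (wf hc hG' hij) hf (hl.trans hij)
  | bname hc hb =>
    obtain rfl : j = 1 := le_antisymm (layer_le_one j) hij
    exact .bname (wf hc hG' hij) hb
  | unb hc hk h1 h2 h3 _ ih =>
    exact .unb (wf hc hG' hij) hk h1 h2 h3 fun x V T hx hV => ih x V T hx hV hG hG' hij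

theorem HasTy.store {S S' P F G D i M T} (h : HasTy S P F G D i M T) (hS : PSub S S')
    (hS' : WfSCtx S') : HasTy S' P F G D i M T :=
  h.weaken hS hS' (List.Subset.refl _) h.wf.1.glob (List.Subset.refl _) h.wf.1.loc le_rfl

theorem HasTy.lift {S P F D i j M T} (h : HasTy S P F [] D i M T) (hij : i ≤ j) :
    HasTy S P F [] D j M T :=
  h.weaken (fun _ _ h => h) h.wf.1.store (List.Subset.refl _) h.wf.1.glob (List.Subset.refl _)
    (WfLCtx.nil j) hij

/-! ## Substitution lemmas -/

theorem HasTy.lren {S P F G D D' i M T} {r : ℕ → ℕ} (h : HasTy S P F G D i M T)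
    (hD' : ∀ T ∈ D', WfTy i T) (hr : ∀ k T, D[k]? = some T → D'[r k]? = some T) :
    HasTy S P F G D' i (M.lren r) T := by
  have wf : ∀ {F G D D' i}, WfCtxs S P F G D i → (∀ T ∈ D', WfTy i T) → WfCtxs S P F G D' i :=
    fun hc hD' => ⟨hc.store, hc.glob, hc.globB, hc.loc, hD'⟩
  have up : ∀ {r : ℕ → ℕ} {D D' : List Ty} {T₁ : Ty}, (∀ k T, D[k]? = some T → D'[r k]? = some T) →
      ∀ k T, (T₁ :: D)[k]? = some T → (T₁ :: D')[upRen r k]? = some T := by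
    intro r D D' T₁ h k T hk
    cases k with
    | zero => exact hk
    | succ k => simpa using h k T (by simpa using hk)
  induction h generalizing D' r with
  | unit hc => exact .unit (wf hc hD')
  | int n hc => exact .int n (wf hc hD')
  | bvar hc hk => exact .bvar (wf hc hD') (hr _ _ hk)
  | fvar hc hx => exact .fvar (wf hc hD') hx
  | gvarB hc hk h1 h2 h3 _ ih =>
    refine .gvarB (wf hc hD') hk (by simpa) (by simpa) (fun x V hV => ?_) fun x V T hx hV => ?_
    · simp only [LSub.lookup_lren, Option.map_eq_some_iff] at hV
      obtain ⟨V, hV, rfl⟩ := hV; exact (h3 x V hV).lren r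
    · simp only [LSub.lookup_lren, Option.map_eq_some_iff] at hV
      obtain ⟨V, hV, rfl⟩ := hV; exact ih x V T hx hV hD' hr
  | gvarF hc hk h1 h2 h3 _ ih =>
    refine .gvarF (wf hc hD') hk (by simpa) (by simpa) (fun x V hV => ?_) fun x V T hx hV => ?_
    · simp only [LSub.lookup_lren, Option.map_eq_some_iff] at hV
      obtain ⟨V, hV, rfl⟩ := hV; exact (h3 x V hV).lren r
    · simp only [LSub.lookup_lren, Option.map_eq_some_iff] at hV
      obtain ⟨V, hV, rfl⟩ := hV; exact ih x V T hx hV hD' hr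
  | loc hc hl hT => exact .loc (wf hc hD') hl hT
  | lam h ih =>
    refine .lam (ih ?_ (up hr))
    rintro T (_ | ⟨_, hT⟩)
    · exact h.wf.1.locB _ List.mem_cons_self
    · exact hD' T hT
  | app _ _ ih1 ih2 => exact .app (ih1 hD' hr) (ih2 hD' hr)
  | recf h ih =>
    refine .recf (ih ?_ (up (up hr)))
    rintro T (_ | ⟨_, _ | ⟨_, hT⟩⟩)
    · exact h.wf.1.locB _ List.mem_cons_self
    · exact h.wf.1.locB _ (List.mem_cons_of_mem _ List.mem_cons_self)
    · exact hD' T hT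
  | arith _ _ ih1 ih2 => exact .arith (ih1 hD' hr) (ih2 hD' hr)
  | ite _ _ _ ih1 ih2 ih3 => exact .ite (ih1 hD' hr) (ih2 hD' hr) (ih3 hD' hr)
  | ref _ ih => exact .ref (ih hD' hr)
  | deref _ ih => exact .deref (ih hD' hr)
  | assign _ _ ih1 ih2 => exact .assign (ih1 hD' hr) (ih2 hD' hr)
  | box hG _ hM _ => exact .box hG hD' hM
  | letbox _ _ ih1 ih2 => exact .letbox (ih1 hD' hr) (ih2 hD' hr)
  | fname hc hf hl => exact .fname (wf hc hD') hf hl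
  | bname hc hb => exact .bname (wf hc hD') hb
  | unb hc hk h1 h2 h3 _ ih =>
    refine .unb (wf hc hD') hk (by simpa) (by simpa) (fun x V hV => ?_) fun x V T hx hV => ?_
    · simp only [LSub.lookup_lren, Option.map_eq_some_iff] at hV
      obtain ⟨V, hV, rfl⟩ := hV; exact (h3 x V hV).lren r
    · simp only [LSub.lookup_lren, Option.map_eq_some_iff] at hV
      obtain ⟨V, hV, rfl⟩ := hV; exact ih x V T hx hV hD' hr

theorem GDecl.shift {P F v p q} (h : GDecl P F v p) : GDecl P (q :: F) v.shift p := by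
  cases v with
  | b k => simpa [GDecl, GV.shift] using h
  | f u => exact h

theorem HasTy.gren {S P P' F F' G D i M T} {r : GV → GV} (h : HasTy S P F G D i M T)
    (hP' : WfGCtx P') (hF' : ∀ G' T, (G', T) ∈ F' → WfLCtx 0 G' ∧ WfTy 0 T)
    (hr : ∀ v p, GDecl P F v p → GDecl P' F' (r v) p) :
    HasTy S P' F' G D i (M.gren r) T := by
  have wf : ∀ {F F' G D i}, WfCtxs S P F G D i →
      (∀ G' T, (G', T) ∈ F' → WfLCtx 0 G' ∧ WfTy 0 T) → WfCtxs S P' F' G D i :=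
    fun hc hF' => ⟨hc.store, hP', hF', hc.loc, hc.locB⟩
  have gv : ∀ {F F' G D i v d G' T} {r : GV → GV}, WfCtxs S P F G D i →
      (∀ G' T, (G', T) ∈ F' → WfLCtx 0 G' ∧ WfTy 0 T) →
      (∀ v p, GDecl P F v p → GDecl P' F' (r v) p) → GDecl P F v (G', T) →
      d.keys.Nodup → (∀ x, x ∈ d.keys ↔ x ∈ G'.dom) →
      (∀ x V, d.lookup x = some V → V.IsValue) →
      (∀ x V T', (x, T') ∈ G' → d.lookup x = some V → HasTy S P' F' G D i (V.gren r) T') →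
      HasTy S P' F' G D i ((Tm.gvar v d).gren r) T := by
    intro F F' G D i v d G' T r hc hF' hr hk h1 h2 h3 ih
    refine .gvar (wf hc hF') (hr _ _ hk) (by simpa) (by simpa) (fun x V hV => ?_)
      fun x V T hx hV => ?_
    · simp only [LSub.lookup_gren, Option.map_eq_some_iff] at hV
      obtain ⟨V, hV, rfl⟩ := hV; exact (h3 x V hV).gren r
    · simp only [LSub.lookup_gren, Option.map_eq_some_iff] at hV
      obtain ⟨V, hV, rfl⟩ := hV; exact ih x V T hx hV
  induction h generalizing F' r with
  | unit hc => exact .unit (wf hc hF')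
  | int n hc => exact .int n (wf hc hF')
  | bvar hc hk => exact .bvar (wf hc hF') hk
  | fvar hc hx => exact .fvar (wf hc hF') hx
  | gvarB hc hk h1 h2 h3 _ ih =>
    exact gv hc hF' hr hk h1 h2 h3 fun x V T hx hV => ih x V T hx hV hF' hr
  | gvarF hc hk h1 h2 h3 _ ih =>
    exact gv (v := .f _) hc hF' hr hk h1 h2 h3 fun x V T hx hV => ih x V T hx hV hF' hr
  | loc hc hl hT => exact .loc (wf hc hF') hl hT
  | lam _ ih => exact .lam (ih hF' hr)
  | app _ _ ih1 ih2 => exact .app (ih1 hF' hr) (ih2 hF' hr)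
  | recf _ ih => exact .recf (ih hF' hr)
  | arith _ _ ih1 ih2 => exact .arith (ih1 hF' hr) (ih2 hF' hr)
  | ite _ _ _ ih1 ih2 ih3 => exact .ite (ih1 hF' hr) (ih2 hF' hr) (ih3 hF' hr)
  | ref _ ih => exact .ref (ih hF' hr)
  | deref _ ih => exact .deref (ih hF' hr)
  | assign _ _ ih1 ih2 => exact .assign (ih1 hF' hr) (ih2 hF' hr)
  | box hG hD _ ih => exact .box hG hD (ih hF' hr)
  | letbox h1 h2 ih1 ih2 =>
    refine .letbox (ih1 hF' hr) (ih2 ?_ ?_)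
    · rintro G' T (_ | ⟨_, hT⟩)
      · exact h2.wf.1.globB _ _ List.mem_cons_self
      · exact hF' _ _ hT
    · rintro ((_ | k) | u) p hp
      · exact hp
      · exact (hr (.b k) p (by simpa [GDecl] using hp)).shift
      · exact (hr (.f u) p hp).shift
  | fname hc hf hl => exact .fname (wf hc hF') hf hl
  | bname hc hb => exact .bname (wf hc hF') hb
  | unb hc hk h1 h2 h3 _ ih =>
    refine .unb (wf hc hF') hk (by simpa) (by simpa) (fun x V hV => ?_) fun x V T hx hV => ?_
    · simp only [LSub.lookup_gren, Option.map_eq_some_iff] at hV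
      obtain ⟨V, hV, rfl⟩ := hV; exact (h3 x V hV).gren r
    · simp only [LSub.lookup_gren, Option.map_eq_some_iff] at hV
      obtain ⟨V, hV, rfl⟩ := hV; exact ih x V T hx hV hF' hr

theorem HasTy.shift {S P F G D i M T p} (h : HasTy S P F G D i M T)
    (hp : WfLCtx 0 p.1 ∧ WfTy 0 p.2) : HasTy S P (p :: F) G D i (M.gren GV.shift) T := by
  refine h.gren h.wf.1.glob ?_ fun v p hv => hv.shift
  rintro G' T (_ | ⟨_, hT⟩)
  · exact hp
  · exact h.wf.1.globB _ _ hT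

theorem HasTy.succ {S P F G D i M T T₁} (h : HasTy S P F G D i M T) (hT : WfTy i T₁) :
    HasTy S P F G (T₁ :: D) i (M.lren Nat.succ) T := by
  refine h.lren ?_ fun k T hk => by simpa using hk
  rintro T (_ | ⟨_, h'⟩)
  · exact hT
  · exact h.wf.1.locB _ h'

/-- The layer may rise from `i` to `j`: code is typed at layer 0, but with its variables replaced it
runs at the layer of its use. Under `box` there is nothing to do, because local substitution stops
there. -/
theorem HasTy.lsub {S P F G G' D D' i j M T} {s : ℕ → Tm} {e : LVar → Tm}
    (h : HasTy S P F G D i M T) (hij : i ≤ j) (hG' : WfLCtx j G') (hD' : ∀ T ∈ D', WfTy j T)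
    (hs : ∀ k T, D[k]? = some T → HasTy S P F G' D' j (s k) T)
    (he : ∀ x T, (x, T) ∈ G → HasTy S P F G' D' j (e x) T)
    (vs : ∀ k, (s k).IsValue) (ve : ∀ x, (e x).IsValue) :
    HasTy S P F G' D' j (M.lsub s e) T := by
  have wf : ∀ {F G G' D D' i j}, WfCtxs S P F G D i → WfLCtx j G' → (∀ T ∈ D', WfTy j T) →
      WfCtxs S P F G' D' j :=
    fun hc hG' hD' => ⟨hc.store, hc.glob, hc.globB, hG', hD'⟩
  have up : ∀ {F G' D D' T₁ j} {s : ℕ → Tm}, WfTy j T₁ → WfCtxs S P F G' D' j →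
      (∀ k T, D[k]? = some T → HasTy S P F G' D' j (s k) T) →
      ∀ k T, (T₁ :: D)[k]? = some T → HasTy S P F G' (T₁ :: D') j (upSub s k) T := by
    intro F G' D D' T₁ j s hT₁ hc hs k T hk
    cases k with
    | zero =>
      refine .bvar ⟨hc.store, hc.glob, hc.globB, hc.loc, ?_⟩ hk
      rintro T (_ | ⟨_, h'⟩)
      · exact hT₁
      · exact hc.locB _ h'
    | succ k => exact (hs k T (by simpa using hk)).succ hT₁
  have upv : ∀ {s : ℕ → Tm}, (∀ k, (s k).IsValue) → ∀ k, (upSub s k).IsValue := by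
    intro s vs k
    cases k with
    | zero => trivial
    | succ k => exact (vs k).lren _
  have cons : ∀ {j} {D' : List Ty} {T₁ : Ty}, (∀ T ∈ D', WfTy j T) → WfTy j T₁ →
      ∀ T ∈ T₁ :: D', WfTy j T := by
    rintro j D' T₁ hD' hT₁ T (_ | ⟨_, h'⟩)
    · exact hT₁
    · exact hD' _ h'
  induction h generalizing G' D' s e j with
  | unit hc => exact .unit (wf hc hG' hD')
  | int n hc => exact .int n (wf hc hG' hD')
  | bvar hc hk => exact hs _ _ hk
  | fvar hc hx => exact he _ _ hx
  | gvarB hc hk h1 h2 h3 _ ih =>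
    refine .gvarB (wf hc hG' hD') hk (by simpa) (by simpa) (fun x V hV => ?_) fun x V T hx hV => ?_
    · simp only [LSub.lookup_lsub, Option.map_eq_some_iff] at hV
      obtain ⟨V, hV, rfl⟩ := hV; exact (h3 x V hV).lsub vs ve
    · simp only [LSub.lookup_lsub, Option.map_eq_some_iff] at hV
      obtain ⟨V, hV, rfl⟩ := hV; exact ih x V T hx hV hij hG' hD' hs he vs ve
  | gvarF hc hk h1 h2 h3 _ ih =>
    refine .gvarF (wf hc hG' hD') hk (by simpa) (by simpa) (fun x V hV => ?_) fun x V T hx hV => ?_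
    · simp only [LSub.lookup_lsub, Option.map_eq_some_iff] at hV
      obtain ⟨V, hV, rfl⟩ := hV; exact (h3 x V hV).lsub vs ve
    · simp only [LSub.lookup_lsub, Option.map_eq_some_iff] at hV
      obtain ⟨V, hV, rfl⟩ := hV; exact ih x V T hx hV hij hG' hD' hs he vs ve
  | loc hc hl hT => exact .loc (wf hc hG' hD') hl (hT.mono hij)
  | lam h ih =>
    have hc := h.wf.1
    have hT₁ := (hc.locB _ List.mem_cons_self).mono hij
    exact .lam (ih hij hG' (cons hD' hT₁) (up hT₁ (wf hc hG' hD') hs)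
      (fun x T hx => (he x T hx).succ hT₁) (upv vs) fun x => (ve x).lren _)
  | app _ _ ih1 ih2 =>
    exact .app (ih1 hij hG' hD' hs he vs ve) (ih2 hij hG' hD' hs he vs ve)
  | recf h ih =>
    have hc := h.wf.1
    have hT₁ := (hc.locB _ List.mem_cons_self).mono hij
    have hT₂ := (hc.locB _ (List.mem_cons_of_mem _ List.mem_cons_self)).mono hij
    exact .recf (ih hij hG' (cons (cons hD' hT₂) hT₁)
      (up hT₁ (wf hc hG' (cons hD' hT₂)) (up hT₂ (wf hc hG' hD') hs))
      (fun x T hx => ((he x T hx).succ hT₂).succ hT₁) (upv (upv vs))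
      fun x => ((ve x).lren _).lren _)
  | arith _ _ ih1 ih2 =>
    exact .arith (ih1 hij hG' hD' hs he vs ve) (ih2 hij hG' hD' hs he vs ve)
  | ite _ _ _ ih1 ih2 ih3 =>
    exact .ite (ih1 hij hG' hD' hs he vs ve) (ih2 hij hG' hD' hs he vs ve)
      (ih3 hij hG' hD' hs he vs ve)
  | ref _ ih => exact .ref (ih hij hG' hD' hs he vs ve)
  | deref _ ih => exact .deref (ih hij hG' hD' hs he vs ve)
  | assign _ _ ih1 ih2 =>
    exact .assign (ih1 hij hG' hD' hs he vs ve) (ih2 hij hG' hD' hs he vs ve)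
  | box hG hD hM _ =>
    obtain rfl : j = 1 := le_antisymm (layer_le_one j) hij
    exact .box hG' hD' hM
  | letbox _ h2 ih1 ih2 =>
    obtain rfl : j = 1 := le_antisymm (layer_le_one j) hij
    have hp := h2.wf.1.globB _ _ List.mem_cons_self
    exact .letbox (ih1 hij hG' hD' hs he vs ve) (ih2 hij hG' hD'
      (fun k T hk => (hs k T hk).shift hp) (fun x T hx => (he x T hx).shift hp)
      (fun k => (vs k).gren _) fun x => (ve x).gren _)
  | fname hc hf hl => exact .fname (wf hc hG' hD') hf (hl.trans hij)
  | bname hc hb =>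
    obtain rfl : j = 1 := le_antisymm (layer_le_one j) hij
    exact .bname (wf hc hG' hD') hb
  | unb hc hk h1 h2 h3 _ ih =>
    refine .unb (wf hc hG' hD') hk (by simpa) (by simpa) (fun x V hV => ?_) fun x V T hx hV => ?_
    · simp only [LSub.lookup_lsub, Option.map_eq_some_iff] at hV
      obtain ⟨V, hV, rfl⟩ := hV; exact (h3 x V hV).lsub vs ve
    · simp only [LSub.lookup_lsub, Option.map_eq_some_iff] at hV
      obtain ⟨V, hV, rfl⟩ := hV; exact ih x V T hx hV hij hG' hD' hs he vs ve

theorem HasTy.inst {S P F G₀ G D i j M T} {e : LVar → Option Tm} (h : HasTy S P F G₀ [] i M T)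
    (hij : i ≤ j) (hG : WfLCtx j G) (hD : ∀ T ∈ D, WfTy j T)
    (ve : ∀ x V, e x = some V → V.IsValue)
    (he : ∀ x T, (x, T) ∈ G₀ → ∃ V, e x = some V ∧ HasTy S P F G D j V T) :
    HasTy S P F G D j (M.inst e) T := by
  refine h.lsub hij hG hD (by simp) (fun x T hx => ?_) (fun _ => trivial) fun x => ?_
  · obtain ⟨V, hV, ht⟩ := he x T hx
    rwa [hV]
  · rcases hx : e x with _ | V
    · trivial
    · exact ve x V hx

/-- A term put for a global variable is code of layer 0 in its own local context. Instantiated by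
the explicit substitution it rises to the layer at which the variable is used (`HasTy.inst`). -/
theorem HasTy.gsub {S P P' F F' G D i M T} {g : GSub} (h : HasTy S P F G D i M T)
    (hP' : WfGCtx P') (hF' : ∀ G' T, (G', T) ∈ F' → WfLCtx 0 G' ∧ WfTy 0 T)
    (hg : ∀ v p, GDecl P F v p → (∃ v', g v = .inl v' ∧ GDecl P' F' v' p) ∨
      ∃ N, g v = .inr N ∧ HasTy S P' F' p.1 [] 0 N p.2) :
    HasTy S P' F' G D i (M.gsub g) T := by
  have wf : ∀ {F F' G D i}, WfCtxs S P F G D i →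
      (∀ G' T, (G', T) ∈ F' → WfLCtx 0 G' ∧ WfTy 0 T) → WfCtxs S P' F' G D i :=
    fun hc hF' => ⟨hc.store, hP', hF', hc.loc, hc.locB⟩
  have gv : ∀ {F F' G D i v d G' T} {g : GSub}, WfCtxs S P F G D i →
      (∀ G' T, (G', T) ∈ F' → WfLCtx 0 G' ∧ WfTy 0 T) →
      (∀ v p, GDecl P F v p → (∃ v', g v = .inl v' ∧ GDecl P' F' v' p) ∨
      ∃ N, g v = .inr N ∧ HasTy S P' F' p.1 [] 0 N p.2) → GDecl P F v (G', T) →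
      d.keys.Nodup → (∀ x, x ∈ d.keys ↔ x ∈ G'.dom) →
      (∀ x V, d.lookup x = some V → V.IsValue) →
      (∀ x V T', (x, T') ∈ G' → d.lookup x = some V → HasTy S P' F' G D i (V.gsub g) T') →
      HasTy S P' F' G D i ((Tm.gvar v d).gsub g) T := by
    intro F F' G D i v d G' T g hc hF' hg hk h1 h2 h3 ih
    rcases hg _ _ hk with ⟨v', hv, hd⟩ | ⟨N, hv, hN⟩
    · simp only [Tm.gsub, hv]
      refine .gvar (wf hc hF') hd (by simpa) (by simpa) (fun x V hV => ?_)
        fun x V T hx hV => ?_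
      · simp only [LSub.lookup_gsub, Option.map_eq_some_iff] at hV
        obtain ⟨V, hV, rfl⟩ := hV; exact (h3 x V hV).gsub g
      · simp only [LSub.lookup_gsub, Option.map_eq_some_iff] at hV
        obtain ⟨V, hV, rfl⟩ := hV; exact ih x V T hx hV
    · simp only [Tm.gsub, hv]
      refine hN.inst (Fin.zero_le _) hc.loc hc.locB (fun x V hV => ?_) fun x T hx => ?_
      · simp only [LSub.lookup_gsub, Option.map_eq_some_iff] at hV
        obtain ⟨V, hV, rfl⟩ := hV; exact (h3 x V hV).gsub g
      · obtain ⟨V, hV⟩ := LSub.lookup_of_mem ((h2 x).2 (LCtx.mem_dom.2 ⟨T, hx⟩))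
        exact ⟨V.gsub g, by simp [hV], ih x V T hx hV⟩
  induction h generalizing F' g with
  | unit hc => exact .unit (wf hc hF')
  | int n hc => exact .int n (wf hc hF')
  | bvar hc hk => exact .bvar (wf hc hF') hk
  | fvar hc hx => exact .fvar (wf hc hF') hx
  | gvarB hc hk h1 h2 h3 _ ih =>
    exact gv hc hF' hg hk h1 h2 h3 fun x V T hx hV => ih x V T hx hV hF' hg
  | gvarF hc hk h1 h2 h3 _ ih =>
    exact gv (v := .f _) hc hF' hg hk h1 h2 h3 fun x V T hx hV => ih x V T hx hV hF' hg
  | loc hc hl hT => exact .loc (wf hc hF') hl hT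
  | lam _ ih => exact .lam (ih hF' hg)
  | app _ _ ih1 ih2 => exact .app (ih1 hF' hg) (ih2 hF' hg)
  | recf _ ih => exact .recf (ih hF' hg)
  | arith _ _ ih1 ih2 => exact .arith (ih1 hF' hg) (ih2 hF' hg)
  | ite _ _ _ ih1 ih2 ih3 => exact .ite (ih1 hF' hg) (ih2 hF' hg) (ih3 hF' hg)
  | ref _ ih => exact .ref (ih hF' hg)
  | deref _ ih => exact .deref (ih hF' hg)
  | assign _ _ ih1 ih2 => exact .assign (ih1 hF' hg) (ih2 hF' hg)
  | box hG hD _ ih => exact .box hG hD (ih hF' hg)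
  | @letbox F₀ _ _ _ _ _ _ _ h1 h2 ih1 ih2 =>
    have hp := h2.wf.1.globB _ _ List.mem_cons_self
    refine .letbox (ih1 hF' hg) (ih2 ?_ ?_)
    · rintro G' T (_ | ⟨_, hT⟩)
      · exact hp
      · exact hF' _ _ hT
    · have key : ∀ (v : GV) (p q : LCtx × Ty), WfLCtx 0 q.1 ∧ WfTy 0 q.2 → GDecl P F₀ v p →
          (∃ v', upGSub g v.shift = .inl v' ∧ GDecl P' (q :: F') v' p) ∨
          ∃ N, upGSub g v.shift = .inr N ∧ HasTy S P' (q :: F') p.1 [] 0 N p.2 := by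
        intro v p q hq hv
        rw [upGSub_shift]
        rcases hg v p hv with ⟨v', hv', hd⟩ | ⟨N, hN, ht⟩
        · exact .inl ⟨v'.shift, by simp [GSub.ren, hv'], hd.shift⟩
        · exact .inr ⟨N.gren GV.shift, by simp [GSub.ren, hN], ht.shift hq⟩
      rintro ((_ | k) | u) p hp'
      · exact .inl ⟨.b 0, rfl, hp'⟩
      · exact key (.b k) p _ hp (by simpa [GDecl] using hp')
      · exact key (.f u) p _ hp hp'
  | fname hc hf hl => exact .fname (wf hc hF') hf hl
  | bname hc hb => exact .bname (wf hc hF') hb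
  | unb hc hk h1 h2 h3 _ ih =>
    refine .unb (wf hc hF') hk (by simpa) (by simpa) (fun x V hV => ?_) fun x V T hx hV => ?_
    · simp only [LSub.lookup_gsub, Option.map_eq_some_iff] at hV
      obtain ⟨V, hV, rfl⟩ := hV; exact (h3 x V hV).gsub g
    · simp only [LSub.lookup_gsub, Option.map_eq_some_iff] at hV
      obtain ⟨V, hV, rfl⟩ := hV; exact ih x V T hx hV hF' hg

/-! ## Scopes and occurrences of typed terms -/

/-- The scope of the global contexts. -/
def scopeOf (P : GCtx) (F : List (LCtx × Ty)) : GV → Set LVar → Prop :=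
  fun v Y => ∃ G T, GDecl P F v (G, T) ∧ Y = {x | x ∈ G.dom}

/-- The typing rules speak of an explicit substitution through `lookup` only. If the keys are
distinct, no entry is hidden by an earlier one, so what holds for all lookups holds for all entries.
-/
theorem LSub.lookup_ind {p : Tm → Prop} {q : LSub → Prop} (hn : q .nil)
    (hc : ∀ x V d, p V → q d → q (.cons x V d)) (d : LSub) (hk : d.keys.Nodup)
    (h : ∀ x V, d.lookup x = some V → p V) : q d := by
  induction d using LSub.rec (motive_1 := fun _ => True) <;> try trivial
  rename_i x V d _ ih
  simp only [LSub.keys, List.nodup_cons] at hk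
  refine hc x V d (h x V (by simp [LSub.lookup])) (ih hk.2 fun y W hW => h y W ?_)
  have : y ≠ x := by rintro rfl; exact hk.1 (LSub.mem_of_lookup hW)
  simp [LSub.lookup, this, hW]

theorem HasTy.sc {S P F G D i M T} (h : HasTy S P F G D i M T) :
    M.Sc (scopeOf P F) D.length {x | x ∈ G.dom} := by
  have sub : ∀ {F : List (LCtx × Ty)} {G D} {G' : LCtx} {d : LSub}, d.keys.Nodup →
      (∀ x, x ∈ d.keys ↔ x ∈ G'.dom) →
      (∀ x V T', (x, T') ∈ G' → d.lookup x = some V → V.Sc (scopeOf P F) D G) →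
      d.Sc (scopeOf P F) D G := by
    intro F G D G' d h1 h2 h3
    refine LSub.lookup_ind (p := fun V => V.Sc (scopeOf P F) D G) trivial
      (fun x V d hV hd => ⟨hV, hd⟩) d h1 fun x V hV => ?_
    obtain ⟨T, hT⟩ := LCtx.mem_dom.1 ((h2 x).1 (LSub.mem_of_lookup hV))
    exact h3 x V T hT hV
  induction h with
  | unit hc => trivial
  | int n hc => trivial
  | bvar hc hk => exact (List.getElem?_eq_some_iff.1 hk).1
  | fvar hc hx => exact LCtx.mem_dom.2 ⟨_, hx⟩
  | gvarB hc hk h1 h2 h3 _ ih =>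
    exact ⟨⟨_, ⟨_, _, hk, rfl⟩, fun x hx => (h2 x).2 hx⟩, sub h1 h2 ih⟩
  | gvarF hc hk h1 h2 h3 _ ih =>
    exact ⟨⟨_, ⟨_, _, hk, rfl⟩, fun x hx => (h2 x).2 hx⟩, sub h1 h2 ih⟩
  | loc hc hl hT => trivial
  | lam _ ih => exact ih
  | app _ _ ih1 ih2 => exact ⟨ih1, ih2⟩
  | recf _ ih => exact ih
  | arith _ _ ih1 ih2 => exact ⟨ih1, ih2⟩
  | ite _ _ _ ih1 ih2 ih3 => exact ⟨ih1, ih2, ih3⟩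
  | ref _ ih => exact ih
  | deref _ ih => exact ih
  | assign _ _ ih1 ih2 => exact ⟨ih1, ih2⟩
  | box hG hD _ ih => exact ⟨_, ih⟩
  | @letbox F₀ _ _ _ _ G₁ _ _ h1 h2 ih1 ih2 =>
    refine ⟨ih1, {x | x ∈ LCtx.dom G₁},
      Tm.Sc.mono (Φ' := upScope {x | x ∈ LCtx.dom G₁} (scopeOf P F₀)) _ ?_ le_rfl subset_rfl ih2⟩
    rintro ((_ | k) | u) Y ⟨G, T, hd, rfl⟩
    · simp only [GDecl, List.getElem?_cons_zero, Option.some.injEq] at hd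
      cases hd; exact rfl
    · exact ⟨G, T, by simpa [GDecl] using hd, rfl⟩
    · exact ⟨G, T, hd, rfl⟩
  | fname hc hf hl => trivial
  | bname hc hb => trivial
  | unb hc hk h1 h2 h3 _ ih => exact sub h1 h2 ih

theorem scopeOf_nil {v Y} (h : scopeOf [] [] v Y) : noScope v Y := by
  obtain ⟨G, T, h, -⟩ := h
  cases v <;> simp [GDecl] at h

theorem HasTy.code {S G i M T} (h : HasTy S [] [] G [] i M T) : M.Code {x | x ∈ G.dom} :=
  Tm.Sc.mono _ (fun _ _ => scopeOf_nil) le_rfl subset_rfl h.sc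

theorem HasTy.closed {S i M T} (h : ClTyped S i M T) : M.Closed :=
  Tm.Sc.mono _ (fun _ _ => scopeOf_nil) le_rfl (by intro x hx; simp [LCtx.dom] at hx) h.sc

theorem HasTy.in {S P F G D i M T} (h : HasTy S P F G D i M T) :
    M.In Set.univ (domOf S) D.length := by
  have sub : ∀ {n} {G' : LCtx} {d : LSub}, d.keys.Nodup →
      (∀ x, x ∈ d.keys ↔ x ∈ G'.dom) →
      (∀ x V T', (x, T') ∈ G' → d.lookup x = some V → V.In Set.univ (domOf S) n) →
      d.In Set.univ (domOf S) n := by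
    intro n G' d h1 h2 h3
    refine LSub.lookup_ind (p := fun V => V.In Set.univ (domOf S) n) trivial
      (fun x V d hV hd => ⟨hV, hd⟩) d h1 fun x V hV => ?_
    obtain ⟨T, hT⟩ := LCtx.mem_dom.1 ((h2 x).1 (LSub.mem_of_lookup hV))
    exact h3 x V T hT hV
  induction h with
  | unit hc => trivial
  | int n hc => trivial
  | bvar hc hk => exact (List.getElem?_eq_some_iff.1 hk).1
  | fvar hc hx => trivial
  | gvarB hc hk h1 h2 h3 _ ih => exact sub h1 h2 ih
  | gvarF hc hk h1 h2 h3 _ ih => exact sub h1 h2 ih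
  | loc hc hl hT => exact Option.isSome_iff_exists.2 ⟨_, hl⟩
  | lam _ ih => exact ih
  | app _ _ ih1 ih2 => exact ⟨ih1, ih2⟩
  | recf _ ih => exact ih
  | arith _ _ ih1 ih2 => exact ⟨ih1, ih2⟩
  | ite _ _ _ ih1 ih2 ih3 => exact ⟨ih1, ih2, ih3⟩
  | ref _ ih => exact ih
  | deref _ ih => exact ih
  | assign _ _ ih1 ih2 => exact ⟨ih1, ih2⟩
  | box hG hD _ ih => exact ih
  | letbox h1 h2 ih1 ih2 => exact ⟨ih1, ih2⟩
  | fname hc hf hl => trivial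
  | bname hc hb => trivial
  | unb hc hk h1 h2 h3 _ ih => exact ⟨trivial, sub h1 h2 ih⟩

theorem Tm.In.of_src {φ : Set Name} {L : Set Loc} (M : Tm) : ∀ {n : ℕ}, M.Src → M.In φ L n →
    M.In ∅ L n := by
  induction M using Tm.rec (motive_2 := fun d => ∀ {n : ℕ}, d.Src → d.In φ L n → d.In ∅ L n) <;>
    intros <;> simp_all [Tm.Src, LSub.Src, Tm.In, LSub.In]

theorem HasTy.in_src {S P F G D i M T} (h : HasTy S P F G D i M T) (hs : M.Src) :
    M.In ∅ (domOf S) D.length := Tm.In.of_src M hs h.in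

/-! ## Typing of contexts -/

theorem HasTy.lamN {S P G i M T₁ T₂ x} (h : Typed S P ((x, T₁) :: G) i M T₂) :
    Typed S P G i (Tm.lamN x M) (.arr T₁ T₂) := by
  have hc := h.wf.1
  have hT₁ : WfTy i T₁ := hc.loc.2 x T₁ List.mem_cons_self
  have hG : WfLCtx i G := ⟨(List.nodup_cons.1 hc.loc.1).2,
    fun y T hy => hc.loc.2 y T (List.mem_cons_of_mem _ hy)⟩
  have hD : ∀ T ∈ [T₁], WfTy i T := by simpa using hT₁
  refine .lam (h.lsub le_rfl hG hD (by simp) (fun y T hy => ?_) (fun _ => trivial) fun y => ?_)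
  · by_cases hyx : y = x
    · subst hyx
      obtain rfl := LCtx.unique hc.loc.1 hy List.mem_cons_self
      simpa using HasTy.bvar ⟨hc.store, hc.glob, hc.globB, hG, hD⟩ rfl
    · rw [if_neg hyx]
      refine .fvar ⟨hc.store, hc.glob, hc.globB, hG, hD⟩ ?_
      simpa [hyx] using hy
  · split <;> trivial

theorem HasTy.recN {S P G i M T₁ T₂ x y}
    (h : Typed S P ((x, T₁) :: (y, .arr T₁ T₂) :: G) i M T₂) :
    Typed S P G i (Tm.recN y x M) (.arr T₁ T₂) := by
  have hc := h.wf.1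
  have hT₁ : WfTy i T₁ := hc.loc.2 x T₁ List.mem_cons_self
  have hT₂ : WfTy i (.arr T₁ T₂) :=
    hc.loc.2 y _ (List.mem_cons_of_mem _ List.mem_cons_self)
  have hn := hc.loc.1
  simp only [List.map_cons, List.nodup_cons] at hn
  have hG : WfLCtx i G := ⟨hn.2.2,
    fun z T hz => hc.loc.2 z T (List.mem_cons_of_mem _ (List.mem_cons_of_mem _ hz))⟩
  have hD : ∀ T ∈ [T₁, .arr T₁ T₂], WfTy i T := by simp [hT₁, hT₂]
  refine .recf (h.lsub le_rfl hG hD (by simp) (fun z T hz => ?_) (fun _ => trivial) fun z => ?_)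
  · by_cases hzx : z = x
    · subst hzx
      obtain rfl := LCtx.unique hc.loc.1 hz List.mem_cons_self
      simpa using HasTy.bvar ⟨hc.store, hc.glob, hc.globB, hG, hD⟩ rfl
    · rw [if_neg hzx]
      by_cases hzy : z = y
      · subst hzy
        obtain rfl := LCtx.unique hc.loc.1 hz (List.mem_cons_of_mem _ List.mem_cons_self)
        simpa using HasTy.bvar (k := 1) ⟨hc.store, hc.glob, hc.globB, hG, hD⟩ rfl
      · rw [if_neg hzy]
        refine .fvar ⟨hc.store, hc.glob, hc.globB, hG, hD⟩ ?_
        simpa [hzx, hzy] using hz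
  · split
    · trivial
    · split <;> trivial

/-- The renaming that turns the global variable `u` into an index. -/
def absGV (u : GVar) : GV → GV
  | .b k => .b (k + 1)
  | .f w => if w = u then .b 0 else .f w

theorem Tm.letboxN_eq (u : GVar) (M N : Tm) :
    Tm.letboxN u M N = .letbox M (N.gren (absGV u)) := by
  simp only [Tm.letboxN]
  rfl

theorem GCtx.unique {P : GCtx} (h : (P.map Prod.fst).Nodup) {x : GVar} {T T' : LCtx × Ty}
    (h1 : (x, T) ∈ P) (h2 : (x, T') ∈ P) : T = T' :=
  congrArg Prod.snd (List.inj_on_of_nodup_map h h1 h2 rfl)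

theorem HasTy.absG {S P G i N T u G₀ T₀} (h : Typed S ((u, (G₀, T₀)) :: P) G i N T) :
    HasTy S P [(G₀, T₀)] G [] i (N.gren (absGV u)) T := by
  have hc := h.wf.1
  refine h.gren ⟨(List.nodup_cons.1 hc.glob.1).2,
    fun w G T hw => hc.glob.2 w G T (List.mem_cons_of_mem _ hw)⟩ ?_ ?_
  · intro G' T' hm
    simp only [List.mem_singleton] at hm
    exact hc.glob.2 u G' T' (hm ▸ List.mem_cons_self)
  · rintro (k | w) p hp
    · simp [GDecl] at hp
    · simp only [absGV]
      by_cases hw : w = u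
      · subst hw
        obtain rfl := GCtx.unique hc.glob.1 hp List.mem_cons_self
        rw [if_pos rfl]; rfl
      · rw [if_neg hw]
        simpa [GDecl, hw] using hp

theorem CxTy.plug {S P' G' i' T' C P G i T M} (hC : CxTy S P' G' i' T' C P G i T)
    (hM : Typed S P' G' i' M T') : Typed S P G i (C.plug M) T := by
  induction hC with
  | hole hS hP hG h1 h2 h3 => exact hM.weaken (fun _ _ h => h) hS h1 hP h2 hG h3
  | lam _ ih => exact ih.lamN
  | appL _ h ih => exact .app ih h
  | appR h _ ih => exact .app h ih
  | recf _ ih => exact ih.recN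
  | arithL _ h ih => exact .arith ih h
  | arithR h _ ih => exact .arith h ih
  | iteC _ h1 h2 ih => exact .ite ih h1 h2
  | iteT h1 _ h2 ih => exact .ite h1 ih h2
  | iteE h1 h2 _ ih => exact .ite h1 h2 ih
  | ref _ ih => exact .ref ih
  | deref _ ih => exact .deref ih
  | assignL _ h ih => exact .assign ih h
  | assignR h _ ih => exact .assign h ih
  | box h _ ih => exact .box h (by simp) ih
  | letboxL _ h ih => exact .letbox ih h
  | letboxR h _ ih => rw [Cx.plug, Tm.letboxN_eq]; exact .letbox h ih.absG

theorem CxTy.store {S S' P' G' i' T' C P G i T} (hC : CxTy S P' G' i' T' C P G i T)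
    (hS : PSub S S') (hS' : WfSCtx S') : CxTy S' P' G' i' T' C P G i T := by
  induction hC with
  | hole _ hP hG h1 h2 h3 => exact .hole hS' hP hG h1 h2 h3
  | lam _ ih => exact .lam ih
  | appL _ h ih => exact .appL ih (h.store hS hS')
  | appR h _ ih => exact .appR (h.store hS hS') ih
  | recf _ ih => exact .recf ih
  | arithL _ h ih => exact .arithL ih (h.store hS hS')
  | arithR h _ ih => exact .arithR (h.store hS hS') ih
  | iteC _ h1 h2 ih => exact .iteC ih (h1.store hS hS') (h2.store hS hS')
  | iteT h1 _ h2 ih => exact .iteT (h1.store hS hS') ih (h2.store hS hS')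
  | iteE h1 h2 _ ih => exact .iteE (h1.store hS hS') (h2.store hS hS') ih
  | ref _ ih => exact .ref ih
  | deref _ ih => exact .deref ih
  | assignL _ h ih => exact .assignL ih (h.store hS hS')
  | assignR h _ ih => exact .assignR (h.store hS hS') ih
  | box h _ ih => exact .box h ih
  | letboxL _ h ih => exact .letboxL ih (h.store hS hS')
  | letboxR h _ ih => exact .letboxR (h.store hS hS') ih

/-- The path to the hole of an evaluation context crosses neither a binder nor a `box`; therefore
the typing contexts and the layer at the hole are those of the whole term. -/
theorem CxTy.of_plug {S j} {K : Cx} (hK : K.IsEval) {M : Tm} {T : Ty}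
    (h : ClTyped S j (K.plug M) T) :
    ∃ T₁, ClTyped S j M T₁ ∧ CxTy S [] [] j T₁ K [] [] j T := by
  induction K generalizing T with
  | hole =>
    exact ⟨T, h, .hole h.wf.1.store .nil (.nil j) (List.Subset.refl _) (List.Subset.refl _) le_rfl⟩
  | appL K N ih =>
    cases h with
    | app h1 h2 => obtain ⟨T₁, h3, h4⟩ := ih hK h1; exact ⟨T₁, h3, .appL h4 h2⟩
  | appR N K ih =>
    cases h with
    | app h1 h2 => obtain ⟨T₁, h3, h4⟩ := ih hK.2 h2; exact ⟨T₁, h3, .appR h1 h4⟩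
  | arithL o K N ih =>
    cases h with
    | arith h1 h2 => obtain ⟨T₁, h3, h4⟩ := ih hK h1; exact ⟨T₁, h3, .arithL h4 h2⟩
  | arithR o N K ih =>
    cases h with
    | arith h1 h2 => obtain ⟨T₁, h3, h4⟩ := ih hK.2 h2; exact ⟨T₁, h3, .arithR h1 h4⟩
  | iteC K N N' ih =>
    cases h with
    | ite h1 h2 h2' => obtain ⟨T₁, h3, h4⟩ := ih hK h1; exact ⟨T₁, h3, .iteC h4 h2 h2'⟩
  | ref K ih =>
    cases h with
    | ref h1 => obtain ⟨T₁, h3, h4⟩ := ih hK h1; exact ⟨T₁, h3, .ref h4⟩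
  | deref K ih =>
    cases h with
    | deref h1 => obtain ⟨T₁, h3, h4⟩ := ih hK h1; exact ⟨T₁, h3, .deref h4⟩
  | assignL K N ih =>
    cases h with
    | assign h1 h2 => obtain ⟨T₁, h3, h4⟩ := ih hK h1; exact ⟨T₁, h3, .assignL h4 h2⟩
  | assignR N K ih =>
    cases h with
    | assign h1 h2 => obtain ⟨T₁, h3, h4⟩ := ih hK.2 h2; exact ⟨T₁, h3, .assignR h1 h4⟩
  | letboxL K N ih =>
    cases h with
    | letbox h1 h2 => obtain ⟨T₁, h3, h4⟩ := ih hK h1; exact ⟨T₁, h3, .letboxL h4 h2⟩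
  | _ => exact hK.elim

/-! ## Composition of evaluation contexts -/

/-- `(K.comp K').plug M = K.plug (K'.plug M)` for evaluation contexts `K`. -/
def Cx.comp : Cx → Cx → Cx
  | .appL C N, K => .appL (C.comp K) N
  | .appR N C, K => .appR N (C.comp K)
  | .arithL o C N, K => .arithL o (C.comp K) N
  | .arithR o N C, K => .arithR o N (C.comp K)
  | .iteC C N N', K => .iteC (C.comp K) N N'
  | .ref C, K => .ref (C.comp K)
  | .deref C, K => .deref (C.comp K)
  | .assignL C N, K => .assignL (C.comp K) N
  | .assignR N C, K => .assignR N (C.comp K)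
  | .letboxL C N, K => .letboxL (C.comp K) N
  | _, K => K

theorem Cx.plug_comp {K : Cx} (hK : K.IsEval) (K' : Cx) (M : Tm) :
    (K.comp K').plug M = K.plug (K'.plug M) := by
  induction K <;> simp_all [Cx.IsEval, Cx.plug, Cx.comp]

theorem Cx.IsEval.comp {K K' : Cx} (hK : K.IsEval) (hK' : K'.IsEval) : (K.comp K').IsEval := by
  induction K <;> simp_all [Cx.IsEval, Cx.comp]

/-! ## Well-typed heaps at a layer -/

theorem PSub.refl {α β : Type} (f : α → Option β) : PSub f f := fun _ _ h => h

theorem PSub.trans {α β : Type} {f g k : α → Option β} (h1 : PSub f g) (h2 : PSub g k) :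
    PSub f k := fun _ _ h => h2 _ _ (h1 _ _ h)

theorem PSub.domOf {α β : Type} {f g : α → Option β} (h : PSub f g) : domOf f ⊆ domOf g := by
  intro a ha
  obtain ⟨b, hb⟩ := Option.isSome_iff_exists.1 ha
  exact Option.isSome_iff_exists.2 ⟨b, h _ _ hb⟩

theorem mem_domOf {α β : Type} {f : α → Option β} {a : α} : a ∈ domOf f ↔ ∃ b, f a = some b :=
  Option.isSome_iff_exists

/-- Values of type `T` as they are stored by a program of layer `s`: a value whose type is not of
layer `s` is abstract. -/
def VOK (s : Layer) (S : SCtx) (V : Tm) (T : Ty) : Prop :=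
  (WfTy s T ∧ ClTyped S s V T) ∨ (¬ WfTy s T ∧ (∃ A : Abs, V = A.toTm) ∧ ClTyped S 1 V T)

theorem VOK.typed {s S V T} (h : VOK s S V T) : ∃ j, ClTyped S j V T := by
  rcases h with h | h
  · exact ⟨_, h.2⟩
  · exact ⟨_, h.2.2⟩

theorem VOK.store {s S S' V T} (h : VOK s S V T) (hS : PSub S S') (hS' : WfSCtx S') :
    VOK s S' V T := by
  rcases h with h | h
  · exact .inl ⟨h.1, h.2.store hS hS'⟩
  · exact .inr ⟨h.1, h.2.1, h.2.2.store hS hS'⟩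

/-- Well-typed heaps of programs of layer `s`. -/
structure HOK (s : Layer) (S : SCtx) (h : Heap) : Prop where
  store : WfSCtx S
  dom : domOf h = domOf S
  value : ∀ l V, h l = some V → V.IsValue
  typed : ∀ l V T, h l = some V → S l = some T → VOK s S V T

theorem HOK.wfHeap {s S h} (H : HOK s S h) : WfHeap S h :=
  ⟨H.store, fun l => Set.ext_iff.1 H.dom l, H.value, fun l V T hl hT => (H.typed l V T hl hT).typed⟩

theorem HOK.finite {s S h} (H : HOK s S h) : (domOf h).Finite := H.dom ▸ H.store.1

theorem HOK.of_wfHeap {S h} (H : WfHeap S h) : HOK 1 S h :=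
  ⟨H.store, Set.ext H.dom, H.value, fun l V T hl hT => by
    obtain ⟨j, hj⟩ := H.typed l V T hl hT
    exact .inl ⟨H.store.2 l T hT, hj.lift (layer_le_one j)⟩⟩

theorem WfSCtx.update {S : SCtx} (h : WfSCtx S) {a T} (hT : WfTy 1 T) :
    WfSCtx (Function.update S a (some T)) := by
  refine ⟨?_, fun l T' hl => ?_⟩
  · change (domOf _).Finite
    rw [domOf_update]; exact h.1.insert a
  · by_cases hla : l = a
    · subst hla; simp at hl; exact hl ▸ hT
    · rw [Function.update_of_ne hla] at hl; exact h.2 l T' hl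

theorem PSub.update {S : SCtx} {a T} (h : S a = none) : PSub S (Function.update S a (some T)) := by
  intro l T' hl
  have : l ≠ a := by rintro rfl; rw [h] at hl; cases hl
  rwa [Function.update_of_ne this]

theorem WfCtxs.closed {S : SCtx} (h : WfSCtx S) (i : Layer) : WfCtxs S [] [] [] [] i :=
  ⟨h, .nil, by simp, .nil i, by simp⟩

theorem idSub_nodup {G : LCtx} (h : (G.map Prod.fst).Nodup) : (idSub G).keys.Nodup := by
  rw [idSub_keys]; exact h

theorem HasTy.unbox {S P F} {b : BName} (hS : WfSCtx S) (hP : WfGCtx P)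
    (hF : ∀ G' T, (G', T) ∈ F → WfLCtx 0 G' ∧ WfTy 0 T) (hb : b.WF) :
    HasTy S P F b.ctx [] 0 b.unbox b.ty := by
  have hb' := hb
  cases hb' with
  | box h1 h2 h3 =>
  have hc : WfCtxs S P F b.ctx [] 0 := ⟨hS, hP, hF, ⟨h1, h2⟩, by simp⟩
  refine .unb hc hb (idSub_nodup h1) (fun x => by rw [idSub_keys]) (fun x V hV => ?_)
    fun x V T hx hV => ?_
  · rw [idSub_lookup _ _ _ hV]; trivial
  · rw [idSub_lookup _ _ _ hV]; exact .fvar hc hx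

theorem HasTy.gbeta {S G D i M N G' T T'} (hM : HasTy S [] [(G', T')] G D i M T)
    (hN : HasTy S [] [] G' [] 0 N T') : HasTy S [] [] G D i (M.gbeta N) T := by
  refine hM.gsub .nil (by simp) ?_
  rintro ((_ | k) | u) p hp
  · simp only [GDecl, List.getElem?_cons_zero, Option.some.injEq] at hp
    subst hp; exact .inr ⟨N, rfl, hN⟩
  · simp [GDecl] at hp
  · simp [GDecl] at hp

theorem HasTy.beta {S i M V T T'} (hM : HasTy S [] [] [] [T'] i M T) (hV : ClTyped S i V T')
    (hv : V.IsValue) : ClTyped S i (M.beta V) T := by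
  refine hM.lsub le_rfl (.nil i) (by simp) ?_ (by simp) ?_ fun _ => trivial
  · rintro (_ | k) T hk
    · simp at hk; exact hk ▸ hV
    · simp at hk
  · rintro (_ | k)
    · exact hv
    · trivial

theorem HasTy.beta2 {S i M V W T T' T''} (hM : HasTy S [] [] [] [T', T''] i M T)
    (hV : ClTyped S i V T') (hv : V.IsValue) (hW : ClTyped S i W T'') (hw : W.IsValue) :
    ClTyped S i (M.beta2 V W) T := by
  refine hM.lsub le_rfl (.nil i) (by simp) ?_ (by simp) ?_ fun _ => trivial
  · rintro (_ | _ | k) T hk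
    · simp at hk; exact hk ▸ hV
    · simp at hk; exact hk ▸ hW
    · simp at hk
  · rintro (_ | _ | k)
    · exact hv
    · exact hw
    · trivial

/-- Subject reduction. -/
theorem St.ty {a M h M' h'} (st : St a M h M' h') : ∀ {s S T}, HOK s S h → ClTyped S s M T →
    ∃ S', PSub S S' ∧ HOK s S' h' ∧ ClTyped S' s M' T := by
  induction st with
  | beta hv =>
    intro s S T hh hM
    cases hM with
    | app h1 h2 => cases h1 with
      | lam h1 => exact ⟨S, .refl S, hh, h1.beta h2 hv⟩
  | recf hv =>
    intro s S T hh hM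
    cases hM with
    | app h1 h2 => cases h1 with
      | recf h1 => exact ⟨S, .refl S, hh, h1.beta2 h2 hv (.recf h1) trivial⟩
  | arith => intro s S T hh hM; cases hM; exact ⟨S, .refl S, hh, .int _ (.closed hh.store s)⟩
  | iteTrue hn => intro s S T hh hM; cases hM with | ite _ h _ => exact ⟨S, .refl S, hh, h⟩
  | iteFalse => intro s S T hh hM; cases hM with | ite _ _ h => exact ⟨S, .refl S, hh, h⟩
  | @ref V h hv ha =>
    intro s S T hh hM
    cases hM with
    | @ref _ _ _ _ _ T hM =>
    have hSa : S a = none := by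
      by_contra hne
      obtain ⟨T', hT'⟩ := Option.ne_none_iff_exists'.1 hne
      have : a ∈ domOf h := hh.dom ▸ mem_domOf.2 ⟨T', hT'⟩
      obtain ⟨V, hV⟩ := mem_domOf.1 this
      rw [ha] at hV; cases hV
    have hS' : WfSCtx (Function.update S a (some T)) :=
      hh.store.update (hM.wf.2.mono (layer_le_one s))
    have hsub : PSub S (Function.update S a (some T)) := .update hSa
    refine ⟨_, hsub, ⟨hS', by rw [domOf_update, domOf_update, hh.dom], ?_, ?_⟩,
      .loc (.closed hS' s) (by simp) hM.wf.2⟩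
    · intro l V hl
      by_cases hla : l = a
      · subst hla; simp at hl; exact hl ▸ hv
      · rw [Function.update_of_ne hla] at hl; exact hh.value l V hl
    · intro l V T hl hT
      by_cases hla : l = a
      · subst hla; simp at hl hT; subst hl hT; exact .inl ⟨hM.wf.2, hM.store hsub hS'⟩
      · rw [Function.update_of_ne hla] at hl hT; exact (hh.typed l V T hl hT).store hsub hS'
  | @deref l V h hl =>
    intro s S T hh hM
    cases hM with
    | deref hM => cases hM with
      | loc hc hT hw =>
        refine ⟨S, .refl S, hh, ?_⟩
        -- A stored value whose type is not of layer `s` cannot be read: typing the location at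
        -- layer `s` requires the type of its content to be of layer `s`.
        rcases hh.typed _ _ _ hl hT with h | h
        · exact h.2
        · exact (h.1 hw).elim
  | @assign l V h hv hl =>
    intro s S T hh hM
    cases hM with
    | assign h1 h2 => cases h1 with
      | loc hc hT hw =>
        refine ⟨S, .refl S, ⟨hh.store, ?_, ?_, ?_⟩, .unit hc⟩
        · rw [domOf_update, Set.insert_eq_of_mem (show _ ∈ domOf _ from hl), hh.dom]
        · intro m V hm
          by_cases hla : m = l
          · subst hla; simp at hm; exact hm ▸ hv
          · rw [Function.update_of_ne hla] at hm; exact hh.value m V hm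
        · intro m V T hm hT'
          by_cases hla : m = l
          · subst hla; simp at hm; subst hm
            rw [hT] at hT'; cases hT'; exact .inl ⟨hw, h2⟩
          · rw [Function.update_of_ne hla] at hm; exact hh.typed m V T hm hT'
  | letbox =>
    intro s S T hh hM
    cases hM with
    | letbox h1 h2 => cases h1 with
      | box _ _ h1 => exact ⟨S, .refl S, hh, h2.gbeta h1⟩
  | letboxName =>
    intro s S T hh hM
    cases hM with
    | letbox h1 h2 => cases h1 with
      | bname _ hb => exact ⟨S, .refl S, hh, h2.gbeta (.unbox hh.store .nil (by simp) hb)⟩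
  | app1 _ ih =>
    intro s S T hh hM
    cases hM with
    | app h1 h2 =>
      obtain ⟨S', hS, hh', h⟩ := ih hh h1; exact ⟨S', hS, hh', .app h (h2.store hS hh'.store)⟩
  | app2 _ _ ih =>
    intro s S T hh hM
    cases hM with
    | app h1 h2 =>
      obtain ⟨S', hS, hh', h⟩ := ih hh h2; exact ⟨S', hS, hh', .app (h1.store hS hh'.store) h⟩
  | arith1 _ ih =>
    intro s S T hh hM
    cases hM with
    | arith h1 h2 =>
      obtain ⟨S', hS, hh', h⟩ := ih hh h1; exact ⟨S', hS, hh', .arith h (h2.store hS hh'.store)⟩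
  | arith2 _ _ ih =>
    intro s S T hh hM
    cases hM with
    | arith h1 h2 =>
      obtain ⟨S', hS, hh', h⟩ := ih hh h2; exact ⟨S', hS, hh', .arith (h1.store hS hh'.store) h⟩
  | ite1 _ ih =>
    intro s S T hh hM
    cases hM with
    | ite h1 h2 h3 =>
      obtain ⟨S', hS, hh', h⟩ := ih hh h1
      exact ⟨S', hS, hh', .ite h (h2.store hS hh'.store) (h3.store hS hh'.store)⟩
  | ref1 _ ih =>
    intro s S T hh hM
    cases hM with
    | ref h1 => obtain ⟨S', hS, hh', h⟩ := ih hh h1; exact ⟨S', hS, hh', .ref h⟩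
  | deref1 _ ih =>
    intro s S T hh hM
    cases hM with
    | deref h1 => obtain ⟨S', hS, hh', h⟩ := ih hh h1; exact ⟨S', hS, hh', .deref h⟩
  | assign1 _ ih =>
    intro s S T hh hM
    cases hM with
    | assign h1 h2 =>
      obtain ⟨S', hS, hh', h⟩ := ih hh h1; exact ⟨S', hS, hh', .assign h (h2.store hS hh'.store)⟩
  | assign2 _ _ ih =>
    intro s S T hh hM
    cases hM with
    | assign h1 h2 =>
      obtain ⟨S', hS, hh', h⟩ := ih hh h2; exact ⟨S', hS, hh', .assign (h1.store hS hh'.store) h⟩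
  | letbox1 _ ih =>
    intro s S T hh hM
    cases hM with
    | letbox h1 h2 =>
      obtain ⟨S', hS, hh', h⟩ := ih hh h1; exact ⟨S', hS, hh', .letbox h (h2.store hS hh'.store)⟩

/-! ## Progress -/

/-- Progress, up to terms that use a name in evaluation position. -/
def Prog (a : Loc) (h : Heap) (M : Tm) : Prop :=
  M.IsValue ∨ (∃ M' h', St a M h M' h') ∨
  (∃ (K : Cx) (f : FName) (V : Tm), K.IsEval ∧ V.IsValue ∧ M = K.plug (.app (.fname f) V)) ∨
  ∃ (K : Cx) (b : BName) (d : LSub), K.IsEval ∧ M = K.plug (.unb b d)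

theorem Prog.plug {a h M} (p : Prog a h M) {F : Cx} (hF : F.IsEval)
    (hv : M.IsValue → Prog a h (F.plug M)) : Prog a h (F.plug M) := by
  rcases p with p | ⟨M', h', s⟩ | ⟨K, f, V, hK, hV, rfl⟩ | ⟨K, b, d, hK, rfl⟩
  · exact hv p
  · exact .inr (.inl ⟨_, _, s.plug hF⟩)
  · exact .inr (.inr (.inl ⟨F.comp K, f, V, hF.comp hK, hV, (Cx.plug_comp hF _ _).symm⟩))
  · exact .inr (.inr (.inr ⟨F.comp K, b, d, hF.comp hK, (Cx.plug_comp hF _ _).symm⟩))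

theorem HasTy.arr_cases {S i V T₁ T₂} (h : ClTyped S i V (.arr T₁ T₂)) (hv : V.IsValue) :
    (∃ M, V = .lam M) ∨ (∃ M, V = .recf M) ∨ ∃ f, V = .fname f := by
  generalize hU : Ty.arr T₁ T₂ = U at h
  cases h <;> simp_all [Tm.IsValue]

theorem HasTy.int_cases {S i V} (h : ClTyped S i V .int) (hv : V.IsValue) :
    ∃ n, V = .int n := by
  generalize hU : Ty.int = U at h
  cases h <;> simp_all [Tm.IsValue]

theorem HasTy.unit_cases {S i V} (h : ClTyped S i V .unit) (hv : V.IsValue) : V = .unit := by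
  generalize hU : Ty.unit = U at h
  cases h <;> simp_all [Tm.IsValue]

theorem HasTy.ref_cases {S i V T} (h : ClTyped S i V (.ref T)) (hv : V.IsValue) :
    ∃ l, V = .loc l ∧ S l = some T := by
  generalize hU : Ty.ref T = U at h
  cases h <;> simp_all [Tm.IsValue]

theorem HasTy.box_cases {S i V G T} (h : ClTyped S i V (.box G T)) (hv : V.IsValue) :
    i = 1 ∧ ((∃ M, V = .box M) ∨ ∃ b, V = .bname b) := by
  generalize hU : Ty.box G T = U at h
  cases h <;> simp_all [Tm.IsValue]

theorem HasTy.prog {S : SCtx} {h : Heap} {a : Loc} (hd : domOf S ⊆ domOf h) (ha : h a = none)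
    (M : Tm) : ∀ {i T}, ClTyped S i M T → Prog a h M := by
  induction M using Tm.rec (motive_2 := fun _ => True)
  case app M N ih1 ih2 =>
    intro i T hM
    cases hM with
    | app h1 h2 =>
    refine (ih1 h1).plug (F := .appL .hole N) trivial fun hv => ?_
    refine (ih2 h2).plug (F := .appR M .hole) ⟨hv, trivial⟩ fun hv' => ?_
    rcases h1.arr_cases hv with ⟨M, rfl⟩ | ⟨M, rfl⟩ | ⟨f, rfl⟩
    · exact .inr (.inl ⟨_, _, .beta hv'⟩)
    · exact .inr (.inl ⟨_, _, .recf hv'⟩)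
    · exact .inr (.inr (.inl ⟨.hole, f, N, trivial, hv', rfl⟩))
  case arith o M N ih1 ih2 =>
    intro i T hM
    cases hM with
    | arith h1 h2 =>
    refine (ih1 h1).plug (F := .arithL o .hole N) trivial fun hv => ?_
    refine (ih2 h2).plug (F := .arithR o M .hole) ⟨hv, trivial⟩ fun hv' => ?_
    obtain ⟨m, rfl⟩ := h1.int_cases hv
    obtain ⟨n, rfl⟩ := h2.int_cases hv'
    exact .inr (.inl ⟨_, _, .arith⟩)
  case ite M N N' ih1 _ _ =>
    intro i T hM
    cases hM with
    | ite h1 h2 h3 =>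
    refine (ih1 h1).plug (F := .iteC .hole N N') trivial fun hv => ?_
    obtain ⟨m, rfl⟩ := h1.int_cases hv
    by_cases hm : m = 0
    · subst hm; exact .inr (.inl ⟨_, _, .iteFalse⟩)
    · exact .inr (.inl ⟨_, _, .iteTrue hm⟩)
  case ref M ih =>
    intro i T hM
    cases hM with
    | ref h1 =>
    exact (ih h1).plug (F := .ref .hole) trivial fun hv => .inr (.inl ⟨_, _, .ref hv ha⟩)
  case deref M ih =>
    intro i T hM
    cases hM with
    | deref h1 =>
    refine (ih h1).plug (F := .deref .hole) trivial fun hv => ?_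
    obtain ⟨l, rfl, hl⟩ := h1.ref_cases hv
    obtain ⟨V, hV⟩ := mem_domOf.1 (hd (mem_domOf.2 ⟨_, hl⟩))
    exact .inr (.inl ⟨_, _, .deref hV⟩)
  case assign M N ih1 ih2 =>
    intro i T hM
    cases hM with
    | assign h1 h2 =>
    refine (ih1 h1).plug (F := .assignL .hole N) trivial fun hv => ?_
    refine (ih2 h2).plug (F := .assignR M .hole) ⟨hv, trivial⟩ fun hv' => ?_
    obtain ⟨l, rfl, hl⟩ := h1.ref_cases hv
    exact .inr (.inl ⟨_, _, .assign hv' (hd (mem_domOf.2 ⟨_, hl⟩))⟩)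
  case letbox M N ih1 _ =>
    intro i T hM
    cases hM with
    | letbox h1 h2 =>
    refine (ih1 h1).plug (F := .letboxL .hole N) trivial fun hv => ?_
    rcases (h1.box_cases hv).2 with ⟨M, rfl⟩ | ⟨b, rfl⟩
    · exact .inr (.inl ⟨_, _, .letbox⟩)
    · exact .inr (.inl ⟨_, _, .letboxName⟩)
  case gvar v d _ =>
    intro i T hM
    cases hM with
    | gvarB _ h => simp at h
    | gvarF _ h => simp at h
  case unb b d _ => exact fun _ => .inr (.inr (.inr ⟨.hole, b, d, trivial, rfl⟩))
  case nil => trivial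
  case cons => trivial
  all_goals exact fun _ => .inl trivial

theorem HasTy.unboxed {S i V G T} (h : ClTyped S i V (.box G T)) (hv : V.IsValue) :
    HasTy S [] [] G [] 0 V.unboxed T := by
  rcases (h.box_cases hv).2 with ⟨M, rfl⟩ | ⟨b, rfl⟩
  · cases h with
    | box _ _ h => exact h
  · cases h with
    | bname hc hb => exact .unbox hc.store .nil (by simp) hb

-- Composition of two sides without types.

/-! ## Name assignments -/

def Name.toTm : Name → Tm
  | .fn f => .fname f
  | .bx b => .bname b

def Name.ty : Name → Ty
  | .fn f => .arr f.dom f.cod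
  | .bx b => .box b.ctx b.ty

/-- Functional assignments of closed values to names. -/
structure BindOK (B : Set (Name × Tm)) : Prop where
  func : ∀ n V V', (n, V) ∈ B → (n, V') ∈ B → V = V'
  typed : ∀ n V, (n, V) ∈ B → V.IsValue ∧ ∃ S j, ClTyped S j V n.ty

/-- The names that are assigned. -/
def bnd (γ : Set (Name × Tm)) : Set Name := {n | ∃ V, (n, V) ∈ γ}

/-- The values assigned by `B` are resolved in the old environment `w`, so there is no recursion to
be solved; when the new names do not occur in these values, old and new resolution agree on them.
The renaming `r` is left free, because two composed sides share the interpretation of names but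
rename their locations differently. -/
theorem Env.exists_bind {w : Env} (hw : w.Ok) {B : Set (Name × Tm)} (hB : BindOK B) :
    ∃ f' b', (∀ r, (Env.mk r f' b').Ok) ∧ (∀ f, Name.fn f ∉ bnd B → f' f = w.f f) ∧
      (∀ b, Name.bx b ∉ bnd B → b' b = w.b b) ∧
      ∀ r n V, (n, V) ∈ B → n.toTm.res ⟨r, f', b'⟩ = V.res w := by
  classical
  let f' : FName → Tm := fun f =>
    if h : ∃ V, (Name.fn f, V) ∈ B then (Classical.choose h).res w else w.f f
  let b' : BName → Tm := fun b =>
    if h : ∃ V, (Name.bx b, V) ∈ B then (Classical.choose h).unboxed.res w else w.b b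
  have hf : ∀ f V, (Name.fn f, V) ∈ B → f' f = V.res w := by
    intro f V h
    have hx : ∃ V, (Name.fn f, V) ∈ B := ⟨V, h⟩
    simp only [f', dif_pos hx]
    rw [hB.func _ _ _ (Classical.choose_spec hx) h]
  have hb : ∀ b V, (Name.bx b, V) ∈ B → b' b = V.unboxed.res w := by
    intro b V h
    have hx : ∃ V, (Name.bx b, V) ∈ B := ⟨V, h⟩
    simp only [b', dif_pos hx]
    rw [hB.func _ _ _ (Classical.choose_spec hx) h]
  have hf' : ∀ f, Name.fn f ∉ bnd B → f' f = w.f f := fun f h => dif_neg h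
  have hb' : ∀ b, Name.bx b ∉ bnd B → b' b = w.b b := fun b h => dif_neg h
  refine ⟨f', b', fun r => ⟨fun f => ?_, fun f => ?_, fun b => ?_⟩, hf', hb', ?_⟩
  · by_cases h : Name.fn f ∈ bnd B
    · obtain ⟨V, h⟩ := h
      change (f' f).IsValue; rw [hf f V h]; exact (hB.typed _ _ h).1.res hw
    · change (f' f).IsValue; rw [hf' f h]; exact hw.fval f
  · by_cases h : Name.fn f ∈ bnd B
    · obtain ⟨V, h⟩ := h
      obtain ⟨S, j, ht⟩ := (hB.typed _ _ h).2
      change (f' f).Closed; rw [hf f V h]; exact Tm.Sc.res hw _ ht.closed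
    · change (f' f).Closed; rw [hf' f h]; exact hw.fcl f
  · by_cases h : Name.bx b ∈ bnd B
    · obtain ⟨V, h⟩ := h
      obtain ⟨hv, S, j, ht⟩ := hB.typed _ _ h
      obtain ⟨rfl, -⟩ := ht.box_cases hv
      change (b' b).Code _; rw [hb b V h]; exact Tm.Sc.res hw _ (HasTy.unboxed ht hv).code
    · change (b' b).Code _; rw [hb' b h]; exact hw.bcl b
  · rintro r (f | b) V h
    · exact hf f V h
    · obtain ⟨hv, S, j, ht⟩ := hB.typed _ _ h
      simp only [Name.toTm, Tm.res, hb b V h]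
      rcases (ht.box_cases hv).2 with ⟨M, rfl⟩ | ⟨c, rfl⟩
      · rfl
      · simp only [Tm.unboxed, Tm.res]; rw [BName.unbox_res hw]

/-- `A` abstracts `V`, relative to an assignment `B` and locations `L`. -/
def Abst (B : Set (Name × Tm)) (L : Set Loc) (V : Tm) : Abs → Prop
  | .unit => V = .unit
  | .int n => V = .int n
  | .loc l => V = .loc l ∧ l ∈ L
  | .fn f => (.fn f, V) ∈ B
  | .bx b => (.bx b, V) ∈ B

/-! ## Occurrences in the parts of a configuration -/

/-- The names that occur in heap, name assignment and stack are in `N`, all names are in `φ`, and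
all locations are in the domain of the heap. -/
structure Supp (N φ : Set Name) (h : Heap) (γ : Set (Name × Tm)) (ξ : List Cx) : Prop where
  sub : N ⊆ φ
  heap : HeapIn N (domOf h) h
  bind : ∀ n V, (n, V) ∈ γ → n ∈ φ ∧ V.IsValue ∧ V.In N (domOf h) 0
  box : ∀ b V, (.bx b, V) ∈ γ → (∃ M, V = .box M) ∨ ∃ c, V = .bname c
  frames : ∀ K ∈ ξ, K.IsEval ∧ K.In N (domOf h)

theorem Supp.mono {N N' φ h γ ξ} (hs : Supp N φ h γ ξ) (hN : N ⊆ N') (hφ : N' ⊆ φ) :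
    Supp N' φ h γ ξ :=
  ⟨hφ, hs.heap.mono hN subset_rfl,
    fun n V hV => ⟨(hs.bind n V hV).1, (hs.bind n V hV).2.1,
      Tm.In.mono _ hN subset_rfl le_rfl (hs.bind n V hV).2.2⟩, hs.box,
    fun K hK => ⟨(hs.frames K hK).1, (hs.frames K hK).2.mono hN subset_rfl⟩⟩

theorem Supp.st {N φ h γ ξ a M M' h'} (hs : Supp N φ h γ ξ) (hM : M.In N (domOf h) 0)
    (s : St a M h M' h') : Supp N φ h' γ ξ :=
  ⟨hs.sub, (s.in hM hs.heap).2,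
    fun n V hV => ⟨(hs.bind n V hV).1, (hs.bind n V hV).2.1,
      Tm.In.mono _ subset_rfl s.dom.1 le_rfl (hs.bind n V hV).2.2⟩, hs.box,
    fun K hK => ⟨(hs.frames K hK).1, (hs.frames K hK).2.mono subset_rfl s.dom.1⟩⟩

/-- A part of a configuration becomes known to the other side: the locations in the domain of `χ`,
and the values that are assigned to names by `B`. -/
structure Reveal (N φ : Set Name) (θ : Set Loc) (h : Heap) (B : Set (Name × Tm)) (χ : AHeap)
    (nm : Set Name) : Prop where
  bind : BindOK B
  fresh : ∀ n V, (n, V) ∈ B → n ∉ φ ∧ n ∈ nm ∧ V.In N (domOf h) 0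
  heap : ∀ l A, χ l = some A → ∃ V, h l = some V ∧ Abst B (domOf χ) V A
  sub : θ ⊆ domOf χ

theorem Reveal.dom {N φ θ h B χ nm} (hr : Reveal N φ θ h B χ nm) : domOf χ ⊆ domOf h := by
  intro l hl
  obtain ⟨A, hA⟩ := mem_domOf.1 hl
  obtain ⟨V, hV, -⟩ := hr.heap l A hA
  exact mem_domOf.2 ⟨V, hV⟩

theorem Supp.reveal {N φ θ h γ ξ B χ nm} (hs : Supp N φ h γ ξ) (hr : Reveal N φ θ h B χ nm) :
    Supp N (φ ∪ nm) h (γ ∪ B) ξ := by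
  refine ⟨fun n hn => .inl (hs.sub hn), hs.heap, ?_, ?_, hs.frames⟩
  · rintro n V (h | h)
    · exact ⟨.inl (hs.bind n V h).1, (hs.bind n V h).2⟩
    · exact ⟨.inr (hr.fresh n V h).2.1, (hr.bind.typed n V h).1, (hr.fresh n V h).2.2⟩
  · rintro b V (h | h)
    · exact hs.box b V h
    · obtain ⟨hv, S, j, ht⟩ := hr.bind.typed _ _ h
      exact (HasTy.box_cases ht hv).2

theorem Abst.in {B L V A N L'} (h : Abst B L V A) (hN : A.names ⊆ N) (hL : L ⊆ L') :
    A.toTm.In N L' 0 := by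
  cases A with
  | unit => trivial
  | int => trivial
  | loc l => exact hL h.2
  | fn f => exact hN rfl
  | bx b => exact hN rfl

theorem pUnion_toTms {χ : AHeap} {h : Heap} {l V} (hl : pUnion (toTms χ) h l = some V) :
    (∃ A, χ l = some A ∧ V = A.toTm) ∨ (χ l = none ∧ h l = some V) := by
  rcases hA : χ l with _ | A
  · simp only [pUnion, toTms, hA, Option.map_none] at hl; exact .inr ⟨rfl, hl⟩
  · simp only [pUnion, toTms, hA, Option.map_some, Option.some.injEq] at hl
    exact .inl ⟨A, rfl, hl.symm⟩

theorem domOf_toTms {α : Type} (χ : α → Option Abs) : domOf (toTms χ) = domOf χ := by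
  ext a; simp [domOf, toTms]

theorem domOf_pUnion {α β : Type} (f g : α → Option β) :
    domOf (pUnion f g) = domOf f ∪ domOf g := by
  ext a; rcases hf : f a with _ | b <;> simp [domOf, pUnion, hf]

theorem Supp.receive {N N' φ φ' θ h h' γ ξ B χ nm} (hs : Supp N φ h γ ξ)
    (hr : Reveal N' φ' θ h' B χ nm) (hn : namesOf χ ⊆ nm) :
    Supp (N ∪ nm) (φ ∪ nm) (pUnion (toTms χ) h) γ ξ := by
  have hd : domOf h ⊆ domOf (pUnion (toTms χ) h) := by
    rw [domOf_pUnion]; exact Set.subset_union_right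
  have hd' : domOf χ ⊆ domOf (pUnion (toTms χ) h) := by
    rw [domOf_pUnion, domOf_toTms]; exact Set.subset_union_left
  refine ⟨Set.union_subset_union_left _ hs.sub, fun l V hl => ?_, fun n V hV => ?_, hs.box,
    fun K hK => ⟨(hs.frames K hK).1, (hs.frames K hK).2.mono Set.subset_union_left hd⟩⟩
  · rcases pUnion_toTms hl with ⟨A, hA, rfl⟩ | ⟨-, hl⟩
    · obtain ⟨V, -, hV⟩ := hr.heap l A hA
      exact hV.in (fun n h => .inr (hn ⟨l, A, hA, h⟩)) hd'
    · exact Tm.In.mono _ Set.subset_union_left hd le_rfl (hs.heap l V hl)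
  · exact ⟨.inl (hs.bind n V hV).1, (hs.bind n V hV).2.1,
      Tm.In.mono _ Set.subset_union_left hd le_rfl (hs.bind n V hV).2.2⟩

/-! ## Composition of heaps and name assignments -/

/-- The heaps of two sides, which share the locations `θ`, are contained in a single heap `H`, and
all names are interpreted by the values that the sides assign to them. -/
structure Comp (wX wY : Env) (θ : Set Loc) (hX : Heap) (γX : Set (Name × Tm)) (hY : Heap)
    (γY : Set (Name × Tm)) (H : Heap) : Prop where
  f : wX.f = wY.f
  b : wX.b = wY.b
  ok : wX.Ok
  heapX : HRel wX hX H
  -- Shared locations are exempt: the copy of their content on the passive side may be out of date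
  -- until the next move replaces it.
  heapY : ∀ l V, hY l = some V → l ∉ θ → H (wY.r l) = some (V.res wY)
  injX : Set.InjOn wX.r (domOf hX)
  injY : Set.InjOn wY.r (domOf hY)
  shared : ∀ l ∈ θ, wX.r l = wY.r l
  sep : ∀ l ∈ domOf hX, ∀ l' ∈ domOf hY, wX.r l = wY.r l' → l = l' ∧ l ∈ θ
  subX : θ ⊆ domOf hX
  subY : θ ⊆ domOf hY
  fin : (domOf H).Finite
  bindX : ∀ n V, (n, V) ∈ γX → n.toTm.res wX = V.res wX
  bindY : ∀ n V, (n, V) ∈ γY → n.toTm.res wY = V.res wY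

theorem Name.res_congr {w w' : Env} {φ : Set Name} {L : Set Loc} (h : w.Agree w' φ L) {n : Name}
    (hn : n ∈ φ) : n.toTm.res w = n.toTm.res w' := by
  cases n with
  | fn f => exact h.f f hn
  | bx b => simp only [Name.toTm, Tm.res, h.b b hn]

theorem Comp.okY {wX wY θ hX γX hY γY H} (c : Comp wX wY θ hX γX hY γY H) : wY.Ok :=
  ⟨c.f ▸ c.ok.fval, c.f ▸ c.ok.fcl, c.b ▸ c.ok.bcl⟩

/-- The location `a` allocated by the active side is sent to whichever fresh `a'` the common heap
uses; nothing else is reinterpreted. By `St.res` the cells outside the image of the active heap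
stay, and by `sep` the private cells of the passive side are among them. -/
theorem Comp.st {wX wY θ hX γX hY γY H NX φ ξX} (c : Comp wX wY θ hX γX hY γY H)
    (sX : Supp NX φ hX γX ξX) {a a' M M' h'}
    (hM : M.In NX (domOf hX) 0) (s : St a M hX M' h') (ha : hX a = none) (ha' : H a' = none) :
    ∃ wX' H', St a' (M.res wX) H (M'.res wX') H' ∧ Comp wX' wY θ h' γX hY γY H' ∧
      ∀ φ, wX.Agree wX' φ (domOf hX) := by
  let w' : Env := ⟨Function.update wX.r a a', wX.f, wX.b⟩
  have hne : ∀ l ∈ domOf hX, l ≠ a := by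
    rintro l hl rfl
    obtain ⟨V, hV⟩ := mem_domOf.1 hl
    rw [ha] at hV; cases hV
  have hr : ∀ l ∈ domOf hX, w'.r l = wX.r l := fun l hl => Function.update_of_ne (hne l hl) _ _
  have hra : w'.r a = a' := Function.update_self _ _ _
  have ag : ∀ φ, wX.Agree w' φ (domOf hX) :=
    fun φ => ⟨fun l hl => (hr l hl).symm, fun _ _ => rfl, fun _ _ => rfl⟩
  have hw' : w'.Ok := ⟨c.ok.fval, c.ok.fcl, c.ok.bcl⟩
  have hne' : ∀ l ∈ domOf hX, wX.r l ≠ a' := by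
    rintro l hl rfl
    obtain ⟨V, hV⟩ := mem_domOf.1 hl
    rw [c.heapX l V hV] at ha'; cases ha'
  have hnY : ∀ l ∈ domOf hY, wY.r l ≠ a' := by
    intro l hl e
    by_cases hθ : l ∈ θ
    · exact hne' l (c.subX hθ) ((c.shared l hθ).trans e)
    · obtain ⟨V, hV⟩ := mem_domOf.1 hl
      rw [← e, c.heapY l V hV hθ] at ha'; cases ha'
  have hrel : HRel w' hX H := by
    intro l V hl
    have hl' : l ∈ domOf hX := mem_domOf.2 ⟨V, hl⟩
    rw [hr l hl', c.heapX l V hl, Tm.res_congr (ag _) V (sX.heap l V hl)]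
  have hinj : Set.InjOn w'.r (domOf hX) := fun l hl m hm e => by
    rw [hr l hl, hr m hm] at e; exact c.injX hl hm e
  obtain ⟨H', s', hrel', hfr⟩ := s.res hw' hM hrel hinj (by rw [hra]; exact ha')
  rw [hra, ← Tm.res_congr (ag _) M hM] at s'
  have hdom : ∀ l ∈ domOf h', l = a ∨ l ∈ domOf hX := fun l hl => s.dom.2 hl
  refine ⟨w', H', s', ⟨c.f, c.b, hw', hrel', ?_, ?_, c.injY, ?_, ?_, c.subX.trans s.dom.1, c.subY,
    s'.finite c.fin, ?_, c.bindY⟩, ag⟩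
  · intro l V hl hθ
    have hlY : l ∈ domOf hY := mem_domOf.2 ⟨V, hl⟩
    rw [hfr, c.heapY l V hl hθ]
    intro m hm e
    rcases hdom m hm with rfl | hm
    · rw [hra] at e; exact hnY l hlY e.symm
    · rw [hr m hm] at e
      obtain ⟨rfl, h⟩ := c.sep m hm l hlY e
      exact hθ h
  · intro l hl m hm e
    rcases hdom l hl with rfl | hl <;> rcases hdom m hm with rfl | hm
    · rfl
    · rw [hra, hr m hm] at e; exact (hne' m hm e.symm).elim
    · rw [hra, hr l hl] at e; exact (hne' l hl e).elim
    · exact hinj hl hm e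
  · intro l hl
    rw [hr l (c.subX hl), c.shared l hl]
  · intro l hl m hm e
    rcases hdom l hl with rfl | hl
    · rw [hra] at e; exact (hnY m hm e.symm).elim
    · rw [hr l hl] at e; exact c.sep l hl m hm e
  · intro n V hV
    rw [← Name.res_congr (ag φ) (sX.bind n V hV).1, c.bindX n V hV]
    exact Tm.res_congr (ag _) V (sX.bind n V hV).2.2

/-- The common heap `H` is the same before and after the sides swap roles. New names are interpreted
by the values that they abstract, and the receiver sends revealed locations to where the sender has
them. Freshness of the names and `hχ` make this an extension: nothing that a side already knew
changes its meaning, as the two `Env.Agree` conclusions say. -/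
theorem Comp.exchange {wX wY θ hX γX hY γY H NX NY φ ξX ξY} (c : Comp wX wY θ hX γX hY γY H)
    (sX : Supp NX φ hX γX ξX) (sY : Supp NY φ hY γY ξY) {B χ nm}
    (hr : Reveal NX φ θ hX B χ nm) (hχ : domOf χ ∩ domOf hY = θ) :
    ∃ wX' wY', Comp wY' wX' (domOf χ) (pUnion (toTms χ) hY) γY hX (γX ∪ B) H ∧
      wX.Agree wX' φ (domOf hX) ∧ wY.Agree wY' φ (domOf hY) ∧
      ∀ V A, V.In NX (domOf hX) 0 → Abst B (domOf χ) V A → A.toTm.res wY' = V.res wX' := by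
  classical
  obtain ⟨f', b', hok, hf, hb, hB⟩ := Env.exists_bind c.ok hr.bind
  let wX' : Env := ⟨wX.r, f', b'⟩
  let wY' : Env := ⟨fun l => if l ∈ domOf χ then wX.r l else wY.r l, f', b'⟩
  have hφ : ∀ n ∈ φ, n ∉ bnd B := by
    rintro n hn ⟨V, hV⟩
    exact (hr.fresh n V hV).1 hn
  have agX : wX.Agree wX' φ (domOf hX) :=
    ⟨fun _ _ => rfl, fun f h => (hf f (hφ _ h)).symm, fun b h => (hb b (hφ _ h)).symm⟩
  have hrχ : ∀ l ∈ domOf χ, wY'.r l = wX.r l := fun l hl => if_pos hl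
  have hrY : ∀ l ∈ domOf hY, wY'.r l = wY.r l := by
    intro l hl
    by_cases h : l ∈ domOf χ
    · rw [hrχ l h, c.shared l (hχ ▸ ⟨h, hl⟩)]
    · exact if_neg h
  have agY : wY.Agree wY' φ (domOf hY) := by
    refine ⟨fun l hl => (hrY l hl).symm, fun f h => ?_, fun b h => ?_⟩
    · rw [← c.f]; exact agX.f f h
    · rw [← c.b]; exact agX.b b h
  have key : ∀ V A, V.In NX (domOf hX) 0 → Abst B (domOf χ) V A →
      A.toTm.res wY' = V.res wX' := by
    intro V A hV hA
    have hV' := Tm.res_congr agX V (Tm.In.mono _ sX.sub subset_rfl le_rfl hV)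
    cases A with
    | unit => cases hA; rfl
    | int n => cases hA; rfl
    | loc l => obtain ⟨rfl, hl⟩ := hA; simp only [Abs.toTm, Tm.res, hrχ l hl]; rfl
    | fn f => rw [← hV']; exact hB _ _ _ hA
    | bx b => rw [← hV']; exact hB _ _ _ hA
  have dom : ∀ l ∈ domOf (pUnion (toTms χ) hY), l ∈ domOf χ ∨ l ∈ domOf hY ∧ l ∉ domOf χ := by
    intro l hl
    rw [domOf_pUnion, domOf_toTms] at hl
    by_cases h : l ∈ domOf χ
    · exact .inl h
    · exact .inr ⟨hl.resolve_left h, h⟩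
  have hnθ : ∀ l, l ∉ domOf χ → l ∉ θ := fun l h h' => h (hr.sub h')
  refine ⟨wX', wY', ⟨rfl, rfl, hok _, ?_, ?_, ?_, c.injX, hrχ, ?_, ?_, hr.dom, c.fin, ?_, ?_⟩,
    agX, agY, key⟩
  · intro l V hl
    rcases pUnion_toTms hl with ⟨A, hA, rfl⟩ | ⟨hn, hl⟩
    · obtain ⟨V, hV, hab⟩ := hr.heap l A hA
      rw [hrχ l (mem_domOf.2 ⟨A, hA⟩), key V A (sX.heap l V hV) hab, c.heapX l V hV,
        Tm.res_congr agX V (Tm.In.mono _ sX.sub subset_rfl le_rfl (sX.heap l V hV))]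
    · have hn' : l ∉ domOf χ := by simp [domOf, hn]
      rw [hrY l (mem_domOf.2 ⟨V, hl⟩), c.heapY l V hl (hnθ l hn'),
        Tm.res_congr agY V (Tm.In.mono _ sY.sub subset_rfl le_rfl (sY.heap l V hl))]
  · intro l V hl hn
    rw [← Tm.res_congr agX V (Tm.In.mono _ sX.sub subset_rfl le_rfl (sX.heap l V hl))]
    exact c.heapX l V hl
  · intro l hl m hm e
    rcases dom l hl with hl | ⟨hl, hl'⟩ <;> rcases dom m hm with hm | ⟨hm, hm'⟩
    · rw [hrχ l hl, hrχ m hm] at e; exact c.injX (hr.dom hl) (hr.dom hm) e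
    · rw [hrχ l hl, hrY m hm] at e; exact (c.sep l (hr.dom hl) m hm e).1
    · rw [hrY l hl, hrχ m hm] at e; exact (c.sep m (hr.dom hm) l hl e.symm).1.symm
    · rw [hrY l hl, hrY m hm] at e; exact c.injY hl hm e
  · intro l hl m hm e
    rcases dom l hl with hl | ⟨hl, hl'⟩
    · rw [hrχ l hl] at e; exact ⟨c.injX (hr.dom hl) hm e, hl⟩
    · rw [hrY l hl] at e
      obtain ⟨rfl, h⟩ := c.sep m hm l hl e.symm
      exact (hnθ _ hl' h).elim
  · rw [domOf_pUnion, domOf_toTms]; exact Set.subset_union_left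
  · intro n V hV
    rw [← Name.res_congr agY (sY.bind n V hV).1, c.bindY n V hV]
    exact Tm.res_congr agY V (Tm.In.mono _ sY.sub subset_rfl le_rfl (sY.bind n V hV).2.2)
  · rintro n V (hV | hV)
    · rw [← Name.res_congr agX (sX.bind n V hV).1, c.bindX n V hV]
      exact Tm.res_congr agX V (Tm.In.mono _ sX.sub subset_rfl le_rfl (sX.bind n V hV).2.2)
    · rw [hB _ _ _ hV]
      exact Tm.res_congr agX V (Tm.In.mono _ sX.sub subset_rfl le_rfl (hr.fresh n V hV).2.2)

/-! ## Composition of terms and stacks -/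

/-- The term that results if `M` is put in the frames of two stacks alternatingly, beginning with
the first stack. -/
def wrap : List Cx → List Cx → Tm → Tm
  | [], _, M => M
  | K :: ks, es, M => wrap es ks (K.plug M)
termination_by ks es => ks.length + es.length
decreasing_by simp; omega

theorem wrap_nil (es : List Cx) (M : Tm) : wrap [] es M = M := by rw [wrap]

theorem wrap_cons (K : Cx) (ks es : List Cx) (M : Tm) :
    wrap (K :: ks) es M = wrap es ks (K.plug M) := by rw [wrap]

theorem St.wrap {a M H M' H'} (s : St a M H M' H') {ks es : List Cx}
    (hk : ∀ K ∈ ks, K.IsEval) (he : ∀ K ∈ es, K.IsEval) :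
    St a (LMML.wrap ks es M) H (LMML.wrap ks es M') H' := by
  induction hn : ks.length + es.length using Nat.strong_induction_on generalizing ks es M M' with
  | _ n ih =>
    cases ks with
    | nil => simpa [wrap_nil] using s
    | cons K ks =>
      rw [wrap_cons, wrap_cons]
      exact ih (es.length + ks.length) (by simp at hn; omega)
        (s.plug (hk K List.mem_cons_self)) he (fun K h => hk K (List.mem_cons_of_mem _ h)) rfl

/-- `(Q, H)` is the composition of an active side with term `M` and a passive side. -/
structure Game (NX NY φ : Set Name) (θ : Set Loc) (M : Tm) (hX : Heap) (γX : Set (Name × Tm))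
    (ξX : List Cx) (hY : Heap) (γY : Set (Name × Tm)) (ξY : List Cx) (Q : Tm) (H : Heap) :
    Prop where
  term : M.In NX (domOf hX) 0
  suppX : Supp NX φ hX γX ξX
  suppY : Supp NY φ hY γY ξY
  comp : ∃ wX wY, Comp wX wY θ hX γX hY γY H ∧
    Q = wrap (ξY.map (Cx.res wY)) (ξX.map (Cx.res wX)) (M.res wX)

theorem Supp.map_congr {N φ h γ ξ w w'} (hs : Supp N φ h γ ξ) (ag : w.Agree w' φ (domOf h)) :
    ξ.map (Cx.res w) = ξ.map (Cx.res w') :=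
  List.map_congr_left fun K hK => Cx.res_congr ag (hs.frames K hK).1
    ((hs.frames K hK).2.mono hs.sub subset_rfl)

theorem Supp.map_eval {N φ h γ ξ w} (hs : Supp N φ h γ ξ) (hw : w.Ok) :
    ∀ K ∈ ξ.map (Cx.res w), K.IsEval := by
  intro K hK
  obtain ⟨K', hK', rfl⟩ := List.mem_map.1 hK
  exact (hs.frames K' hK').1.res hw

theorem Game.mono {NX NY NX' NY' φ θ M hX γX ξX hY γY ξY Q H}
    (g : Game NX NY φ θ M hX γX ξX hY γY ξY Q H) (h1 : NX ⊆ NX') (h2 : NY ⊆ NY') (h3 : NX' ⊆ φ)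
    (h4 : NY' ⊆ φ) : Game NX' NY' φ θ M hX γX ξX hY γY ξY Q H :=
  ⟨Tm.In.mono _ h1 subset_rfl le_rfl g.term, g.suppX.mono h1 h3, g.suppY.mono h2 h4, g.comp⟩

theorem Game.st {NX NY φ θ M hX γX ξX hY γY ξY Q H}
    (g : Game NX NY φ θ M hX γX ξX hY γY ξY Q H) {a a' M' h'} (s : St a M hX M' h')
    (ha : hX a = none) (ha' : H a' = none) :
    ∃ Q' H', St a' Q H Q' H' ∧ Game NX NY φ θ M' h' γX ξX hY γY ξY Q' H' := by
  obtain ⟨wX, wY, c, rfl⟩ := g.comp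
  obtain ⟨wX', H', s', c', ag⟩ := c.st g.suppX g.term s ha ha'
  refine ⟨_, H', s'.wrap (g.suppY.map_eval c.okY) (g.suppX.map_eval c.ok),
    (s.in g.term g.suppX.heap).1, g.suppX.st g.term s, g.suppY, wX', wY, c', ?_⟩
  rw [g.suppX.map_congr (ag _)]

theorem Game.finite {NX NY φ θ M hX γX ξX hY γY ξY Q H}
    (g : Game NX NY φ θ M hX γX ξX hY γY ξY Q H) : (domOf H).Finite := by
  obtain ⟨wX, wY, c, -⟩ := g.comp
  exact c.fin

theorem Game.value {NX NY φ θ M hX γX hY γY ξX Q H}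
    (g : Game NX NY φ θ M hX γX ξX hY γY [] Q H) (hM : M.IsValue) : Q.IsValue := by
  obtain ⟨wX, wY, c, rfl⟩ := g.comp
  simpa [wrap_nil] using hM.res c.ok

/-! ## Moves -/

def Move.names : Move → Set Name
  | .ans A => A.names
  | .call _ A => A.names
  | .run _ ρ => namesOf ρ

/-- The moves of an active side, without types. -/
inductive PMv (N φ : Set Name) (θ : Set Loc) (h : Heap) (χ : AHeap) (B : Set (Name × Tm))
    (ξ : List Cx) : Tm → Move → List Cx → Prop
  | ans {V A} : V.IsValue → V.In N (domOf h) 0 →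
      Abst B (domOf χ) V A → PMv N φ θ h χ B ξ V (.ans A) ξ
  | call {K : Cx} {f V A} : K.IsEval → V.IsValue → Abst B (domOf χ) V A →
      PMv N φ θ h χ B ξ (K.plug (.app (.fname f) V)) (.call f A) (K :: ξ)
  | run {K : Cx} {b d ρ} : K.IsEval → (∀ x ∈ b.ctx.dom, ∃ V A, d.lookup x = some V ∧
      ρ x = some A ∧ Abst B (domOf χ) V A) → (∀ x A, ρ x = some A → x ∈ b.ctx.dom) →
      PMv N φ θ h χ B ξ (K.plug (.unb b d)) (.run b ρ) (K :: ξ)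

/-- The answers of a passive side to moves of the other side, without types. -/
inductive OMv (γ : Set (Name × Tm)) : List Cx → Move → Tm → List Cx → Prop
  | ans {K ξ A} : OMv γ (K :: ξ) (.ans A) (K.plug A.toTm) ξ
  | call {f U A ξ} : (Name.fn f, U) ∈ γ → OMv γ ξ (.call f A) (.app U A.toTm) ξ
  | run {b U ρ ξ} : (Name.bx b, U) ∈ γ → OMv γ ξ (.run b ρ) (U.unboxed.inst (toTms ρ)) ξ

/-- A move only redistributes the composite term. An answer puts the value into the top frame of the
other stack, as `wrap` would have done. A question pushes the context around it and continues with
the value or the code for which the name already stands. No typing of the sides is assumed, so this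
applies to every program that performs the same moves. -/
theorem Game.exchange {NX NY φ θ M hX γX ξX hY γY ξY Q H}
    (g : Game NX NY φ θ M hX γX ξX hY γY ξY Q H) {χ B mv ξX' ξY' M'}
    (hp : PMv NX φ θ hX χ B ξX M mv ξX')
    (hr : Reveal NX φ θ hX B χ (mv.names ∪ namesOf χ)) (ho : OMv γY ξY mv M' ξY')
    (hχ : domOf χ ∩ domOf hY = θ) :
    Game (NY ∪ (mv.names ∪ namesOf χ)) NX (φ ∪ (mv.names ∪ namesOf χ)) (domOf χ) M'
      (pUnion (toTms χ) hY) γY ξY' hX (γX ∪ B) ξX' Q H := by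
  obtain ⟨wX, wY, c, rfl⟩ := g.comp
  obtain ⟨wX', wY', c', agX, agY, key⟩ := c.exchange g.suppX g.suppY hr hχ
  have sX := g.suppX.reveal hr
  have sY := g.suppY.receive hr Set.subset_union_right
  have hd : domOf hY ⊆ domOf (pUnion (toTms χ) hY) := by
    rw [domOf_pUnion]; exact Set.subset_union_right
  have hd' : domOf χ ⊆ domOf (pUnion (toTms χ) hY) := by
    rw [domOf_pUnion, domOf_toTms]; exact Set.subset_union_left
  have eX := g.suppX.map_congr agX
  have eY := g.suppY.map_congr agY
  have eM := Tm.res_congr agX M (Tm.In.mono _ g.suppX.sub subset_rfl le_rfl g.term)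
  rw [eX, eY, eM]
  cases hp with
  | @ans V A hv hV hA =>
    cases ho with
    | @ans K ξ _ =>
    have hK := sY.frames K List.mem_cons_self
    refine ⟨(Cx.in_plug hK.1).2 ⟨hK.2, hA.in (fun n h => .inr (.inl h)) hd'⟩,
      ⟨sY.sub, sY.heap, sY.bind, sY.box, fun K h => sY.frames K (List.mem_cons_of_mem _ h)⟩, sX,
      wY', wX', c', ?_⟩
    rw [List.map_cons, wrap_cons, Cx.res_plug _ hK.1, key _ _ hV hA]
  | @call K f V A hK hv hA =>
    cases ho with
    | @call _ U _ _ hU =>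
    have hM := (Cx.in_plug hK).1 g.term
    have hUs := sY.bind _ _ hU
    refine ⟨⟨hUs.2.2, hA.in (fun n h => .inr (.inl h)) hd'⟩, sY, ⟨sX.sub, sX.heap, sX.bind, sX.box, ?_⟩,
      wY', wX', c', ?_⟩
    · rintro K' (_ | ⟨_, h⟩)
      · exact ⟨hK, hM.1⟩
      · exact sX.frames K' h
    · rw [List.map_cons, wrap_cons, Cx.res_plug _ hK]
      simp only [Tm.res]
      have hf := c'.bindX _ _ hU
      simp only [Name.toTm, Tm.res] at hf
      rw [key V A hM.2.2 hA, ← c'.f, hf]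
  | @run K b d ρ hK hd1 hd2 =>
    cases ho with
    | @run _ U _ _ hU =>
    have hM := (Cx.in_plug hK).1 g.term
    have hUs := sY.bind _ _ hU
    refine ⟨?_, sY, ⟨sX.sub, sX.heap, sX.bind, sX.box, ?_⟩, wY', wX', c', ?_⟩
    · refine Tm.In.inst (Tm.In.unboxed hUs.2.2) le_rfl fun x V hV => ?_
      simp only [toTms, Option.map_eq_some_iff] at hV
      obtain ⟨A, hA, rfl⟩ := hV
      obtain ⟨V, A', -, hA', hab⟩ := hd1 x (hd2 x A hA)
      rw [hA] at hA'; cases hA'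
      exact hab.in (fun n h => .inr (.inl ⟨x, A, hA, h⟩)) hd'
    · rintro K' (_ | ⟨_, h⟩)
      · exact ⟨hK, hM.1⟩
      · exact sX.frames K' h
    · rw [List.map_cons, wrap_cons, Cx.res_plug _ hK]
      congr 2
      have hb := c'.bindX _ _ hU
      simp only [Name.toTm, Tm.res] at hb
      have hU' : U.unboxed.res wY' = wY'.b b := by
        rcases sY.box _ _ hU with ⟨M, rfl⟩ | ⟨b', rfl⟩
        · simpa [Tm.unboxed, Tm.res] using hb.symm
        · simp only [Tm.res, Tm.box.injEq] at hb
          rw [Tm.unboxed, BName.unbox_res c'.ok, hb]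
      rw [Tm.res_inst c'.ok, hU']
      simp only [Tm.res, Tm.inst]
      rw [← c'.b]
      refine Tm.lsub_congr _ (c'.ok.bcl b) (by simp) fun x hx => ?_
      obtain ⟨V, A, hV, hA, hab⟩ := hd1 x hx
      simp only [toTms, LSub.lookup_res, hV, hA, Option.map_some, Option.getD_some]
      exact (key V A (hM.2.2.lookup hV) hab).symm

/-! ## Entrywise abstraction -/

def Name.idx : Name → ℕ
  | .fn f => f.idx
  | .bx b => b.idx

/-- `A` is an abstraction of the closed value `V`, up to layers. -/
structure Entry (V : Tm) (A : Abs) : Prop where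
  value : V.IsValue
  typed : ∀ n ∈ A.names, ∃ S j, ClTyped S j V n.ty
  abst : Abst (A.bind V) A.locs V A

theorem AVal.entry {S i V T A} (h : AVal S i V T A) : Entry V A := by
  cases h with
  | unit => exact ⟨trivial, by simp [Abs.names], rfl⟩
  | int => exact ⟨trivial, by simp [Abs.names], rfl⟩
  | loc => exact ⟨trivial, by simp [Abs.names], rfl, rfl⟩
  | fn hv ht => exact ⟨hv, by rintro n rfl; exact ⟨_, _, ht⟩, rfl, rfl⟩
  | bx hv _ ht => exact ⟨hv, by rintro n rfl; exact ⟨_, _, ht⟩, rfl, rfl⟩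

theorem Abst.mono {B B' L L' V A} (h : Abst B L V A) (hB : B ⊆ B') (hL : L ⊆ L') :
    Abst B' L' V A := by
  cases A with
  | unit => exact h
  | int => exact h
  | loc => exact ⟨h.1, hL h.2⟩
  | fn => exact hB h
  | bx => exact hB h

theorem Entry.bindOK {V A} (h : Entry V A) : BindOK (A.bind V) :=
  ⟨fun n W W' h1 h2 => h1.2.trans h2.2.symm, fun n W hW => by
    obtain ⟨h1, rfl⟩ := hW; exact ⟨h.value, h.typed n h1⟩⟩

theorem bindOf_ok {α : Type} {f : α → Option Abs} {g : α → Option Tm} (hf : DistinctNames f)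
    (he : ∀ a A V, f a = some A → g a = some V → Entry V A) : BindOK (bindOf f g) := by
  refine ⟨?_, ?_⟩
  · rintro n V V' ⟨a, A, W, hA, hW, h1, rfl⟩ ⟨a', A', W', hA', hW', h1', rfl⟩
    by_cases h : a = a'
    · subst h; rw [hW] at hW'; exact Option.some.inj hW'
    · exact ((hf a a' A A' h hA hA').le_bot ⟨h1, h1'⟩).elim
  · rintro n V ⟨a, A, W, hA, hW, h1, rfl⟩
    exact ⟨(he a A _ hA hW).value, (he a A _ hA hW).typed n h1⟩

theorem BindOK.union {B B'} (h : BindOK B) (h' : BindOK B') (hd : Disjoint (bnd B) (bnd B')) :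
    BindOK (B ∪ B') := by
  refine ⟨?_, ?_⟩
  · rintro n V V' (h1 | h1) (h2 | h2)
    · exact h.func n V V' h1 h2
    · exact (hd.le_bot ⟨⟨V, h1⟩, ⟨V', h2⟩⟩).elim
    · exact (hd.le_bot ⟨⟨V', h2⟩, ⟨V, h1⟩⟩).elim
    · exact h'.func n V V' h1 h2
  · rintro n V (h1 | h1)
    · exact h.typed n V h1
    · exact h'.typed n V h1

theorem bnd_bind (A : Abs) (V : Tm) : bnd (A.bind V) = A.names := by
  ext n; exact ⟨fun ⟨W, h, _⟩ => h, fun h => ⟨V, h, rfl⟩⟩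

theorem bnd_bindOf {α : Type} {f : α → Option Abs} {g : α → Option Tm}
    (h : ∀ a A, f a = some A → ∃ V, g a = some V) : bnd (bindOf f g) = namesOf f := by
  ext n
  constructor
  · rintro ⟨V, a, A, W, hA, hW, h1, -⟩; exact ⟨a, A, hA, h1⟩
  · rintro ⟨a, A, hA, h1⟩
    obtain ⟨V, hV⟩ := h a A hA
    exact ⟨V, a, A, V, hA, hV, h1, rfl⟩

/-- `χ` is an abstraction of the closed part `h'` of `h`, up to layers. -/
structure HAbs (h : Heap) (X : Set Loc) (h' : Heap) (χ : AHeap) : Prop where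
  part : ClosedPart h X h'
  dom : domOf χ = domOf h'
  entry : ∀ l A V, χ l = some A → h' l = some V → Entry V A
  distinct : DistinctNames χ

theorem HAbs.value {h X h' χ} (H : HAbs h X h' χ) {l A} (hA : χ l = some A) :
    ∃ V, h' l = some V := mem_domOf.1 (H.dom ▸ mem_domOf.2 ⟨A, hA⟩ : l ∈ domOf h')

theorem AValHeap.habs {S S' h X h' χ} (hr : IsRestrS S h X S' h') (hc : AValHeap S S' h' χ) :
    HAbs h X h' χ := by
  refine ⟨hr.heap.part, hc.1, fun l A V hA hV => ?_, hc.2.2⟩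
  obtain ⟨T, hT⟩ := mem_domOf.1 (hr.dom ▸ mem_domOf.2 ⟨V, hV⟩ : l ∈ domOf S')
  obtain ⟨i, hi⟩ := hc.2.1 l V A T hV hA hT
  exact hi.entry

theorem HAbs.reveal {h θ Y h' χ N φ B nm} (H : HAbs h (θ ∪ Y) h' χ) (hh : HeapIn N (domOf h) h)
    (hB : BindOK B) (hn : bnd B = nm) (hV : ∀ n V, (n, V) ∈ B → V.In N (domOf h) 0)
    (hd : Disjoint nm (namesOf χ)) (hφ : Disjoint φ (nm ∪ namesOf χ)) :
    Reveal N φ θ h (B ∪ bindOf χ h') χ (nm ∪ namesOf χ) := by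
  have hb : bnd (bindOf χ h') = namesOf χ := bnd_bindOf fun l A hA => H.value hA
  refine ⟨hB.union (bindOf_ok H.distinct H.entry) (by rw [hn, hb]; exact hd), ?_, ?_, ?_⟩
  · intro n V hnV
    have hn' : n ∈ nm ∪ namesOf χ := by
      rw [← hn, ← hb]
      exact hnV.imp (fun h => ⟨V, h⟩) (fun h => ⟨V, h⟩)
    refine ⟨fun h => hφ.le_bot ⟨h, hn'⟩, hn', ?_⟩
    rcases hnV with h1 | ⟨l, A, W, hA, hW, -, rfl⟩
    · exact hV n V h1
    · exact hh l _ (H.part.sub _ _ hW)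
  · intro l A hA
    obtain ⟨V, hV⟩ := H.value hA
    refine ⟨V, H.part.sub _ _ hV, (H.entry l A V hA hV).abst.mono ?_ ?_⟩
    · exact fun p hp => .inr ⟨l, A, V, hA, hV, hp⟩
    · intro l' hl'
      have := (H.entry l A V hA hV).abst
      cases A <;> simp only [Abs.locs, Set.mem_empty_iff_false] at hl'
      obtain rfl := hl'
      rw [H.dom]
      exact H.part.closed l l' (this.1 ▸ hV)
  · rw [H.dom]; exact fun l hl => H.part.cover (.inl hl)

theorem HAbs.cover {h θ Y h' χ} (H : HAbs h (θ ∪ Y) h' χ) : Y ⊆ domOf χ := by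
  rw [H.dom]; exact fun l hl => H.part.cover (.inr hl)

/-- For the program that merely shares a trace with the given one, only its transitions are
available. The untyped data that `Game.exchange` needs are read off from them, here for the moves of
the player and in `Act.opponent` for the replies to the environment. -/
theorem Act.player {M j T S h γ φ ξ θ mv S' χ C' N}
    (a : Act (.active M j T S h γ φ ξ θ) ⟨.player, mv, S', χ⟩ C') (hM : M.In N (domOf h) 0)
    (hh : HeapIn N (domOf h) h) :
    ∃ ξ' B, C' = .passive S h (γ ∪ B) (φ ∪ (mv.names ∪ namesOf χ)) ξ' (domOf χ) ∧
      PMv N φ θ h χ B (ξ.map Frame.K) M mv (ξ'.map Frame.K) ∧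
      Reveal N φ θ h B χ (mv.names ∪ namesOf χ) := by
  cases a with
  | @PA _ _ _ _ _ _ _ _ _ A _ h' _ hv hA hr hc hd hφ =>
    have H := hc.habs hr
    have hR := H.reveal hh hA.entry.bindOK (bnd_bind _ _)
      (fun n W hW => by have e : W = _ := hW.2; rw [e]; exact hM) hd hφ
    refine ⟨ξ, A.bind M ∪ bindOf χ h', ?_, .ans hv hM ?_, hR⟩
    · simp only [Set.union_assoc]; rfl
    · exact hA.entry.abst.mono Set.subset_union_left H.cover
  | @PQF K f V _ _ i₃ _ _ _ _ _ _ _ A _ h' _ hK hv hf ht hA hr hc hd hφ =>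
    have H := hc.habs hr
    have hM' := (Cx.in_plug hK).1 hM
    have hR := H.reveal hh hA.entry.bindOK (bnd_bind _ _)
      (fun n W hW => by have e : W = _ := hW.2; rw [e]; exact hM'.2.2) hd hφ
    refine ⟨⟨S, K, f.cod, i₃, T, j⟩ :: ξ, A.bind V ∪ bindOf χ h', ?_, .call hK hv ?_, hR⟩
    · simp only [Set.union_assoc]; rfl
    · exact hA.entry.abst.mono Set.subset_union_left H.cover
  | @PQB K b d _ i₁ _ _ _ _ _ _ _ ρ _ h' _ hK hb ht hA hr hc hd hφ =>
    have H := hc.habs hr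
    have hM' := (Cx.in_plug hK).1 hM
    have hex : ∀ x A, ρ x = some A → ∃ V, d.lookup x = some V ∧ Entry V A := by
      intro x A hx
      obtain ⟨T₀, hT₀⟩ := LCtx.mem_dom.1 ((hA.1 x).1 (by simp [hx]))
      obtain ⟨V, A', hV, hA', hav⟩ := hA.2.1 x T₀ hT₀
      rw [hx] at hA'; cases hA'
      exact ⟨V, hV, hav.entry⟩
    have he : ∀ x A V, ρ x = some A → d.lookup x = some V → Entry V A := by
      intro x A V hx hV
      obtain ⟨V', hV', h⟩ := hex x A hx
      rw [hV] at hV'; cases hV'; exact h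
    have hR := H.reveal hh (bindOf_ok hA.2.2 he)
      (bnd_bindOf fun x A hx => (hex x A hx).imp fun V h => h.1)
      (fun n W ⟨x, A, V, hx, hV, hW⟩ => by
        have e : W = _ := hW.2; rw [e]; exact hM'.2.2.lookup hV) hd hφ
    refine ⟨⟨S, K, b.ty, i₁, T, j⟩ :: ξ, bindOf ρ d.lookup ∪ bindOf χ h', ?_, .run hK ?_ ?_, hR⟩
    · simp only [Set.union_assoc]; rfl
    · intro x hx
      obtain ⟨T₀, hT₀⟩ := LCtx.mem_dom.1 hx
      obtain ⟨V, A, hV, hx, hav⟩ := hA.2.1 x T₀ hT₀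
      refine ⟨V, A, hV, hx, hav.entry.abst.mono ?_ ?_⟩
      · exact fun p hp => .inl ⟨x, A, V, hx, hV, hp⟩
      · exact fun l hl => H.cover ⟨x, A, hx, hl⟩
    · exact fun x A hx => (hA.1 x).1 (by simp [hx])

theorem Act.opponent {S h γ φ ξ θ mv S' χ C'}
    (a : Act (.passive S h γ φ ξ θ) ⟨.opponent, mv, S', χ⟩ C') :
    ∃ M' j' T' ξ', C' = .active M' j' T' (pUnion S S') (pUnion (toTms χ) h) γ
        (φ ∪ (mv.names ∪ namesOf χ)) ξ' (domOf χ) ∧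
      OMv γ (ξ.map Frame.K) mv M' (ξ'.map Frame.K) ∧ domOf χ ∩ domOf h = θ := by
  cases a with
  | OA hA ho hd hφ =>
    exact ⟨_, _, _, _, by rw [Set.union_assoc]; rfl, .ans, ho.shared⟩
  | OQF hf hA ho hd hφ =>
    exact ⟨_, _, _, _, by rw [Set.union_assoc]; rfl, .call hf, ho.shared⟩
  | OQB hb hA ho hd hφ =>
    exact ⟨_, _, _, _, by rw [Set.union_assoc]; rfl, .run hb, ho.shared⟩

-- Fresh abstractions, and termination of exchanges.

/-! ## Construction of abstractions -/

/-- The abstract value of a closed value of type `T`, with a name of layer `lv` and number `k` for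
functions and boxes. -/
def mkAbs (lv : Layer) (k : ℕ) : Ty → Tm → Abs
  | .arr T₁ T₂, _ => .fn ⟨T₁, T₂, lv, k⟩
  | .box G T, _ => .bx ⟨G, T, k⟩
  | _, .int n => .int n
  | _, .loc l => .loc l
  | _, _ => .unit

theorem mkAbs_loc {S j T l} (h : ClTyped S j (.loc l) T) (lv : Layer) (k : ℕ) :
    mkAbs lv k T (.loc l) = .loc l := by
  cases h; rfl

theorem mkAbs_locs {S j T V} (h : ClTyped S j V T) (hv : V.IsValue) {lv k l}
    (hl : l ∈ (mkAbs lv k T V).locs) : V = .loc l := by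
  cases T with
  | unit => rw [h.unit_cases hv] at hl; exact hl.elim
  | int => obtain ⟨n, rfl⟩ := h.int_cases hv; exact hl.elim
  | arr => exact hl.elim
  | ref => obtain ⟨m, rfl, -⟩ := h.ref_cases hv; exact congrArg _ (Eq.symm hl)
  | box => exact hl.elim

theorem mkAbs_names {lv k T V n} (h : n ∈ (mkAbs lv k T V).names) : n.idx = k ∧ n.ty = T := by
  cases T <;> cases V <;> simp_all [mkAbs, Abs.names, Name.idx, Name.ty]

theorem mkAbs_entry {S j T V} (h : ClTyped S j V T) (hv : V.IsValue) (lv : Layer) (k : ℕ) :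
    Entry V (mkAbs lv k T V) := by
  refine ⟨hv, fun n hn => ⟨S, j, (mkAbs_names hn).2 ▸ h⟩, ?_⟩
  cases T with
  | unit => rw [h.unit_cases hv]; rfl
  | int => obtain ⟨n, rfl⟩ := h.int_cases hv; rfl
  | arr => exact ⟨rfl, rfl⟩
  | ref => obtain ⟨m, rfl, -⟩ := h.ref_cases hv; exact ⟨rfl, rfl⟩
  | box => exact ⟨rfl, rfl⟩

theorem mkAbs_typed {S S' j T V} (h : ClTyped S j V T) (hv : V.IsValue) {lv : Layer} (k : ℕ)
    (hlv : WfTy lv T) (hS' : WfSCtx S') (hl : ∀ l, V = .loc l → S' l = S l) :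
    ClTyped S' lv (mkAbs lv k T V).toTm T := by
  have hc := WfCtxs.closed hS' lv
  cases T with
  | unit => rw [h.unit_cases hv]; exact .unit hc
  | int => obtain ⟨n, rfl⟩ := h.int_cases hv; exact .int n hc
  | arr T₁ T₂ => exact HasTy.fname (f := ⟨T₁, T₂, lv, k⟩) hc hlv le_rfl
  | ref T =>
    obtain ⟨m, rfl, hm⟩ := h.ref_cases hv
    cases hlv with
    | ref hlv => exact .loc hc ((hl m rfl).trans hm) hlv
  | box G T =>
    have hlv' := hlv
    cases hlv' with
    | box => exact HasTy.bname (b := ⟨G, T, k⟩) hc hlv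

theorem mkAbs_aval {S j T V} (h : ClTyped S j V T) (hv : V.IsValue) (k : ℕ) :
    AVal S j V T (mkAbs j k T V) := by
  cases T with
  | unit => obtain rfl := h.unit_cases hv; exact .unit h
  | int => obtain ⟨n, rfl⟩ := h.int_cases hv; exact .int h
  | arr T₁ T₂ => exact .fn (f := ⟨T₁, T₂, j, k⟩) hv h rfl
  | ref T => obtain ⟨m, rfl, hm⟩ := h.ref_cases hv; exact .loc h
  | box G T => exact .bx (b := ⟨G, T, k⟩) hv (h.box_cases hv).1 h

/-- Reachability of locations. -/
inductive Reach (h : Heap) (X : Set Loc) : Loc → Prop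
  | base {l} : l ∈ X → Reach h X l
  | step {l l'} : Reach h X l → h l = some (.loc l') → Reach h X l'

open Classical in
/-- The restriction of a partial map. -/
noncomputable def restr {α : Type} (f : Loc → Option α) (p : Loc → Prop) : Loc → Option α :=
  fun l => if p l then f l else none

theorem restr_some {α : Type} {f : Loc → Option α} {p : Loc → Prop} {l : Loc} {a : α} :
    restr f p l = some a ↔ p l ∧ f l = some a := by
  unfold restr; split <;> simp_all

open Classical in
/-- The layer at which abstract values of type `T` are introduced in a session of layer `s`. -/
noncomputable def lvl (s : Layer) (T : Ty) : Layer := if WfTy s T then s else 1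

theorem lvl_wf {s T} (h : WfTy 1 T) : WfTy (lvl s T) T := by
  unfold lvl; split <;> assumption

/-- The abstraction of the heap `h` with types `S`. -/
noncomputable def mkHeap (s : Layer) (k : ℕ) (S : SCtx) (h : Heap) : AHeap := fun l =>
  match h l, S l with
  -- Freshness is a matter of numbers: `k` is to exceed all numbers in use, heap entries take odd
  -- offsets, entries of substitutions take even ones, and a single answer or argument takes the
  -- offset 0.
  | some V, some T => some (mkAbs (lvl s T) (k + 2 * l + 1) T V)
  | _, _ => none

theorem mkHeap_some {s k S h l A} (hA : mkHeap s k S h l = some A) :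
    ∃ V T, h l = some V ∧ S l = some T ∧ A = mkAbs (lvl s T) (k + 2 * l + 1) T V := by
  unfold mkHeap at hA
  split at hA
  · next V T hV hT => cases hA; exact ⟨V, T, hV, hT, rfl⟩
  · cases hA

theorem VOK.mkAbs {s S S' j T V} (h : ClTyped S j V T) (hv : V.IsValue) (k : ℕ) (hS' : WfSCtx S')
    (hl : ∀ l, V = .loc l → S' l = S l) : VOK s S' (mkAbs (lvl s T) k T V).toTm T := by
  have := mkAbs_typed h hv k (lvl_wf (s := s) (h.wf.2.mono (layer_le_one j))) hS' hl
  by_cases hw : WfTy s T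
  · rw [lvl, if_pos hw] at this ⊢; exact .inl ⟨hw, this⟩
  · rw [lvl, if_neg hw] at this ⊢; exact .inr ⟨hw, ⟨_, rfl⟩, this⟩

/-- The heap part of an action, as the abstraction of the locations that are reachable from `X`. -/
structure HMove (s : Layer) (k : ℕ) (S : SCtx) (h : Heap) (X : Set Loc) (S' : SCtx) (h' : Heap)
    (χ : AHeap) : Prop where
  restr : IsRestrS S h X S' h'
  habs : HAbs h X h' χ
  hok : HOK s S' (toTms χ)
  wf : WfAHeap S' χ
  least : IsRestr (toTms χ) X (toTms χ)
  idx : ∀ n ∈ namesOf χ, ∃ l, n.idx = k + 2 * l + 1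
  fin : (domOf χ).Finite
  ent : ∀ l A V, χ l = some A → h' l = some V → ∃ T, h l = some V ∧ S l = some T ∧
    A = mkAbs (lvl s T) (k + 2 * l + 1) T V
  aval : (∀ l V T, h l = some V → S l = some T → VOK s S V T) → AValHeap S S' h' χ

/-- The least closed part is the set of locations reachable from `X`. Abstraction keeps locations as
they are, so the abstract heap has the same pointers. Hence one construction meets the demands on a
player heap, which restricts `h`, and those on an opponent heap, which must be its own restriction.
-/
theorem exists_hmove (s : Layer) (k : ℕ) {S h} (H : WfHeap S h) {X} (hX : X ⊆ domOf h) :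
    ∃ S' h' χ, HMove s k S h X S' h' χ := by
  have hty : ∀ l V, h l = some V → ∃ T j, S l = some T ∧ ClTyped S j V T := by
    intro l V hV
    obtain ⟨T, hT⟩ := Option.isSome_iff_exists.1 ((H.dom l).1 (by simp [hV]))
    obtain ⟨j, hj⟩ := H.typed l V T hV hT
    exact ⟨T, j, hT, hj⟩
  have hloc : ∀ l l', h l = some (.loc l') → l' ∈ domOf h := by
    intro l l' hl
    obtain ⟨T, j, -, hj⟩ := hty l _ hl
    exact (H.dom l').2 hj.in
  have hre : ∀ l, Reach h X l → l ∈ domOf h := by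
    intro l hl
    cases hl with
    | base hl => exact hX hl
    | step _ hl => exact hloc _ _ hl
  have hdom : ∀ l, l ∈ domOf (restr h (Reach h X)) ↔ Reach h X l := by
    intro l
    simp only [mem_domOf, restr_some]
    exact ⟨fun ⟨V, h1, _⟩ => h1, fun h1 => (mem_domOf.1 (hre l h1)).imp fun V hV => ⟨h1, hV⟩⟩
  have hdomS : ∀ l, l ∈ domOf (restr S (Reach h X)) ↔ Reach h X l := by
    intro l
    simp only [mem_domOf, restr_some]
    refine ⟨fun ⟨V, h1, _⟩ => h1, fun h1 => ?_⟩
    obtain ⟨V, hV⟩ := mem_domOf.1 (hre l h1)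
    obtain ⟨T, -, hT, -⟩ := hty l V hV
    exact ⟨T, h1, hT⟩
  have hdomχ : ∀ l, l ∈ domOf (mkHeap s k S (restr h (Reach h X))) ↔ Reach h X l := by
    intro l
    refine ⟨fun hl => ?_, fun hl => ?_⟩
    · obtain ⟨A, hA⟩ := mem_domOf.1 hl
      obtain ⟨V, T, hV, -⟩ := mkHeap_some hA
      exact (restr_some.1 hV).1
    · obtain ⟨V, hV⟩ := mem_domOf.1 (hre l hl)
      obtain ⟨T, -, hT, -⟩ := hty l V hV
      refine mem_domOf.2 ⟨mkAbs (lvl s T) (k + 2 * l + 1) T V, ?_⟩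
      simp only [mkHeap, restr_some.2 ⟨hl, hV⟩, hT]
  have hpart : ClosedPart h X (restr h (Reach h X)) :=
    ⟨fun l V hV => (restr_some.1 hV).2, fun l hl => (hdom l).2 (.base hl),
      fun l l' hl => (hdom l').2 (.step (restr_some.1 hl).1 (restr_some.1 hl).2)⟩
  have hsubS : PSub (restr S (Reach h X)) S := fun l T hT => (restr_some.1 hT).2
  have hS' : WfSCtx (restr S (Reach h X)) :=
    ⟨H.store.1.subset hsubS.domOf, fun l T hT => H.store.2 l T (hsubS l T hT)⟩
  have hloc' : ∀ l V, restr h (Reach h X) l = some V → ∀ m, V = .loc m →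
      restr S (Reach h X) m = S m := by
    rintro l V hV m rfl
    have : Reach h X m := .step (restr_some.1 hV).1 (restr_some.1 hV).2
    simp [restr, this]
  have hent : ∀ l A, mkHeap s k S (restr h (Reach h X)) l = some A → ∃ V T j, Reach h X l ∧
      h l = some V ∧ S l = some T ∧ ClTyped S j V T ∧
      A = mkAbs (lvl s T) (k + 2 * l + 1) T V := by
    intro l A hA
    obtain ⟨V, T, hV, hT, rfl⟩ := mkHeap_some hA
    obtain ⟨hl, hV⟩ := restr_some.1 hV
    obtain ⟨j, hj⟩ := H.typed l V T hV hT
    exact ⟨V, T, j, hl, hV, hT, hj, rfl⟩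
  have hidx : ∀ l A, mkHeap s k S (restr h (Reach h X)) l = some A → ∀ n ∈ A.names,
      n.idx = k + 2 * l + 1 := by
    intro l A hA n hn
    obtain ⟨V, T, j, hl, hV, hT, hj, rfl⟩ := hent l A hA
    exact (mkAbs_names hn).1
  have hdist : DistinctNames (mkHeap s k S (restr h (Reach h X))) := by
    intro l l' A A' hne hA hA'
    refine Set.disjoint_left.2 fun n hn hn' => hne ?_
    have h1 := hidx l A hA n hn
    have h2 := hidx l' A' hA' n hn'
    have : @Eq ℕ l l' := by omega
    exact this
  have hHOK : HOK s (restr S (Reach h X)) (toTms (mkHeap s k S (restr h (Reach h X)))) := by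
    refine ⟨hS', ?_, ?_, ?_⟩
    · rw [domOf_toTms]; ext l; rw [hdomχ, hdomS]
    · intro l V hV
      simp only [toTms, Option.map_eq_some_iff] at hV
      obtain ⟨A, -, rfl⟩ := hV
      cases A <;> trivial
    · intro l W T hW hT
      simp only [toTms, Option.map_eq_some_iff] at hW
      obtain ⟨A, hA, rfl⟩ := hW
      obtain ⟨V, T', j, hl, hV, hT', hj, rfl⟩ := hent l A hA
      have := (restr_some.1 hT).2
      rw [hT'] at this; cases this
      exact .mkAbs hj (H.value l V hV) _ hS' (hloc' l V (restr_some.2 ⟨hl, hV⟩))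
  refine ⟨restr S (Reach h X), restr h (Reach h X), mkHeap s k S (restr h (Reach h X)),
    ⟨⟨hpart, ?_⟩, hsubS, ?_⟩, ⟨hpart, ?_, ?_, hdist⟩, hHOK, ⟨hHOK.wfHeap, hdist⟩, ⟨?_, ?_⟩, ?_,
    ?_, ?_, ?_⟩
  · intro h'' hc l V hV
    have key : ∀ l, Reach h X l → l ∈ domOf h'' := by
      intro l hl
      induction hl with
      | base hl => exact hc.cover hl
      | step _ hl ih =>
        obtain ⟨W, hW⟩ := mem_domOf.1 ih
        have := hc.sub _ _ hW
        rw [hl] at this; cases this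
        exact hc.closed _ _ hW
    obtain ⟨W, hW⟩ := mem_domOf.1 (key l (restr_some.1 hV).1)
    rw [hW, ← (restr_some.1 hV).2, hc.sub _ _ hW]
  · ext l; rw [hdom, hdomS]
  · ext l; rw [hdom, hdomχ]
  · intro l A V hA hV
    obtain ⟨V', T, j, hl, hV', hT, hj, rfl⟩ := hent l A hA
    have := (restr_some.1 hV).2
    rw [hV'] at this; cases this
    exact mkAbs_entry hj (H.value l V hV') _ _
  · refine ⟨fun _ _ h => h, ?_, ?_⟩
    · intro l hl; rw [domOf_toTms]; exact (hdomχ l).2 (.base hl)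
    · intro l l' hl
      rw [domOf_toTms, hdomχ]
      simp only [toTms, Option.map_eq_some_iff] at hl
      obtain ⟨A, hA, hl⟩ := hl
      obtain ⟨V, T, j, hr, hV, hT, hj, rfl⟩ := hent l A hA
      have : l' ∈ (mkAbs (lvl s T) (k + 2 * l + 1) T V).locs := by
        revert hl
        cases mkAbs (lvl s T) (k + 2 * l + 1) T V <;> simp [Abs.toTm, Abs.locs, eq_comm]
      rw [mkAbs_locs hj (H.value l V hV) this] at hV
      exact .step hr hV
  · intro h'' hc l W hW
    have hl : Reach h X l := by
      rw [← hdomχ, ← domOf_toTms]; exact mem_domOf.2 ⟨W, hW⟩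
    have : l ∈ domOf h'' := by
      clear hW
      induction hl with
      | base hl => exact hc.cover hl
      | @step l l' hr hl ih =>
        obtain ⟨W, hW⟩ := mem_domOf.1 ih
        have := hc.sub _ _ hW
        simp only [toTms, Option.map_eq_some_iff] at this
        obtain ⟨A, hA, rfl⟩ := this
        obtain ⟨V, T, j, -, hV, hT, hj, rfl⟩ := hent l A hA
        rw [hl] at hV; cases hV
        rw [mkAbs_loc hj] at hW
        exact hc.closed _ _ hW
    obtain ⟨W', hW'⟩ := mem_domOf.1 this
    rw [hW', ← hW, hc.sub _ _ hW']
  · rintro n ⟨l, A, hA, hn⟩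
    exact ⟨l, hidx l A hA n hn⟩
  · refine (show (domOf h).Finite from ?_).subset fun l hl => hre l ((hdomχ l).1 hl)
    exact (HOK.of_wfHeap H).finite
  · intro l A V hA hV
    obtain ⟨V', T, j, hl, hV', hT, hj, rfl⟩ := hent l A hA
    have := (restr_some.1 hV).2
    rw [hV'] at this; cases this
    exact ⟨T, hV', hT, rfl⟩
  · intro hvok
    refine ⟨by ext l; rw [hdom, hdomχ], ?_, hdist⟩
    intro l V A T hV hA hT
    obtain ⟨V', T', j, hl, hV', hT', hj, rfl⟩ := hent l A hA
    have e1 := (restr_some.1 hV).2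
    have e2 := (restr_some.1 hT).2
    rw [hV'] at e1; cases e1
    rw [hT'] at e2; cases e2
    rcases hvok l V T hV' hT' with ⟨hw, ht⟩ | ⟨hw, -, ht⟩
    · rw [lvl, if_pos hw]; exact ⟨_, mkAbs_aval ht (H.value l V hV') _⟩
    · rw [lvl, if_neg hw]; exact ⟨_, mkAbs_aval ht (H.value l V hV') _⟩

/-- The abstraction of the local substitution `d` for `G`. -/
def mkSub (lv : Layer) (k : ℕ) (d : LSub) : LCtx → ASub
  | [] => fun _ => none
  | (y, T) :: G => fun x => if x = y then (d.lookup x).map (mkAbs lv (k + 2 * x) T)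
      else mkSub lv k d G x

theorem mkSub_some {lv k d G x A} (h : mkSub lv k d G x = some A) :
    ∃ T V, (x, T) ∈ G ∧ d.lookup x = some V ∧ A = mkAbs lv (k + 2 * x) T V := by
  induction G with
  | nil => cases h
  | cons p G ih =>
    obtain ⟨y, T⟩ := p
    simp only [mkSub] at h
    split at h
    · next e =>
      subst e
      obtain ⟨V, hV, rfl⟩ := Option.map_eq_some_iff.1 h
      exact ⟨T, V, List.mem_cons_self, hV, rfl⟩
    · obtain ⟨T', V, hm, h⟩ := ih h
      exact ⟨T', V, List.mem_cons_of_mem _ hm, h⟩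

theorem mkSub_isSome {lv k} {d : LSub} {G x} (hx : x ∈ G.dom) (hd : x ∈ d.keys) :
    (mkSub lv k d G x).isSome := by
  induction G with
  | nil => simp [LCtx.dom] at hx
  | cons p G ih =>
    obtain ⟨y, T⟩ := p
    simp only [mkSub]
    split
    · obtain ⟨V, hV⟩ := LSub.lookup_of_mem hd; simp [hV]
    · next e => exact ih (by simpa [LCtx.dom, e] using hx)

theorem mkSub_distinct (lv : Layer) (k : ℕ) (d : LSub) (G : LCtx) :
    DistinctNames (mkSub lv k d G) := by
  intro x x' A A' hne hA hA'
  refine Set.disjoint_left.2 fun n hn hn' => hne ?_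
  obtain ⟨_, _, -, -, rfl⟩ := mkSub_some hA
  obtain ⟨_, _, -, -, rfl⟩ := mkSub_some hA'
  have h1 := (mkAbs_names hn).1
  have h2 := (mkAbs_names hn').1
  have : @Eq ℕ x x' := by omega
  exact this

theorem mkSub_idx {lv k d G n} (h : n ∈ namesOf (mkSub lv k d G)) : ∃ x, n.idx = k + 2 * x := by
  obtain ⟨x, A, hA, hn⟩ := h
  obtain ⟨_, _, -, -, rfl⟩ := mkSub_some hA
  exact ⟨x, (mkAbs_names hn).1⟩

theorem mkSub_finite (lv : Layer) (k : ℕ) (d : LSub) (G : LCtx) :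
    (domOf (mkSub lv k d G)).Finite := by
  refine (List.finite_toSet G.dom).subset fun x hx => ?_
  obtain ⟨A, hA⟩ := mem_domOf.1 hx
  obtain ⟨T, V, hm, -⟩ := mkSub_some hA
  exact LCtx.mem_dom.2 ⟨T, hm⟩

theorem mkSub_locs {S j lv k} {d : LSub} {G : LCtx} (hv : ∀ x V, d.lookup x = some V → V.IsValue)
    (ht : ∀ x V T, (x, T) ∈ G → d.lookup x = some V → ClTyped S j V T) {l}
    (hl : l ∈ locsOf (mkSub lv k d G)) : ∃ x, d.lookup x = some (.loc l) ∧ l ∈ domOf S := by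
  obtain ⟨x, A, hA, hl⟩ := hl
  obtain ⟨T, V, hm, hV, rfl⟩ := mkSub_some hA
  obtain rfl := mkAbs_locs (ht x V T hm hV) (hv x V hV) hl
  exact ⟨x, hV, (ht x _ T hm hV).in⟩

theorem mkSub_aval {S j k} {d : LSub} {G : LCtx} (hG : (G.map Prod.fst).Nodup)
    (hk : ∀ x, x ∈ d.keys ↔ x ∈ G.dom) (hv : ∀ x V, d.lookup x = some V → V.IsValue)
    (ht : ∀ x V T, (x, T) ∈ G → d.lookup x = some V → ClTyped S j V T) :
    AValSub S j d G (mkSub j k d G) := by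
  refine ⟨fun x => ⟨fun hx => ?_, fun hx => mkSub_isSome hx ((hk x).2 hx)⟩, fun x T hx => ?_,
    mkSub_distinct _ _ _ _⟩
  · obtain ⟨A, hA⟩ := Option.isSome_iff_exists.1 hx
    obtain ⟨T, V, hm, -⟩ := mkSub_some hA
    exact LCtx.mem_dom.2 ⟨T, hm⟩
  · have hd : x ∈ G.dom := LCtx.mem_dom.2 ⟨T, hx⟩
    obtain ⟨A, hA⟩ := Option.isSome_iff_exists.1 (mkSub_isSome (lv := j) (k := k) hd ((hk x).2 hd))
    obtain ⟨T', V, hm, hV, e⟩ := mkSub_some hA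
    obtain rfl := LCtx.unique hG hx hm
    exact ⟨V, A, hV, hA, e ▸ mkAbs_aval (ht x V T hx hV) (hv x V hV) _⟩

theorem mkSub_wf {S S' j lv k} {d : LSub} {G : LCtx} (hG : WfLCtx lv G)
    (hk : ∀ x, x ∈ d.keys ↔ x ∈ G.dom) (hv : ∀ x V, d.lookup x = some V → V.IsValue)
    (ht : ∀ x V T, (x, T) ∈ G → d.lookup x = some V → ClTyped S j V T) (hS' : WfSCtx S')
    (hl : ∀ x l, d.lookup x = some (.loc l) → x ∈ G.dom → S' l = S l) :
    WfASub S' lv (mkSub lv k d G) G := by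
  refine ⟨fun x => ⟨fun hx => ?_, fun hx => mkSub_isSome hx ((hk x).2 hx)⟩,
    fun x T A hx hA => ?_, mkSub_distinct _ _ _ _⟩
  · obtain ⟨A, hA⟩ := Option.isSome_iff_exists.1 hx
    obtain ⟨T, V, hm, -⟩ := mkSub_some hA
    exact LCtx.mem_dom.2 ⟨T, hm⟩
  · obtain ⟨T', V, hm, hV, rfl⟩ := mkSub_some hA
    obtain rfl := LCtx.unique hG.1 hx hm
    refine mkAbs_typed (ht x V T hx hV) (hv x V hV) _ (hG.2 x T hx) hS' ?_
    rintro l rfl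
    exact hl x l hV (LCtx.mem_dom.2 ⟨T, hx⟩)

/-! ## A measure that decreases with every exchange of moves -/

/-- A function name may be assigned another function name, and a call of it is then forwarded
without a reduction step. `WOK` makes the weights drop strictly along such a chain, so `rank` bounds
the number of forwardings; for any other value there is nothing to forward. -/
def rank (W : Name → ℕ) : Tm → ℕ
  | .fname f => W (.fn f) + 1
  | _ => 0

/-- The weight of a name bounds the weight of its value. -/
structure WOK (W : Name → ℕ) (γ : Set (Name × Tm)) : Prop where
  fn : ∀ f V, (Name.fn f, V) ∈ γ → rank W V ≤ W (.fn f)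
  -- Running `b` replaces its weight by that of the code and pushes a frame, which counts 1 in
  -- addition to its own weight; the second unit of the summand 2 makes the decrease strict.
  bx : ∀ b V, (Name.bx b, V) ∈ γ → V.unboxed.wt (fun b => W (.bx b)) + 2 ≤ W (.bx b)

/-- Every frame counts 1 for the answer that will remove it, and its weight for the box names
waiting in it. -/
def stk (W : Name → ℕ) (ξ : List Cx) : ℕ := (ξ.map fun K => K.wt (fun b => W (.bx b)) + 1).sum

/-- Applications of values to values. -/
def Tm.IsAV : Tm → Prop
  | .app V A => V.IsValue ∧ A.IsValue
  | _ => False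

-- An application of values either reduces or calls a name in the empty context. From there on,
-- until the next reduction step, all exchanges are calls in the empty context and are counted by
-- `msr₂`. The value 0 on such terms absorbs the frames that these calls push, and the summand 1
-- keeps all other terms above 0.
open Classical in
noncomputable def msr₁ (W : Name → ℕ) (M : Tm) (ξ ξ' : List Cx) : ℕ :=
  if M.IsAV then 0 else 1 + M.wt (fun b => W (.bx b)) + stk W ξ + stk W ξ'

def msr₂ (W : Name → ℕ) : Tm → ℕ
  | .app V _ => rank W V
  | _ => 0

theorem msr₁_le (W : Name → ℕ) (M : Tm) (ξ ξ' : List Cx) :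
    msr₁ W M ξ ξ' ≤ 1 + M.wt (fun b => W (.bx b)) + stk W ξ + stk W ξ' := by
  unfold msr₁; split <;> omega

theorem Tm.IsAV.plug {K : Cx} (hK : K.IsEval) {M : Tm} (h : (K.plug M).IsAV) :
    K = .hole ∨ M.IsValue := by
  cases K <;> simp_all [Cx.IsEval, Cx.plug, Tm.IsAV]
  · exact (Cx.plug_value hK h.1).2
  · exact (Cx.plug_value hK.2 h).2

theorem rank_congr {W W' : Name → ℕ} {φ : Set Name} {L : Set Loc} (h : ∀ n ∈ φ, W' n = W n)
    {V : Tm} {k : ℕ} (hV : V.In φ L k) : rank W' V = rank W V := by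
  cases V <;> simp_all [rank, Tm.In]

theorem WOK.congr {W W' : Name → ℕ} {N φ h γ ξ} (hs : Supp N φ h γ ξ) (w : WOK W γ)
    (hW : ∀ n ∈ φ, W' n = W n) : WOK W' γ := by
  have sub : ∀ {n V}, (n, V) ∈ γ → V.In φ (domOf h) 0 := fun hV =>
    Tm.In.mono _ hs.sub subset_rfl le_rfl (hs.bind _ _ hV).2.2
  refine ⟨fun f V hV => ?_, fun b V hV => ?_⟩
  · rw [hW _ (hs.bind _ _ hV).1, rank_congr hW (sub hV)]; exact w.fn f V hV
  · rw [hW _ (hs.bind _ _ hV).1, Tm.wt_congr (fun b hb => hW _ hb) _ (Tm.In.unboxed (sub hV))]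
    exact w.bx b V hV

theorem stk_congr {W W' : Name → ℕ} {N φ h γ ξ} (hs : Supp N φ h γ ξ)
    (hW : ∀ n ∈ φ, W' n = W n) : stk W' ξ = stk W ξ := by
  unfold stk
  congr 1
  refine List.map_congr_left fun K hK => ?_
  have := Cx.In.mono hs.sub subset_rfl (hs.frames K hK).2
  rw [Cx.wt, Tm.wt_congr (fun b hb => hW _ hb) _ this, Cx.wt]

/-- The values assigned to the new names contain old names only, so weights for the new names are
computed from the old ones. The old weights stay, hence so does every measure taken before. -/
theorem exists_weight {W : Name → ℕ} {N φ θ h γ ξ B χ nm} (hs : Supp N φ h γ ξ) (w : WOK W γ)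
    (hr : Reveal N φ θ h B χ nm) : ∃ W' : Name → ℕ, (∀ n ∈ φ, W' n = W n) ∧ WOK W' (γ ∪ B) := by
  classical
  let v : Name → Tm → ℕ := fun n V => match n with
    | .fn _ => rank W V
    | .bx _ => V.unboxed.wt (fun b => W (.bx b)) + 2
  let W' : Name → ℕ := fun n => if h : ∃ V, (n, V) ∈ B then v n (Classical.choose h) else W n
  have hφ : ∀ n ∈ φ, W' n = W n := fun n hn =>
    dif_neg fun ⟨V, hV⟩ => (hr.fresh n V hV).1 hn
  have hB : ∀ n V, (n, V) ∈ B → W' n = v n V := by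
    intro n V h
    have hx : ∃ V, (n, V) ∈ B := ⟨V, h⟩
    simp only [W', dif_pos hx]
    rw [hr.bind.func _ _ _ (Classical.choose_spec hx) h]
  have sub : ∀ {n V}, (n, V) ∈ B → V.In φ (domOf h) 0 := fun hV =>
    Tm.In.mono _ hs.sub subset_rfl le_rfl (hr.fresh _ _ hV).2.2
  refine ⟨W', hφ, ⟨?_, ?_⟩⟩
  · rintro f V (hV | hV)
    · exact (w.congr hs hφ).fn f V hV
    · rw [hB _ _ hV, rank_congr hφ (sub hV)]
  · rintro b V (hV | hV)
    · exact (w.congr hs hφ).bx b V hV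
    · rw [hB _ _ hV, Tm.wt_congr (fun b hb => hφ _ hb) _ (Tm.In.unboxed (sub hV))]

theorem stk_cons (W : Name → ℕ) (K : Cx) (ξ : List Cx) :
    stk W (K :: ξ) = K.wt (fun b => W (.bx b)) + 1 + stk W ξ := by simp [stk]

theorem Abs.toTm_value (A : Abs) : A.toTm.IsValue := by cases A <;> trivial

theorem toTms_value {α : Type} {ρ : α → Option Abs} {x : α} {V : Tm}
    (h : toTms ρ x = some V) : V.IsValue := by
  simp only [toTms, Option.map_eq_some_iff] at h
  obtain ⟨A, -, rfl⟩ := h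
  exact A.toTm_value

/-- An answer removes a frame. A box name weighs more than its code together with the frame left
behind. A call in a nonempty context leads to an application of values, where `msr₁` is 0. These
lower `msr₁`. A call in the empty context keeps `msr₁` at 0 and advances along a chain of names,
which lowers `msr₂`. -/
theorem exists_measure_lt {W : Name → ℕ} {NX NY φ θ M hX γX ξX hY γY ξY}
    (hM : M.In NX (domOf hX) 0) (sX : Supp NX φ hX γX ξX) (sY : Supp NY φ hY γY ξY)
    (wX : WOK W γX) (wY : WOK W γY) {χ B mv ξX' ξY' M'} (hp : PMv NX φ θ hX χ B ξX M mv ξX')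
    (hr : Reveal NX φ θ hX B χ (mv.names ∪ namesOf χ)) (ho : OMv γY ξY mv M' ξY') :
    ∃ W' : Name → ℕ, WOK W' (γX ∪ B) ∧ WOK W' γY ∧
      (msr₁ W' M' ξY' ξX' < msr₁ W M ξX ξY ∨
        msr₁ W' M' ξY' ξX' = msr₁ W M ξX ξY ∧ msr₂ W' M' < msr₂ W M) := by
  obtain ⟨W', hW, w'⟩ := exists_weight sX wX hr
  refine ⟨W', w', wY.congr sY hW, ?_⟩
  have eX := stk_congr sX hW
  have eY := stk_congr sY hW
  have ewt : ∀ {N L} {M : Tm} {k : ℕ}, N ⊆ φ → M.In N L k →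
      M.wt (fun b => W' (.bx b)) = M.wt (fun b => W (.bx b)) := fun hN h =>
    Tm.wt_congr (fun b hb => hW _ (hN hb)) _ h
  cases hp with
  | @ans V A hv hV hA =>
    cases ho with
    | @ans K ξ _ =>
    left
    have hK := sY.frames K List.mem_cons_self
    refine (msr₁_le _ _ _ _).trans_lt ?_
    have hnav : ¬ M.IsAV := by cases M <;> simp_all [Tm.IsAV, Tm.IsValue]
    rw [msr₁, if_neg hnav, hv.wt, Cx.wt_plug _ hK.1, A.toTm_value.wt]
    have e : K.wt (fun b => W' (.bx b)) = K.wt (fun b => W (.bx b)) := ewt sY.sub hK.2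
    rw [stk_cons, stk_cons] at eY
    rw [stk_cons]
    omega
  | @call K f V A hK hv hA =>
    cases ho with
    | @call _ U _ _ hU =>
    have hUs := sY.bind _ _ hU
    have hav : (Tm.app U A.toTm).IsAV := ⟨hUs.2.1, A.toTm_value⟩
    have h0 : msr₁ W' (.app U A.toTm) ξY (K :: ξX) = 0 := if_pos hav
    by_cases hh : K = .hole
    · subst hh
      right
      refine ⟨?_, ?_⟩
      · rw [h0, msr₁, if_pos]; exact ⟨trivial, hv⟩
      · change rank W' U < W (.fn f) + 1
        rw [rank_congr hW (Tm.In.mono _ sY.sub subset_rfl le_rfl hUs.2.2)]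
        exact Nat.lt_succ_of_le (wY.fn _ _ hU)
    · left
      rw [h0, msr₁, if_neg]
      · omega
      · intro h
        rcases h.plug hK with h | h
        · exact hh h
        · exact h
  | @run K b d ρ hK hd1 hd2 =>
    cases ho with
    | @run _ U _ _ hU =>
    left
    have hUs := sY.bind _ _ hU
    have hMK := (Cx.in_plug hK).1 hM
    refine (msr₁_le _ _ _ _).trans_lt ?_
    have hnav : ¬ (K.plug (.unb b d)).IsAV := by
      intro h
      rcases h.plug hK with rfl | h
      · exact h
      · exact h
    rw [msr₁, if_neg hnav, Cx.wt_plug _ hK, Tm.wt_inst _ fun x V h => toTms_value h]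
    have e : K.wt (fun b => W' (.bx b)) = K.wt (fun b => W (.bx b)) := ewt sX.sub hMK.1
    have e' := ewt sY.sub (Tm.In.unboxed hUs.2.2)
    have := wY.bx _ _ hU
    rw [stk_cons]
    simp only [Tm.wt]
    omega

-- Typed programs and environments, and their moves.

/-! ## Typed sides -/

/-- The part of a configuration that belongs to one side: store context, heap, name assignment and
stack. -/
structure Side where
  S : SCtx
  h : Heap
  γ : Set (Name × Tm)
  ξ : List Frame

def Side.pas (X : Side) (φ : Set Name) (θ : Set Loc) : Cfg := .passive X.S X.h X.γ φ X.ξ θ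

def Side.act (X : Side) (M : Tm) (j : Layer) (T : Ty) (φ : Set Name) (θ : Set Loc) : Cfg :=
  .active M j T X.S X.h X.γ φ X.ξ θ

/-- The values that a program of layer `s` assigns to names: values of layer `s`, or names that it
received. -/
def PBind (s : Layer) (S : SCtx) : Name → Tm → Prop
  | .fn f, V => (f.lvl = s ∧ ClTyped S s V (.arr f.dom f.cod)) ∨
      (f.lvl = 1 ∧ (∃ g, V = .fname g) ∧ ClTyped S 1 V (.arr f.dom f.cod))
  | .bx b, V => ClTyped S 1 V (.box b.ctx b.ty)

/-- The second alternative is the frame of a forwarded call. A program of layer 0 may store names of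
layer 1 that it cannot use itself; if the environment calls such a value through a name given to it
by the program, the call is passed on in the empty context, at layer 1. -/
def PFrame (s : Layer) (S : SCtx) (F : Frame) : Prop :=
  (F.i₁ = s ∧ F.i₂ = s ∧ WfTy s F.T₁ ∧ CxTy S [] [] s F.T₁ F.K [] [] s F.T₂) ∨
    (F.K = .hole ∧ F.T₁ = F.T₂ ∧ F.i₁ = 1 ∧ F.i₂ = 1)

/-- The terms of a program of layer `s`: terms of layer `s`, or names that it received, applied to
abstract values. -/
def PTerm (s : Layer) (S : SCtx) (M : Tm) (j : Layer) (T : Ty) : Prop :=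
  (j = s ∧ ClTyped S s M T) ∨ (j = 1 ∧ ClTyped S 1 M T ∧
    ((∃ A : Abs, M = A.toTm) ∨ ∃ f, ∃ A : Abs, M = .app (.fname f) A.toTm))

/-- Well-typed program of layer `s`. -/
structure PSide (s : Layer) (X : Side) : Prop where
  hok : HOK s X.S X.h
  bind : ∀ n V, (n, V) ∈ X.γ → PBind s X.S n V
  frames : ∀ F ∈ X.ξ, PFrame s X.S F

/-- Well-typed environment. -/
structure ESide (X : Side) : Prop where
  hok : HOK 1 X.S X.h
  bind : ∀ n V, (n, V) ∈ X.γ → ClTyped X.S 1 V n.ty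
  frames : ∀ F ∈ X.ξ, CxTy X.S [] [] 1 F.T₁ F.K [] [] 1 F.T₂

theorem PBind.store {s S S' n V} (h : PBind s S n V) (hS : PSub S S') (hS' : WfSCtx S') :
    PBind s S' n V := by
  cases n with
  | fn f =>
    rcases h with h | h
    · exact .inl ⟨h.1, h.2.store hS hS'⟩
    · exact .inr ⟨h.1, h.2.1, h.2.2.store hS hS'⟩
  | bx b => exact HasTy.store h hS hS'

theorem PFrame.store {s S S' F} (h : PFrame s S F) (hS : PSub S S') (hS' : WfSCtx S') :
    PFrame s S' F := by
  rcases h with h | h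
  · exact .inl ⟨h.1, h.2.1, h.2.2.1, h.2.2.2.store hS hS'⟩
  · exact .inr h

theorem PSide.heap {s X S' h'} (hX : PSide s X) (hS : PSub X.S S') (hok : HOK s S' h') :
    PSide s ⟨S', h', X.γ, X.ξ⟩ :=
  ⟨hok, fun n V hV => (hX.bind n V hV).store hS hok.store,
    fun F hF => (hX.frames F hF).store hS hok.store⟩

theorem ESide.heap {X S' h'} (hX : ESide X) (hS : PSub X.S S') (hok : HOK 1 S' h') :
    ESide ⟨S', h', X.γ, X.ξ⟩ :=
  ⟨hok, fun n V hV => (hX.bind n V hV).store hS hok.store,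
    fun F hF => (hX.frames F hF).store hS hok.store⟩

theorem PSub.pUnion_left {α β : Type} (f g : α → Option β) : PSub f (pUnion f g) := by
  intro a b h; simp [pUnion, h]

theorem PSub.pUnion_right {α β : Type} {f g : α → Option β} (h : Agree f g) :
    PSub g (pUnion f g) := by
  intro a b hb
  rcases hf : f a with _ | b'
  · simp [pUnion, hf, hb]
  · rw [h a b' b hf hb] at hf; simp [pUnion, hf]

theorem pUnion_some {α β : Type} {f g : α → Option β} {a : α} {b : β}
    (h : pUnion f g a = some b) : f a = some b ∨ f a = none ∧ g a = some b := by
  rcases hf : f a with _ | b' <;> simp_all [pUnion]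

theorem HOK.union {s S S' h h'} (H : HOK s S h) (H' : HOK s S' h') (ha : Agree S S') :
    HOK s (pUnion S S') (pUnion h' h) := by
  have hS : WfSCtx (pUnion S S') := by
    refine ⟨?_, fun l T hl => ?_⟩
    · change (LMML.domOf _).Finite
      rw [domOf_pUnion]; exact H.store.1.union H'.store.1
    · rcases pUnion_some hl with hl | ⟨-, hl⟩
      · exact H.store.2 l T hl
      · exact H'.store.2 l T hl
  refine ⟨hS, by rw [domOf_pUnion, domOf_pUnion, H.dom, H'.dom, Set.union_comm], ?_, ?_⟩
  · intro l V hl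
    rcases pUnion_some hl with hl | ⟨-, hl⟩
    · exact H'.value l V hl
    · exact H.value l V hl
  · intro l V T hl hT
    rcases pUnion_some hl with hl | ⟨-, hl⟩
    · obtain ⟨T', hT'⟩ := mem_domOf.1 (H'.dom ▸ mem_domOf.2 ⟨V, hl⟩ : l ∈ domOf S')
      have := PSub.pUnion_right ha _ _ hT'
      rw [hT] at this; cases this
      exact (H'.typed l V T hl hT').store (PSub.pUnion_right ha) hS
    · obtain ⟨T', hT'⟩ := mem_domOf.1 (H.dom ▸ mem_domOf.2 ⟨V, hl⟩ : l ∈ domOf S)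
      have := PSub.pUnion_left S S' _ _ hT'
      rw [hT] at this; cases this
      exact (H.typed l V T hl hT').store (PSub.pUnion_left S S') hS

/-! ## Types of stacks -/

/-- A term of type `T` fits in two stacks, whose frames are used alternatingly. -/
inductive Chain : Ty → List Frame → List Frame → Prop
  | nil (T : Ty) : Chain T [] []
  | cons {F : Frame} {ks es : List Frame} : Chain F.T₂ es ks → Chain F.T₁ (F :: ks) es

/-- The types of the parts of a move by a side with a term of type `T`, and the type of the hole of
the frame that is pushed. -/
inductive MvTy (lv : Layer) (S : SCtx) (T : Ty) : Move → Option Ty → Prop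
  | ans {A} : VOK lv S A.toTm T → MvTy lv S T (.ans A) none
  | call {f A} : VOK lv S A.toTm f.dom → MvTy lv S T (.call f A) (some f.cod)
  | run {b ρ} : WfASub S lv ρ b.ctx → MvTy lv S T (.run b ρ) (some b.ty)

def Pushes (T : Ty) (ξ ξ' : List Frame) : Option Ty → Prop
  | none => ξ' = ξ
  | some T₁ => ∃ F, ξ' = F :: ξ ∧ F.T₁ = T₁ ∧ F.T₂ = T

def Move.locs : Move → Set Loc
  | .ans A => A.locs
  | .call _ A => A.locs
  | .run _ ρ => locsOf ρ

/-- A move of an active side, which introduces abstract values for a session of layer `s`, and is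
typed at layer `lv`. -/
structure PlayerMove (s lv : Layer) (X : Side) (N φ : Set Name) (θ : Set Loc) (M : Tm) (T : Ty)
    (mv : Move) (S' : SCtx) (χ : AHeap) (B : Set (Name × Tm)) (ξ' : List Frame) : Prop where
  pmv : PMv N φ θ X.h χ B (X.ξ.map Frame.K) M mv (ξ'.map Frame.K)
  rev : Reveal N φ θ X.h B χ (mv.names ∪ namesOf χ)
  names : mv.names ∪ namesOf χ ⊆ bnd B
  ty : ∃ o, MvTy lv S' T mv o ∧ Pushes T X.ξ ξ' o
  hok : HOK s S' (toTms χ)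
  sub : PSub S' X.S
  wf : WfAHeap S' χ
  least : IsRestr (toTms χ) (θ ∪ mv.locs) (toTms χ)
  disj : Disjoint mv.names (namesOf χ)
  fresh : Disjoint φ (mv.names ∪ namesOf χ)
  fin : (mv.names ∪ namesOf χ).Finite

theorem namesOf_finite {α : Type} {f : α → Option Abs} (h : (domOf f).Finite) :
    (namesOf f).Finite := by
  have : namesOf f ⊆ ⋃ a ∈ domOf f, ⋃ A ∈ {A | f a = some A}, A.names := by
    rintro n ⟨a, A, hA, hn⟩
    simp only [Set.mem_iUnion]
    exact ⟨a, mem_domOf.2 ⟨A, hA⟩, A, hA, hn⟩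
  refine (h.biUnion fun a _ => Set.Finite.biUnion ?_ fun A _ => ?_).subset this
  · exact Set.Subsingleton.finite fun A hA A' hA' => Option.some.inj (hA.symm.trans hA')
  · cases A <;> simp [Abs.names]

theorem Abs.names_finite (A : Abs) : A.names.Finite := by cases A <;> simp [Abs.names]

/-- The parts of a player move that do not depend on its kind. -/
theorem HMove.reveal {s k S h θ Y S' h' χ N φ B nm} (H : HMove s k S h (θ ∪ Y) S' h' χ)
    (hh : HeapIn N (domOf h) h) (hφ : ∀ n ∈ φ, n.idx < k) (hB : BindOK B) (hn : bnd B = nm)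
    (hV : ∀ n V, (n, V) ∈ B → V.In N (domOf h) 0) (hi : ∀ n ∈ nm, ∃ x, n.idx = k + 2 * x) :
    Reveal N φ θ h (B ∪ bindOf χ h') χ (nm ∪ namesOf χ) ∧
      nm ∪ namesOf χ ⊆ bnd (B ∪ bindOf χ h') ∧ Disjoint nm (namesOf χ) ∧
      Disjoint φ (nm ∪ namesOf χ) := by
  have hd : Disjoint nm (namesOf χ) := by
    refine Set.disjoint_left.2 fun n h1 h2 => ?_
    obtain ⟨x, hx⟩ := hi n h1
    obtain ⟨l, hl⟩ := H.idx n h2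
    have hx' : @Eq ℕ n.idx (k + 2 * x) := hx
    have hl' : @Eq ℕ n.idx (k + 2 * l + 1) := hl
    omega
  have hf : Disjoint φ (nm ∪ namesOf χ) := by
    refine Set.disjoint_left.2 fun n h0 h => ?_
    have := hφ n h0
    rcases h with h | h
    · obtain ⟨x, hx⟩ := hi n h; omega
    · obtain ⟨l, hl⟩ := H.idx n h; omega
  refine ⟨H.habs.reveal hh hB hn hV hd hf, ?_, hd, hf⟩
  rintro n (h | h)
  · rw [← hn] at h; obtain ⟨V, hV⟩ := h; exact ⟨V, .inl hV⟩
  · have : n ∈ bnd (bindOf χ h') := by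
      rw [bnd_bindOf fun l A hA => H.habs.value hA]; exact h
    obtain ⟨V, hV⟩ := this; exact ⟨V, .inr hV⟩

theorem IsRestrS.typed {S h X S' h'} (hr : IsRestrS S h X S' h') {l} (hl : l ∈ X) :
    S' l = S l := by
  obtain ⟨T, hT⟩ := mem_domOf.1 (hr.dom ▸ hr.heap.part.cover hl : l ∈ domOf S')
  rw [hT, hr.store l T hT]

/-- Several layers are involved: `s` is that of the session, for the names in the heap; `lv₀` is
that of a name in the answer; `lv` is that at which the receiver reads the move. The program takes
`lv₀` to be the layer of its term and `lv = 1`, while the environment takes `lv₀ = lvl s T` and `lv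
= s`. The same scheme serves for calls in `exists_call`. -/
theorem exists_ans {s lv j lv₀ : Layer} {X : Side} {N φ θ M T} {k : ℕ} (hh : WfHeap X.S X.h)
    (hin : HeapIn N (domOf X.h) X.h) (hM : M.In N (domOf X.h) 0) (hθ : θ ⊆ domOf X.h)
    (hφ : ∀ n ∈ φ, n.idx < k) (hv : M.IsValue) (ht : ClTyped X.S j M T) (hlv : WfTy lv₀ T)
    (hVOK : ∀ S' A, ClTyped S' lv₀ (Abs.toTm A) T → VOK lv S' A.toTm T) :
    ∃ S' h' χ, HMove s k X.S X.h (θ ∪ (mkAbs lv₀ k T M).locs) S' h' χ ∧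
      PlayerMove s lv X N φ θ M T (.ans (mkAbs lv₀ k T M)) S' χ
        ((mkAbs lv₀ k T M).bind M ∪ bindOf χ h') X.ξ := by
  have hX : θ ∪ (mkAbs lv₀ k T M).locs ⊆ domOf X.h := by
    refine Set.union_subset hθ fun l hl => ?_
    rw [mkAbs_locs ht hv hl] at hM; exact hM
  obtain ⟨S', h', χ, H⟩ := exists_hmove s k hh hX
  have he := mkAbs_entry ht hv lv₀ k
  obtain ⟨hR, hn, hd, hf⟩ := H.reveal hin hφ he.bindOK (bnd_bind _ _)
    (fun n W hW => by have e : W = _ := hW.2; rw [e]; exact hM)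
    (fun n hn => ⟨0, (mkAbs_names hn).1⟩)
  refine ⟨S', h', χ, H, .ans hv hM (he.abst.mono Set.subset_union_left H.habs.cover), hR, hn,
    ⟨none, .ans (hVOK _ _ (mkAbs_typed ht hv k hlv H.hok.store ?_)), rfl⟩, H.hok, H.restr.store,
    H.wf, H.least, hd, hf, (Abs.names_finite _).union (namesOf_finite H.fin)⟩
  rintro l rfl
  exact H.restr.typed (.inr (by rw [mkAbs_loc ht]; rfl))

theorem exists_call {s lv j lv₀ : Layer} {X : Side} {N φ θ f V T} {K : Cx} {k : ℕ}
    (hh : WfHeap X.S X.h) (hin : HeapIn N (domOf X.h) X.h)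
    (hM : (K.plug (.app (.fname f) V)).In N (domOf X.h) 0) (hθ : θ ⊆ domOf X.h)
    (hφ : ∀ n ∈ φ, n.idx < k) (hK : K.IsEval) (hv : V.IsValue) (ht : ClTyped X.S j V f.dom)
    (hlv : WfTy lv₀ f.dom)
    (hVOK : ∀ S' A, ClTyped S' lv₀ (Abs.toTm A) f.dom → VOK lv S' A.toTm f.dom) (i₁ i₂ : Layer) :
    ∃ S' h' χ, HMove s k X.S X.h (θ ∪ (mkAbs lv₀ k f.dom V).locs) S' h' χ ∧
      PlayerMove s lv X N φ θ (K.plug (.app (.fname f) V)) T (.call f (mkAbs lv₀ k f.dom V)) S' χ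
        ((mkAbs lv₀ k f.dom V).bind V ∪ bindOf χ h') (⟨X.S, K, f.cod, i₁, T, i₂⟩ :: X.ξ) := by
  have hV := ((Cx.in_plug hK).1 hM).2.2
  have hX : θ ∪ (mkAbs lv₀ k f.dom V).locs ⊆ domOf X.h := by
    refine Set.union_subset hθ fun l hl => ?_
    rw [mkAbs_locs ht hv hl] at hV; exact hV
  obtain ⟨S', h', χ, H⟩ := exists_hmove s k hh hX
  have he := mkAbs_entry ht hv lv₀ k
  obtain ⟨hR, hn, hd, hf⟩ := H.reveal hin hφ he.bindOK (bnd_bind _ _)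
    (fun n W hW => by have e : W = _ := hW.2; rw [e]; exact hV)
    (fun n hn => ⟨0, (mkAbs_names hn).1⟩)
  refine ⟨S', h', χ, H, .call hK hv (he.abst.mono Set.subset_union_left H.habs.cover), hR, hn,
    ⟨some f.cod, .call (hVOK _ _ (mkAbs_typed ht hv k hlv H.hok.store ?_)), _, rfl, rfl, rfl⟩,
    H.hok, H.restr.store,
    H.wf, H.least, hd, hf, (Abs.names_finite _).union (namesOf_finite H.fin)⟩
  rintro l rfl
  exact H.restr.typed (.inr (by rw [mkAbs_loc ht]; rfl))

theorem WfASub.lift {S i j ρ G} (h : WfASub S i ρ G) (hij : i ≤ j) : WfASub S j ρ G :=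
  ⟨h.dom, fun x T A hx hA => (h.typed x T A hx hA).lift hij, h.distinct⟩

theorem exists_run {s lv j : Layer} {X : Side} {N φ θ T} {b : BName} {d : LSub} {K : Cx} {k : ℕ}
    (hh : WfHeap X.S X.h) (hin : HeapIn N (domOf X.h) X.h)
    (hM : (K.plug (.unb b d)).In N (domOf X.h) 0) (hθ : θ ⊆ domOf X.h)
    (hφ : ∀ n ∈ φ, n.idx < k) (hK : K.IsEval) (hb : b.WF) (hk : ∀ x, x ∈ d.keys ↔ x ∈ b.ctx.dom)
    (hv : ∀ x V, d.lookup x = some V → V.IsValue)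
    (ht : ∀ x V T, (x, T) ∈ b.ctx → d.lookup x = some V → ClTyped X.S j V T)
    (hlv : s ≤ lv) (i₁ i₂ : Layer) :
    ∃ S' h' χ, HMove s k X.S X.h (θ ∪ locsOf (mkSub s k d b.ctx)) S' h' χ ∧
      PlayerMove s lv X N φ θ (K.plug (.unb b d)) T (.run b (mkSub s k d b.ctx)) S' χ
        (bindOf (mkSub s k d b.ctx) d.lookup ∪ bindOf χ h')
        (⟨X.S, K, b.ty, i₁, T, i₂⟩ :: X.ξ) := by
  have hV := ((Cx.in_plug hK).1 hM).2.2
  have hX : θ ∪ locsOf (mkSub s k d b.ctx) ⊆ domOf X.h := by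
    refine Set.union_subset hθ fun l hl => ?_
    obtain ⟨x, hx, -⟩ := mkSub_locs hv ht hl
    exact hV.lookup hx
  obtain ⟨S', h', χ, H⟩ := exists_hmove s k hh hX
  have hex : ∀ x A, mkSub s k d b.ctx x = some A → ∃ V, d.lookup x = some V ∧ Entry V A := by
    intro x A hA
    obtain ⟨T, V, hm, hV, rfl⟩ := mkSub_some hA
    exact ⟨V, hV, mkAbs_entry (ht x V T hm hV) (hv x V hV) _ _⟩
  have he : ∀ x A V, mkSub s k d b.ctx x = some A → d.lookup x = some V → Entry V A := by
    intro x A V hx hV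
    obtain ⟨V', hV', h⟩ := hex x A hx
    rw [hV] at hV'; cases hV'; exact h
  obtain ⟨hR, hn, hd, hf⟩ := H.reveal hin hφ (bindOf_ok (mkSub_distinct _ _ _ _) he)
    (bnd_bindOf fun x A hx => (hex x A hx).imp fun V h => h.1)
    (fun n W ⟨x, A, V, hx, hV', hW⟩ => by
      have e : W = _ := hW.2; rw [e]; exact hV.lookup hV')
    (fun n hn => mkSub_idx hn)
  have hG : WfLCtx s b.ctx := by
    have hb' := hb
    cases hb' with
    | box h1 h2 _ => exact ⟨h1, fun x T hx => (h2 x T hx).mono (Fin.zero_le _)⟩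
  refine ⟨S', h', χ, H, .run hK ?_ ?_, hR, hn, ⟨some b.ty, .run (WfASub.lift (mkSub_wf hG hk hv ht
    H.hok.store ?_) hlv), _, rfl, rfl, rfl⟩, H.hok, H.restr.store,
    H.wf, H.least, hd, hf, (namesOf_finite (mkSub_finite _ _ _ _)).union (namesOf_finite H.fin)⟩
  · intro x hx
    obtain ⟨A, hA⟩ := Option.isSome_iff_exists.1
      (mkSub_isSome (lv := s) (k := k) hx ((hk x).2 hx))
    obtain ⟨V, hV, he⟩ := hex x A hA
    refine ⟨V, A, hV, hA, he.abst.mono ?_ ?_⟩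
    · exact fun p hp => .inl ⟨x, A, V, hA, hV, hp⟩
    · exact fun l hl => H.habs.cover ⟨x, A, hA, hl⟩
  · intro x A hA
    obtain ⟨T, V, hm, -⟩ := mkSub_some hA
    exact LCtx.mem_dom.2 ⟨T, hm⟩
  · intro x l hl hx
    refine H.restr.typed (.inr ?_)
    obtain ⟨A, hA⟩ := Option.isSome_iff_exists.1
      (mkSub_isSome (lv := s) (k := k) hx ((hk x).2 hx))
    refine ⟨x, A, hA, ?_⟩
    obtain ⟨T, V, hm, hV, rfl⟩ := mkSub_some hA
    rw [hl] at hV; cases hV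
    rw [mkAbs_loc (ht x _ T hm hl)]; rfl

/-! ## Moves of well-typed sides -/

theorem VOK.of_one {S V T} (h : ClTyped S 1 V T) : VOK 1 S V T := .inl ⟨h.wf.2, h⟩

theorem VOK.one {s S V T} (h : VOK s S V T) : ClTyped S 1 V T := by
  rcases h with h | h
  · exact h.2.lift (layer_le_one s)
  · exact h.2.2

theorem VOK.of_wf {s S V T} (h : VOK s S V T) (hT : WfTy s T) : ClTyped S s V T := by
  rcases h with h | h
  · exact h.2
  · exact (h.1 hT).elim

theorem PBind.mkAbs {s lv S V T k n} (h : ClTyped S lv V T)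
    (h' : lv = s ∨ lv = 1 ∧ ∃ A : Abs, V = A.toTm) (hn : n ∈ (mkAbs lv k T V).names) :
    PBind s S n V := by
  cases T with
  | arr T₁ T₂ =>
    obtain rfl : n = _ := hn
    rcases h' with rfl | ⟨rfl, A, rfl⟩
    · exact .inl ⟨rfl, h⟩
    · refine .inr ⟨rfl, ?_, h⟩
      cases A with
      | fn f => exact ⟨f, rfl⟩
      | _ => cases h
  | box G T =>
    obtain rfl : n = _ := hn
    exact h.lift (layer_le_one lv)
  | unit => cases V <;> exact hn.elim
  | int => cases V <;> exact hn.elim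
  | ref => cases V <;> exact hn.elim

theorem HMove.pbind {s k S h X S' h' χ} (H : HMove s k S h X S' h' χ) (hh : HOK s S h) :
    ∀ n V, (n, V) ∈ bindOf χ h' → PBind s S n V := by
  rintro n V ⟨l, A, W, hA, hW, hn, e⟩
  obtain rfl : V = W := e
  obtain ⟨T, hV, hT, rfl⟩ := H.ent l A V hA hW
  rcases hh.typed l V T hV hT with ⟨hw, ht⟩ | ⟨hw, ha, ht⟩
  · rw [lvl, if_pos hw] at hn; exact .mkAbs ht (.inl rfl) hn
  · rw [lvl, if_neg hw] at hn; exact .mkAbs ht (.inr ⟨rfl, ha⟩) hn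

theorem HMove.ebind {s k S h X S' h' χ} (H : HMove s k S h X S' h' χ) (hh : HOK 1 S h) :
    ∀ n V, (n, V) ∈ bindOf χ h' → ClTyped S 1 V n.ty := by
  rintro n V ⟨l, A, W, hA, hW, hn, e⟩
  obtain rfl : V = W := e
  obtain ⟨T, hV, hT, rfl⟩ := H.ent l A V hA hW
  rw [(mkAbs_names hn).2]
  exact (hh.typed l V T hV hT).one

theorem exists_idx {φ : Set Name} (h : φ.Finite) : ∃ k, ∀ n ∈ φ, n.idx < k := by
  obtain ⟨k, hk⟩ := (h.image Name.idx).bddAbove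
  exact ⟨k + 1, fun n hn => Nat.lt_succ_of_le (hk ⟨n, hn, rfl⟩)⟩

/-- The terms that do not reduce. -/
def Stuck (M : Tm) : Prop :=
  M.IsValue ∨
  (∃ (K : Cx) (f : FName) (V : Tm), K.IsEval ∧ V.IsValue ∧ M = K.plug (.app (.fname f) V)) ∨
  ∃ (K : Cx) (b : BName) (d : LSub), K.IsEval ∧ M = K.plug (.unb b d)

theorem WfTy.cod {i T₁ T₂} (h : WfTy i (.arr T₁ T₂)) : WfTy i T₂ := by
  cases h with
  | arr _ h => exact h

theorem CxTy.hole_ty {S P' G' i' T' P G i T} (h : CxTy S P' G' i' T' .hole P G i T) : T' = T := by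
  generalize hC : Cx.hole = C at h
  cases h with
  | hole => rfl
  | _ => cases hC

theorem PTerm.typed {s S M j T} (h : PTerm s S M j T) : ClTyped S j M T := by
  rcases h with ⟨rfl, h⟩ | ⟨rfl, h, -⟩ <;> exact h

/-- A term of the program's own layer leaves behind a frame of that layer. A forwarded application
is its own redex, so its context is empty and the frame is the second kind of `PFrame`; a use of a
box name is never forwarded. New names carry the layer `j` of the term, or `lvl s T` in the heap,
because `AVal` ties the layer of a name to the layer at which its value is typed. This is where
`VOK` is needed: it provides exactly these typings for the heap. -/
theorem PSide.move {s P N φ θ M j T} (hP : PSide s P) (hM : PTerm s P.S M j T)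
    (hin : HeapIn N (domOf P.h) P.h) (hMi : M.In N (domOf P.h) 0) (hθ : θ ⊆ domOf P.h)
    (hφ : φ.Finite) (hst : Stuck M) :
    ∃ mv S' χ B ξ', PlayerMove s 1 P N φ θ M T mv S' χ B ξ' ∧
      PSide s ⟨P.S, P.h, P.γ ∪ B, ξ'⟩ ∧
      Act (P.act M j T φ θ) ⟨.player, mv, S', χ⟩
        (Side.pas ⟨P.S, P.h, P.γ ∪ B, ξ'⟩ (φ ∪ (mv.names ∪ namesOf χ)) (domOf χ)) := by
  obtain ⟨k, hk⟩ := exists_idx hφ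
  have hwf := hP.hok.wfHeap
  have hVOK : ∀ {i T} S' A, ClTyped S' i (Abs.toTm A) T → VOK 1 S' A.toTm T :=
    fun S' A h => .of_one (h.lift (layer_le_one _))
  rcases hst with hv | ⟨K, f, V, hK, hv, rfl⟩ | ⟨K, b, d, hK, rfl⟩
  · have ht := hM.typed
    obtain ⟨S', h', χ, H, pm⟩ := exists_ans (s := s) (lv := 1) (lv₀ := j) hwf hin hMi hθ hk hv ht
      ht.wf.2 hVOK
    refine ⟨_, S', χ, _, _, pm, ⟨hP.hok, ?_, hP.frames⟩, ?_⟩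
    · rintro n V (hV | ⟨hn, e⟩ | hV)
      · exact hP.bind n V hV
      · obtain rfl : V = M := e
        refine .mkAbs ht ?_ hn
        rcases hM with hM | ⟨rfl, -, h | ⟨f, A, rfl⟩⟩
        · exact .inl hM.1
        · exact .inr ⟨rfl, h⟩
        · exact hv.elim
      · exact H.pbind hP.hok n V hV
    · have := Act.PA (γ := P.γ) (ξ := P.ξ) hv (mkAbs_aval ht hv k) H.restr (H.aval hP.hok.typed)
        pm.disj pm.fresh
      simp only [Set.union_assoc] at this
      exact this
  · obtain ⟨T₁, ht, hKt⟩ := CxTy.of_plug hK hM.typed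
    have hc : (j = s ∨ j = 1 ∧ ∃ A : Abs, V = A.toTm) ∧
        ((j = s) ∨ K = .hole ∧ j = 1) := by
      rcases hM with ⟨rfl, -⟩ | ⟨rfl, -, ⟨A, h⟩ | ⟨g, A, h⟩⟩
      · exact ⟨.inl rfl, .inl rfl⟩
      · have := (Cx.plug_value hK (h ▸ A.toTm_value)).2
        exact this.elim
      · have hav : (K.plug (.app (.fname f) V)).IsAV := by
          rw [h]; exact ⟨trivial, A.toTm_value⟩
        rcases hav.plug hK with rfl | hf
        · cases h; exact ⟨.inr ⟨rfl, A, rfl⟩, .inr ⟨rfl, rfl⟩⟩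
        · exact hf.elim
    cases ht with
    | app h1 h2 =>
    cases h1 with
    | fname hcs hf hl =>
    obtain ⟨S', h', χ, H, pm⟩ := exists_call (s := s) (lv := 1) (lv₀ := j) (T := T) hwf hin hMi hθ
      hk hK hv h2 h2.wf.2 hVOK j j
    refine ⟨_, S', χ, _, _, pm, ⟨hP.hok, ?_, ?_⟩, ?_⟩
    · rintro n W (hV | ⟨hn, e⟩ | hV)
      · exact hP.bind n W hV
      · obtain rfl : W = V := e
        exact .mkAbs h2 hc.1 hn
      · exact H.pbind hP.hok n W hV
    · rintro F (_ | ⟨_, hF⟩)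
      · rcases hc.2 with rfl | ⟨rfl, rfl⟩
        · refine .inl ⟨rfl, rfl, ?_, hKt⟩
          exact (WfTy.cod hf).mono hl
        · exact .inr ⟨rfl, hKt.hole_ty, rfl, rfl⟩
      · exact hP.frames F hF
    · have := Act.PQF (γ := P.γ) (ξ := P.ξ) hK hv hf hKt (mkAbs_aval h2 hv k) H.restr
        (H.aval hP.hok.typed) pm.disj pm.fresh
      simp only [Set.union_assoc] at this
      exact this
  · obtain ⟨rfl, ht⟩ : j = s ∧ ClTyped P.S s (K.plug (.unb b d)) T := by
      rcases hM with h | ⟨rfl, -, ⟨A, h⟩ | ⟨g, A, h⟩⟩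
      · exact h
      · have hv : (K.plug (.unb b d)).IsValue := by rw [h]; exact A.toTm_value
        have := (Cx.plug_value hK hv).2
        exact this.elim
      · have hav : (K.plug (.unb b d)).IsAV := by
          rw [h]; exact ⟨trivial, A.toTm_value⟩
        rcases hav.plug hK with rfl | hf
        · cases h
        · exact hf.elim
    obtain ⟨T₁, ht, hKt⟩ := CxTy.of_plug hK ht
    cases ht with
    | unb hcs hb hn hkk hv h2 =>
    have h2' : ∀ x V T, (x, T) ∈ b.ctx → d.lookup x = some V → ClTyped P.S j V T :=
      fun x V T hx hV => h2 x V T hx hV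
    obtain ⟨S', h', χ, H, pm⟩ := exists_run (s := j) (lv := 1) (T := T) hwf hin hMi hθ
      hk hK hb hkk hv h2' (layer_le_one j) j j
    refine ⟨_, S', χ, _, _, pm, ⟨hP.hok, ?_, ?_⟩, ?_⟩
    · rintro n W (hV | ⟨x, A, V, hA, hV, hnA, e⟩ | hV)
      · exact hP.bind n W hV
      · obtain rfl : W = V := e
        obtain ⟨T', V', hm, hV', rfl⟩ := mkSub_some hA
        rw [hV] at hV'; cases hV'
        exact .mkAbs (h2 x W T' hm hV) (.inl rfl) hnA
      · exact H.pbind hP.hok n W hV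
    · rintro F (_ | ⟨_, hF⟩)
      · refine .inl ⟨rfl, rfl, ?_, hKt⟩
        cases hb with
        | box _ _ h => exact h.mono (Fin.zero_le _)
      · exact hP.frames F hF
    · have hnd : (b.ctx.map Prod.fst).Nodup := by
        have hb' := hb
        cases hb' with
        | box h _ _ => exact h
      have := Act.PQB (γ := P.γ) (ξ := P.ξ) hK hb hKt (mkSub_aval hnd hkk hv h2') H.restr
        (H.aval hP.hok.typed) pm.disj pm.fresh
      simp only [Set.union_assoc] at this
      exact this

/-- No transition of the environment itself is required, only a move that the program can accept. So
the environment is free to choose the layers of its names: `s` if the program can use the type, and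
1 otherwise. In the second case the abstract value falls under the second alternative of `VOK`. -/
theorem ESide.move (s : Layer) {E N φ θ M T} (hE : ESide E) (hM : ClTyped E.S 1 M T)
    (hin : HeapIn N (domOf E.h) E.h) (hMi : M.In N (domOf E.h) 0) (hθ : θ ⊆ domOf E.h)
    (hφ : φ.Finite) (hst : Stuck M) :
    ∃ mv S' χ B ξ', PlayerMove s s E N φ θ M T mv S' χ B ξ' ∧
      ESide ⟨E.S, E.h, E.γ ∪ B, ξ'⟩ ∧ (∀ A, mv = .ans A → M.IsValue) := by
  obtain ⟨k, hk⟩ := exists_idx hφ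
  have hwf := hE.hok.wfHeap
  have hVOK : ∀ {T} S' A, ClTyped S' (lvl s T) (Abs.toTm A) T → VOK s S' A.toTm T := by
    intro T S' A h
    by_cases hw : WfTy s T
    · rw [lvl, if_pos hw] at h; exact .inl ⟨hw, h⟩
    · rw [lvl, if_neg hw] at h; exact .inr ⟨hw, ⟨A, rfl⟩, h⟩
  rcases hst with hv | ⟨K, f, V, hK, hv, rfl⟩ | ⟨K, b, d, hK, rfl⟩
  · obtain ⟨S', h', χ, H, pm⟩ := exists_ans (s := s) (lv := s) (lv₀ := lvl s T) hwf hin hMi hθ hk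
      hv hM (lvl_wf hM.wf.2) hVOK
    refine ⟨_, S', χ, _, _, pm, ⟨hE.hok, ?_, hE.frames⟩, fun _ _ => hv⟩
    rintro n V (hV | ⟨hn, e⟩ | hV)
    · exact hE.bind n V hV
    · obtain rfl : V = M := e
      rw [(mkAbs_names hn).2]; exact hM
    · exact H.ebind hE.hok n V hV
  · obtain ⟨T₁, ht, hKt⟩ := CxTy.of_plug hK hM
    cases ht with
    | app h1 h2 =>
    cases h1 with
    | fname hcs hf hl =>
    obtain ⟨S', h', χ, H, pm⟩ := exists_call (s := s) (lv := s) (lv₀ := lvl s f.dom) (T := T) hwf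
      hin hMi hθ hk hK hv h2 (lvl_wf h2.wf.2) hVOK 1 1
    refine ⟨_, S', χ, _, _, pm, ⟨hE.hok, ?_, ?_⟩, by rintro A ⟨⟩⟩
    · rintro n W (hV | ⟨hn, e⟩ | hV)
      · exact hE.bind n W hV
      · obtain rfl : W = V := e
        rw [(mkAbs_names hn).2]; exact h2
      · exact H.ebind hE.hok n W hV
    · rintro F (_ | ⟨_, hF⟩)
      · exact hKt
      · exact hE.frames F hF
  · obtain ⟨T₁, ht, hKt⟩ := CxTy.of_plug hK hM
    cases ht with
    | unb hcs hb hn hkk hv h2 =>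
    have h2' : ∀ x V T, (x, T) ∈ b.ctx → d.lookup x = some V → ClTyped E.S 1 V T :=
      fun x V T hx hV => h2 x V T hx hV
    obtain ⟨S', h', χ, H, pm⟩ := exists_run (s := s) (lv := s) (T := T) hwf hin hMi hθ
      hk hK hb hkk hv h2' le_rfl 1 1
    refine ⟨_, S', χ, _, _, pm, ⟨hE.hok, ?_, ?_⟩, by rintro A ⟨⟩⟩
    · rintro n W (hV | ⟨x, A, V, hA, hV, hnA, e⟩ | hV)
      · exact hE.bind n W hV
      · obtain rfl : W = V := e
        obtain ⟨T', V', hm, hV', rfl⟩ := mkSub_some hA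
        rw [hV] at hV'; cases hV'
        rw [(mkAbs_names hnA).2]; exact h2 x W T' hm hV
      · exact H.ebind hE.hok n W hV
    · rintro F (_ | ⟨_, hF⟩)
      · exact hKt
      · exact hE.frames F hF

theorem HasTy.inst_toTms {S i ρ} {G : LCtx} {M T} (h : HasTy S [] [] G [] 0 M T)
    (hρ : WfASub S i ρ G) : ClTyped S i (M.inst (toTms ρ)) T := by
  refine h.inst (Fin.zero_le _) (.nil i) (by simp) (fun x V hV => toTms_value hV) fun x T hx => ?_
  obtain ⟨A, hA⟩ := Option.isSome_iff_exists.1 ((hρ.dom x).2 (LCtx.mem_dom.2 ⟨T, hx⟩))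
  exact ⟨A.toTm, by simp [toTms, hA], hρ.typed x T A hx hA⟩

theorem WfASub.store {S S' i ρ G} (h : WfASub S i ρ G) (hS : PSub S S') (hS' : WfSCtx S') :
    WfASub S' i ρ G :=
  ⟨h.dom, fun x T A hx hA => (h.typed x T A hx hA).store hS hS', h.distinct⟩

/-- The answer of a well-typed environment to a move. -/
theorem ESide.receive {s E P N N' φ θ M T mv S' χ B ξ'} (hE : ESide E)
    (sE : Supp N' φ E.h E.γ (E.ξ.map Frame.K))
    (pm : PlayerMove s 1 P N φ θ M T mv S' χ B ξ') (hM : M.In N (domOf P.h) 0) (hN : N ⊆ bnd E.γ)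
    (hc : Chain T E.ξ P.ξ) (hne : E.ξ ≠ []) (ha : Agree E.S S') :
    ∃ M' T' ζ, OMv E.γ (E.ξ.map Frame.K) mv M' (ζ.map Frame.K) ∧
      ClTyped (pUnion E.S S') 1 M' T' ∧
      ESide ⟨pUnion E.S S', pUnion (toTms χ) E.h, E.γ, ζ⟩ ∧ Chain T' ξ' ζ ∧
      ζ.length + P.ξ.length + 1 = E.ξ.length + ξ'.length := by
  obtain ⟨o, hty, hpush⟩ := pm.ty
  have hS := PSub.pUnion_left E.S S'
  have hok := hE.hok.union (HOK.of_wfHeap pm.hok.wfHeap) ha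
  have hE' := hE.heap hS hok
  have hS'' := PSub.pUnion_right ha
  cases hty with
  | ans hA =>
    obtain rfl : ξ' = P.ξ := hpush
    rcases hξ : E.ξ with _ | ⟨F, ζ⟩
    · exact (hne hξ).elim
    · rw [hξ] at hc
      have hF := hE'.frames
      simp only [hξ] at hF
      cases hc with
      | cons hc =>
      refine ⟨F.K.plug (Abs.toTm _), F.T₂, ζ, .ans, ?_, ⟨hok, hE'.bind, fun F h =>
        hF F (List.mem_cons_of_mem _ h)⟩, hc, by simp; omega⟩
      exact (hF F List.mem_cons_self).plug (hA.one.store hS'' hok.store)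
  | @call f A hA =>
    obtain ⟨F, rfl, h1, rfl⟩ := hpush
    -- The called name occurs in the term of the caller, hence it is one of the names to which the
    -- receiver has assigned a value.
    have hf : Name.fn f ∈ N := by
      generalize hm : Move.call f A = m at pm
      have := pm.pmv
      rw [← hm] at this
      cases this with
      | call hK _ _ => exact ((Cx.in_plug hK).1 hM).2.1
    obtain ⟨U, hU⟩ := hN hf
    refine ⟨.app U A.toTm, f.cod, E.ξ, .call hU, ?_, hE', h1 ▸ .cons hc, by simp; omega⟩
    exact .app (hE'.bind _ _ hU) (hA.one.store hS'' hok.store)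
  | @run b ρ hρ =>
    obtain ⟨F, rfl, h1, rfl⟩ := hpush
    have hb : Name.bx b ∈ N := by
      generalize hm : Move.run b ρ = m at pm
      have := pm.pmv
      rw [← hm] at this
      cases this with
      | run hK _ _ => exact ((Cx.in_plug hK).1 hM).2.1
    obtain ⟨U, hU⟩ := hN hb
    refine ⟨U.unboxed.inst (toTms ρ), b.ty, E.ξ, .run hU, ?_, hE', h1 ▸ .cons hc, by simp; omega⟩
    exact (HasTy.unboxed (hE'.bind _ _ hU) (sE.bind _ _ hU).2.1).inst_toTms
      (hρ.store hS'' hok.store)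

/-- The answer of a well-typed program to a move. -/
theorem PSide.receive {s P E N N' φ θ M T mv S' χ B ξ'} (hP : PSide s P)
    (sP : Supp N' φ P.h P.γ (P.ξ.map Frame.K))
    (pm : PlayerMove s s E N φ θ M T mv S' χ B ξ') (hM : M.In N (domOf E.h) 0) (hN : N ⊆ bnd P.γ)
    (hc : Chain T P.ξ E.ξ) (hne : ∀ A, mv = .ans A → P.ξ ≠ []) (ha : Agree P.S S')
    (hχ : domOf χ ∩ domOf P.h = θ) :
    ∃ M' j T' ζ, Act (P.pas φ θ) ⟨.opponent, mv, S', χ⟩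
        (Side.act ⟨pUnion P.S S', pUnion (toTms χ) P.h, P.γ, ζ⟩ M' j T'
          (φ ∪ (mv.names ∪ namesOf χ)) (domOf χ)) ∧
      OMv P.γ (P.ξ.map Frame.K) mv M' (ζ.map Frame.K) ∧
      PTerm s (pUnion P.S S') M' j T' ∧
      PSide s ⟨pUnion P.S S', pUnion (toTms χ) P.h, P.γ, ζ⟩ ∧ Chain T' ξ' ζ ∧
      ζ.length + E.ξ.length + 1 = P.ξ.length + ξ'.length := by
  obtain ⟨o, hty, hpush⟩ := pm.ty
  have hS := PSub.pUnion_left P.S S'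
  have hok := hP.hok.union pm.hok ha
  have hP' := hP.heap hS hok
  have hS'' := PSub.pUnion_right ha
  have opp : OppHeap P.S P.h θ mv.locs S' χ := ⟨pm.wf, ha, hχ, pm.least⟩
  have hd := pm.disj
  have hf := pm.fresh
  cases hty with
  | @ans A hA =>
    obtain rfl : ξ' = E.ξ := hpush
    rcases hξ : P.ξ with _ | ⟨F, ζ⟩
    · exact (hne A rfl hξ).elim
    · rw [hξ] at hc
      have hF := hP'.frames
      simp only [hξ] at hF
      have hA' := hA.store hS'' hok.store
      have hF₀ := hF F List.mem_cons_self
      cases hc with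
      | cons hc =>
      refine ⟨F.K.plug A.toTm, F.i₂, F.T₂, ζ, ?_, .ans, ?_, ⟨hok, hP'.bind, fun F h =>
        hF F (List.mem_cons_of_mem _ h)⟩, hc, by simp; omega⟩
      -- The answer must be typed at the layer of the frame. In a frame of the program's own layer
      -- the type of the hole is of that layer, which excludes the second alternative of `VOK`; a
      -- forwarding frame accepts everything at layer 1.
      · have hAi : ClTyped S' F.i₁ A.toTm F.T₁ := by
          rcases hF₀ with ⟨h1, -, hw, -⟩ | ⟨-, -, h1, -⟩
          · rw [h1]; exact hA.of_wf hw
          · rw [h1]; exact hA.one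
        have := Act.OA (S₀ := F.S) (K := F.K) (T₂ := F.T₂) (i₂ := F.i₂) (γ := P.γ) (ξ := ζ)
          hAi opp hd hf
        rw [Set.union_assoc] at this
        simp only [Side.pas, hξ]
        exact this
      · rcases hF₀ with ⟨-, h2, hw, ht⟩ | ⟨hK, hT, -, h2⟩
        · exact .inl ⟨h2, ht.plug (hA'.of_wf hw)⟩
        · rw [hK, ← hT]; exact .inr ⟨h2, hA'.one, .inl ⟨A, rfl⟩⟩
  | @call f A hA =>
    obtain ⟨F, rfl, h1, rfl⟩ := hpush
    have hfN : Name.fn f ∈ N := by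
      generalize hm : Move.call f A = m at pm
      have := pm.pmv
      rw [← hm] at this
      cases this with
      | call hK _ _ => exact ((Cx.in_plug hK).1 hM).2.1
    obtain ⟨U, hU⟩ := hN hfN
    have hUb := hP'.bind _ _ hU
    refine ⟨.app U A.toTm, f.lvl, f.cod, P.ξ, ?_, .call hU, ?_, hP', h1 ▸ .cons hc,
      by simp; omega⟩
    · have hAi : ClTyped S' f.lvl A.toTm f.dom := by
        rcases hUb with ⟨h1, ht⟩ | ⟨h1, -, ht⟩
        · rw [h1]
          cases ht.wf.2 with
          | arr h _ => exact hA.of_wf h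
        · rw [h1]; exact hA.one
      -- The argument is taken at the layer of `f`, so that the layer of the new term, a maximum, is
      -- again that of `f`.
      have := Act.OQF (ξ := P.ξ) hU hAi opp hd hf
      rw [Set.union_assoc, max_self] at this
      exact this
    · have hA' := hA.store hS'' hok.store
      rcases hUb with ⟨h1, ht⟩ | ⟨h1, ⟨g, rfl⟩, ht⟩
      · refine .inl ⟨h1, .app ht ?_⟩
        cases ht.wf.2 with
        | arr h _ => exact hA'.of_wf h
      · exact .inr ⟨h1, .app ht hA'.one, .inr ⟨g, A, rfl⟩⟩
  | @run b ρ hρ =>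
    obtain ⟨F, rfl, h1, rfl⟩ := hpush
    have hb : Name.bx b ∈ N := by
      generalize hm : Move.run b ρ = m at pm
      have := pm.pmv
      rw [← hm] at this
      cases this with
      | run hK _ _ => exact ((Cx.in_plug hK).1 hM).2.1
    obtain ⟨U, hU⟩ := hN hb
    refine ⟨U.unboxed.inst (toTms ρ), s, b.ty, P.ξ, ?_, .run hU, ?_, hP', h1 ▸ .cons hc,
      by simp; omega⟩
    · have := Act.OQB (ξ := P.ξ) hU hρ opp hd hf
      rw [Set.union_assoc] at this
      exact this
    · exact .inl ⟨rfl, (HasTy.unboxed (hP'.bind _ _ hU) (sP.bind _ _ hU).2.1).inst_toTms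
        (hρ.store hS'' hok.store)⟩

-- Extraction of a trace from a converging composition.

/-! ## Traces -/

theorem Tau.traces {C C' t} (h : Tau C C') (ht : t ∈ CfgTraces C') : t ∈ CfgTraces C := by
  obtain ⟨S, k, γ, φ, θ, r⟩ := ht
  cases r with
  | nil => cases h
  | cons w r =>
    obtain ⟨D, h1, h2⟩ := w
    exact ⟨S, k, γ, φ, θ, .cons ⟨D, .head h h1, h2⟩ r⟩

theorem Act.traces {C a C' t} (h : Act C a C') (ht : t ∈ CfgTraces C') : a :: t ∈ CfgTraces C := by
  obtain ⟨S, k, γ, φ, θ, r⟩ := ht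
  exact ⟨S, k, γ, φ, θ, .cons ⟨C, .refl, h⟩ r⟩

theorem Run.eq_of_nil {C C'} (r : Run C [] C') : C = C' := by
  cases r; rfl

theorem CfgTraces.cons {C a t} (h : a :: t ∈ CfgTraces C) :
    ∃ C'' C', Relation.ReflTransGen Tau C C'' ∧ Act C'' a C' ∧ t ∈ CfgTraces C' := by
  obtain ⟨S, k, γ, φ, θ, r⟩ := h
  cases r with
  | cons w r =>
    obtain ⟨D, h1, h2⟩ := w
    exact ⟨D, _, h1, h2, S, k, γ, φ, θ, r⟩

theorem CfgTraces.passive_cons {S h γ φ ξ θ a t} (hc : a :: t ∈ CfgTraces (.passive S h γ φ ξ θ)) :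
    ∃ C', Act (.passive S h γ φ ξ θ) a C' ∧ t ∈ CfgTraces C' := by
  obtain ⟨C'', C', r, ha, ht⟩ := CfgTraces.cons hc
  rcases r.cases_head with rfl | ⟨D, h, -⟩
  · exact ⟨C', ha, ht⟩
  · cases h

theorem Game.finiteX {NX NY φ θ M hX γX ξX hY γY ξY Q H}
    (g : Game NX NY φ θ M hX γX ξX hY γY ξY Q H) : (domOf hX).Finite := by
  obtain ⟨wX, wY, c, -⟩ := g.comp
  refine Set.Finite.of_finite_image (c.fin.subset ?_) c.injX
  rintro _ ⟨l, hl, rfl⟩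
  obtain ⟨V, hV⟩ := mem_domOf.1 hl
  exact mem_domOf.2 ⟨_, c.heapX l V hV⟩

/-- Silent transitions of an arbitrary program are mirrored in the composite, with any fresh
location. Since `Step` is closed under steps at the front, convergence has to be transported
backwards only, and no determinism is needed. -/
theorem Game.taus {NX NY φ θ M j T S h γ ξ hY γY ξY Q H C}
    (r : Relation.ReflTransGen Tau (.active M j T S h γ φ ξ θ) C)
    (g : Game NX NY φ θ M h γ (ξ.map Frame.K) hY γY ξY Q H) :
    ∃ M' S' h' Q' H', C = .active M' j T S' h' γ φ ξ θ ∧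
      Game NX NY φ θ M' h' γ (ξ.map Frame.K) hY γY ξY Q' H' ∧
      (Converges Q' H' → Converges Q H) := by
  induction r with
  | refl => exact ⟨M, S, h, Q, H, rfl, g, id⟩
  | tail _ s ih =>
    obtain ⟨M', S', h', Q', H', rfl, g', hc⟩ := ih
    cases s with
    | mk s _ _ _ =>
    obtain ⟨a, ha, s⟩ := s.toSt g'.finiteX
    obtain ⟨a', ha', -⟩ := exists_fresh g'.finite ∅ Set.finite_empty
    obtain ⟨Q'', H'', s', g''⟩ := g'.st s ha ha'
    exact ⟨_, _, _, _, _, rfl, g'', fun h => hc (.head s'.toStep h)⟩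

/-! ## Compatible sides -/

structure Compat (φ : Set Name) (θ : Set Loc) (X Y : Side) : Prop where
  fin : φ.Finite
  agree : Agree X.S Y.S
  shared : domOf X.h ∩ domOf Y.h = θ

/-- The transition system asks for a location that is new for the active side. Here it must also be
new for the other side, so that the shared locations stay the same; this can be arranged because the
run of the first program is constructed and not given. -/
theorem Compat.st {φ θ X Y s s' a M M' h' S'} (c : Compat φ θ X Y) (hX : HOK s X.S X.h)
    (hY : HOK s' Y.S Y.h) (st : St a M X.h M' h') (ha : a ∉ domOf Y.h) (hS : PSub X.S S')
    (hX' : HOK s S' h') : Compat φ θ ⟨S', h', X.γ, X.ξ⟩ Y := by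
  have hd : ∀ l ∈ domOf h', l = a ∨ l ∈ domOf X.h := fun l hl => st.dom.2 hl
  refine ⟨c.fin, fun l T T' hl hl' => ?_, ?_⟩
  · have hlY : l ∈ domOf Y.h := hY.dom ▸ mem_domOf.2 ⟨T', hl'⟩
    have hl₁ : l ∈ domOf h' := hX'.dom ▸ mem_domOf.2 ⟨T, hl⟩
    rcases hd l hl₁ with rfl | hl₂
    · exact (ha hlY).elim
    · rw [hX.dom] at hl₂
      obtain ⟨T'', hT⟩ := mem_domOf.1 hl₂
      have := hS _ _ hT
      have hl : S' l = some T := hl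
      rw [hl] at this; cases this
      exact c.agree l T T' hT hl'
  · rw [← c.shared]
    refine Set.Subset.antisymm ?_ (Set.inter_subset_inter_left _ st.dom.1)
    rintro l ⟨h1, h2⟩
    rcases hd l h1 with rfl | h1
    · exact (ha h2).elim
    · exact ⟨h1, h2⟩

theorem Compat.move {s lv φ θ X Y N M T mv S' χ B ξ' ζ} (c : Compat φ θ X Y)
    (pm : PlayerMove s lv X N φ θ M T mv S' χ B ξ') :
    Agree Y.S S' ∧ domOf χ ∩ domOf Y.h = θ ∧
    Compat (φ ∪ (mv.names ∪ namesOf χ)) (domOf χ)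
      ⟨pUnion Y.S S', pUnion (toTms χ) Y.h, Y.γ, ζ⟩ ⟨X.S, X.h, X.γ ∪ B, ξ'⟩ := by
  have hd := pm.rev.dom
  have hθ := pm.rev.sub
  have hsh := c.shared
  refine ⟨fun l T T' hl hl' => (c.agree l T' T (pm.sub _ _ hl') hl).symm, ?_, c.fin.union pm.fin,
    fun l T T' hl hl' => ?_, ?_⟩
  · refine Set.Subset.antisymm (fun l h => hsh ▸ ⟨hd h.1, h.2⟩) fun l h => ⟨hθ h, ?_⟩
    rw [← hsh] at h; exact h.2
  · rcases pUnion_some hl with hl | ⟨-, hl⟩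
    · exact (c.agree l T' T hl' hl).symm
    · have := pm.sub _ _ hl
      have hl' : X.S l = some T' := hl'
      rw [hl'] at this; cases this; rfl
  · simp only [domOf_pUnion, domOf_toTms]
    refine Set.Subset.antisymm ?_ fun l h => ⟨.inl h, hd h⟩
    rintro l ⟨h | h, h'⟩
    · exact h
    · exact hθ (hsh ▸ ⟨h', h⟩)

theorem bnd_union (γ B : Set (Name × Tm)) : bnd (γ ∪ B) = bnd γ ∪ bnd B := by
  ext n; simp [bnd, exists_or]

theorem Supp.bnd {N φ h γ ξ} (hs : Supp N φ h γ ξ) : bnd γ ⊆ φ :=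
  fun n ⟨V, hV⟩ => (hs.bind n V hV).1

/-! ## The composition of a program with an environment -/

abbrev Ks (ξ : List Frame) : List Cx := ξ.map Frame.K

/-- A program of layer `s` at work, in an environment. -/
structure PState (s : Layer) (φ : Set Name) (θ : Set Loc) (P E : Side) (M : Tm) (j : Layer) (T : Ty)
    (Q : Tm) (H : Heap) (W : Name → ℕ) : Prop where
  p : PSide s P
  e : ESide E
  compat : Compat φ θ P E
  term : PTerm s P.S M j T
  chain : Chain T E.ξ P.ξ
  len : E.ξ.length = P.ξ.length + 1
  game : Game (bnd E.γ) (bnd P.γ) φ θ M P.h P.γ (Ks P.ξ) E.h E.γ (Ks E.ξ) Q H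
  wP : WOK W P.γ
  wE : WOK W E.γ

/-- An environment at work, with a program of layer `s`. -/
structure EState (s : Layer) (φ : Set Name) (θ : Set Loc) (P E : Side) (M : Tm) (T : Ty)
    (Q : Tm) (H : Heap) (W : Name → ℕ) : Prop where
  p : PSide s P
  e : ESide E
  compat : Compat φ θ E P
  term : ClTyped E.S 1 M T
  chain : Chain T P.ξ E.ξ
  len : E.ξ.length = P.ξ.length
  game : Game (bnd P.γ) (bnd E.γ) φ θ M E.h E.γ (Ks E.ξ) P.h P.γ (Ks P.ξ) Q H
  wP : WOK W P.γ
  wE : WOK W E.γ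

/-- There is a trace of the program that makes all its programs converge in the environment. -/
def PGoal (φ : Set Name) (θ : Set Loc) (P E : Side) (M : Tm) (j : Layer) (T : Ty) : Prop :=
  ∃ t ∈ CfgTraces (P.act M j T φ θ), ∀ (P₂ : Side) M₂ j₂ T₂ Q₂ H₂,
    Game φ φ φ θ M₂ P₂.h P₂.γ (Ks P₂.ξ) E.h E.γ (Ks E.ξ) Q₂ H₂ →
    t ∈ CfgTraces (P₂.act M₂ j₂ T₂ φ θ) → Converges Q₂ H₂

def EGoal (φ : Set Name) (θ : Set Loc) (P E : Side) (M : Tm) : Prop :=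
  ∃ t ∈ CfgTraces (P.pas φ θ), ∀ (P₂ : Side) Q₂ H₂,
    Game φ φ φ θ M E.h E.γ (Ks E.ξ) P₂.h P₂.γ (Ks P₂.ξ) Q₂ H₂ →
    t ∈ CfgTraces (P₂.pas φ θ) → Converges Q₂ H₂

/-- `n` is the number of steps of the composite; `n`, `m₁`, `m₂` are the components of the
lexicographic induction in `claims`. -/
def PClaim (s : Layer) (n m₁ m₂ : ℕ) : Prop := ∀ φ θ P E M j T Q H W,
  PState s φ θ P E M j T Q H W → ConvN n Q H → msr₁ W M (Ks P.ξ) (Ks E.ξ) = m₁ →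
  msr₂ W M = m₂ → PGoal φ θ P E M j T

def EClaim (s : Layer) (n m₁ m₂ : ℕ) : Prop := ∀ φ θ P E M T Q H W,
  EState s φ θ P E M T Q H W → ConvN n Q H → msr₁ W M (Ks E.ξ) (Ks P.ξ) = m₁ →
  msr₂ W M = m₂ → EGoal φ θ P E M

theorem Prog.stuck {a h M} (p : Prog a h M) : (∃ M' h', St a M h M' h') ∨ Stuck M := by
  rcases p with p | p | p
  · exact .inr (.inl p)
  · exact .inl p
  · exact .inr (.inr p)

theorem PTerm.st {s S M j T a h M' h'} (hM : PTerm s S M j T) (st : St a M h M' h') :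
    j = s ∧ ClTyped S s M T := by
  rcases hM with h | ⟨-, -, ⟨A, rfl⟩ | ⟨f, A, rfl⟩⟩
  · exact h
  · exact (st.not_value A.toTm_value).elim
  · cases st with
    | app1 st => exact (st.not_value trivial).elim
    | app2 _ st => exact (st.not_value A.toTm_value).elim

theorem PMv.mono {N N' φ θ h χ B ξ M mv ξ'} (p : PMv N φ θ h χ B ξ M mv ξ') (hN : N ⊆ N') :
    PMv N' φ θ h χ B ξ M mv ξ' := by
  cases p with
  | ans h1 h2 h3 => exact .ans h1 (Tm.In.mono _ hN subset_rfl le_rfl h2) h3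
  | call h1 h2 h3 => exact .call h1 h2 h3
  | run h1 h2 h3 => exact .run h1 h2 h3

theorem Reveal.mono {N N' φ θ h B χ nm} (r : Reveal N φ θ h B χ nm) (hN : N ⊆ N') :
    Reveal N' φ θ h B χ nm :=
  ⟨r.bind, fun n V hV => ⟨(r.fresh n V hV).1, (r.fresh n V hV).2.1,
    Tm.In.mono _ hN subset_rfl le_rfl (r.fresh n V hV).2.2⟩, r.heap, r.sub⟩

/-- If the program reduces, the composite uses up one step and the trace gets a silent transition.
If it is stuck, it makes a move and the environment takes over with the same composite and a smaller
measure. The second claim goes through at the same time: a program with the trace found here reaches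
the same move after silent steps, and the exchange leads to the situation to which the induction
hypothesis applies. -/
theorem PState.step {s φ θ P E M j T Q H W n m₁ m₂} (g : PState s φ θ P E M j T Q H W)
    (c : ConvN n Q H)
    (ih : ∀ n' m₁' m₂', (n' < n ∨ n' = n ∧ (m₁' < m₁ ∨ m₁' = m₁ ∧ m₂' < m₂)) →
      PClaim s n' m₁' m₂' ∧ EClaim s n' m₁' m₂')
    (h1 : msr₁ W M (Ks P.ξ) (Ks E.ξ) = m₁) (h2 : msr₂ W M = m₂) : PGoal φ θ P E M j T := by
  obtain ⟨a, ha, haE⟩ := exists_fresh g.p.hok.finite _ g.e.hok.finite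
  rcases (g.term.typed.prog (g.p.hok.dom ▸ subset_rfl) ha M).stuck with ⟨M', h', st⟩ | hst
  · obtain ⟨rfl, hM⟩ := g.term.st st
    obtain ⟨S', hS, hok, hM'⟩ := st.ty g.p.hok hM
    have step : ∀ a', H a' = none → ∃ Q' H', St a' Q H Q' H' ∧ Game (bnd E.γ) (bnd P.γ) φ θ M' h'
        P.γ (Ks P.ξ) E.h E.γ (Ks E.ξ) Q' H' := fun a' ha' => g.game.st st ha ha'
    obtain ⟨k, Q', H', rfl, c', game⟩ : ∃ k Q' H', n = k + 1 ∧ ConvN k Q' H' ∧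
        Game (bnd E.γ) (bnd P.γ) φ θ M' h' P.γ (Ks P.ξ) E.h E.γ (Ks E.ξ) Q' H' := by
      cases n with
      | zero =>
        obtain ⟨a', ha', -⟩ := exists_fresh g.game.finite ∅ Set.finite_empty
        obtain ⟨Q', H', s', -⟩ := step a' ha'
        exact (s'.not_value c).elim
      | succ k =>
        obtain ⟨a', Q', H', ha', s', c'⟩ := c
        obtain ⟨Q'', H'', s'', game⟩ := step a' ha'
        -- The step of the program is replayed with the location `a'` used by the given step of the
        -- composite; then the two steps coincide by determinism.
        obtain ⟨rfl, rfl⟩ := s'.det s''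
        exact ⟨k, Q', H', rfl, c', game⟩
    obtain ⟨t, ht, hall⟩ := (ih k _ _ (.inl k.lt_succ_self)).1 φ θ ⟨S', h', P.γ, P.ξ⟩ E M' j T Q' H' W
      ⟨g.p.heap hS hok, g.e, g.compat.st g.p.hok g.e.hok st haE hS hok, .inl ⟨rfl, hM'⟩, g.chain,
        g.len, game, g.wP, g.wE⟩ c' rfl rfl
    exact ⟨t, Tau.traces (.mk st.toStep hS hok.wfHeap hM') ht, hall⟩
  · have hθ : θ ⊆ domOf P.h := fun l hl => by rw [← g.compat.shared] at hl; exact hl.1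
    obtain ⟨mv, S', χ, B, ξ', pm, hP, hact⟩ := g.p.move g.term g.game.suppX.heap g.game.term hθ
      g.compat.fin hst
    obtain ⟨hag, hχ, -⟩ := g.compat.move (ζ := []) pm
    obtain ⟨M', T', ζ, ho, hM', hE, hch, hlen⟩ := g.e.receive g.game.suppY pm g.game.term subset_rfl
      g.chain (by intro h; have := g.len; simp [h] at this) hag
    obtain ⟨W', w1, w2, hm⟩ := exists_measure_lt g.game.term g.game.suppX g.game.suppY g.wP g.wE
      pm.pmv pm.rev ho
    have game := g.game.exchange pm.pmv pm.rev ho hχ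
    have hsub : bnd P.γ ∪ (mv.names ∪ namesOf χ) ⊆ bnd (P.γ ∪ B) := by
      rw [bnd_union]; exact Set.union_subset_union_right _ pm.names
    have game' := game.mono hsub subset_rfl game.suppY.bnd
      (g.game.suppX.sub.trans Set.subset_union_left)
    rw [h1, h2] at hm
    obtain ⟨t, ht, hall⟩ := (ih n _ _ (.inr ⟨rfl, hm⟩)).2 _ _ ⟨P.S, P.h, P.γ ∪ B, ξ'⟩
      ⟨pUnion E.S S', pUnion (toTms χ) E.h, E.γ, ζ⟩ M' T' Q H W'
      ⟨hP, hE, (g.compat.move pm).2.2, hM', hch, by have := g.len; simp; omega, game', w1, w2⟩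
      c rfl rfl
    -- The reply `ho` of the environment depends on the move alone, so it is also the reply to the
    -- second program. About the names of that program nothing is known except that they are in `φ`.
    refine ⟨_, hact.traces ht, fun P₂ M₂ j₂ T₂ Q₂ H₂ g₂ ht₂ => ?_⟩
    obtain ⟨C'', C', r, ha₂, ht₂⟩ := CfgTraces.cons ht₂
    obtain ⟨M₃, S₃, h₃, Q₃, H₃, rfl, g₃, hconv⟩ := Game.taus r g₂
    obtain ⟨ξ₃, B₃, rfl, pm₃, rev₃⟩ := ha₂.player g₃.term g₃.suppX.heap
    have g₄ := g₃.exchange pm₃ rev₃ ho hχ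
    exact hconv (hall ⟨S₃, h₃, P₂.γ ∪ B₃, ξ₃⟩ Q₃ H₃ (g₄.mono subset_rfl Set.subset_union_left
      subset_rfl subset_rfl) ht₂)

/-- The roles are exchanged compared with `PState.step`. A reduction of the environment leaves no
mark in the trace, and it is performed once more against the second program; a move of the
environment is an opponent action of either program. -/
theorem EState.step {s φ θ P E M T Q H W n m₁ m₂} (g : EState s φ θ P E M T Q H W)
    (c : ConvN n Q H)
    (ih : ∀ n' m₁' m₂', (n' < n ∨ n' = n ∧ (m₁' < m₁ ∨ m₁' = m₁ ∧ m₂' < m₂)) →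
      PClaim s n' m₁' m₂' ∧ EClaim s n' m₁' m₂')
    (h1 : msr₁ W M (Ks E.ξ) (Ks P.ξ) = m₁) (h2 : msr₂ W M = m₂) : EGoal φ θ P E M := by
  obtain ⟨a, ha, haP⟩ := exists_fresh g.e.hok.finite _ g.p.hok.finite
  rcases (g.term.prog (g.e.hok.dom ▸ subset_rfl) ha M).stuck with ⟨M', h', st⟩ | hst
  · obtain ⟨S', hS, hok, hM'⟩ := st.ty g.e.hok g.term
    have step : ∀ a', H a' = none → ∃ Q' H', St a' Q H Q' H' ∧ Game (bnd P.γ) (bnd E.γ) φ θ M' h'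
        E.γ (Ks E.ξ) P.h P.γ (Ks P.ξ) Q' H' := fun a' ha' => g.game.st st ha ha'
    obtain ⟨k, Q', H', rfl, c', game⟩ : ∃ k Q' H', n = k + 1 ∧ ConvN k Q' H' ∧
        Game (bnd P.γ) (bnd E.γ) φ θ M' h' E.γ (Ks E.ξ) P.h P.γ (Ks P.ξ) Q' H' := by
      cases n with
      | zero =>
        obtain ⟨a', ha', -⟩ := exists_fresh g.game.finite ∅ Set.finite_empty
        obtain ⟨Q', H', s', -⟩ := step a' ha'
        exact (s'.not_value c).elim
      | succ k =>
        obtain ⟨a', Q', H', ha', s', c'⟩ := c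
        obtain ⟨Q'', H'', s'', game⟩ := step a' ha'
        obtain ⟨rfl, rfl⟩ := s'.det s''
        exact ⟨k, Q', H', rfl, c', game⟩
    obtain ⟨t, ht, hall⟩ := (ih k _ _ (.inl k.lt_succ_self)).2 φ θ P ⟨S', h', E.γ, E.ξ⟩ M' T Q' H' W
      ⟨g.p, g.e.heap hS hok, g.compat.st g.e.hok g.p.hok st haP hS hok, hM', g.chain,
        g.len, game, g.wP, g.wE⟩ c' rfl rfl
    refine ⟨t, ht, fun P₂ Q₂ H₂ g₂ ht₂ => ?_⟩
    obtain ⟨a₂, ha₂, -⟩ := exists_fresh g₂.finite ∅ Set.finite_empty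
    obtain ⟨Q₃, H₃, s₃, g₃⟩ := g₂.st st ha ha₂
    exact .head s₃.toStep (hall P₂ Q₃ H₃ g₃ ht₂)
  · by_cases hfin : M.IsValue ∧ P.ξ = []
    · refine ⟨[], ?_, fun P₂ Q₂ H₂ g₂ ht₂ => ?_⟩
      · rw [Side.pas, hfin.2]; exact ⟨_, _, _, _, _, .nil _⟩
      · obtain ⟨S, k, γ, φ', θ', r⟩ := ht₂
        have hξ : P₂.ξ = [] := by
          have := r.eq_of_nil
          simp only [Side.pas, Cfg.passive.injEq] at this
          exact this.2.2.2.2.1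
        rw [hξ] at g₂
        exact .of_value (g₂.value hfin.1)
    have hθ : θ ⊆ domOf E.h := fun l hl => by rw [← g.compat.shared] at hl; exact hl.1
    obtain ⟨mv, S', χ, B, ξ', pm, hE, hv⟩ := g.e.move s g.term g.game.suppX.heap g.game.term hθ
      g.compat.fin hst
    obtain ⟨hag, hχ, -⟩ := g.compat.move (ζ := []) pm
    obtain ⟨M', j, T', ζ, hact, ho, hM', hP, hch, hlen⟩ := g.p.receive g.game.suppY pm g.game.term
      subset_rfl g.chain (fun A e h => hfin ⟨hv A e, h⟩) hag hχ
    obtain ⟨W', w1, w2, hm⟩ := exists_measure_lt g.game.term g.game.suppX g.game.suppY g.wE g.wP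
      pm.pmv pm.rev ho
    have game := g.game.exchange pm.pmv pm.rev ho hχ
    have hsub : bnd E.γ ∪ (mv.names ∪ namesOf χ) ⊆ bnd (E.γ ∪ B) := by
      rw [bnd_union]; exact Set.union_subset_union_right _ pm.names
    have game' := game.mono hsub subset_rfl game.suppY.bnd
      (g.game.suppX.sub.trans Set.subset_union_left)
    rw [h1, h2] at hm
    obtain ⟨t, ht, hall⟩ := (ih n _ _ (.inr ⟨rfl, hm⟩)).1 _ _
      ⟨pUnion P.S S', pUnion (toTms χ) P.h, P.γ, ζ⟩ ⟨E.S, E.h, E.γ ∪ B, ξ'⟩ M' j T' Q H W'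
      ⟨hP, hE, (g.compat.move pm).2.2, hM', hch, by have := g.len; simp; omega, game', w2, w1⟩
      c rfl rfl
    refine ⟨_, hact.traces ht, fun P₂ Q₂ H₂ g₂ ht₂ => ?_⟩
    obtain ⟨C', ha₂, ht₂⟩ := CfgTraces.passive_cons ht₂
    obtain ⟨M₃, j₃, T₃, ξ₃, rfl, ho₃, hχ₃⟩ := ha₂.opponent
    have g₄ := g₂.exchange (pm.pmv.mono g.game.suppX.sub) (pm.rev.mono g.game.suppX.sub) ho₃ hχ₃
    exact hall ⟨pUnion P₂.S S', pUnion (toTms χ) P₂.h, P₂.γ, ξ₃⟩ M₃ j₃ T₃ Q₂ H₂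
      (g₄.mono subset_rfl Set.subset_union_left subset_rfl subset_rfl) ht₂

theorem claims (s : Layer) (n m₁ m₂ : ℕ) : PClaim s n m₁ m₂ ∧ EClaim s n m₁ m₂ := by
  induction n using Nat.strong_induction_on generalizing m₁ m₂ with
  | _ n ihn =>
  induction m₁ using Nat.strong_induction_on generalizing m₂ with
  | _ m₁ ih1 =>
  induction m₂ using Nat.strong_induction_on with
  | _ m₂ ih2 =>
  have ih : ∀ n' m₁' m₂', (n' < n ∨ n' = n ∧ (m₁' < m₁ ∨ m₁' = m₁ ∧ m₂' < m₂)) →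
      PClaim s n' m₁' m₂' ∧ EClaim s n' m₁' m₂' := by
    rintro n' m₁' m₂' (h | ⟨rfl, h | ⟨rfl, h⟩⟩)
    · exact ihn _ h _ _
    · exact ih1 _ h _
    · exact ih2 _ h
  exact ⟨fun φ θ P E M j T Q H W g c h1 h2 => g.step c ih h1 h2,
    fun φ θ P E M T Q H W g c h1 h2 => g.step c ih h1 h2⟩

/-- A program that converges in an environment has a trace all of whose programs converge in this
environment. -/
theorem PState.goal {s φ θ P E M j T Q H W} (g : PState s φ θ P E M j T Q H W)
    (c : Converges Q H) : PGoal φ θ P E M j T := by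
  obtain ⟨n, c⟩ := c.convN g.game.finite
  exact (claims s n _ _).1 φ θ P E M j T Q H W g c rfl rfl

-- Closing substitutions and evaluation contexts as environments.

/-! ## Closing substitutions -/

/-- The global substitution of a partial map from named variables to terms. -/
def gmap (σ : GVar → Option Tm) : GSub
  | .b k => .inl (.b k)
  | .f u => match σ u with
    | some N => .inr N
    | none => .inl (.f u)

/-- `M[σ][δ]`. -/
def Tm.cl (σ : GVar → Option Tm) (δ : LVar → Option Tm) (M : Tm) : Tm := (M.gsub (gmap σ)).inst δ

/-- Closing substitutions of terms without names, for the contexts `P` and `G`. -/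
structure Closing (S : SCtx) (P : GCtx) (G : LCtx) (σ : GVar → Option Tm) (δ : LVar → Option Tm) :
    Prop where
  glob : ∀ u N, σ u = some N → N.Src ∧ ∃ G' T, HasTy S [] [] G' [] 0 N T
  loc : ∀ x V, δ x = some V → V.IsValue ∧ V.Src ∧ ∃ T, ClTyped S 1 V T
  globTy : ∀ u G' T, (u, (G', T)) ∈ P → ∃ N, σ u = some N ∧ HasTy S [] [] G' [] 0 N T
  locTy : ∀ x T, (x, T) ∈ G → ∃ V, δ x = some V ∧ ClTyped S 1 V T

theorem gmap_inr {σ : GVar → Option Tm} {v N} (h : gmap σ v = .inr N) : ∃ u, σ u = some N := by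
  rcases v with k | u
  · cases h
  · simp only [gmap] at h
    rcases hu : σ u with _ | N' <;> simp [hu] at h
    exact ⟨u, h ▸ hu⟩

theorem Tm.ginst_eq (η : AGSub) (M : Tm) :
    M.ginst η = M.gsub (gmap fun u => (η u).map BName.unbox) := by
  rw [Tm.ginst]
  congr 1
  funext v
  rcases v with k | u
  · rfl
  · cases h : η u <;> simp [gmap, h]

theorem HasTy.gmap {S S' P G G₀ i M T σ δ} (h : HasTy S P [] G [] i M T) (c : Closing S' P G₀ σ δ)
    (hS : PSub S S') (hS' : WfSCtx S') : HasTy S' [] [] G [] i (M.gsub (gmap σ)) T := by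
  refine (h.store hS hS').gsub .nil (by simp) ?_
  rintro (k | u) ⟨G', T'⟩ hp
  · simp [GDecl] at hp
  · obtain ⟨N, hN, ht⟩ := c.globTy u G' T' hp
    exact .inr ⟨N, by simp [LMML.gmap, hN], ht⟩

theorem HasTy.cl {S S' P G i M T σ δ} (h : HasTy S P [] G [] i M T) (c : Closing S' P G σ δ)
    (hS : PSub S S') (hS' : WfSCtx S') : ClTyped S' 1 (M.cl σ δ) T := by
  exact (h.gmap c hS hS').inst (layer_le_one i) (.nil 1) (by simp) (fun x V hV => (c.loc x V hV).1) c.locTy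

theorem Tm.In.cl {φ L σ δ} {M : Tm} (h : M.In φ L 0) (hσ : ∀ u N, σ u = some N → N.In φ L 0)
    (hδ : ∀ x V, δ x = some V → V.In φ L 0) : (M.cl σ δ).In φ L 0 :=
  Tm.In.inst (Tm.In.gsub M h fun _ _ hN => by
    obtain ⟨u, hu⟩ := gmap_inr hN
    exact hσ u _ hu) le_rfl hδ

theorem Closing.in_glob {S P G σ δ} (c : Closing S P G σ δ) (u N) (h : σ u = some N) :
    N.In ∅ (domOf S) 0 := by
  obtain ⟨hs, G', T, ht⟩ := c.glob u N h
  exact ht.in_src hs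

theorem Closing.in_loc {S P G σ δ} (c : Closing S P G σ δ) (x V) (h : δ x = some V) :
    V.In ∅ (domOf S) 0 := by
  obtain ⟨-, hs, T, ht⟩ := c.loc x V h
  exact ht.in_src hs

theorem Tm.Src.cl {S S' P G i M T σ δ} (hs : M.Src) (h : HasTy S P [] G [] i M T)
    (c : Closing S' P G σ δ) (hS : PSub S S') : (M.cl σ δ).Src :=
  Tm.In.src _ rfl (Tm.In.cl (Tm.In.mono _ subset_rfl hS.domOf le_rfl (h.in_src hs)) c.in_glob
    c.in_loc)

theorem gmap_lc {S P G σ δ} (c : Closing S P G σ δ) : (gmap σ).Lc := by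
  have : (gmap σ).In ∅ (domOf S) := fun v N hN => by
    obtain ⟨u, hu⟩ := gmap_inr hN
    exact c.in_glob u N hu
  exact this.lc

theorem Cx.res_src {w : Env} (hr : ∀ l, w.r l = l) {K : Cx} (hK : K.Src) : K.res w = K := by
  induction K <;> simp_all [Cx.Src, Cx.res, Tm.res_src hr]

theorem Cx.Src.plug {K : Cx} (hK : K.IsEval) (hs : K.Src) {M : Tm} (hM : M.Src) :
    (K.plug M).Src := by
  induction K <;> simp_all [Cx.Src, Cx.IsEval, Cx.plug, Tm.Src]

theorem Tm.Src.wt (W : BName → ℕ) (M : Tm) : M.Src → M.wt W = 0 := by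
  induction M using Tm.rec (motive_2 := fun _ => True) <;> simp_all [Tm.Src, Tm.wt]

theorem Tm.Src.unboxed {V : Tm} (h : V.Src) : V.unboxed.Src := by
  cases V <;> exact h

/-! ## Names for the variables of a term -/

/-- The abstract global substitution for `P`, with the box name number `u` for `u`. -/
def mkEta : GCtx → AGSub
  | [] => fun _ => none
  | (w, (G, T)) :: P => fun u => if u = w then some ⟨G, T, u⟩ else mkEta P u

theorem mkEta_some {P u b} (h : mkEta P u = some b) : (u, (b.ctx, b.ty)) ∈ P ∧ b.idx = u := by
  induction P with
  | nil => cases h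
  | cons p P ih =>
    obtain ⟨w, G, T⟩ := p
    simp only [mkEta] at h
    split at h
    · rename_i e; subst e; cases h; exact ⟨List.mem_cons_self, rfl⟩
    · exact ⟨List.mem_cons_of_mem _ (ih h).1, (ih h).2⟩

theorem mkEta_isSome {P u} (h : u ∈ P.map Prod.fst) : ∃ b, mkEta P u = some b := by
  induction P with
  | nil => simp at h
  | cons p P ih =>
    obtain ⟨w, G, T⟩ := p
    simp only [mkEta]
    split
    · exact ⟨_, rfl⟩
    · rename_i hne
      refine ih ?_
      simpa [hne] using h

theorem mkEta_wf {P : GCtx} (hP : WfGCtx P) : WfAGSub (mkEta P) P := by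
  refine ⟨fun u => ⟨fun h => ?_, fun h => ?_⟩, fun u G T b hu hb => ?_, fun u u' b b' hne hb hb' e => ?_⟩
  · obtain ⟨b, hb⟩ := Option.isSome_iff_exists.1 h
    exact List.mem_map.2 ⟨_, (mkEta_some hb).1, rfl⟩
  · exact Option.isSome_iff_exists.2 (mkEta_isSome h)
  · have := GCtx.unique hP.1 (mkEta_some hb).1 hu
    simp only [Prod.mk.injEq] at this
    obtain ⟨rfl, rfl⟩ := this
    have h := hP.2 _ _ _ hu
    exact ⟨.box h.1.1 h.1.2 h.2, rfl, rfl⟩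
  · subst e
    exact hne ((mkEta_some hb).2.symm.trans (mkEta_some hb').2)

theorem mkEta_finite (P : GCtx) : (mkEta P).names.Finite := by
  refine ((P.map fun p => Name.bx ⟨p.2.1, p.2.2, p.1⟩).finite_toSet).subset ?_
  rintro n ⟨u, b, hb, rfl⟩
  obtain ⟨h, e⟩ := mkEta_some hb
  exact List.mem_map.2 ⟨_, h, by rw [← e]⟩

/-- The restriction of `δ` to the variables of `G`. -/
def mkLSub (δ : LVar → Option Tm) : LCtx → LSub
  | [] => .nil
  | (x, _) :: G => .cons x ((δ x).getD .unit) (mkLSub δ G)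

theorem mkLSub_keys (δ : LVar → Option Tm) (G : LCtx) : (mkLSub δ G).keys = G.dom := by
  induction G with
  | nil => rfl
  | cons p G ih => simp only [mkLSub, LSub.keys, ih]; rfl

theorem mkLSub_lookup {δ : LVar → Option Tm} {G : LCtx} {x V}
    (h : (mkLSub δ G).lookup x = some V) : x ∈ G.dom ∧ V = (δ x).getD .unit := by
  refine ⟨by rw [← mkLSub_keys δ]; exact LSub.mem_of_lookup h, ?_⟩
  induction G with
  | nil => cases h
  | cons p G ih =>
    simp only [mkLSub, LSub.lookup] at h
    split at h
    · rename_i e; subst e; cases h; rfl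
    · exact ih h

/-- The code that closing substitutions assign to the box names of `mkEta`. -/
def etaBind (P : GCtx) (σ : GVar → Option Tm) : Set (Name × Tm) :=
  {p | ∃ u b N, mkEta P u = some b ∧ σ u = some N ∧ p = (.bx b, .box N)}

theorem Closing.etaBind {S P G σ δ} (c : Closing S P G σ δ) {u b N} (hb : mkEta P u = some b)
    (hN : σ u = some N) : N.Src ∧ HasTy S [] [] b.ctx [] 0 N b.ty := by
  obtain ⟨N', hN', ht⟩ := c.globTy u _ _ (mkEta_some hb).1
  rw [hN] at hN'; cases hN'
  exact ⟨(c.glob u N hN).1, ht⟩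

theorem etaBind_ok {S P G σ δ} (c : Closing S P G σ δ) : BindOK (etaBind P σ) := by
  refine ⟨?_, ?_⟩
  · rintro n V V' ⟨u, b, N, hb, hN, e⟩ ⟨u', b', N', hb', hN', e'⟩
    simp only [Prod.mk.injEq] at e e'
    obtain ⟨rfl, rfl⟩ := e
    obtain ⟨e, rfl⟩ := e'
    cases e
    obtain rfl : u = u' := (mkEta_some hb).2.symm.trans (mkEta_some hb').2
    rw [hN] at hN'; cases hN'; rfl
  · rintro n V ⟨u, b, N, hb, hN, e⟩
    cases e
    exact ⟨trivial, S, 1, .box (.nil 1) (by simp) (c.etaBind hb hN).2⟩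

theorem bnd_etaBind {S P G σ δ} (c : Closing S P G σ δ) :
    bnd (etaBind P σ) = (mkEta P).names := by
  ext n
  constructor
  · rintro ⟨V, u, b, N, hb, hN, e⟩
    cases e; exact ⟨u, b, hb, rfl⟩
  · rintro ⟨u, b, hb, rfl⟩
    obtain ⟨N, hN, -⟩ := c.globTy u _ _ (mkEta_some hb).1
    exact ⟨_, u, b, N, hb, hN, rfl⟩

theorem exists_env {B : Set (Name × Tm)} (hB : BindOK B) (hs : ∀ n V, (n, V) ∈ B → V.Src) :
    ∃ w : Env, w.Ok ∧ (∀ l, w.r l = l) ∧ ∀ n V, (n, V) ∈ B → n.toTm.res w = V := by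
  have h0 : (Env.mk id (fun _ => .unit) (fun _ => .unit)).Ok :=
    ⟨fun _ => trivial, fun _ => trivial, fun _ => trivial⟩
  obtain ⟨f, b, hok, -, -, h⟩ := Env.exists_bind h0 hB
  refine ⟨⟨id, f, b⟩, hok _, fun _ => rfl, fun n V hV => ?_⟩
  rw [h id n V hV, Tm.res_src (fun _ => rfl) V (hs n V hV)]

theorem HMove.of_dom {s k S h S' h' χ} (H : HMove s k S h (domOf h) S' h' χ)
    (hd : domOf S = domOf h) : S' = S ∧ h' = h := by
  have key : ∀ {α : Type} {f g : Loc → Option α}, PSub f g → domOf g ⊆ domOf f → f = g := by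
    intro α f g h1 h2
    funext l
    rcases hg : g l with _ | a
    · rcases hf : f l with _ | b
      · rfl
      · rw [h1 _ _ hf] at hg; cases hg
    · obtain ⟨b, hb⟩ := mem_domOf.1 (h2 (mem_domOf.2 ⟨a, hg⟩))
      rw [← hg, h1 _ _ hb, hb]
  have hh := key H.restr.heap.part.sub H.restr.heap.part.cover
  refine ⟨key H.restr.store ?_, hh⟩
  rw [H.restr.dom, hh, hd]

/-- The initial configurations of terms with the same type, in an environment that consists of an
evaluation context, closing substitutions and a heap. -/
theorem exists_init {S S' P G σ δ K T T' h} {i : Layer} {M₀ : Tm} (hM₀ : M₀.Src)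
    (ht₀ : HasTy S P [] G [] i M₀ T) (hS : PSub S S') (c : Closing S' P G σ δ) (hh : WfHeap S' h)
    (hs : ∀ l V, h l = some V → V.Src) (hK : K.IsEval) (hKs : K.Src)
    (hKt : CxTy S' [] [] 1 T K [] [] 1 T') :
    ∃ (η : AGSub) (ρ : ASub) (χ : AHeap) (E : Side), E.ξ = [⟨S', K, T, 1, T', 1⟩] ∧
      WfAGSub η P ∧ WfASub S' i ρ G ∧ WfAHeap S' χ ∧ Disjoint η.names (namesOf ρ) ∧
      Disjoint (η.names ∪ namesOf ρ) (namesOf χ) ∧ HOK i S' (toTms χ) ∧ ESide E ∧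
      Compat (η.names ∪ namesOf ρ ∪ namesOf χ) (domOf χ) ⟨S', toTms χ, ∅, []⟩ E ∧
      (∃ W, WOK W E.γ) ∧ ∀ M, M.Src → HasTy S P [] G [] i M T →
        Game (bnd E.γ) ∅ (η.names ∪ namesOf ρ ∪ namesOf χ) (domOf χ)
          ((M.ginst η).inst (toTms ρ)) (toTms χ) ∅ [] E.h E.γ (Ks E.ξ) (K.plug (M.cl σ δ)) h := by
  have hd : domOf h = domOf S' := Set.ext hh.dom
  have hP := ht₀.wf.1.glob
  have hG := ht₀.wf.1.loc
  set η := mkEta P with hη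
  set d := mkLSub δ G with hdd
  obtain ⟨k, hk⟩ := exists_idx (mkEta_finite P)
  set ρ := mkSub i k d G with hρ
  have hdk : ∀ x, x ∈ d.keys ↔ x ∈ G.dom := fun x => by rw [hdd, mkLSub_keys]
  have hdl : ∀ x V, d.lookup x = some V → δ x = some V := by
    intro x V hV
    obtain ⟨hx, rfl⟩ := mkLSub_lookup hV
    obtain ⟨T, hT⟩ := LCtx.mem_dom.1 hx
    obtain ⟨V, hV, -⟩ := c.locTy x T hT
    rw [hV]; rfl
  have hdv : ∀ x V, d.lookup x = some V → V.IsValue := fun x V hV => (c.loc x V (hdl x V hV)).1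
  have hdt : ∀ x V T, (x, T) ∈ G → d.lookup x = some V → ClTyped S' 1 V T := by
    intro x V T hx hV
    obtain ⟨V', hV', ht⟩ := c.locTy x T hx
    rw [hdl x V hV] at hV'; cases hV'; exact ht
  have hrho : ∀ x A, ρ x = some A → ∃ V, d.lookup x = some V ∧ δ x = some V ∧ Entry V A := by
    intro x A hA
    obtain ⟨T, V, hm, hV, rfl⟩ := mkSub_some hA
    exact ⟨V, hV, hdl x V hV, mkAbs_entry (hdt x V T hm hV) (hdv x V hV) _ _⟩
  -- The whole heap is shared from the start, since the initial abstract heap must have the domain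
  -- of the store context.
  obtain ⟨S'', h', χ, H⟩ := exists_hmove i k hh (subset_refl (domOf h))
  obtain ⟨e, e'⟩ := H.of_dom hd.symm
  subst S'' h'
  have hχd : domOf χ = domOf h := H.habs.dom
  have hhin : HeapIn ∅ (domOf h) h := fun l V hl => by
    obtain ⟨T, hT⟩ := Option.isSome_iff_exists.1 ((hh.dom l).1 (by simp [hl]))
    obtain ⟨j, hj⟩ := hh.typed l V T hl hT
    rw [hd]; exact hj.in_src (hs l V hl)
  have hE₀ := bnd_etaBind c
  have H' : HMove i k S' h (∅ ∪ domOf h) S' h χ := by rw [Set.empty_union]; exact H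
  obtain ⟨hR, hn, hdj, hfr⟩ := H'.reveal hhin hk
    (bindOf_ok (mkSub_distinct i k d G) fun x A V hA hV => by
      obtain ⟨V', hV', -, he⟩ := hrho x A hA
      rw [hV] at hV'; cases hV'; exact he)
    (bnd_bindOf fun x A hA => (hrho x A hA).imp fun V h => h.1)
    (fun n W ⟨x, A, V, hA, hV, hW⟩ => by
      have e : W = _ := hW.2
      rw [e, hd]; exact c.in_loc x V (hdl x V hV))
    (fun n hn => mkSub_idx hn)
  have hsrcE : ∀ n V, (n, V) ∈ etaBind P σ → V.Src := by
    rintro n V ⟨u, b, N, hb, hN, e⟩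
    cases e; exact (c.glob u N hN).1
  have hsrcB : ∀ n V, (n, V) ∈ etaBind P σ ∪ (bindOf ρ d.lookup ∪ bindOf χ h) → V.Src := by
    rintro n V (hV | ⟨x, A, V, hA, hV, hn, e⟩ | ⟨l, A, V, hA, hV, hn, e⟩)
    · exact hsrcE n V hV
    · obtain rfl : _ = V := e
      exact (c.loc x _ (hdl x _ hV)).2.1
    · obtain rfl : _ = V := e
      exact hs l _ hV
  obtain ⟨w, hw, hwr, hwB⟩ := exists_env (etaBind_ok c) hsrcE
  have hKin : K.In ∅ (domOf h) := by
    have ht := hKt.plug (ht₀.cl c hS hh.store)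
    rw [hd]
    exact ((Cx.in_plug hK).1 (ht.in_src (hKs.plug hK (hM₀.cl ht₀ c hS)))).1
  have sX : Supp ∅ η.names h (etaBind P σ) [K] := by
    refine ⟨Set.empty_subset _, hhin, ?_, ?_, ?_⟩
    · intro n V hV
      refine ⟨hE₀ ▸ ⟨V, hV⟩, ?_⟩
      obtain ⟨u, b, N, hb, hN, e⟩ := hV
      cases e
      exact ⟨trivial, hd ▸ c.in_glob u N hN⟩
    · rintro b V ⟨u, b, N, hb, hN, e⟩
      cases e; exact .inl ⟨N, rfl⟩
    · intro K' hK'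
      obtain rfl := List.mem_singleton.1 hK'
      exact ⟨hK, hKin⟩
  -- The initial composition is itself obtained by an exchange: an environment that holds
  -- everything, with the code for `η` already assigned, faces an empty program and reveals `ρ` and
  -- `χ` to it.
  have sY : Supp ∅ η.names (fun _ => none) ∅ [] :=
    ⟨Set.empty_subset _, fun l V hl => (by cases hl), by simp, by simp, by simp⟩
  have comp : Comp w w ∅ h (etaBind P σ) (fun _ => none) ∅ h := by
    refine ⟨rfl, rfl, hw, fun l V hl => ?_, fun l V hl => by (cases hl), fun l _ l' _ e => ?_,
      fun l hl => by simp [domOf] at hl, by simp, fun l _ l' hl => by simp [domOf] at hl,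
      Set.empty_subset _, Set.empty_subset _, hd ▸ hh.store.1, fun n V hV => ?_, by simp⟩
    · rw [hwr, Tm.res_src hwr V (hs l V hl)]; exact hl
    · rwa [hwr, hwr] at e
    · rw [hwB n V hV, Tm.res_src hwr V (hsrcE n V hV)]
  obtain ⟨wX, wY, c', agX, agY, key⟩ := comp.exchange sX sY hR (by ext l; simp [domOf])
  have hU : pUnion (toTms χ) (fun _ => none) = toTms χ := by
    funext l; simp only [pUnion]; cases toTms χ l <;> rfl
  have sY' := sY.receive hR Set.subset_union_right
  have sX' := sX.reveal hR
  rw [hU] at c' sY'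
  refine ⟨η, ρ, χ, ⟨S', h, etaBind P σ ∪ (bindOf ρ d.lookup ∪ bindOf χ h), [⟨S', K, T, 1, T', 1⟩]⟩,
    rfl, mkEta_wf hP, mkSub_wf hG hdk hdv hdt hh.store fun _ _ _ _ => rfl, H.wf,
    hfr.mono_right Set.subset_union_left, Set.disjoint_union_left.2
      ⟨hfr.mono_right Set.subset_union_right, hdj⟩, H.hok, ⟨.of_wfHeap hh, ?_, ?_⟩, ⟨?_, ?_, ?_⟩,
    -- The values of the environment are source terms: none is a function name, so weight 0 suffices
    -- for functions, and code has weight 0, so weight 2 suffices for boxes.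
    ⟨fun n => match n with | .bx _ => 2 | .fn _ => 0, ?_, ?_⟩, fun M hM ht => ?_⟩
  · rintro n V (⟨u, b, N, hb, hN, e⟩ | ⟨x, A, V, hA, hV, hn, e⟩ | hV)
    · cases e; exact .box (.nil 1) (by simp) (c.etaBind hb hN).2
    · obtain rfl : _ = V := e
      obtain ⟨T, V', hm, hV', rfl⟩ := mkSub_some hA
      rw [hV] at hV'; cases hV'
      rw [(mkAbs_names hn).2]; exact hdt x _ T hm hV
    · exact H.ebind (.of_wfHeap hh) n V hV
  · intro F hF
    obtain rfl := List.mem_singleton.1 hF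
    exact hKt
  · exact ((mkEta_finite P).union (namesOf_finite (mkSub_finite _ _ _ _))).union
      (namesOf_finite H.fin)
  · intro l T T' h1 h2
    exact Option.some.inj (h1.symm.trans h2)
  · change domOf (toTms χ) ∩ domOf h = domOf χ
    rw [domOf_toTms, hχd, Set.inter_self]
  · intro f V hV
    have := hsrcB _ _ hV
    cases V <;> first | exact this.elim | exact Nat.zero_le _
  · intro b V hV
    rw [Tm.Src.wt _ _ (Tm.Src.unboxed (hsrcB _ _ hV))]
  · have hbnd : η.names ∪ namesOf ρ ∪ namesOf χ ⊆
        bnd (etaBind P σ ∪ (bindOf ρ d.lookup ∪ bindOf χ h)) := by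
      rw [bnd_union, hE₀, Set.union_assoc]
      exact Set.union_subset_union_right _ hn
    have hbnd' : bnd (etaBind P σ ∪ (bindOf ρ d.lookup ∪ bindOf χ h)) ⊆
        η.names ∪ namesOf ρ ∪ namesOf χ := by
      rw [Set.union_assoc]; exact sX'.bnd
    have sub : ∀ x V, toTms ρ x = some V → ∃ A V', ρ x = some A ∧ V = A.toTm ∧
        δ x = some V' ∧ V'.In ∅ (domOf h) 0 ∧
        Abst (bindOf ρ d.lookup ∪ bindOf χ h) (domOf χ) V' A := by
      intro x V hV
      simp only [toTms, Option.map_eq_some_iff] at hV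
      obtain ⟨A, hA, rfl⟩ := hV
      obtain ⟨V', hV', hδ, he⟩ := hrho x A hA
      refine ⟨A, V', hA, rfl, hδ, hd ▸ c.in_loc x V' hδ, he.abst.mono ?_ ?_⟩
      · exact fun p hp => .inl ⟨x, A, V', hA, hV', hp⟩
      · intro l hl
        obtain ⟨y, -, hy⟩ := mkSub_locs hdv hdt ⟨x, A, hA, hl⟩
        rw [hχd, hd]; exact hy
    have hMin : M.In ∅ (domOf h) 0 := by
      rw [hd]; exact Tm.In.mono _ subset_rfl hS.domOf le_rfl (ht.in_src hM)
    refine ⟨?_, ?_, ?_, wY, wX, c', ?_⟩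
    · rw [domOf_toTms]
      refine Tm.In.inst (Tm.In.gsub M (Tm.In.mono _ (Set.empty_subset _) hχd.ge le_rfl hMin) ?_)
        le_rfl ?_
      · rintro (k | u) N hN
        · cases hN
        · rcases hu : η u with _ | b <;> simp [hu] at hN
          subst hN
          exact ⟨hbnd (.inl (.inl ⟨u, b, hu, rfl⟩)), idSub_In _ _⟩
      · intro x V hV
        obtain ⟨A, V', hA, rfl, -, -, hab⟩ := sub x V hV
        exact hab.in (fun n h => hbnd (.inl (.inr ⟨x, A, hA, h⟩))) subset_rfl
    · rw [Set.union_assoc] at hbnd hbnd' ⊢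
      exact sY'.mono (by rw [Set.empty_union]; exact Set.subset_union_right.trans hbnd) hbnd'
    · rw [Set.union_assoc]; exact sX'
    · have e1 : K.res wX = K := by
        rw [← Cx.res_congr agX hK (hKin.mono (Set.empty_subset _) subset_rfl), Cx.res_src hwr hKs]
      have agM : wY.Agree w ∅ (domOf h) := by
        refine ⟨fun l hl => ?_, by simp, by simp⟩
        rw [c'.shared l (hχd ▸ hl), ← agX.r l hl]
      have e2 : M.res wY = M := by rw [Tm.res_congr agM M hMin, Tm.res_src hwr M hM]
      have e3 : ∀ x ∈ G.dom, (toTms ρ x).map (Tm.res wY) = δ x := by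
        intro x hx
        obtain ⟨A, hA⟩ := Option.isSome_iff_exists.1
          (mkSub_isSome (lv := i) (k := k) hx ((hdk x).2 hx))
        have hA' : toTms ρ x = some A.toTm := by simp [toTms, hρ, hA]
        obtain ⟨A', V, -, e, hδ, hVin, hab⟩ := sub x _ hA'
        obtain ⟨A'', V', hA'', e', hδ', hVin', hab'⟩ := sub x _ hA'
        have hV : V'.res wX = V' := by
          rw [← Tm.res_congr agX V' (Tm.In.mono _ (Set.empty_subset _) subset_rfl le_rfl hVin'),
            Tm.res_src hwr V' (Tm.In.src V' rfl hVin')]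
        rw [hA', hδ', Option.map_some, e', key V' A'' hVin' hab', hV]
      have e5 : ∀ u b, η u = some b → σ u = some (b.unbox.res wY) := by
        intro u b hb
        obtain ⟨N, hN, -⟩ := c.globTy u _ _ (mkEta_some hb).1
        have h1 := hwB (.bx b) (.box N) ⟨u, b, N, hb, hN, rfl⟩
        simp only [Name.toTm, Tm.res, Tm.box.injEq] at h1
        rw [BName.unbox_res c'.ok, c'.b, ← agX.b b ⟨u, b, hb, rfl⟩, h1, hN]
      -- Each name put for a variable resolves to what the closing substitution puts there, so the
      -- initial term of the program resolves to the closed source term.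
      have e4 : ((M.ginst η).inst (toTms ρ)).res wY = M.cl σ δ := by
        have hlc : (gmap fun u => (η u).map BName.unbox).Lc := by
          intro v N hN r
          obtain ⟨u, hu⟩ := gmap_inr hN
          simp only [Option.map_eq_some_iff] at hu
          obtain ⟨b, -, rfl⟩ := hu
          exact b.unbox_lren r
        rw [Tm.res_inst c'.ok, Tm.ginst_eq, Tm.res_gsub c'.ok M hlc, e2]
        have hg := Tm.gsub_congr M (g' := gmap σ) ht.sc
            (g := GSub.res wY (gmap fun u => (η u).map BName.unbox)) (by
          rintro (k | u) Y ⟨G', T', hY, -⟩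
          · simp [GDecl] at hY
          · obtain ⟨b, hb⟩ := mkEta_isSome (List.mem_map.2 ⟨_, hY, rfl⟩)
            have hb' : η u = some b := hb
            simp only [GSub.res, gmap, hb', e5 u b hb', Option.map_some, Sum.map_inr])
        rw [hg]
        exact Tm.lsub_congr _ (ht.gmap c hS hh.store).code (by simp) fun x hx => by
          change (Option.map _ _).getD _ = _; rw [e3 x hx]
      simp only [Ks, List.map_cons, List.map_nil, wrap_cons, wrap_nil, e1, e4]

/-! ## Trace inclusion implies the preorder for closing substitutions and evaluation contexts -/

/-- The preorder on terms of type `T` for closing substitutions and evaluation contexts. -/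
def Ciu (S : SCtx) (P : GCtx) (G : LCtx) (T : Ty) (M N : Tm) : Prop :=
  ∀ S' σ δ K T' h, PSub S S' → Closing S' P G σ δ → K.IsEval → K.Src →
    CxTy S' [] [] 1 T K [] [] 1 T' → WfHeap S' h → (∀ l V, h l = some V → V.Src) →
    Converges (K.plug (M.cl σ δ)) h → Converges (K.plug (N.cl σ δ)) h

/-- The test is turned into one environment that fits both terms. `PState.goal` extracts from the
convergence of the first term a trace that guarantees convergence in this environment, and the
inclusion hands this trace to the second term. -/
theorem ciu_of_traces {S P G i T M₁ M₂} (hs₁ : M₁.Src) (hs₂ : M₂.Src)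
    (h₁ : HasTy S P [] G [] i M₁ T) (h₂ : HasTy S P [] G [] i M₂ T)
    (hTr : Traces S P G i T M₁ ⊆ Traces S P G i T M₂) : Ciu S P G T M₁ M₂ := by
  intro S' σ δ K T' h hS c hK hKs hKt hh hs hc
  obtain ⟨η, ρ, χ, E, hξ, hη, hρ, hχ, hd1, hd2, hok, hE, hcomp, ⟨W, hW⟩, game⟩ :=
    exists_init hs₁ h₁ hS c hh hs hK hKs hKt
  have hM : ClTyped S' i ((M₁.ginst η).inst (toTms ρ)) T := by
    rw [Tm.ginst_eq]
    refine HasTy.inst (G₀ := G) ((h₁.store hS hh.store).gsub .nil (by simp) ?_) le_rfl (.nil i)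
      (by simp) (fun x V hV => toTms_value hV) fun x T hx => ?_
    · rintro (k | u) ⟨G', T'⟩ hp
      · simp [GDecl] at hp
      · obtain ⟨b, hb⟩ := Option.isSome_iff_exists.1
          ((hη.dom u).2 (List.mem_map.2 ⟨_, hp, rfl⟩))
        obtain ⟨hwf, rfl, rfl⟩ := hη.typed u G' T' b hp hb
        exact .inr ⟨b.unbox, by simp [gmap, hb], .unbox hh.store .nil (by simp) hwf⟩
    · obtain ⟨A, hA⟩ := Option.isSome_iff_exists.1 ((hρ.dom x).2 (LCtx.mem_dom.2 ⟨T, hx⟩))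
      exact ⟨A.toTm, by simp [toTms, hA], hρ.typed x T A hx hA⟩
  have hb : bnd (∅ : Set (Name × Tm)) = ∅ := by ext; simp [bnd]
  have g : PState i (η.names ∪ namesOf ρ ∪ namesOf χ) (domOf χ) ⟨S', toTms χ, ∅, []⟩ E
      ((M₁.ginst η).inst (toTms ρ)) i T (K.plug (M₁.cl σ δ)) h W :=
    ⟨⟨hok, by simp, by simp⟩, hE, hcomp, .inl ⟨rfl, hM⟩, by
      rw [hξ]; exact Chain.cons (F := ⟨S', K, T, 1, T', 1⟩) (.nil T'), by simp [hξ],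
      hb ▸ game M₁ hs₁ h₁, ⟨by simp, by simp⟩, hW⟩
  obtain ⟨t, ht, hall⟩ := g.goal hc
  have hm : (η, ρ, χ, t) ∈ Traces S P G i T M₁ :=
    ⟨η, ρ, χ, t, rfl, S', hS, hη, hρ, hχ, hd1, hd2, ht⟩
  -- Elements of `Traces` record `η`, `ρ` and `χ`, so the second term starts from the same abstract
  -- data. Its store context may be a different one; this does no harm, since the second composition
  -- is not typed.
  obtain ⟨η', ρ', χ', t', e, S'', -, -, -, -, -, -, ht'⟩ := hTr hm
  simp only [Prod.mk.injEq] at e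
  obtain ⟨rfl, rfl, rfl, rfl⟩ := e
  have g₂ := game M₂ hs₂ h₂
  exact hall ⟨S'', toTms χ, ∅, []⟩ _ i T _ h
    (g₂.mono g₂.suppY.bnd (Set.empty_subset _) subset_rfl subset_rfl) ht'

-- Preservation of the preorder by arbitrary contexts.

/-! ## The preorder on closed terms -/

/-- The preorder on closed terms of type `T` for evaluation contexts. -/
def CCiu (S : SCtx) (T : Ty) (M N : Tm) : Prop :=
  ∀ S' K T' h, PSub S S' → K.IsEval → K.Src → CxTy S' [] [] 1 T K [] [] 1 T' → WfHeap S' h →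
    (∀ l V, h l = some V → V.Src) → Converges (K.plug M) h → Converges (K.plug N) h

theorem CCiu.trans {S T M N P} (h : CCiu S T M N) (h' : CCiu S T N P) : CCiu S T M P :=
  fun S' K T' H hS hK hs ht hh hH c => h' S' K T' H hS hK hs ht hh hH (h S' K T' H hS hK hs ht hh hH c)

theorem WfHeap.finite {S h} (H : WfHeap S h) : (domOf h).Finite := HOK.finite (.of_wfHeap H)

theorem CCiu.exp {S T M N} (h : ∀ a h, St a M h N h) : CCiu S T N M :=
  fun _ _ _ H _ hK _ _ _ _ c => c.head ((h 0 H).plug hK).toStep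

/-- The step exists for every `a` and does not change the heap. By determinism it is therefore the
first step of any converging reduction, whichever location that reduction carries. -/
theorem CCiu.red {S T M N} (h : ∀ a h, St a M h N h) : CCiu S T M N := by
  intro S' K T' H hS hK hs ht hh hH c
  obtain ⟨n, c'⟩ := c.convN hh.finite
  clear c
  rcases n with _ | n
  · exact ((h 0 H).not_value (Cx.plug_value hK c').2).elim
  · obtain ⟨a, M', h', -, s, c⟩ := c'
    obtain ⟨rfl, rfl⟩ := s.det ((h a H).plug hK)
    exact ConvN.converges c

theorem CxTy.comp {S T₀ T T' i} {F K : Cx} (hK : K.IsEval) (h : CxTy S [] [] 1 T K [] [] 1 T')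
    (hF : CxTy S [] [] i T₀ F [] [] 1 T) : CxTy S [] [] i T₀ (K.comp F) [] [] 1 T' := by
  induction K generalizing T' with
  | hole => cases h; exact hF
  | appL C N ih => cases h with | appL h h' => exact .appL (ih hK h) h'
  | appR N C ih => cases h with | appR h' h => exact .appR h' (ih hK.2 h)
  | arithL o C N ih => cases h with | arithL h h' => exact .arithL (ih hK h) h'
  | arithR o N C ih => cases h with | arithR h' h => exact .arithR h' (ih hK.2 h)
  | iteC C N N' ih => cases h with | iteC h h' h'' => exact .iteC (ih hK h) h' h''
  | ref C ih => cases h with | ref h => exact .ref (ih hK h)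
  | deref C ih => cases h with | deref h => exact .deref (ih hK h)
  | assignL C N ih => cases h with | assignL h h' => exact .assignL (ih hK h) h'
  | assignR N C ih => cases h with | assignR h' h => exact .assignR h' (ih hK.2 h)
  | letboxL C N ih => cases h with | letboxL h h' => exact .letboxL (ih hK h) h'
  | _ => exact hK.elim

theorem Cx.Src.comp {K F : Cx} (hK : K.IsEval) (hs : K.Src) (hF : F.Src) : (K.comp F).Src := by
  induction K <;> simp_all [Cx.Src, Cx.IsEval, Cx.comp]

theorem CCiu.frame {S T T' M N} {F : Cx} (h : CCiu S T M N) (hF : F.IsEval) (hs : F.Src)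
    (ht : CxTy S [] [] 1 T F [] [] 1 T') : CCiu S T' (F.plug M) (F.plug N) := by
  intro S' K T'' H hS hK hKs hKt hh hH c
  rw [← Cx.plug_comp hK] at c ⊢
  exact h S' _ T'' H hS (hK.comp hF) (hKs.comp hK hs) (hKt.comp hK (ht.store hS hh.store)) hh hH c

theorem Tm.Src.not_app {K : Cx} {M : Tm} (hK : K.IsEval) (h : (K.plug M).Src) : M.Src := by
  induction K <;> simp_all [Cx.IsEval, Cx.plug, Tm.Src]

theorem St.src {S a M h M' h' T} (s : St a M h M' h') (hh : HOK 1 S h) (ht : ClTyped S 1 M T)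
    (hM : M.Src) (hs : ∀ l V, h l = some V → V.Src) :
    M'.Src ∧ ∀ l V, h' l = some V → V.Src := by
  have := s.in (φ := ∅) (hh.dom ▸ ht.in_src hM) fun l V hl => by
    obtain ⟨T', hT⟩ := mem_domOf.1 (hh.dom ▸ mem_domOf.2 ⟨V, hl⟩ : l ∈ domOf S)
    obtain ⟨j, hj⟩ := (hh.typed l V T' hl hT).typed
    rw [hh.dom]
    exact hj.in_src (hs l V hl)
  exact ⟨Tm.In.src _ rfl this.1, fun l V hl => Tm.In.src _ rfl (this.2 l V hl)⟩

/-- Terms that first evaluate the same term are related if they are so for all its values. -/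
theorem CCiu.of_values {S T T' N} {F₁ F₂ : Cx} (hF₁ : F₁.IsEval) (hF₂ : F₂.IsEval)
    (h : ∀ S' V, PSub S S' → WfSCtx S' → V.IsValue → V.Src → ClTyped S' 1 V T →
      CCiu S' T' (F₁.plug V) (F₂.plug V))
    (hN : N.Src) (ht : ClTyped S 1 N T) : CCiu S T' (F₁.plug N) (F₂.plug N) := by
  intro S' K T'' H hS hK hKs hKt hh hH c
  obtain ⟨n, c'⟩ := c.convN hh.finite
  have ht' := ht.store hS hh.store
  have hok := HOK.of_wfHeap hh
  clear ht hh c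
  induction n generalizing S' N H with
  | zero =>
    exact h S' N hS hok.store (Cx.plug_value hF₁ (Cx.plug_value hK c').2).2 hN ht' S' K T'' H (.refl _)
      hK hKs hKt hok.wfHeap hH (ConvN.converges (n := 0) c')
  | succ n ih =>
    obtain ⟨a, M', h', ha, s, c⟩ := id c'
    rcases HasTy.prog hok.dom.ge ha N ht' with hv | ⟨N', h'', s'⟩ | ⟨K', f, V, hK', hV, rfl⟩ | ⟨K', b, d, hK', rfl⟩
    · exact h S' N hS hok.store hv hN ht' S' K T'' H (.refl _) hK hKs hKt hok.wfHeap hH (ConvN.converges c')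
    -- Both contexts first evaluate `N`, with the same steps; they differ only once it is a value.
    · obtain ⟨rfl, rfl⟩ := s.det ((s'.plug hF₁).plug hK)
      obtain ⟨S'', hS'', hok', ht''⟩ := s'.ty hok ht'
      obtain ⟨hN', hH'⟩ := s'.src hok ht' hN hH
      exact (ih hN' S'' h' (hS.trans hS'') (hKt.store hS'' hok'.store) hH' c ht'' hok').head
        ((s'.plug hF₂).plug hK).toStep
    · exact (Tm.Src.not_app hK' hN).1.elim
    · exact (Tm.Src.not_app hK' hN).elim

/-! ## Typing of resolved terms -/

theorem HasTy.of_closed {S P F G i M T} (h : HasTy S [] [] G [] i M T) (hP : WfGCtx P)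
    (hF : ∀ G' T, (G', T) ∈ F → WfLCtx 0 G' ∧ WfTy 0 T) : HasTy S P F G [] i M T := by
  have := h.gren (r := id) hP hF (by rintro (k | u) p hp <;> simp [GDecl] at hp)
  rwa [h.code.gren] at this

theorem HasTy.of_closed' {S P F G D i j M T} (h : ClTyped S i M T) (hij : i ≤ j)
    (hc : WfCtxs S P F G D j) : HasTy S P F G D j M T := by
  have := (h.of_closed hc.glob hc.globB).inst (e := fun _ => none) hij hc.loc hc.locB (by simp) (by simp)
  rwa [show M.inst (fun _ => none) = M from Tm.lsub_id M] at this

/-- The environment `w` resolves the names in `φ` according to their types. -/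
structure Env.Typed (w : Env) (S : SCtx) (φ : Set Name) : Prop where
  ok : w.Ok
  r : ∀ l, w.r l = l
  fn : ∀ f, .fn f ∈ φ → (w.f f).Src ∧ ClTyped S f.lvl (w.f f) (.arr f.dom f.cod)
  bx : ∀ b, .bx b ∈ φ → (w.b b).Src ∧ HasTy S [] [] b.ctx [] 0 (w.b b) b.ty

theorem HasTy.res {S P F G D i M T w φ L n} (hw : Env.Typed w S φ) (h : HasTy S P F G D i M T)
    (hM : M.In φ L n) : HasTy S P F G D i (M.res w) T := by
  induction h generalizing n with
  | unit hc => exact .unit hc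
  | int m hc => exact .int m hc
  | bvar hc h => exact .bvar hc h
  | fvar hc h => exact .fvar hc h
  | loc hc h h' => simp only [Tm.res, hw.r]; exact .loc hc h h'
  | lam _ ih => exact .lam (ih hM)
  | recf _ ih => exact .recf (ih hM)
  | app _ _ ih ih' => exact .app (ih hM.1) (ih' hM.2)
  | arith _ _ ih ih' => exact .arith (ih hM.1) (ih' hM.2)
  | assign _ _ ih ih' => exact .assign (ih hM.1) (ih' hM.2)
  | letbox _ _ ih ih' => exact .letbox (ih hM.1) (ih' hM.2)
  | ite _ _ _ ih ih' ih'' => exact .ite (ih hM.1) (ih' hM.2.1) (ih'' hM.2.2)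
  | ref _ ih => exact .ref (ih hM)
  | deref _ ih => exact .deref (ih hM)
  | box h h' _ ih => exact .box h h' (ih hM)
  | fname hc _ hl => exact (hw.fn _ hM).2.of_closed' hl hc
  | bname hc _ =>
    exact .box hc.loc hc.locB ((hw.bx _ hM).2.of_closed hc.glob hc.globB)
  | gvarB hc h h1 h2 h3 _ ih =>
    refine .gvarB hc h (by rwa [LSub.keys_res]) (by rwa [LSub.keys_res]) (fun x V hV => ?_) fun x V T' hx hV => ?_
    all_goals
      rw [LSub.lookup_res, Option.map_eq_some_iff] at hV
      obtain ⟨V, hV, rfl⟩ := hV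
    · exact (h3 x V hV).res hw.ok
    · exact ih x V T' hx hV (hM.lookup hV)
  | gvarF hc h h1 h2 h3 _ ih =>
    refine .gvarF hc h (by rwa [LSub.keys_res]) (by rwa [LSub.keys_res]) (fun x V hV => ?_) fun x V T' hx hV => ?_
    all_goals
      rw [LSub.lookup_res, Option.map_eq_some_iff] at hV
      obtain ⟨V, hV, rfl⟩ := hV
    · exact (h3 x V hV).res hw.ok
    · exact ih x V T' hx hV (hM.lookup hV)
  | @unb F G D i b d hc hb h1 h2 h3 _ ih =>
    have ht := (hw.bx _ hM.1).2.of_closed hc.glob hc.globB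
    refine ht.lsub (Fin.zero_le _) hc.loc hc.locB (by simp) (fun x T hx => ?_) (fun _ => trivial) fun x => ?_
    · obtain ⟨V, hV⟩ := LSub.lookup_of_mem ((h2 x).2 (LCtx.mem_dom.2 ⟨T, hx⟩))
      rw [LSub.lookup_res, hV]
      exact ih x V T hx hV (hM.2.lookup hV)
    · rw [LSub.lookup_res]
      rcases hV : d.lookup x with _ | V
      · trivial
      · exact (h3 x V hV).res hw.ok

theorem CxTy.res {S w φ L T T'} {K : Cx} (hw : Env.Typed w S φ) (hK : K.IsEval)
    (h : CxTy S [] [] 1 T K [] [] 1 T') (hi : K.In φ L) :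
    CxTy S [] [] 1 T (K.res w) [] [] 1 T' := by
  have hi' := (Cx.in_plug (φ := φ) (L := L) hK (M := .unit)).2 ⟨hi, trivial⟩
  clear hi
  induction K generalizing T' with
  | hole => exact h
  | appL C N ih => cases h with | appL h h' => exact .appL (ih hK h hi'.1) (h'.res hw hi'.2)
  | appR N C ih => cases h with | appR h' h => exact .appR (h'.res hw hi'.1) (ih hK.2 h hi'.2)
  | arithL o C N ih => cases h with | arithL h h' => exact .arithL (ih hK h hi'.1) (h'.res hw hi'.2)
  | arithR o N C ih => cases h with | arithR h' h => exact .arithR (h'.res hw hi'.1) (ih hK.2 h hi'.2)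
  | iteC C N N' ih => cases h with | iteC h h' h'' => exact .iteC (ih hK h hi'.1) (h'.res hw hi'.2.1) (h''.res hw hi'.2.2)
  | ref C ih => cases h with | ref h => exact .ref (ih hK h hi')
  | deref C ih => cases h with | deref h => exact .deref (ih hK h hi')
  | assignL C N ih => cases h with | assignL h h' => exact .assignL (ih hK h hi'.1) (h'.res hw hi'.2)
  | assignR N C ih => cases h with | assignR h' h => exact .assignR (h'.res hw hi'.1) (ih hK.2 h hi'.2)
  | letboxL C N ih => cases h with | letboxL h h' => exact .letboxL (ih hK h hi'.1) (h'.res hw hi'.2)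
  | _ => exact hK.elim

/-! ## Replacing the values of names by greater ones -/

/-- Resolution of the names in a heap. -/
def resH (w : Env) (h : Heap) : Heap := fun l => (h l).map (Tm.res w)

theorem St.resH {w : Env} (hw : w.Ok) (hr : ∀ l, w.r l = l) {φ : Set Name} {L : Set Loc}
    {a M h M' h'} (s : St a M h M' h') (hM : M.In φ L 0) (ha : h a = none) :
    St a (M.res w) (resH w h) (M'.res w) (resH w h') := by
  obtain ⟨H', s', h1, h2⟩ := s.res hw hM (H := LMML.resH w h)
    (fun l V hl => by simp [LMML.resH, hr, hl]) (fun l _ l' _ e => by rwa [hr, hr] at e)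
    (by simp [LMML.resH, hr, ha])
  rw [hr] at s'
  convert s'
  funext l
  rcases hl : h' l with _ | V
  · rw [h2 l fun l' hl' e => by
      rw [hr] at e; subst e
      obtain ⟨V, hV⟩ := mem_domOf.1 hl'
      rw [hl] at hV; cases hV]
    have : h l = none := by
      rcases hl' : h l with _ | V
      · rfl
      · obtain ⟨V, hV⟩ := mem_domOf.1 (s.dom.1 (mem_domOf.2 ⟨V, hl'⟩))
        rw [hl] at hV; cases hV
    simp [LMML.resH, hl, this]
  · rw [← hr l, h1 l V hl, hr]; simp [LMML.resH, hl]

/-- The values that `w₂` assigns to the names in `φ` are greater than those that `w₁` assigns. -/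
structure Repl (φ : Set Name) (S : SCtx) (w₁ w₂ : Env) : Prop where
  ok : w₁.Ok
  r : ∀ l, w₁.r l = l
  ty : w₂.Typed S φ
  -- `N` is the body after one unfolding, in which names of `φ`, in particular `f`, may still occur.
  -- Thus only one use of the name is compared, and all later uses are left to the induction in
  -- `Repl.conv`.
  fn : ∀ f S' V, .fn f ∈ φ → PSub S S' → WfSCtx S' → V.IsValue → V.In φ (domOf S') 0 →
    ClTyped S' 1 V f.dom → ∃ N, N.In φ (domOf S') 0 ∧ ClTyped S' 1 N f.cod ∧
      (∀ a h, St a (.app (w₁.f f) (V.res w₁)) h (N.res w₁) h) ∧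
      CCiu S' f.cod (N.res w₂) (.app (w₂.f f) (V.res w₂))
  -- Replacing `#b^δ` by `N` takes no reduction step. The induction therefore needs `N` to have no
  -- use of a box name in evaluation position, so that the number of such uses drops.
  bx : ∀ b S' d, .bx b ∈ φ → PSub S S' → WfSCtx S' → d.In φ (domOf S') 0 →
    (∀ x, x ∈ d.keys ↔ x ∈ b.ctx.dom) → (∀ x V, d.lookup x = some V → V.IsValue) →
    (∀ x V T, (x, T) ∈ b.ctx → d.lookup x = some V → ClTyped S' 1 V T) →
    ∃ N, N.In φ (domOf S') 0 ∧ ClTyped S' 1 N b.ty ∧ N.wt (fun _ => 1) = 0 ∧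
      N.res w₁ = (Tm.unb b d).res w₁ ∧ CCiu S' b.ty (N.res w₂) ((Tm.unb b d).res w₂)

theorem Env.Typed.store {w : Env} {S S' φ} (hw : w.Typed S φ) (hS : PSub S S') (hS' : WfSCtx S') :
    w.Typed S' φ :=
  ⟨hw.ok, hw.r, fun f hf => ⟨(hw.fn f hf).1, (hw.fn f hf).2.store hS hS'⟩,
    fun b hb => ⟨(hw.bx b hb).1, (hw.bx b hb).2.store hS hS'⟩⟩

theorem Env.Typed.in_res {w : Env} {S φ L} (hw : w.Typed S φ) (hL : domOf S ⊆ L) {M : Tm} {n}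
    (h : M.In φ L n) : (M.res w).In ∅ L n :=
  Tm.In.res (L := L) (L' := L) (fun l hl => by rwa [hw.r])
    (fun f hf => Tm.In.mono _ subset_rfl hL le_rfl ((hw.fn f hf).2.in_src (hw.fn f hf).1))
    (fun b hb => Tm.In.mono _ subset_rfl hL le_rfl ((hw.bx b hb).2.in_src (hw.bx b hb).1)) M h

theorem Env.Typed.src {w : Env} {S φ n} (hw : w.Typed S φ) {M : Tm}
    (h : M.In φ (domOf S) n) : (M.res w).Src :=
  Tm.In.src _ rfl (hw.in_res subset_rfl h)

theorem Cx.src_iff {K : Cx} (hK : K.IsEval) {M : Tm} (hM : M.Src) : (K.plug M).Src ↔ K.Src := by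
  induction K <;> simp_all [Cx.Src, Cx.IsEval, Cx.plug, Tm.Src, and_comm]

theorem WfHeap.resH {w : Env} {S φ h} (hw : w.Typed S φ) (hh : WfHeap S h)
    (hi : HeapIn φ (domOf S) h) :
    WfHeap S (resH w h) ∧ ∀ l V, LMML.resH w h l = some V → V.Src := by
  have key : ∀ l V, LMML.resH w h l = some V → ∃ V', h l = some V' ∧ V'.res w = V :=
    fun l V hV => Option.map_eq_some_iff.1 hV
  refine ⟨⟨hh.store, fun l => ?_, fun l V hV => ?_, fun l V T hV hT => ?_⟩, fun l V hV => ?_⟩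
  · rw [← hh.dom l]; simp [LMML.resH]
  all_goals obtain ⟨V, hl, rfl⟩ := key l V hV
  · exact (hh.value l V hl).res hw.ok
  · obtain ⟨i, hi'⟩ := hh.typed l V T hl hT
    exact ⟨i, hi'.res hw (hi l V hl)⟩
  · exact hw.src (hi l V hl)

/-- The induction is on the number of steps under `w₁` and, for a fixed number, on the number of
uses of box names in evaluation position. Ordinary steps are common to both resolutions. When a name
is used in a context `K`, the induction hypothesis applies to `K` with the unfolded `N` in place of
the use, after a step for functions and by the smaller weight for boxes. This gives convergence
under `w₂`, and the comparison of `N` with the use, in the evaluation context `K.res w₂`, finishes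
the case. -/
theorem Repl.conv {φ S w₁ w₂} (R : Repl φ S w₁ w₂) {n : ℕ} : ∀ {m : ℕ} {S' M h T},
    M.wt (fun _ => 1) = m → PSub S S' → HOK 1 S' h → ClTyped S' 1 M T → M.In φ (domOf S') 0 →
    HeapIn φ (domOf S') h → ConvN n (M.res w₁) (resH w₁ h) →
    Converges (M.res w₂) (resH w₂ h) := by
  induction n using Nat.strong_induction_on with
  | _ n ihn =>
  intro m
  induction m using Nat.strong_induction_on with
  | _ m ihm =>
  intro S' M h T hm hS hok ht hM hh c
  have hw₂ := R.ty.store hS hok.store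
  have hh₂ := WfHeap.resH hw₂ hok.wfHeap hh
  obtain ⟨a, ha, hstep⟩ : ∃ a, h a = none ∧ ∀ M' h', St a M h M' h' →
      ∃ k, n = k + 1 ∧ ConvN k (M'.res w₁) (resH w₁ h') := by
    rcases n with _ | k
    · obtain ⟨a, ha, -⟩ := exists_fresh hok.finite ∅ Set.finite_empty
      exact ⟨a, ha, fun M' h' s => ((s.resH R.ok R.r hM ha).not_value c).elim⟩
    · obtain ⟨a, M', h', ha, s, c⟩ := c
      have ha' : h a = none := by simpa [resH] using ha
      refine ⟨a, ha', fun M'' h'' s' => ⟨k, rfl, ?_⟩⟩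
      obtain ⟨rfl, rfl⟩ := s.det (s'.resH R.ok R.r hM ha')
      exact c
  rcases HasTy.prog hok.dom.ge ha M ht with hv | ⟨M', h', s⟩ | ⟨K, f, V, hK, hV, rfl⟩ |
    ⟨K, b, d, hK, rfl⟩
  · exact .of_value (hv.res R.ty.ok)
  · obtain ⟨k, rfl, c'⟩ := hstep M' h' s
    obtain ⟨S'', hS', hok', ht'⟩ := s.ty hok ht
    obtain ⟨hM', hh'⟩ := s.in (φ := φ) (by rwa [hok.dom]) (by rwa [hok.dom])
    rw [hok'.dom] at hM' hh'
    exact (ihn k (Nat.lt_succ_self k) rfl (hS.trans hS') hok' ht' hM' hh' c').head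
      (s.resH R.ty.ok R.ty.r hM ha).toStep
  · obtain ⟨hKi, hf, hVi⟩ := (Cx.in_plug hK).1 hM
    obtain ⟨T₁, ht₁, hKt⟩ := CxTy.of_plug hK ht
    cases ht₁ with
    | app hft hVt =>
    cases hft with
    | fname hc hwf hl =>
    obtain ⟨N, hN, hNt, hst, hle⟩ := R.fn f S' V hf hS hok.store hV hVi hVt
    rw [Cx.res_plug _ hK] at c ⊢
    have hK₂ := hw₂.src ((Cx.in_plug hK (M := .unit)).2 ⟨hKi, trivial⟩)
    rw [Cx.res_plug _ hK] at hK₂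
    refine hle S' _ T _ (.refl _) (hK.res R.ty.ok)
      ((Cx.src_iff (M := .unit) (hK.res R.ty.ok) trivial).1 hK₂) (hKt.res hw₂ hK hKi) hh₂.1 hh₂.2 ?_
    rw [← Cx.res_plug _ hK]
    rcases n with _ | k
    · exact (Cx.plug_value (hK.res R.ok) c).2.elim
    · obtain ⟨a, M', h', ha, s, c⟩ := c
      obtain ⟨rfl, rfl⟩ := s.det ((hst a _).plug (hK.res R.ok))
      rw [← Cx.res_plug _ hK] at c
      exact ihn k (Nat.lt_succ_self k) rfl hS hok (hKt.plug hNt) ((Cx.in_plug hK).2 ⟨hKi, hN⟩) hh c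
  · obtain ⟨hKi, hb, hdi⟩ := (Cx.in_plug hK).1 hM
    obtain ⟨T₁, ht₁, hKt⟩ := CxTy.of_plug hK ht
    cases ht₁ with
    | unb hc hwf h1 h2 h3 h4 =>
    obtain ⟨N, hN, hNt, hw0, he, hle⟩ := R.bx b S' d hb hS hok.store hdi h2 h3
      fun x V T hx hV => h4 x V T hx hV
    rw [Cx.res_plug _ hK] at c ⊢
    have hK₂ := hw₂.src ((Cx.in_plug hK (M := .unit)).2 ⟨hKi, trivial⟩)
    rw [Cx.res_plug _ hK] at hK₂
    refine hle S' _ T _ (.refl _) (hK.res R.ty.ok)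
      ((Cx.src_iff (M := .unit) (hK.res R.ty.ok) trivial).1 hK₂) (hKt.res hw₂ hK hKi) hh₂.1 hh₂.2 ?_
    rw [← Cx.res_plug _ hK]
    rw [← he, ← Cx.res_plug _ hK] at c
    refine ihm _ ?_ rfl hS hok (hKt.plug hNt) ((Cx.in_plug hK).2 ⟨hKi, hN⟩) hh c
    rw [← hm, Cx.wt_plug _ hK, Cx.wt_plug _ hK, hw0]
    exact Nat.lt_succ_self _

/-- A source context and a source heap are not affected by resolution, so putting the name in the
hole and resolving it gives the context filled with either value; this reduces the claim to
`Repl.conv`. -/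
theorem Repl.value {S T w₁ w₂} {n : Name} {φ : Set Name} (R : Repl φ S w₁ w₂) (hφ : φ = {n})
    (hr₂ : ∀ l, w₂.r l = l) (hn : ∀ {S'}, WfSCtx S' → ClTyped S' 1 n.toTm T)
    (hs : (n.toTm.res w₁).Src) (ht : ClTyped S 1 (n.toTm.res w₁) T) :
    CCiu S T (n.toTm.res w₁) (n.toTm.res w₂) := by
  intro S' K T' h hS hK hKs hKt hh hhs c
  have hres : ∀ w : Env, (∀ l, w.r l = l) → resH w h = h := by
    intro w hr
    funext l
    rcases hl : h l with _ | V
    · simp [resH, hl]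
    · simp [resH, hl, Tm.res_src hr V (hhs l V hl)]
  have e : ∀ w : Env, (∀ l, w.r l = l) → (K.plug n.toTm).res w = K.plug (n.toTm.res w) := by
    intro w hr
    rw [Cx.res_plug w hK, Cx.res_src hr hKs]
  obtain ⟨k, c⟩ := c.convN hh.finite
  have hd : domOf h = domOf S' := Set.ext hh.dom
  have hKi : K.In ∅ (domOf S') :=
    ((Cx.in_plug hK).1 ((hKt.plug (ht.store hS hh.store)).in_src (hKs.plug hK hs))).1
  have hni : n.toTm.In φ (domOf S') 0 := by subst hφ; cases n <;> exact rfl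
  have := R.conv (M := K.plug n.toTm) (h := h) (n := k) rfl hS (.of_wfHeap hh)
    (hKt.plug (hn hh.store))
    ((Cx.in_plug hK).2 ⟨hKi.mono (Set.empty_subset _) subset_rfl, hni⟩)
    (fun l V hV => by
      obtain ⟨T, hT⟩ := mem_domOf.1 (hd ▸ mem_domOf.2 ⟨V, hV⟩ : l ∈ domOf S')
      obtain ⟨j, hj⟩ := hh.typed l V T hV hT
      exact Tm.In.mono _ (Set.empty_subset _) subset_rfl le_rfl (hj.in_src (hhs l V hV)))
    (by rwa [e w₁ R.r, hres w₁ R.r])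
  rwa [e w₂ hr₂, hres w₂ hr₂] at this

/-- Functions are related if their applications are, where the argument `V` and the unfolded body
`N` may contain the name `f` of the function itself. In this way the copies of the function that
spread during the reduction, including its recursive calls, are replaced together. -/
theorem CCiu.fn_of {S V₁ V₂} {f : FName} (hl : f.lvl = 1) (hv₁ : V₁.IsValue) (hv₂ : V₂.IsValue)
    (hs₁ : V₁.Src) (hs₂ : V₂.Src) (h₁ : ClTyped S 1 V₁ (.arr f.dom f.cod))
    (h₂ : ClTyped S 1 V₂ (.arr f.dom f.cod))
    (hN : ∀ S' V, PSub S S' → WfSCtx S' → V.IsValue → V.In {.fn f} (domOf S') 0 →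
      ClTyped S' 1 V f.dom → ∃ N, N.In {.fn f} (domOf S') 0 ∧ ClTyped S' 1 N f.cod ∧
      ∀ w : Env, w.Ok → (∀ l, w.r l = l) →
        (w.f f = V₁ → ∀ a h, St a (.app V₁ (V.res w)) h (N.res w) h) ∧
        (w.Typed S' {.fn f} → w.f f = V₂ → CCiu S' f.cod (N.res w) (.app V₂ (V.res w)))) :
    CCiu S (.arr f.dom f.cod) V₁ V₂ := by
  have env : ∀ V : Tm, V.IsValue → V.Src → ClTyped S 1 V (.arr f.dom f.cod) →
      ∃ w : Env, w.Ok ∧ (∀ l, w.r l = l) ∧ w.f f = V := by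
    intro V hv hs ht
    obtain ⟨w, hw, hr, hb⟩ := exists_env (B := {(.fn f, V)})
      ⟨fun n V V' h h' => by cases h; cases h'; rfl, fun n V h => by cases h; exact ⟨hv, S, 1, ht⟩⟩
      (fun n V h => by cases h; exact hs)
    exact ⟨w, hw, hr, hb (.fn f) V rfl⟩
  obtain ⟨w₁, hw₁, hr₁, hf₁⟩ := env V₁ hv₁ hs₁ h₁
  obtain ⟨w₂, hw₂, hr₂, hf₂⟩ := env V₂ hv₂ hs₂ h₂
  have ty : w₂.Typed S {.fn f} :=
    ⟨hw₂, hr₂, fun g hg => by cases hg; rw [hf₂, hl]; exact ⟨hs₂, h₂⟩, fun b hb => by cases hb⟩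
  have R : Repl {.fn f} S w₁ w₂ := by
    refine ⟨hw₁, hr₁, ty, fun g S' V hg hS hS' hv hVi ht => ?_, fun b _ _ hb => by cases hb⟩
    cases hg
    obtain ⟨N, hi, hNt, hw⟩ := hN S' V hS hS' hv hVi ht
    refine ⟨N, hi, hNt, ?_, ?_⟩
    · rw [hf₁]; exact (hw w₁ hw₁ hr₁).1 hf₁
    · rw [hf₂]; exact (hw w₂ hw₂ hr₂).2 (ty.store hS hS') hf₂
  have e₁ : (Name.fn f).toTm.res w₁ = V₁ := hf₁
  have e₂ : (Name.fn f).toTm.res w₂ = V₂ := hf₂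
  rw [← e₁, ← e₂]
  exact R.value rfl hr₂ (fun h => .fname (.closed h 1) (by rw [FName.WF, hl]; exact h₁.wf.2) hl.le)
    (e₁ ▸ hs₁) (e₁ ▸ h₁)

/-- The only use of a box is to run its code under some substitution of values, so related instances
suffice. The intermediate term for `Repl` is `A₁` under the explicit substitution: it equals the use
of `b` under `w₁`, and it has weight 0 because `A₁` is a source term. -/
theorem CCiu.box_of {S A₁ A₂} {b : BName} (hs₁ : A₁.Src) (hs₂ : A₂.Src)
    (h₁ : HasTy S [] [] b.ctx [] 0 A₁ b.ty) (h₂ : HasTy S [] [] b.ctx [] 0 A₂ b.ty)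
    (hle : ∀ S' e, PSub S S' → WfSCtx S' →
      (∀ x V, e x = some V → V.IsValue ∧ V.Src ∧ ∃ T, ClTyped S' 1 V T) →
      (∀ x T, (x, T) ∈ b.ctx → ∃ V, e x = some V ∧ ClTyped S' 1 V T) →
      CCiu S' b.ty (A₁.inst e) (A₂.inst e)) :
    CCiu S (.box b.ctx b.ty) (.box A₁) (.box A₂) := by
  have hbox : ∀ {A}, HasTy S [] [] b.ctx [] 0 A b.ty → ClTyped S 1 (.box A) (.box b.ctx b.ty) :=
    fun h => .box (.nil 1) (by simp) h
  have env : ∀ A : Tm, A.Src → HasTy S [] [] b.ctx [] 0 A b.ty →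
      ∃ w : Env, w.Ok ∧ (∀ l, w.r l = l) ∧ w.b b = A := by
    intro A hs ht
    obtain ⟨w, hw, hr, hb⟩ := exists_env (B := {(.bx b, .box A)})
      ⟨fun n V V' h h' => by cases h; cases h'; rfl,
        fun n V h => by cases h; exact ⟨trivial, S, 1, hbox ht⟩⟩
      (fun n V h => by cases h; exact hs)
    have := hb (.bx b) (.box A) rfl
    simp only [Name.toTm, Tm.res, Tm.box.injEq] at this
    exact ⟨w, hw, hr, this⟩
  obtain ⟨w₁, hw₁, hr₁, hf₁⟩ := env A₁ hs₁ h₁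
  obtain ⟨w₂, hw₂, hr₂, hf₂⟩ := env A₂ hs₂ h₂
  have ty : w₂.Typed S {.bx b} :=
    ⟨hw₂, hr₂, (fun b hb => by cases hb), fun g hg => by cases hg; rw [hf₂]; exact ⟨hs₂, h₂⟩⟩
  have unb : ∀ (w : Env) (d : LSub) (A : Tm), w.b b = A → (∀ x, x ∈ d.keys ↔ x ∈ b.ctx.dom) →
      HasTy S [] [] b.ctx [] 0 A b.ty → (Tm.unb b d).res w = A.inst (d.res w).lookup := by
    intro w d A hA hk ht
    simp only [Tm.res, hA]
    refine Tm.lsub_congr A ht.code (by simp) fun x hx => ?_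
    obtain ⟨V, hV⟩ := LSub.lookup_of_mem ((hk x).2 hx)
    simp [hV]
  have R : Repl {.bx b} S w₁ w₂ := by
    refine ⟨hw₁, hr₁, ty, (fun f _ _ hf => by cases hf), fun g S' d hg hS hS' hd hk hv ht => ?_⟩
    cases hg
    have ind : ∀ w : Env, w.Ok → (∀ l, w.r l = l) →
        (A₁.inst d.lookup).res w = A₁.inst (d.res w).lookup := by
      intro w hw hr
      rw [Tm.res_inst hw, Tm.res_src hr A₁ hs₁]
      congr 1; funext x; simp
    refine ⟨A₁.inst d.lookup, ?_, ?_, ?_, ?_, ?_⟩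
    · exact Tm.In.inst (Tm.In.mono _ (Set.empty_subset _) hS.domOf le_rfl (h₁.in_src hs₁)) le_rfl
        fun x V hV => hd.lookup hV
    · refine (h₁.store hS hS').inst (Fin.zero_le _) (.nil 1) (by simp) hv fun x T hx => ?_
      obtain ⟨V, hV⟩ := LSub.lookup_of_mem ((hk x).2 (LCtx.mem_dom.2 ⟨T, hx⟩))
      exact ⟨V, hV, ht x V T hx hV⟩
    · rw [Tm.wt_inst _ hv]; exact hs₁.wt _
    · rw [ind w₁ hw₁ hr₁, unb w₁ d A₁ hf₁ hk h₁]
    · rw [ind w₂ hw₂ hr₂, unb w₂ d A₂ hf₂ hk h₂]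
      have ty' := ty.store hS hS'
      refine hle S' _ hS hS' (fun x V hV => ?_) fun x T hx => ?_
      · rw [LSub.lookup_res, Option.map_eq_some_iff] at hV
        obtain ⟨V, hV, rfl⟩ := hV
        obtain ⟨T, hx⟩ := LCtx.mem_dom.1 ((hk x).1 (LSub.mem_of_lookup hV))
        exact ⟨(hv x V hV).res hw₂, ty'.src (hd.lookup hV), T, (ht x V T hx hV).res ty' (hd.lookup hV)⟩
      · obtain ⟨V, hV⟩ := LSub.lookup_of_mem ((hk x).2 (LCtx.mem_dom.2 ⟨T, hx⟩))
        exact ⟨V.res w₂, by simp [hV], (ht x V T hx hV).res ty' (hd.lookup hV)⟩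
  have e₁ : (Name.bx b).toTm.res w₁ = .box A₁ := congrArg Tm.box hf₁
  have e₂ : (Name.bx b).toTm.res w₂ = .box A₂ := congrArg Tm.box hf₂
  have hs : (Tm.box A₁).Src := hs₁
  have ht := hbox h₁
  rw [← e₁, ← e₂]
  exact R.value rfl hr₂ (fun h => .bname (.closed h 1) ht.wf.2) (e₁ ▸ hs) (e₁ ▸ ht)

/-! ## Closing substitutions under binders -/

theorem Closing.store {S S' P G σ δ} (c : Closing S P G σ δ) (hS : PSub S S') (hS' : WfSCtx S') :
    Closing S' P G σ δ := by
  refine ⟨fun u N h => ?_, fun x V h => ?_, fun u G' T h => ?_, fun x T h => ?_⟩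
  · obtain ⟨hs, G', T, ht⟩ := c.glob u N h
    exact ⟨hs, G', T, ht.store hS hS'⟩
  · obtain ⟨hv, hs, T, ht⟩ := c.loc x V h
    exact ⟨hv, hs, T, ht.store hS hS'⟩
  · obtain ⟨N, hN, ht⟩ := c.globTy u G' T h
    exact ⟨N, hN, ht.store hS hS'⟩
  · obtain ⟨V, hV, ht⟩ := c.locTy x T h
    exact ⟨V, hV, ht.store hS hS'⟩

theorem Closing.mono {S P P' G G' σ δ} (c : Closing S P' G' σ δ) (hP : P ⊆ P') (hG : G ⊆ G') :
    Closing S P G σ δ :=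
  ⟨c.glob, c.loc, fun u G T h => c.globTy u G T (hP h), fun x T h => c.locTy x T (hG h)⟩

theorem Closing.local {S P G G' σ δ e} (c : Closing S P G σ δ)
    (he : ∀ x V, e x = some V → V.IsValue ∧ V.Src ∧ ∃ T, ClTyped S 1 V T)
    (ht : ∀ x T, (x, T) ∈ G' → ∃ V, e x = some V ∧ ClTyped S 1 V T) : Closing S P G' σ e :=
  ⟨c.glob, he, c.globTy, ht⟩

theorem locTy_update {S G δ x T V} (hG : (((x, T) :: G : LCtx).map Prod.fst).Nodup)
    (hV : ClTyped S 1 V T) (h : ∀ y T, (y, T) ∈ G → ∃ V, δ y = some V ∧ ClTyped S 1 V T) :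
    ∀ y T', (y, T') ∈ (x, T) :: G → ∃ V', Function.update δ x (some V) y = some V' ∧
      ClTyped S 1 V' T' := by
  intro y T' hy
  by_cases e : y = x
  · subst e
    obtain rfl := LCtx.unique hG hy List.mem_cons_self
    exact ⟨V, by simp, hV⟩
  · rcases List.mem_cons.1 hy with h' | h'
    · cases h'; exact (e rfl).elim
    · simpa [Function.update_of_ne e] using h y T' h'

theorem Closing.update {S P G σ δ x T V} (c : Closing S P G σ δ)
    (hG : (((x, T) :: G : LCtx).map Prod.fst).Nodup) (hv : V.IsValue) (hs : V.Src)
    (hV : ClTyped S 1 V T) : Closing S P ((x, T) :: G) σ (Function.update δ x (some V)) := by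
  refine c.local (fun y W hW => ?_) (locTy_update hG hV c.locTy)
  by_cases e : y = x
  · subst e; simp at hW; subst hW; exact ⟨hv, hs, T, hV⟩
  · rw [Function.update_of_ne e] at hW; exact c.loc y W hW

theorem Closing.gupdate {S P G σ δ u G₀ T N} (c : Closing S P G σ δ)
    (hP : (((u, (G₀, T)) :: P : GCtx).map Prod.fst).Nodup) (hs : N.Src)
    (hN : HasTy S [] [] G₀ [] 0 N T) :
    Closing S ((u, (G₀, T)) :: P) G (Function.update σ u (some N)) δ := by
  refine ⟨fun w N' h => ?_, c.loc, fun w G' T' h => ?_, c.locTy⟩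
  · by_cases e : w = u
    · subst e; simp at h; subst h; exact ⟨hs, G₀, T, hN⟩
    · rw [Function.update_of_ne e] at h; exact c.glob w N' h
  · by_cases e : w = u
    · subst e
      have := GCtx.unique hP h List.mem_cons_self
      simp only [Prod.mk.injEq] at this
      obtain ⟨rfl, rfl⟩ := this
      exact ⟨N, by simp, hN⟩
    · rcases List.mem_cons.1 h with h' | h'
      · cases h'; exact (e rfl).elim
      · simpa [Function.update_of_ne e] using c.globTy w G' T' h'

theorem Closing.sc {S P G σ δ} (c : Closing S P G σ δ) :
    (gmap σ).Sc (scopeOf P []) (scopeOf [] []) := by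
  rintro (k | u) Y ⟨G', T, h, rfl⟩
  · simp [GDecl] at h
  · obtain ⟨N, hN, ht⟩ := c.globTy u G' T h
    refine ⟨fun v' hv => by simp [gmap, hN] at hv, fun N' hN' => ?_⟩
    simp only [gmap, hN, Sum.inr.injEq] at hN'
    subst hN'
    exact ht.sc

/-- Applying the closed abstraction to `W` is closing the body with `x` sent to `W`. This translates
the instances of the body that arise in a reduction into closing substitutions, to which the
hypothesis on the body applies. `Tm.recN_cl` and `Tm.letboxN_cl` do the same for the other binders.
-/
theorem Tm.lamN_cl {S S' P G G' i M T σ δ} (h : HasTy S P [] G [] i M T)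
    (c : Closing S' P G' σ δ) (x : LVar) : ∃ B, (Tm.lamN x M).cl σ δ = .lam B ∧
      ∀ W, B.beta W = M.cl σ (Function.update δ x (some W)) := by
  refine ⟨_, rfl, fun W => ?_⟩
  rw [Tm.gsub_lsub M _ _ h.sc c.sc (gmap_lc c), Tm.beta, Tm.lsub_lsub, Tm.lsub_lsub, Tm.cl, Tm.inst]
  refine Tm.lsub_congr _ (Tm.Sc.gsub M h.sc c.sc) (by simp) fun y _ => ?_
  by_cases e : y = x
  · subst e; simp [Tm.gsub, Tm.lsub, upSub]
  · simp only [e, if_false, Tm.gsub, Tm.lsub, Function.update_of_ne e, Tm.lsub_lren]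
    exact Tm.lsub_id _

theorem Tm.recN_cl {S S' P G G' i M T σ δ} (h : HasTy S P [] G [] i M T)
    (c : Closing S' P G' σ δ) (y x : LVar) : ∃ B, (Tm.recN y x M).cl σ δ = .recf B ∧
      ∀ V W, B.beta2 V W = M.cl σ (Function.update (Function.update δ y (some W)) x (some V)) := by
  refine ⟨_, rfl, fun V W => ?_⟩
  rw [Tm.gsub_lsub M _ _ h.sc c.sc (gmap_lc c), Tm.beta2, Tm.lsub_lsub, Tm.lsub_lsub, Tm.cl, Tm.inst]
  refine Tm.lsub_congr _ (Tm.Sc.gsub M h.sc c.sc) (by simp) fun z _ => ?_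
  by_cases e : z = x
  · subst e; simp [Tm.gsub, Tm.lsub, upSub]
  by_cases e' : z = y
  · subst e'; simp [e, Tm.gsub, Tm.lsub, upSub, Tm.lren]
  · simp only [e, e', if_false, Tm.gsub, Tm.lsub, Function.update_of_ne e, Function.update_of_ne e',
      Tm.lsub_lren]
    exact Tm.lsub_id _

theorem Tm.letboxN_cl {S S' P G u G₀ T₀ i M T σ δ} {N : Tm}
    (h : HasTy S ((u, (G₀, T₀)) :: P) [] G [] i M T) (c : Closing S' P G σ δ) :
    ∃ B, (Tm.letboxN u N M).cl σ δ = .letbox (N.cl σ δ) B ∧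
      ∀ M₀, HasTy S' [] [] G₀ [] 0 M₀ T₀ → B.gbeta M₀ = M.cl (Function.update σ u (some M₀)) δ := by
  rw [Tm.letboxN_eq]
  refine ⟨_, rfl, fun M₀ hM₀ => ?_⟩
  obtain ⟨gb, hgb, g0, gs⟩ : ∃ gb : GSub, (∀ B : Tm, B.gbeta M₀ = B.gsub gb) ∧
      gb (.b 0) = .inr M₀ ∧ ∀ v N, gb v = .inr N → N = M₀ :=
    ⟨_, fun _ => rfl, rfl, by rintro ((_ | k) | u) v' h <;> simp_all⟩
  set g₁ : GSub := fun v => upGSub (gmap σ) (absGV u v) with hg₁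
  -- Once the free global variables are closed, the index bound by `letbox` is the only global
  -- variable left; this scope lets the two global substitutions be composed.
  set Φ : GV → Set LVar → Prop := fun v Y => v = .b 0 ∧ Y = {x | x ∈ G₀.dom} with hΦ
  have hP := h.wf.1.glob.1
  have hu : g₁ (.f u) = .inl (.b 0) := by simp [hg₁, absGV, upGSub]
  have hw : ∀ w G' T', w ≠ u → (w, (G', T')) ∈ (u, (G₀, T₀)) :: P → ∃ N, σ w = some N ∧
      HasTy S' [] [] G' [] 0 N T' ∧ g₁ (.f w) = .inr N := by
    intro w G' T' e hm
    rcases List.mem_cons.1 hm with h' | h'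
    · cases h'; exact (e rfl).elim
    obtain ⟨N, hN, ht⟩ := c.globTy w G' T' h'
    exact ⟨N, hN, ht, by simp [hg₁, absGV, e, upGSub, gmap, hN, ht.code.gren]⟩
  have hu' : ∀ G' T', (u, (G', T')) ∈ (u, (G₀, T₀)) :: P → G' = G₀ := by
    intro G' T' hm
    have := GCtx.unique hP hm List.mem_cons_self
    simp only [Prod.mk.injEq] at this
    exact this.1
  have s₁ : g₁.Sc (scopeOf ((u, (G₀, T₀)) :: P) []) Φ := by
    rintro (k | w) Y ⟨G', T', hd, rfl⟩
    · simp [GDecl] at hd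
    by_cases e : w = u
    · subst e
      rw [hu, hu' G' T' hd]
      exact ⟨fun v' hv => (by cases hv; exact ⟨rfl, rfl⟩), fun N hN => by cases hN⟩
    · obtain ⟨N, -, ht, hg⟩ := hw w G' T' e hd
      rw [hg]
      refine ⟨fun v' hv => (by cases hv), fun N hN => ?_⟩
      cases hN
      exact Tm.Sc.mono _ (fun v Y hv => hv.elim) le_rfl subset_rfl ht.code
  have s₂ : gb.Sc Φ (scopeOf [] []) := by
    rintro v Y ⟨rfl, rfl⟩
    rw [g0]
    exact ⟨fun v' hv => (by cases hv), fun N hN => by cases hN; exact hM₀.sc⟩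
  have l₂ : gb.Lc := by
    intro v N hN r
    obtain rfl := gs v N hN
    exact hM₀.code.lren_eq r
  have hl : ∀ y, Tm.gsub gb (((δ y).getD (.fvar y)).gren GV.shift) = (δ y).getD (.fvar y) := by
    intro y
    rcases hy : δ y with _ | V
    · rfl
    · obtain ⟨-, -, T', ht⟩ := c.loc y V hy
      simp only [Option.getD_some, ht.code.gren, ht.code.gsub]
  rw [hgb, Tm.gsub_gren, ← hg₁, Tm.gsub_lsub _ _ _ (Tm.Sc.gsub M h.sc s₁) s₂ l₂,
    Tm.gsub_gsub M h.sc s₁ s₂ l₂, Tm.cl, Tm.inst]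
  simp only [hl]
  congr 1
  refine Tm.gsub_congr M h.sc ?_
  rintro (k | w) Y ⟨G', T', hd, -⟩
  · simp [GDecl] at hd
  by_cases e : w = u
  · subst e
    simp [GSub.comp, hu, g0, gmap]
  · obtain ⟨N, hN, ht, hg⟩ := hw w G' T' e hd
    simp [GSub.comp, hg, gmap, Function.update_of_ne e, hN, ht.code.gsub]

/-- The values of `δ'` may contain names, unlike those of a closing substitution. This is needed for
bodies that receive a name, as in `CCiu.fn_of`. -/
theorem HasTy.cl_of {S S' P G G' i M T σ δ δ'} (h : HasTy S P [] G' [] i M T)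
    (c : Closing S' P G σ δ) (hS : PSub S S') (hS' : WfSCtx S')
    (hv : ∀ x V, δ' x = some V → V.IsValue)
    (ht : ∀ x T, (x, T) ∈ G' → ∃ V, δ' x = some V ∧ ClTyped S' 1 V T) :
    ClTyped S' 1 (M.cl σ δ') T :=
  (h.gmap c hS hS').inst (layer_le_one i) (.nil 1) (by simp) hv ht

theorem Tm.cl_res {S S' P G G' i M T σ δ δ' w} (hs : M.Src) (h : HasTy S P [] G' [] i M T)
    (c : Closing S' P G σ δ) (hw : Env.Ok w) (hr : ∀ l, w.r l = l) :
    (M.cl σ δ').res w = M.cl σ (fun x => (δ' x).map (Tm.res w)) := by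
  have hg : (M.gsub (gmap σ)).Src := by
    refine Tm.In.src (L := Set.univ) (n := 0) _ rfl (Tm.In.gsub M
      (Tm.In.mono _ subset_rfl (Set.subset_univ _) le_rfl (h.in_src hs)) fun v N hN => ?_)
    obtain ⟨u, hu⟩ := gmap_inr hN
    exact Tm.In.mono _ subset_rfl (Set.subset_univ _) le_rfl (c.in_glob u N hu)
  rw [Tm.cl, Tm.res_inst hw, Tm.res_src hr _ hg]; rfl

theorem Closing.map_res {S P G σ δ w} (c : Closing S P G σ δ) (hr : ∀ l, Env.r w l = l) (x : LVar) :
    (δ x).map (Tm.res w) = δ x := by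
  rcases h : δ x with _ | V
  · rfl
  · rw [Option.map_some, Tm.res_src hr V (c.loc x V h).2.1]

/-! ## Compatibility with the constructions of terms -/

theorem ciu_iff {S P G T M N} : Ciu S P G T M N ↔ ∀ S' σ δ, PSub S S' → WfSCtx S' →
    Closing S' P G σ δ → CCiu S' T (M.cl σ δ) (N.cl σ δ) :=
  ⟨fun H _ σ δ hS _ c S'' K T' h hS' hK hKs hKt hh =>
    H S'' σ δ K T' h (hS.trans hS') (c.store hS' hh.store) hK hKs hKt hh,
  fun H S' σ δ K T' h hS c hK hKs hKt hh =>
    H S' σ δ hS hh.store c S' K T' h (.refl _) hK hKs hKt hh⟩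

theorem Ciu.lam {S P G i x T₁ T₂ M₁ M₂} (hs₁ : M₁.Src)
    (h₁ : HasTy S P [] ((x, T₁) :: G) [] i M₁ T₂) (h₂ : HasTy S P [] ((x, T₁) :: G) [] i M₂ T₂)
    (sl₁ : (Tm.lamN x M₁).Src) (sl₂ : (Tm.lamN x M₂).Src)
    (H : Ciu S P ((x, T₁) :: G) T₂ M₁ M₂) :
    Ciu S P G (.arr T₁ T₂) (Tm.lamN x M₁) (Tm.lamN x M₂) := by
  rw [ciu_iff] at H ⊢
  intro S' σ δ hS hS' c
  obtain ⟨B₁, e₁, b₁⟩ := Tm.lamN_cl h₁ c x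
  obtain ⟨B₂, e₂, b₂⟩ := Tm.lamN_cl h₂ c x
  have hG := h₁.wf.1.loc.1
  refine CCiu.fn_of (f := ⟨T₁, T₂, 1, 0⟩) rfl (by rw [e₁]; trivial) (by rw [e₂]; trivial)
    (sl₁.cl h₁.lamN c hS) (sl₂.cl h₂.lamN c hS) (h₁.lamN.cl c hS hS') (h₂.lamN.cl c hS hS') ?_
  intro S'' V hS'' hS₂ hv hVi hVt
  have c' := c.store hS'' hS₂
  -- The unfolded body is that of the smaller function. Under `w₁` it is what the application
  -- reduces to; under `w₂` the hypothesis compares it with the body of the larger function, from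
  -- which the last step is undone by `CCiu.exp`.
  refine ⟨M₁.cl σ (Function.update δ x (some V)), ?_, ?_, fun w hw hr => ?_⟩
  · refine Tm.In.cl (Tm.In.mono _ (Set.empty_subset _) (hS.trans hS'').domOf le_rfl (h₁.in_src hs₁))
      (fun u N h => Tm.In.mono _ (Set.empty_subset _) subset_rfl le_rfl (c'.in_glob u N h))
      fun y W h => ?_
    by_cases e : y = x
    · subst e; simp at h; subst h; exact hVi
    · rw [Function.update_of_ne e] at h
      exact Tm.In.mono _ (Set.empty_subset _) subset_rfl le_rfl (c'.in_loc y W h)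
  · refine h₁.cl_of c' (hS.trans hS'') hS₂ (fun y W h => ?_) (locTy_update hG hVt c'.locTy)
    by_cases e : y = x
    · subst e; simp at h; subst h; exact hv
    · rw [Function.update_of_ne e] at h; exact (c'.loc y W h).1
  · have e : (M₁.cl σ (Function.update δ x (some V))).res w =
        M₁.cl σ (Function.update δ x (some (V.res w))) := by
      rw [Tm.cl_res hs₁ h₁ c hw hr]
      congr 1
      funext y
      by_cases e : y = x
      · subst e; simp
      · simp only [Function.update_of_ne e]; exact c.map_res hr y
    rw [e, e₁, e₂]
    refine ⟨fun _ a h => b₁ (V.res w) ▸ .beta (hv.res hw), fun hwt _ => ?_⟩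
    refine .trans (H S'' σ _ (hS.trans hS'') hS₂
      (c'.update hG (hv.res hw) (hwt.src hVi) (hVt.res hwt hVi))) (.exp fun a h => ?_)
    exact b₂ (V.res w) ▸ .beta (hv.res hw)

theorem Ciu.recf {S P G i y x T₁ T₂ M₁ M₂} (hs₁ : M₁.Src)
    (h₁ : HasTy S P [] ((x, T₁) :: (y, .arr T₁ T₂) :: G) [] i M₁ T₂)
    (h₂ : HasTy S P [] ((x, T₁) :: (y, .arr T₁ T₂) :: G) [] i M₂ T₂)
    (sl₁ : (Tm.recN y x M₁).Src) (sl₂ : (Tm.recN y x M₂).Src)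
    (H : Ciu S P ((x, T₁) :: (y, .arr T₁ T₂) :: G) T₂ M₁ M₂) :
    Ciu S P G (.arr T₁ T₂) (Tm.recN y x M₁) (Tm.recN y x M₂) := by
  rw [ciu_iff] at H ⊢
  intro S' σ δ hS hS' c
  obtain ⟨B₁, e₁, b₁⟩ := Tm.recN_cl h₁ c y x
  obtain ⟨B₂, e₂, b₂⟩ := Tm.recN_cl h₂ c y x
  have hG := h₁.wf.1.loc.1
  have hG' : (((y, Ty.arr T₁ T₂) :: G : LCtx).map Prod.fst).Nodup := (List.nodup_cons.1 hG).2
  have t₁ := h₁.recN.cl c hS hS'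
  have t₂ := h₂.recN.cl c hS hS'
  have s₂ := sl₂.cl h₂.recN c hS
  refine CCiu.fn_of (f := ⟨T₁, T₂, 1, 0⟩) rfl (by rw [e₁]; trivial) (by rw [e₂]; trivial)
    (sl₁.cl h₁.recN c hS) s₂ t₁ t₂ ?_
  intro S'' V hS'' hS₂ hv hVi hVt
  have c' := c.store hS'' hS₂
  set f : FName := ⟨T₁, T₂, 1, 0⟩
  have hf : ClTyped S'' 1 (.fname f) (.arr T₁ T₂) := .fname (.closed hS₂ 1) t₁.wf.2 le_rfl
  -- The recursion variable is sent to the name `f` and not to one of the functions: resolution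
  -- turns it into the smaller function under `w₁` and into the larger one under `w₂`, as unfolding
  -- requires on either side.
  refine ⟨M₁.cl σ (Function.update (Function.update δ y (some (.fname f))) x (some V)), ?_, ?_,
    fun w hw hr => ?_⟩
  · refine Tm.In.cl (Tm.In.mono _ (Set.empty_subset _) (hS.trans hS'').domOf le_rfl (h₁.in_src hs₁))
      (fun u N h => Tm.In.mono _ (Set.empty_subset _) subset_rfl le_rfl (c'.in_glob u N h))
      fun z W h => ?_
    by_cases e : z = x
    · subst e; simp at h; subst h; exact hVi
    rw [Function.update_of_ne e] at h
    by_cases e' : z = y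
    · subst e'; simp at h; subst h; exact rfl
    rw [Function.update_of_ne e'] at h
    exact Tm.In.mono _ (Set.empty_subset _) subset_rfl le_rfl (c'.in_loc z W h)
  · refine h₁.cl_of c' (hS.trans hS'') hS₂ (fun z W h => ?_)
      (locTy_update hG hVt (locTy_update hG' hf c'.locTy))
    by_cases e : z = x
    · subst e; simp at h; subst h; exact hv
    rw [Function.update_of_ne e] at h
    by_cases e' : z = y
    · subst e'; simp at h; subst h; trivial
    rw [Function.update_of_ne e'] at h; exact (c'.loc z W h).1
  · have e : (M₁.cl σ (Function.update (Function.update δ y (some (.fname f))) x (some V))).res w =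
        M₁.cl σ (Function.update (Function.update δ y (some (w.f f))) x (some (V.res w))) := by
      rw [Tm.cl_res hs₁ h₁ c hw hr]
      congr 1
      funext z
      by_cases e : z = x
      · subst e; simp
      by_cases e' : z = y
      · subst e'; simp [Function.update_of_ne e, Tm.res]
      · simp only [Function.update_of_ne e, Function.update_of_ne e']; exact c.map_res hr z
    rw [e]
    refine ⟨fun hf a h => ?_, fun hwt hf => ?_⟩
    · rw [hf, e₁, ← b₁]; exact .recf (hv.res hw)
    · rw [hf]
      refine .trans (H S'' σ _ (hS.trans hS'') hS₂
        ((c'.update hG' (by rw [e₂]; trivial) s₂ (t₂.store hS'' hS₂)).update hG (hv.res hw)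
          (hwt.src hVi) (hVt.res hwt hVi))) (.exp fun a h => ?_)
      rw [e₂, ← b₂]; exact .recf (hv.res hw)

/-- The code has its own local context. Whatever values it is run with form, together with `σ`, a
closing substitution for this context, so the hypothesis covers all uses of the box. -/
theorem Ciu.box {S P G G₀ T M₁ M₂} (hs₁ : M₁.Src) (hs₂ : M₂.Src)
    (h₁ : HasTy S P [] G₀ [] 0 M₁ T) (h₂ : HasTy S P [] G₀ [] 0 M₂ T) (H : Ciu S P G₀ T M₁ M₂) :
    Ciu S P G (.box G₀ T) (.box M₁) (.box M₂) := by
  rw [ciu_iff] at H ⊢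
  intro S' σ δ hS hS' c
  have src : ∀ {M : Tm}, M.Src → HasTy S P [] G₀ [] 0 M T → (M.gsub (gmap σ)).Src := by
    intro M hs ht
    refine Tm.In.src (L := Set.univ) (n := 0) _ rfl (Tm.In.gsub M
      (Tm.In.mono _ subset_rfl (Set.subset_univ _) le_rfl (ht.in_src hs)) fun v N hN => ?_)
    obtain ⟨u, hu⟩ := gmap_inr hN
    exact Tm.In.mono _ subset_rfl (Set.subset_univ _) le_rfl (c.in_glob u N hu)
  exact CCiu.box_of (b := ⟨G₀, T, 0⟩) (src hs₁ h₁) (src hs₂ h₂) (h₁.gmap c hS hS')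
    (h₂.gmap c hS hS') fun S'' e hS'' hS₂ he ht =>
      H S'' σ e (hS.trans hS'') hS₂ ((c.store hS'' hS₂).local he ht)

theorem CxTy.root {S T i} (hS : WfSCtx S) : CxTy S [] [] i T .hole [] [] i T :=
  .hole hS .nil (.nil i) (by simp) (by simp) le_rfl

theorem Ciu.appL {S P G i T₁ T₂ M₁ M₂ N} (ht : HasTy S P [] G [] i N T₁) (hs : N.Src)
    (H : Ciu S P G (.arr T₁ T₂) M₁ M₂) : Ciu S P G T₂ (.app M₁ N) (.app M₂ N) := by
  rw [ciu_iff] at H ⊢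
  exact fun S' σ δ hS hS' c => (H S' σ δ hS hS' c).frame (F := .appL .hole (N.cl σ δ)) trivial
    ⟨trivial, hs.cl ht c hS⟩ (.appL (.root hS') (ht.cl c hS hS'))

/-- The hole is in evaluation position only after `N` has become a value; `CCiu.of_values` reduces
the claim to that case, in which the context is a frame. -/
theorem Ciu.appR {S P G i T₁ T₂ M₁ M₂ N} (ht : HasTy S P [] G [] i N (.arr T₁ T₂)) (hs : N.Src)
    (H : Ciu S P G T₁ M₁ M₂) : Ciu S P G T₂ (.app N M₁) (.app N M₂) := by
  rw [ciu_iff] at H ⊢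
  exact fun S' σ δ hS hS' c => CCiu.of_values (F₁ := .appL .hole (M₁.cl σ δ))
    (F₂ := .appL .hole (M₂.cl σ δ)) trivial trivial
    (fun S'' V hS'' hS₂ hv hs hV => (H S'' σ δ (hS.trans hS'') hS₂ (c.store hS'' hS₂)).frame
      (F := .appR V .hole) ⟨hv, trivial⟩ ⟨trivial, hs⟩ (.appR hV (.root hS₂)))
    (hs.cl ht c hS) (ht.cl c hS hS')

theorem Ciu.arithL {S P G i o M₁ M₂ N} (ht : HasTy S P [] G [] i N .int) (hs : N.Src)
    (H : Ciu S P G .int M₁ M₂) : Ciu S P G .int (.arith o M₁ N) (.arith o M₂ N) := by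
  rw [ciu_iff] at H ⊢
  exact fun S' σ δ hS hS' c => (H S' σ δ hS hS' c).frame (F := .arithL o .hole (N.cl σ δ)) trivial
    ⟨trivial, hs.cl ht c hS⟩ (.arithL (.root hS') (ht.cl c hS hS'))

theorem Ciu.arithR {S P G i o M₁ M₂ N} (ht : HasTy S P [] G [] i N .int) (hs : N.Src)
    (H : Ciu S P G .int M₁ M₂) : Ciu S P G .int (.arith o N M₁) (.arith o N M₂) := by
  rw [ciu_iff] at H ⊢
  exact fun S' σ δ hS hS' c => CCiu.of_values (F₁ := .arithL o .hole (M₁.cl σ δ))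
    (F₂ := .arithL o .hole (M₂.cl σ δ)) trivial trivial
    (fun S'' V hS'' hS₂ hv hs hV => (H S'' σ δ (hS.trans hS'') hS₂ (c.store hS'' hS₂)).frame
      (F := .arithR o V .hole) ⟨hv, trivial⟩ ⟨trivial, hs⟩ (.arithR hV (.root hS₂)))
    (hs.cl ht c hS) (ht.cl c hS hS')

theorem Ciu.iteC {S P G i T M₁ M₂ N N'} (ht : HasTy S P [] G [] i N T)
    (ht' : HasTy S P [] G [] i N' T) (hs : N.Src) (hs' : N'.Src)
    (H : Ciu S P G .int M₁ M₂) : Ciu S P G T (.ite M₁ N N') (.ite M₂ N N') := by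
  rw [ciu_iff] at H ⊢
  exact fun S' σ δ hS hS' c => (H S' σ δ hS hS' c).frame
    (F := .iteC .hole (N.cl σ δ) (N'.cl σ δ)) trivial
    ⟨trivial, hs.cl ht c hS, hs'.cl ht' c hS⟩
    (.iteC (.root hS') (ht.cl c hS hS') (ht'.cl c hS hS'))

/-- Both branches vary at once; a context with its hole in one branch uses reflexivity for the
other. -/
theorem Ciu.branches {S P G i T M₁ M₂ M₁' M₂' N} (ht : HasTy S P [] G [] i N .int) (hs : N.Src)
    (H : Ciu S P G T M₁ M₂) (H' : Ciu S P G T M₁' M₂') :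
    Ciu S P G T (.ite N M₁ M₁') (.ite N M₂ M₂') := by
  rw [ciu_iff] at H H' ⊢
  refine fun S' σ δ hS hS' c => CCiu.of_values (F₁ := .iteC .hole (M₁.cl σ δ) (M₁'.cl σ δ))
    (F₂ := .iteC .hole (M₂.cl σ δ) (M₂'.cl σ δ)) trivial trivial
    (fun S'' V hS'' hS₂ hv hs hV => ?_) (hs.cl ht c hS) (ht.cl c hS hS')
  obtain ⟨n, rfl⟩ := hV.int_cases hv
  have c' := c.store hS'' hS₂
  by_cases hn : n = 0
  · subst hn
    exact (CCiu.red fun _ _ => .iteFalse).trans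
      ((H' S'' σ δ (hS.trans hS'') hS₂ c').trans (.exp fun _ _ => .iteFalse))
  · exact (CCiu.red fun _ _ => .iteTrue hn).trans
      ((H S'' σ δ (hS.trans hS'') hS₂ c').trans (.exp fun _ _ => .iteTrue hn))

theorem Ciu.refl (S P G T M) : Ciu S P G T M M := fun _ _ _ _ _ _ _ _ _ _ _ _ _ h => h

theorem Ciu.ref {S P G T M₁ M₂} (H : Ciu S P G T M₁ M₂) :
    Ciu S P G (.ref T) (.ref M₁) (.ref M₂) := by
  rw [ciu_iff] at H ⊢
  exact fun S' σ δ hS hS' c => (H S' σ δ hS hS' c).frame (F := .ref .hole) trivial trivial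
    (.ref (.root hS'))

theorem Ciu.deref {S P G T M₁ M₂} (H : Ciu S P G (.ref T) M₁ M₂) :
    Ciu S P G T (.deref M₁) (.deref M₂) := by
  rw [ciu_iff] at H ⊢
  exact fun S' σ δ hS hS' c => (H S' σ δ hS hS' c).frame (F := .deref .hole) trivial trivial
    (.deref (.root hS'))

theorem Ciu.assignL {S P G i T M₁ M₂ N} (ht : HasTy S P [] G [] i N T) (hs : N.Src)
    (H : Ciu S P G (.ref T) M₁ M₂) : Ciu S P G .unit (.assign M₁ N) (.assign M₂ N) := by
  rw [ciu_iff] at H ⊢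
  exact fun S' σ δ hS hS' c => (H S' σ δ hS hS' c).frame (F := .assignL .hole (N.cl σ δ)) trivial
    ⟨trivial, hs.cl ht c hS⟩ (.assignL (.root hS') (ht.cl c hS hS'))

theorem Ciu.assignR {S P G i T M₁ M₂ N} (ht : HasTy S P [] G [] i N (.ref T)) (hs : N.Src)
    (H : Ciu S P G T M₁ M₂) : Ciu S P G .unit (.assign N M₁) (.assign N M₂) := by
  rw [ciu_iff] at H ⊢
  exact fun S' σ δ hS hS' c => CCiu.of_values (F₁ := .assignL .hole (M₁.cl σ δ))
    (F₂ := .assignL .hole (M₂.cl σ δ)) trivial trivial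
    (fun S'' V hS'' hS₂ hv hs hV => (H S'' σ δ (hS.trans hS'') hS₂ (c.store hS'' hS₂)).frame
      (F := .assignR V .hole) ⟨hv, trivial⟩ ⟨trivial, hs⟩ (.assignR hV (.root hS₂)))
    (hs.cl ht c hS) (ht.cl c hS hS')

theorem Ciu.letboxL {S P G G₀ T₀ T M₁ M₂ N} (ht₁ : HasTy S P [] G [] 1 M₁ (.box G₀ T₀))
    (ht : HasTy S P [(G₀, T₀)] G [] 1 N T) (hs : N.Src) (H : Ciu S P G (.box G₀ T₀) M₁ M₂) :
    Ciu S P G T (.letbox M₁ N) (.letbox M₂ N) := by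
  rw [ciu_iff] at H ⊢
  intro S' σ δ hS hS' c
  obtain ⟨B, hB⟩ : ∃ B, ∀ M : Tm, (Tm.letbox M N).cl σ δ = .letbox (M.cl σ δ) B :=
    ⟨_, fun M => rfl⟩
  have hc := ht₁.wf.1
  -- A box name serves as a dummy for the bound term: it closes to itself, and inverting the typing
  -- of the closed `letbox` then gives the type of the closed body `B`.
  have key : HasTy S P [] G [] 1 (.letbox (.bname ⟨G₀, T₀, 0⟩) N) T :=
    .letbox (.bname hc ht₁.wf.2) ht
  have hBt := key.cl c hS hS'
  have hMs : (Tm.letbox .unit N).Src := ⟨trivial, hs⟩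
  have hBi : B.In ∅ (domOf S') 0 := by
    have h1 := Tm.In.cl (φ := ∅) (L := domOf S') (M := .letbox .unit N)
      ⟨trivial, Tm.In.mono _ subset_rfl hS.domOf le_rfl (ht.in_src hs)⟩ c.in_glob c.in_loc
    rw [hB] at h1
    exact h1.2
  rw [hB] at hBt ⊢
  rw [hB]
  cases hBt with
  | letbox h1 h2 =>
    generalize hU : Ty.box _ _ = U at h1
    cases h1 with
    | bname _ _ =>
      cases hU
      exact (H S' σ δ hS hS' c).frame (F := .letboxL .hole B) trivial
        ⟨trivial, Tm.In.src _ rfl hBi⟩ (.letboxL (.root hS') h2)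

/-- Once `N` has evaluated to a box, both sides make the `letbox` step, and the results are the two
bodies closed with `u` sent to the code. `Ciu` for the context extended by `u` compares them. -/
theorem Ciu.letboxR {S P G u G₀ T₀ T M₁ M₂ N} (ht : HasTy S P [] G [] 1 N (.box G₀ T₀))
    (hs : N.Src) (h₁ : HasTy S ((u, (G₀, T₀)) :: P) [] G [] 1 M₁ T)
    (h₂ : HasTy S ((u, (G₀, T₀)) :: P) [] G [] 1 M₂ T)
    (H : Ciu S ((u, (G₀, T₀)) :: P) G T M₁ M₂) :
    Ciu S P G T (Tm.letboxN u N M₁) (Tm.letboxN u N M₂) := by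
  rw [ciu_iff] at H ⊢
  intro S' σ δ hS hS' c
  obtain ⟨B₁, e₁, -⟩ := Tm.letboxN_cl (N := N) h₁ c
  obtain ⟨B₂, e₂, -⟩ := Tm.letboxN_cl (N := N) h₂ c
  rw [e₁, e₂]
  refine CCiu.of_values (F₁ := .letboxL .hole B₁) (F₂ := .letboxL .hole B₂) trivial trivial
    (fun S'' V hS'' hS₂ hv hs hV => ?_) (hs.cl ht c hS) (ht.cl c hS hS')
  have c' := c.store hS'' hS₂
  obtain ⟨-, ⟨A, rfl⟩ | ⟨b, rfl⟩⟩ := hV.box_cases hv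
  · have hA : HasTy S'' [] [] G₀ [] 0 A T₀ := hV.unboxed trivial
    have hs : A.Src := hs
    obtain ⟨B₁', e₁', b₁⟩ := Tm.letboxN_cl (N := N) h₁ c'
    obtain ⟨B₂', e₂', b₂⟩ := Tm.letboxN_cl (N := N) h₂ c'
    rw [e₁] at e₁'; rw [e₂] at e₂'
    cases e₁'; cases e₂'
    refine (CCiu.red fun a h => ?_).trans
      ((H S'' _ δ (hS.trans hS'') hS₂ (c'.gupdate h₁.wf.1.glob.1 hs hA)).trans
        (.exp fun a h => ?_))
    · rw [← b₁ A hA]; exact .letbox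
    · rw [← b₂ A hA]; exact .letbox
  · exact hs.elim

/-! ## Contexts -/

theorem HasTy.src_lamN {S P G i M T} (h : HasTy S P [] G [] i M T) (hs : M.Src) (x : LVar) :
    (Tm.lamN x M).Src := by
  have : (M.lsub (fun k => .bvar (k + 1)) (fun y => if y = x then .bvar 0 else .fvar y)).In ∅
      (domOf S) 1 := Tm.In.lsub M (h.in_src hs) (by simp) fun y => by split <;> simp [Tm.In]
  exact Tm.In.src _ rfl this

theorem HasTy.src_recN {S P G i M T} (h : HasTy S P [] G [] i M T) (hs : M.Src) (y x : LVar) :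
    (Tm.recN y x M).Src := by
  have : (M.lsub (fun k => .bvar (k + 2))
      (fun z => if z = x then .bvar 0 else if z = y then .bvar 1 else .fvar z)).In ∅
      (domOf S) 2 := Tm.In.lsub M (h.in_src hs) (by simp) fun z => by
        split
        · simp [Tm.In]
        · split <;> simp [Tm.In]
  exact Tm.In.src _ rfl this

theorem HasTy.src_letboxN {S P G i M T} (h : HasTy S P [] G [] i M T) (hs : M.Src) {N : Tm}
    (hN : N.Src) (u : GVar) : (Tm.letboxN u N M).Src :=
  ⟨hN, Tm.In.src _ rfl (Tm.In.gren M (h.in_src hs))⟩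

theorem CxTy.src {S P' G' i' T' C P G i T M} (hC : CxTy S P' G' i' T' C P G i T) (hs : C.Src)
    (hM : Typed S P' G' i' M T') (hMs : M.Src) : (C.plug M).Src := by
  induction hC with
  | hole => exact hMs
  | lam h ih => exact (h.plug hM).src_lamN (ih hs) _
  | recf h ih => exact (h.plug hM).src_recN (ih hs) _ _
  | letboxR h' h ih => exact (h.plug hM).src_letboxN (ih hs.1) hs.2 _
  | appL _ _ ih | arithL _ _ ih | assignL _ _ ih | letboxL _ _ ih => exact ⟨ih hs.1, hs.2⟩
  | appR _ _ ih | arithR _ _ ih | assignR _ _ ih => exact ⟨hs.2, ih hs.1⟩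
  | iteC _ _ _ ih => exact ⟨ih hs.1, hs.2.1, hs.2.2⟩
  | iteT _ _ _ ih => exact ⟨hs.2.1, ih hs.1, hs.2.2⟩
  | iteE _ _ _ ih => exact ⟨hs.2.1, hs.2.2, ih hs.1⟩
  | ref _ ih | deref _ ih => exact ih hs
  | box _ _ ih => exact ih hs

/-- Induction on the context, with one preservation lemma per construction. At the hole the contexts
`P'` and `G'` may only grow, and a closing substitution for larger contexts is one for smaller
contexts. -/
theorem Ciu.plug {S P' G' i' T' C P G i T M₁ M₂} (hC : CxTy S P' G' i' T' C P G i T) (hs : C.Src)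
    (h₁ : Typed S P' G' i' M₁ T') (h₂ : Typed S P' G' i' M₂ T') (hs₁ : M₁.Src) (hs₂ : M₂.Src)
    (H : Ciu S P' G' T' M₁ M₂) : Ciu S P G T (C.plug M₁) (C.plug M₂) := by
  induction hC with
  | hole hS hP hG hPs hGs hij =>
    exact fun S' σ δ K T' h hS' c => H S' σ δ K T' h hS' (c.mono hPs hGs)
  | lam h ih =>
    exact .lam (h.src hs h₁ hs₁) (h.plug h₁) (h.plug h₂) ((h.plug h₁).src_lamN (h.src hs h₁ hs₁) _)
      ((h.plug h₂).src_lamN (h.src hs h₂ hs₂) _) (ih hs)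
  | recf h ih =>
    exact .recf (h.src hs h₁ hs₁) (h.plug h₁) (h.plug h₂)
      ((h.plug h₁).src_recN (h.src hs h₁ hs₁) _ _) ((h.plug h₂).src_recN (h.src hs h₂ hs₂) _ _)
      (ih hs)
  | appL h h' ih => exact .appL h' hs.2 (ih hs.1)
  | appR h' h ih => exact .appR h' hs.2 (ih hs.1)
  | arithL h h' ih => exact .arithL h' hs.2 (ih hs.1)
  | arithR h' h ih => exact .arithR h' hs.2 (ih hs.1)
  | iteC h h' h'' ih => exact .iteC h' h'' hs.2.1 hs.2.2 (ih hs.1)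
  | iteT h' h h'' ih => exact .branches h' hs.2.1 (ih hs.1) (Ciu.refl _ _ _ _ _)
  | iteE h' h'' h ih => exact .branches h' hs.2.1 (Ciu.refl _ _ _ _ _) (ih hs.1)
  | ref h ih => exact .ref (ih hs)
  | deref h ih => exact .deref (ih hs)
  | assignL h h' ih => exact .assignL h' hs.2 (ih hs.1)
  | assignR h' h ih => exact .assignR h' hs.2 (ih hs.1)
  | box hG h ih =>
    exact .box (h.src hs h₁ hs₁) (h.src hs h₂ hs₂) (h.plug h₁) (h.plug h₂) (ih hs)
  | letboxL h h' ih => exact .letboxL (h.plug h₁) h' hs.2 (ih hs.1)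
  | letboxR h' h ih => exact .letboxR h' hs.2 (h.plug h₁) (h.plug h₂) (ih hs.1)

theorem Ciu.store {S S' P G T M N} (h : Ciu S P G T M N) (hS : PSub S S') : Ciu S' P G T M N :=
  fun S'' σ δ K T' H hS' => h S'' σ δ K T' H (hS.trans hS')

/-- For closed terms, empty closing substitutions and the empty evaluation context make `Ciu` a
statement about plain convergence. -/
theorem Ciu.closed {S S' i T M N h} (H : Ciu S [] [] T M N) (hM : ClTyped S i M T)
    (hN : ClTyped S i N T) (hS : PSub S S') (hh : WfHeap S' h)
    (hs : ∀ l V, h l = some V → V.Src) (hc : Converges M h) : Converges N h := by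
  have e : ∀ {M : Tm}, ClTyped S i M T → M.cl (fun _ => none) (fun _ => none) = M := fun h => by
    rw [Tm.cl, h.code.gsub, Tm.inst, h.closed.lsub]
  have := H S' (fun _ => none) (fun _ => none) .hole T h hS ⟨by simp, by simp, by simp, by simp⟩
    trivial trivial (.root hh.store) hh hs
  rw [e hM, e hN] at this
  exact this hc

end LMML

theorem mainTheorem6 (S : LMML.SCtx) (P : LMML.GCtx) (G : LMML.LCtx) (i : LMML.Layer)
    (T : LMML.Ty) (M₁ M₂ : LMML.Tm) (hs₁ : M₁.Src) (hs₂ : M₂.Src)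
    (h₁ : LMML.Typed S P G i M₁ T) (h₂ : LMML.Typed S P G i M₂ T)
    (hTr : LMML.Traces S P G i T M₁ ⊆ LMML.Traces S P G i T M₂) :
    LMML.CtxPreorder S P G i T M₁ M₂ := by
  intro S' C i' T' h hS hCs hC hh hs hc
  have t₁ := h₁.store hS hh.store
  have t₂ := h₂.store hS hh.store
  exact (LMML.Ciu.plug hC hCs t₁ t₂ hs₁ hs₂
    ((LMML.ciu_of_traces hs₁ hs₂ h₁ h₂ hTr).store hS)).closed (hC.plug t₁) (hC.plug t₂) (.refl S')
    hh hs hc
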